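/- **Setting.** Let $\mathfrak g$ be a finite dimensional simple complex Lie algebra with Chevalley generators $e_i,f_i$, Cartan subalgebra $\mathfrak h$ and $\mathfrak b=\mathfrak h\oplus\mathfrak n$ ($\mathfrak n$ generated by the $e_i$). Put $p_{-1}=\sum_i f_i$, let $\rho^\vee\in\mathfrak h$ be given by $[\rho^\vee,e_i]=e_i$, let $p_1$ be the element for which $(p_1,2\rho^\vee,p_{-1})$ is an $\mathfrak{sl}_2$-triple, put $V^{\rm can}=\ker \operatorname{ad}p_1$, and let $v_1,\dots,v_l$ be a basis of $V^{\rm can}$ with $[\rho^\vee,v_i]=d_iv_i$, $d_i\in\mathbb N$. Let $n\ge 1$, $A=\mathbb C[[a_1,\dots,a_n]]$, $\varphi=\prod_i(z-a_i)$. For an $A$-algebra $S$ let $S(R_n)=\varprojlim_N S[z]/(\varphi^N)$ and $S(K_n)=S(R_n)[\varphi^{-1}]$, with $\partial=d/dz$; let $R_n=A(R_n)$, $K_n=A(K_n)$. Let $\int:S(K_n)\to S$ be the residue, that is, the continuous $S$-linear map that sends $u/\varphi^k$ ($u\in S[z]$) to the sum of its residues at $a_1,\dots,a_n$. **Opers.**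 For a commutative $\mathbb C$-algebra $L$ with a derivation $\partial$, an oper over $L$ is a class of connections $d+(\sum_i\psi_if_i+v)dt$, with $\psi_i\in L^\times$ and $v\in L\otimes\mathfrak b$, modulo gauge transformations by $B(L)$, where $B$ is the Borel subgroup of the adjoint group. Let $Op_{\mathfrak g,n}$ be the functor on $A$-algebras that sends $S$ to the set of opers over $(S(K_n),\partial)$, and $Op_{\mathfrak g}(D)$ the functor on $\mathbb C$-algebras that sends $S$ to the set of opers over $(S[[t]],d/dt)$; let $A[Op_{\mathfrak g,n}]$ and $\mathbb C[Op_{\mathfrak g}(D)]$ be the algebras of natural transformations from these functors to $\mathbb A^1$. The algebra $A[Op_{\mathfrak g,n}]$ has the topology generated by the ideals of functions that vanish on all $d+(p_{-1}+\sum_i c_iv_i)dt$ with $\varphi^Nc_i\in S(R_n)$ for all $i$. An automorphism $\psi$ of $S(K_n)$ acts on opers by the change of coordinate $d+M\,dt\mapsto d+\psi(M)\,\partial(\psi(t))\,dt$. A vector field $h\partial$ with $h\in K_n$ acts on $A[Op_{\mathfrak g,n}]$ by $F(\exp(-\varepsilon h\partial)\cdot x)=F(x)+\varepsilon\,((h\partial)\cdot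 F)(x)$, where $\varepsilon^2=0$. In the same way $L_k=-t^{k+1}\partial_t$, $k\ge-1$, acts on $V=\mathbb C[Op_{\mathfrak g}(D)]$. We view $V$ as a commutative vertex algebra with vacuum $1$, $a_{(-1)}b=ab$, $a_{(k)}b=0$ for $k\ge0$, translation operator $T=L_{-1}$, and grading by $L_0$. **The algebra $\tilde U_{K_n}(V)$.** Let $\mathrm{Lie}_{K_n}(V)=(V\otimes_{\mathbb C}K_n)/\mathrm{Im}(T\otimes1+1\otimes\partial)$, an abelian Lie algebra over $A$; write $ag$ for the image of $a\otimes g$. Let $U^0$ be its enveloping algebra over $A$ modulo the ideal generated by the elements $\int g\,dz-1g$ ($g\in K_n$), where $1g$ is the element $ag$ for the vacuum $a=1$. Let $\tilde I_N\subset U^0$ be the ideal generated by the $ag$ with $L_0a=ma$ and $g\in\varphi^kR_n$, $k\ge Nm$, and let $U'=\varprojlim_N U^0/\tilde I_N$. For $a\in V$ let $\tilde a(g)$ be the image of $ag$ in $U'$. Then $\tilde U_{K_n}(V)=U'/J$, where $J$ is the closure of the ideal generated by the elements $(ab)g-(\tilde a_{(-1)}\tilde b)(g)$ with $a,b\in V$,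 $g\in K_n$. Here, with $\frac{\varphi(z)-\varphi(w)}{z-w}=\sum_{j}p_j(z)q_j(w)$ a finite sum, $$(\tilde a_{(-1)}\tilde b)(g)=\sum_{m\ge0}\sum_j\Big(\tilde a(p_j\varphi^{-m-1})\,\tilde b(q_j\varphi^{m}g)+\tilde a(p_j\varphi^{m})\,\tilde b(q_j\varphi^{-m-1}g)\Big).$$ **Statement.** 1. There are unique functions $v^*_{i,-1}\in\mathbb C[Op_{\mathfrak g}(D)]$ and $v_i^*(g)\in A[Op_{\mathfrak g,n}]$ ($1\le i\le l$, $g\in K_n$) such that $v^*_{i,-1}$ takes the value $c_i(0)$ at the class of $d+(p_{-1}+\sum_jc_j(t)v_j)dt$, $c_j\in S[[t]]$, and $v_i^*(g)$ takes the value $\int c_i\,g\,dt$ at the class of $d+(p_{-1}+\sum_jc_jv_j)dt$, $c_j\in S(K_n)$. 2. There is a unique isomorphism of topological $A$-algebras $$\Phi:\tilde U_{K_n}(\mathbb C[Op_{\mathfrak g}(D)])\to A[Op_{\mathfrak g,n}]\qquad\text{with}\qquad \Phi(v^*_{i,-1}g)=v^*_i(g)\quad\text{for all } i \text{ and all } g\in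 K_n.$$ 3. For every $h\in K_n$ there is a unique continuous $A$-linear derivation of $\tilde U_{K_n}(\mathbb C[Op_{\mathfrak g}(D)])$, denoted $x\mapsto(h\partial)\cdot x$, with $$(h\partial)\cdot(ag)=-\sum_{k\ge-1}\frac1{(k+1)!}\,(L_ka)\,(g\,\partial^{k+1}h)\qquad\text{for all } a\in \mathbb C[Op_{\mathfrak g}(D)],\ g\in K_n.$$ 4. The isomorphism $\Phi$ is equivariant for $\operatorname{Der}K_n=K_n\partial$: $\Phi((h\partial)\cdot x)=(h\partial)\cdot\Phi(x)$ for all $h\in K_n$ and all $x\in\tilde U_{K_n}(\mathbb C[Op_{\mathfrak g}(D)])$. -/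

import Mathlib

open scoped TensorProduct BigOperators
open Set Topology

namespace OperFF

section Opers

variable {𝔤 : Type*} [LieRing 𝔤] [LieAlgebra ℂ 𝔤] {ι : Type*} [Fintype ι]
  {H : LieSubalgebra ℂ 𝔤} (B : LieAlgebra.Basis ι H)

/-- The nilpotent subalgebra `𝔫`, generated by the `e i`. -/
noncomputable def nilradical : Submodule ℂ 𝔤 := (LieSubalgebra.lieSpan ℂ 𝔤 (range B.e)).toSubmodule

/-- The Borel subalgebra `𝔟 = 𝔥 ⊕ 𝔫`. -/
noncomputable def borel : Submodule ℂ 𝔤 := H.toSubmodule ⊔ nilradical B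

/-- The principal nilpotent element `p₋₁ = ∑ f i`. -/
noncomputable def pMinus : 𝔤 := ∑ i, B.f i

/-- `V^can = 𝔤^{p₁}`, the centralizer of `p₁`. -/
noncomputable def canSpace (p₁ : 𝔤) : Submodule ℂ 𝔤 := LinearMap.ker (LieAlgebra.ad ℂ 𝔤 p₁)

variable (L : Type*) [CommRing L] [Algebra ℂ L]

/-- `σ` is an `L`-point of the maximal torus of the adjoint group: a Lie algebra automorphism that
acts on each root vector `e i`, `f i` by a unit and its inverse. -/
def IsTorus (σ : (L ⊗[ℂ] 𝔤) ≃ₗ[L] (L ⊗[ℂ] 𝔤)) : Prop :=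
  (∀ x y, σ ⁅x, y⁆ = ⁅σ x, σ y⁆) ∧
    ∃ c : ι → Lˣ, ∀ i, σ (1 ⊗ₜ B.e i) = (c i : L) ⊗ₜ B.e i ∧
      σ (1 ⊗ₜ B.f i) = (((c i)⁻¹ : Lˣ) : L) ⊗ₜ B.f i

/-- `σ = exp (ad u)` for some `u ∈ L ⊗ 𝔫` (with `ad u` nilpotent). -/
def IsUnipotent (σ : (L ⊗[ℂ] 𝔤) ≃ₗ[L] (L ⊗[ℂ] 𝔤)) : Prop :=
  ∃ u ∈ (nilradical B).baseChange L, ∃ k : ℕ,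
    (∀ x, ((LieAlgebra.ad L (L ⊗[ℂ] 𝔤) u) ^ k) x = 0) ∧
    ∀ x, σ x = ∑ j ∈ Finset.range k,
      ((j.factorial : ℂ)⁻¹) • ((LieAlgebra.ad L (L ⊗[ℂ] 𝔤) u) ^ j) x

/-- `B(L)`, the `L`-points of the Borel subgroup of the adjoint group of `𝔤`, generated by the
`L`-points of the torus and of the unipotent radical; it acts faithfully on `L ⊗ 𝔤`. -/
noncomputable def borelGroup : Subgroup ((L ⊗[ℂ] 𝔤) ≃ₗ[L] (L ⊗[ℂ] 𝔤)) :=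
  Subgroup.closure ({σ | IsTorus B L σ} ∪ {σ | IsUnipotent B L σ})

/-- `d + A dt` is an oper connection: `A = ∑ ψᵢ fᵢ + v` with `ψᵢ` invertible and `v ∈ L ⊗ 𝔟`. -/
def IsOper (A : L ⊗[ℂ] 𝔤) : Prop :=
  ∃ ψ : ι → Lˣ, ∃ v ∈ (borel B).baseChange L, A = ∑ i, (ψ i : L) ⊗ₜ B.f i + v

variable {L}

/-- The covariant derivative `∂ + ad A` on `L ⊗ 𝔤`. -/
noncomputable def covDer (D : Derivation ℂ L L) (A : L ⊗[ℂ] 𝔤) (x : L ⊗[ℂ] 𝔤) : L ⊗[ℂ] 𝔤 :=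
  LinearMap.rTensor 𝔤 (D : L →ₗ[ℂ] L) x + ⁅A, x⁆

/-- Gauge equivalence under `B(L)`: `b ∘ (∂ + ad A) ∘ b⁻¹ = ∂ + ad A'`. As `ad` is faithful for `𝔤`
semisimple, this says that `A'` is the gauge transform of `A` by `b`. -/
def operSetoid (D : Derivation ℂ L L) : Setoid {A : L ⊗[ℂ] 𝔤 // IsOper B L A} where
  r A A' := ∃ b ∈ borelGroup B L, ∀ x, b (covDer D A x) = covDer D A' (b x)
  iseqv := by
    refine ⟨fun A => ⟨1, one_mem _, fun x => rfl⟩, ?_, ?_⟩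
    · rintro A A' ⟨b, hb, h⟩
      refine ⟨b⁻¹, inv_mem hb, fun x => ?_⟩
      apply b.injective
      rw [h]
      change b (b.symm _) = covDer D A' (b (b.symm x))
      simp
    · rintro A A' A'' ⟨b, hb, h⟩ ⟨b', hb', h'⟩
      refine ⟨b' * b, mul_mem hb' hb, fun x => ?_⟩
      rw [LinearEquiv.mul_apply, LinearEquiv.mul_apply, h, h']

/-- Isomorphism classes of opers over the differential ring `(L, D)`. -/
def Op (D : Derivation ℂ L L) : Type _ := Quotient (operSetoid B D)

/-- A ring homomorphism `toHom : L → L'` for which the derivations are related by a change of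
coordinate: `D' ∘ toHom = jac · toHom ∘ D` with `jac` invertible (`jac = ∂(ψ(t))`). -/
structure DiffHom {L L' : Type*} [CommRing L] [Algebra ℂ L] [CommRing L'] [Algebra ℂ L']
    (D : Derivation ℂ L L) (D' : Derivation ℂ L' L') where
  toHom : L →ₐ[ℂ] L'
  jac : L'ˣ
  chain : ∀ f, D' (toHom f) = jac * toHom (D f)

variable {L' : Type*} [CommRing L'] [Algebra ℂ L']

/-- `f ⊗ id : L ⊗ 𝔤 → L' ⊗ 𝔤`. -/
noncomputable def extMap (f : L →ₐ[ℂ] L') : L ⊗[ℂ] 𝔤 →ₗ[ℂ] L' ⊗[ℂ] 𝔤 := LinearMap.rTensor 𝔤 f.toLinearMap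


theorem extMap_tmul (f : L →ₐ[ℂ] L') (l : L) (x : 𝔤) :
    extMap f (l ⊗ₜ[ℂ] x) = f l ⊗ₜ[ℂ] x := rfl

theorem extMap_smul (f : L →ₐ[ℂ] L') (l : L) (x : L ⊗[ℂ] 𝔤) :
    extMap f (l • x) = f l • extMap f x := by
  induction x using TensorProduct.induction_on with
  | zero => simp
  | tmul a y => simp [extMap_tmul, TensorProduct.smul_tmul']
  | add x y hx hy => simp only [smul_add, map_add, hx, hy]

theorem extMap_lie (f : L →ₐ[ℂ] L') (x y : L ⊗[ℂ] 𝔤) :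
    extMap f ⁅x, y⁆ = ⁅extMap f x, extMap f y⁆ := by
  induction x using TensorProduct.induction_on with
  | zero => simp
  | tmul a u =>
    induction y using TensorProduct.induction_on with
    | zero => simp
    | tmul b v => simp [extMap_tmul]
    | add y z hy hz => simp only [lie_add, map_add, hy, hz]
  | add x z hx hz => simp only [add_lie, map_add, hx, hz]

theorem extMap_der {D : Derivation ℂ L L} {D' : Derivation ℂ L' L'} (φ : DiffHom D D')
    (x : L ⊗[ℂ] 𝔤) :
    LinearMap.rTensor 𝔤 (D' : L' →ₗ[ℂ] L') (extMap φ.toHom x) =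
      (φ.jac : L') • extMap φ.toHom (LinearMap.rTensor 𝔤 (D : L →ₗ[ℂ] L) x) := by
  induction x using TensorProduct.induction_on with
  | zero => simp
  | tmul a u => simp [extMap_tmul, φ.chain, TensorProduct.smul_tmul']
  | add x z hx hz => simp only [map_add, hx, hz, smul_add]

theorem extMap_covDer {D : Derivation ℂ L L} {D' : Derivation ℂ L' L'} (φ : DiffHom D D')
    (A x : L ⊗[ℂ] 𝔤) :
    covDer D' ((φ.jac : L') • extMap φ.toHom A) (extMap φ.toHom x) =
      (φ.jac : L') • extMap φ.toHom (covDer D A x) := by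
  simp only [covDer, extMap_der, map_add, extMap_lie, smul_add, smul_lie]

theorem extMap_ext (f : L →ₐ[ℂ] L') {σ τ : (L' ⊗[ℂ] 𝔤) →ₗ[L'] (L' ⊗[ℂ] 𝔤)}
    (h : ∀ x, σ (extMap f x) = τ (extMap f x)) : σ = τ := by
  ext x
  simpa [extMap_tmul] using h (1 ⊗ₜ x)

/-- Base change of an `L`-linear map along `f : L → L'`. -/
noncomputable def bcMap (f : L →ₐ[ℂ] L') (σ : (L ⊗[ℂ] 𝔤) →ₗ[L] (L ⊗[ℂ] 𝔤)) :
    (L' ⊗[ℂ] 𝔤) →ₗ[L'] (L' ⊗[ℂ] 𝔤) :=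
  LinearMap.liftBaseChange L'
    ((extMap f ∘ₗ σ.restrictScalars ℂ) ∘ₗ (TensorProduct.mk ℂ L 𝔤 1))

theorem bcMap_extMap (f : L →ₐ[ℂ] L') (σ : (L ⊗[ℂ] 𝔤) →ₗ[L] (L ⊗[ℂ] 𝔤)) (x : L ⊗[ℂ] 𝔤) :
    bcMap f σ (extMap f x) = extMap f (σ x) := by
  induction x using TensorProduct.induction_on with
  | zero => simp
  | tmul a u =>
    have : a ⊗ₜ[ℂ] u = a • ((1 : L) ⊗ₜ[ℂ] u) := by simp [TensorProduct.smul_tmul']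
    rw [this, extMap_smul, map_smul, map_smul, extMap_smul]
    simp [bcMap, extMap_tmul]
  | add x z hx hz => simp only [map_add, hx, hz]

/-- Base change of an `L`-linear automorphism along `f : L → L'`. -/
noncomputable def bcEquiv (f : L →ₐ[ℂ] L') (σ : (L ⊗[ℂ] 𝔤) ≃ₗ[L] (L ⊗[ℂ] 𝔤)) :
    (L' ⊗[ℂ] 𝔤) ≃ₗ[L'] (L' ⊗[ℂ] 𝔤) :=
  LinearEquiv.ofLinearMap (bcMap f σ) (bcMap f σ.symm)
    (extMap_ext f fun x => by simp [bcMap_extMap])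
    (extMap_ext f fun x => by simp [bcMap_extMap])

theorem bcEquiv_extMap (f : L →ₐ[ℂ] L') (σ : (L ⊗[ℂ] 𝔤) ≃ₗ[L] (L ⊗[ℂ] 𝔤)) (x : L ⊗[ℂ] 𝔤) :
    bcEquiv f σ (extMap f x) = extMap f (σ x) := by
  have := bcMap_extMap f (σ : (L ⊗[ℂ] 𝔤) →ₗ[L] (L ⊗[ℂ] 𝔤)) x
  exact this

theorem extMap_baseChange (f : L →ₐ[ℂ] L') (N : Submodule ℂ 𝔤) {x : L ⊗[ℂ] 𝔤}
    (hx : x ∈ N.baseChange L) : extMap f x ∈ N.baseChange L' := by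
  rw [Submodule.baseChange_eq_span] at hx
  induction hx using Submodule.span_induction with
  | mem y hy =>
    obtain ⟨y, hy, rfl⟩ := hy
    simpa [extMap_tmul] using Submodule.tmul_mem_baseChange_of_mem (1 : L') hy
  | zero => simp
  | add x y _ _ hx hy => rw [map_add]; exact add_mem hx hy
  | smul a x _ hx => rw [extMap_smul]; exact Submodule.smul_mem _ _ hx

theorem ad_pow_extMap (f : L →ₐ[ℂ] L') (u : L ⊗[ℂ] 𝔤) (k : ℕ) (x : L ⊗[ℂ] 𝔤) :
    ((LieAlgebra.ad L' (L' ⊗[ℂ] 𝔤) (extMap f u)) ^ k) (extMap f x) =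
      extMap f (((LieAlgebra.ad L (L ⊗[ℂ] 𝔤) u) ^ k) x) := by
  induction k with
  | zero => rfl
  | succ k ih =>
    rw [pow_succ', pow_succ', Module.End.mul_apply, Module.End.mul_apply, ih]
    simp [extMap_lie]

/-- `B(L) → B(L')` is compatible with `L ⊗ 𝔤 → L' ⊗ 𝔤`. -/
theorem exists_borelGroup_extMap (f : L →ₐ[ℂ] L') {b : (L ⊗[ℂ] 𝔤) ≃ₗ[L] (L ⊗[ℂ] 𝔤)}
    (hb : b ∈ borelGroup B L) :
    ∃ b' ∈ borelGroup B L', ∀ x, b' (extMap f x) = extMap f (b x) := by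
  induction hb using Subgroup.closure_induction with
  | mem σ hσ =>
    refine ⟨bcEquiv f σ, Subgroup.subset_closure ?_, bcEquiv_extMap f σ⟩
    rcases hσ with ⟨hl, c, hc⟩ | ⟨u, hu, k, hk, hs⟩
    · left
      refine ⟨fun x y => ?_, fun i => Units.map (f : L →* L') (c i), fun i => ⟨?_, ?_⟩⟩
      · have key : ∀ (a b : L') (x y : 𝔤), bcEquiv f σ ⁅a ⊗ₜ[ℂ] x, b ⊗ₜ[ℂ] y⁆ =
            ⁅bcEquiv f σ (a ⊗ₜ[ℂ] x), bcEquiv f σ (b ⊗ₜ[ℂ] y)⁆ := by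
          intro a b x y
          have h1 : ∀ (a : L') (x : 𝔤), a ⊗ₜ[ℂ] x = a • extMap f ((1 : L) ⊗ₜ[ℂ] x) := by
            intro a x; simp [extMap_tmul, TensorProduct.smul_tmul']
          rw [h1 a, h1 b]
          simp only [map_smul, smul_lie, lie_smul, bcEquiv_extMap, ← extMap_lie, hl]
        induction x using TensorProduct.induction_on with
        | zero => simp
        | tmul a u =>
          induction y using TensorProduct.induction_on with
          | zero => simp
          | tmul b v => exact key a b u v
          | add y z hy hz => simp only [lie_add, map_add, hy, hz]
        | add x z hx hz => simp only [add_lie, map_add, hx, hz]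
      · have := bcEquiv_extMap f σ (1 ⊗ₜ B.e i)
        rw [(hc i).1] at this
        simpa [extMap_tmul] using this
      · have := bcEquiv_extMap f σ (1 ⊗ₜ B.f i)
        rw [(hc i).2] at this
        simpa [extMap_tmul] using this
    · right
      refine ⟨extMap f u, extMap_baseChange f _ hu, k, fun x => ?_, fun x => ?_⟩
      · have : (LieAlgebra.ad L' (L' ⊗[ℂ] 𝔤) (extMap f u)) ^ k = 0 :=
          extMap_ext f fun x => by rw [ad_pow_extMap, hk]; simp
        rw [this]; rfl
      · have : (bcEquiv f σ : (L' ⊗[ℂ] 𝔤) →ₗ[L'] (L' ⊗[ℂ] 𝔤)) = ∑ j ∈ Finset.range k,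
            ((j.factorial : ℂ)⁻¹) • ((LieAlgebra.ad L' (L' ⊗[ℂ] 𝔤) (extMap f u)) ^ j) :=
          extMap_ext f fun x => by
            simp [bcEquiv_extMap, hs, ad_pow_extMap]
        have h2 := LinearMap.congr_fun this x
        simpa using h2
  | one => exact ⟨1, one_mem _, fun x => rfl⟩
  | mul a b _ _ ha hb =>
    obtain ⟨a', ha', h1⟩ := ha
    obtain ⟨b', hb', h2⟩ := hb
    exact ⟨a' * b', mul_mem ha' hb', fun x => by
      rw [LinearEquiv.mul_apply, LinearEquiv.mul_apply, h2, h1]⟩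
  | inv a _ ha =>
    obtain ⟨a', ha', h1⟩ := ha
    refine ⟨a'⁻¹, inv_mem ha', fun x => ?_⟩
    apply a'.injective
    have h3 : a' (a'⁻¹ (extMap f x)) = extMap f x := a'.apply_symm_apply _
    have h4 : a (a⁻¹ x) = x := a.apply_symm_apply _
    rw [h3, h1, h4]

theorem isOper_extMap (f : L →ₐ[ℂ] L') (j : L'ˣ) {A : L ⊗[ℂ] 𝔤} (hA : IsOper B L A) :
    IsOper B L' ((j : L') • extMap f A) := by
  obtain ⟨ψ, v, hv, rfl⟩ := hA
  refine ⟨fun i => j * Units.map (f : L →* L') (ψ i), (j : L') • extMap f v,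
    Submodule.smul_mem _ _ (extMap_baseChange f _ hv), ?_⟩
  simp [extMap_tmul, Finset.smul_sum, TensorProduct.smul_tmul']

theorem extMap_gauge {D : Derivation ℂ L L} {D' : Derivation ℂ L' L'} (φ : DiffHom D D')
    {A A' : L ⊗[ℂ] 𝔤}
    (h : ∃ b ∈ borelGroup B L, ∀ x, b (covDer D A x) = covDer D A' (b x)) :
    ∃ b ∈ borelGroup B L', ∀ x, b (covDer D' ((φ.jac : L') • extMap φ.toHom A) x) =
      covDer D' ((φ.jac : L') • extMap φ.toHom A') (b x) := by
  obtain ⟨b, hb, h⟩ := h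
  obtain ⟨b', hb', h'⟩ := exists_borelGroup_extMap B φ.toHom hb
  refine ⟨b', hb', fun x => ?_⟩
  have hD : ∀ (A : L' ⊗[ℂ] 𝔤) (l : L') (y : L' ⊗[ℂ] 𝔤),
      covDer D' A (l • y) = D' l • y + l • covDer D' A y := by
    intro A l y
    have : LinearMap.rTensor 𝔤 (D' : L' →ₗ[ℂ] L') (l • y) =
        D' l • y + l • LinearMap.rTensor 𝔤 (D' : L' →ₗ[ℂ] L') y := by
      induction y using TensorProduct.induction_on with
      | zero => simp
      | tmul a u =>
        simp [TensorProduct.smul_tmul', ← TensorProduct.add_tmul, mul_comm, add_comm]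
      | add x z hx hz => simp only [smul_add, map_add, hx, hz]; abel
    simp only [covDer, this, lie_smul, smul_add]; abel
  have hadd : ∀ (A x y : L' ⊗[ℂ] 𝔤), covDer D' A (x + y) = covDer D' A x + covDer D' A y := by
    intro A x y; simp only [covDer, map_add, lie_add]; abel
  induction x using TensorProduct.induction_on with
  | zero => simp [covDer]
  | tmul a u =>
    have h1 : a ⊗ₜ[ℂ] u = a • extMap φ.toHom ((1 : L) ⊗ₜ[ℂ] u) := by
      simp [extMap_tmul, TensorProduct.smul_tmul']
    rw [h1, hD, map_add, map_smul, map_smul, map_smul, hD, extMap_covDer, map_smul, h', h', h,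
      extMap_covDer]
  | add x y hx hy => rw [hadd, map_add, map_add, hadd, hx, hy]

/-- Pull-back of opers: `d + A dt ↦ d + ψ(A) ∂(ψ(t)) dt`, on gauge equivalence classes. -/
noncomputable def Op.pull {D : Derivation ℂ L L} {D' : Derivation ℂ L' L'} (φ : DiffHom D D') :
    Op B D → Op B D' :=
  Quotient.map (fun A => ⟨(φ.jac : L') • extMap φ.toHom A.1, isOper_extMap B φ.toHom φ.jac A.2⟩)
    (fun _ _ h => extMap_gauge B φ h)

end Opers

/-! ### Families of discs -/

open CategoryTheory

section Discs

/-- A functor from `A`-algebras `S` to `S`-algebras with an `S`-linear derivation: the functions on a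
(punctured) disc with a global coordinate, in families. -/
structure Disc (A : Type) [CommRing A] [Algebra ℂ A] where
  obj : CommAlgCat.{0} A → Type
  [commRing : ∀ S : CommAlgCat.{0} A, CommRing (obj S)]
  [algebra : ∀ S : CommAlgCat.{0} A, Algebra S (obj S)]
  der : ∀ S : CommAlgCat.{0} A, Derivation S (obj S) (obj S)
  map : ∀ {S T : CommAlgCat.{0} A}, (S ⟶ T) → obj S →+* obj T
  map_algebraMap : ∀ {S T : CommAlgCat.{0} A} (f : S ⟶ T) (s : S),
    map f (algebraMap S (obj S) s) = algebraMap T (obj T) (f.hom s)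
  map_der : ∀ {S T : CommAlgCat.{0} A} (f : S ⟶ T) (x : obj S),
    map f (der S x) = der T (map f x)
  map_id : ∀ (S : CommAlgCat.{0} A) (x : obj S), map (𝟙 S) x = x
  map_comp : ∀ {S T U : CommAlgCat.{0} A} (f : S ⟶ T) (g : T ⟶ U) (x : obj S),
    map (f ≫ g) x = map g (map f x)

namespace Disc

attribute [instance] Disc.commRing Disc.algebra

variable {A : Type} [CommRing A] [Algebra ℂ A] (𝔻 : Disc A)

instance algebraBase (S : CommAlgCat.{0} A) : Algebra A (𝔻.obj S) :=
  ((algebraMap S (𝔻.obj S)).comp (algebraMap A S)).toAlgebra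

instance algebraComplex (S : CommAlgCat.{0} A) : Algebra ℂ (𝔻.obj S) :=
  ((algebraMap A (𝔻.obj S)).comp (algebraMap ℂ A)).toAlgebra

instance (S : CommAlgCat.{0} A) : SMulCommClass ℂ A (𝔻.obj S) where
  smul_comm z a x := by simp only [Algebra.smul_def]; ring

/-- The derivation `∂` of `𝔻.obj S`, as a `ℂ`-linear derivation. -/
noncomputable def cder (S : CommAlgCat.{0} A) : Derivation ℂ (𝔻.obj S) (𝔻.obj S) where
  toFun := 𝔻.der S
  map_add' := map_add _
  map_smul' z x := by
    change 𝔻.der S (z • x) = z • 𝔻.der S x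
    rw [Algebra.smul_def, Algebra.smul_def]
    change 𝔻.der S (algebraMap S (𝔻.obj S) _ * x) = algebraMap S (𝔻.obj S) _ * _
    rw [← Algebra.smul_def, ← Algebra.smul_def, (𝔻.der S).map_smul]
  map_one_eq_zero' := (𝔻.der S).map_one_eq_zero
  leibniz' x y := (𝔻.der S).leibniz x y

theorem cder_apply (S : CommAlgCat.{0} A) (x : 𝔻.obj S) : 𝔻.cder S x = 𝔻.der S x := rfl

/-- Base change along `S → T`; the coordinate does not change. -/
noncomputable def baseChange {S T : CommAlgCat.{0} A} (f : S ⟶ T) :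
    DiffHom (𝔻.cder S) (𝔻.cder T) where
  toHom :=
    { 𝔻.map f with
      commutes' := fun z => by
        change 𝔻.map f (algebraMap S (𝔻.obj S) (algebraMap A S (algebraMap ℂ A z))) =
          algebraMap T (𝔻.obj T) (algebraMap A T (algebraMap ℂ A z))
        rw [𝔻.map_algebraMap, AlgHom.commutes] }
  jac := 1
  chain x := by
    rw [Units.val_one, one_mul]
    exact (𝔻.map_der f x).symm

/-- Dual numbers `S[ε]`. -/
def dual (S : CommAlgCat.{0} A) : CommAlgCat.{0} A := CommAlgCat.of A (DualNumber S)

/-- The coefficient of `ε` of an element of `S[ε]`. -/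
def dualSnd {S : CommAlgCat.{0} A} (x : dual S) : S := TrivSqZeroExt.snd (R := S) (M := S) x

/-- The element `ε` of `S[ε]`. -/
def dualEps (S : CommAlgCat.{0} A) : dual S := (DualNumber.eps : DualNumber S)

theorem dualEps_mul (S : CommAlgCat.{0} A) : dualEps S * dualEps S = 0 :=
  DualNumber.eps_mul_eps (R := S)

/-- The base ring `A` as an `A`-algebra. -/
def base (A : Type) [CommRing A] : CommAlgCat.{0} A := CommAlgCat.of A A

/-- The inclusion `S → S[ε]`. -/
noncomputable def toDual (S : CommAlgCat.{0} A) : S ⟶ dual S :=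
  CommAlgCat.ofHom (X := S) (Y := DualNumber S) (TrivSqZeroExt.inlAlgHom A S S)

/-- `ε`, as a function on the disc over `S[ε]`. -/
noncomputable def eps (S : CommAlgCat.{0} A) : 𝔻.obj (dual S) :=
  algebraMap (dual S) (𝔻.obj (dual S)) (dualEps S)

theorem eps_mul_eps (S : CommAlgCat.{0} A) : 𝔻.eps S * 𝔻.eps S = 0 := by
  rw [eps, ← map_mul, dualEps_mul, map_zero]

theorem der_eps (S : CommAlgCat.{0} A) : 𝔻.der (dual S) (𝔻.eps S) = 0 :=
  (𝔻.der (dual S)).map_algebraMap _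

/-- The infinitesimal automorphism `exp (ε h ∂) : f ↦ f + ε h ∂f`, which maps the coordinate `t` to
`t + ε h`, so that its Jacobian is `1 + ε ∂h`. -/
noncomputable def infAut (S : CommAlgCat.{0} A) (h : 𝔻.obj (dual S)) :
    DiffHom (𝔻.cder (dual S)) (𝔻.cder (dual S)) where
  toHom :=
    { toFun := fun f => f + 𝔻.eps S * (h * 𝔻.der (dual S) f)
      map_one' := by simp
      map_zero' := by simp
      map_add' := fun f g => by rw [map_add]; ring
      map_mul' := fun f g => by
        rw [Derivation.leibniz, smul_eq_mul, smul_eq_mul]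
        linear_combination (-h * h * 𝔻.der (dual S) f * 𝔻.der (dual S) g) * 𝔻.eps_mul_eps S
      commutes' := fun z => by
        have : 𝔻.der (dual S) (algebraMap ℂ (𝔻.obj (dual S)) z) = 0 :=
          (𝔻.cder (dual S)).map_algebraMap z
        rw [this]; simp }
  jac :=
    { val := 1 + 𝔻.eps S * 𝔻.der (dual S) h
      inv := 1 - 𝔻.eps S * 𝔻.der (dual S) h
      val_inv := by
        linear_combination (-(𝔻.der (dual S) h)^2) * 𝔻.eps_mul_eps S
      inv_val := by
        linear_combination (-(𝔻.der (dual S) h)^2) * 𝔻.eps_mul_eps S }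
  chain f := by
    change 𝔻.der (dual S) (f + 𝔻.eps S * (h * 𝔻.der (dual S) f)) =
      (1 + 𝔻.eps S * 𝔻.der (dual S) h) * (𝔻.der (dual S) f + 𝔻.eps S *
        (h * 𝔻.der (dual S) (𝔻.der (dual S) f)))
    simp only [map_add, Derivation.leibniz, smul_eq_mul, der_eps]
    linear_combination (-h * 𝔻.der (dual S) h *
      𝔻.der (dual S) (𝔻.der (dual S) f)) * 𝔻.eps_mul_eps S

end Disc

variable {𝔤 : Type*} [LieRing 𝔤] [LieAlgebra ℂ 𝔤] {ι : Type*} [Fintype ι]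
  {H : LieSubalgebra ℂ 𝔤} (B : LieAlgebra.Basis ι H)
  {A : Type} [CommRing A] [Algebra ℂ A] (𝔻 : Disc A)

/-- The functor of opers on the disc `𝔻`: the isomorphism classes of `S`-families. -/
abbrev OpOn (S : CommAlgCat.{0} A) : Type _ := Op B (𝔻.cder S)

/-- The natural transformations from the functor of opers to the affine line, as a subalgebra of the
algebra of all families of functions. -/
noncomputable def opFunSubalgebra : Subalgebra A (∀ S : CommAlgCat.{0} A, OpOn B 𝔻 S → S) where
  carrier := {F | ∀ (S T : CommAlgCat.{0} A) (f : S ⟶ T) (x : OpOn B 𝔻 S),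
    F T (Op.pull B (𝔻.baseChange f) x) = f.hom (F S x)}
  mul_mem' {F G} hF hG S T f x := by
    simp only [Pi.mul_apply, map_mul]; rw [hF, hG]
  add_mem' {F G} hF hG S T f x := by
    simp only [Pi.add_apply, map_add]; rw [hF, hG]
  algebraMap_mem' a S T f x := by
    simp only [Pi.algebraMap_apply, AlgHom.commutes]

/-- `A[Op]`: the algebra of functions on the functor of opers on the disc `𝔻`. -/
def OpFun : Type _ := opFunSubalgebra B 𝔻

noncomputable instance : CommRing (OpFun B 𝔻) :=
  inferInstanceAs (CommRing (opFunSubalgebra B 𝔻))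

noncomputable instance : Algebra A (OpFun B 𝔻) :=
  inferInstanceAs (Algebra A (opFunSubalgebra B 𝔻))

variable {B 𝔻} in
/-- The value of a function at an `S`-family of opers. -/
def OpFun.eval (F : OpFun B 𝔻) {S : CommAlgCat.{0} A} (x : OpOn B 𝔻 S) : S := F.1 S x

/-- The structure map `A → S`. -/
noncomputable def fromBase (S : CommAlgCat.{0} A) : Disc.base A ⟶ S :=
  CommAlgCat.ofHom (X := A) (Y := S) (Algebra.ofId A S)

/-- The `S[ε]`-family of opers `exp (ε h ∂) · x`, obtained from `x` by the infinitesimal change of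
coordinate `exp (ε h ∂)`. -/
noncomputable def infMove (h : 𝔻.obj (Disc.base A)) (S : CommAlgCat.{0} A)
    (x : OpOn B 𝔻 S) : OpOn B 𝔻 (Disc.dual S) :=
  Op.pull B (𝔻.infAut S (𝔻.map (fromBase (Disc.dual S)) h))
    (Op.pull B (𝔻.baseChange (Disc.toDual S)) x)

theorem Op.pull_pull {L L' L'' : Type*} [CommRing L] [Algebra ℂ L] [CommRing L'] [Algebra ℂ L']
    [CommRing L''] [Algebra ℂ L''] {D : Derivation ℂ L L} {D' : Derivation ℂ L' L'}
    {D'' : Derivation ℂ L'' L''} (φ : DiffHom D D') (φ' : DiffHom D' D'') (x : Op B D) :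
    ∃ φ'' : DiffHom D D'', (∀ f, φ''.toHom f = φ'.toHom (φ.toHom f)) ∧
      (φ''.jac : L'') = φ'.jac * φ'.toHom φ.jac ∧
      Op.pull B φ' (Op.pull B φ x) = Op.pull B φ'' x := by
  refine ⟨⟨φ'.toHom.comp φ.toHom, φ'.jac * Units.map (φ'.toHom : L' →* L'') φ.jac,
    fun f => ?_⟩, fun f => rfl, rfl, ?_⟩
  · simp [φ.chain, φ'.chain, mul_assoc]
  · induction x using Quotient.inductionOn with
    | h a =>
      refine congrArg (Quotient.mk _) (Subtype.ext ?_)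
      change (φ'.jac : L'') • extMap φ'.toHom ((φ.jac : L') • extMap φ.toHom a.1) =
        ((φ'.jac : L'') * φ'.toHom φ.jac) • extMap (φ'.toHom.comp φ.toHom) a.1
      rw [extMap_smul, smul_smul]
      congr 1
      generalize (a : L ⊗[ℂ] 𝔤) = y
      induction y using TensorProduct.induction_on with
      | zero => simp
      | tmul a u => simp [extMap_tmul]
      | add x z hx hz => simp only [map_add, hx, hz]

theorem DiffHom.ext' {L L' : Type*} [CommRing L] [Algebra ℂ L] [CommRing L'] [Algebra ℂ L']
    {D : Derivation ℂ L L} {D' : Derivation ℂ L' L'} {φ ψ : DiffHom D D'}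
    (h : ∀ f, φ.toHom f = ψ.toHom f) (hj : (φ.jac : L') = ψ.jac) : φ = ψ := by
  obtain ⟨f, j, _⟩ := φ
  obtain ⟨f', j', _⟩ := ψ
  obtain rfl : f = f' := AlgHom.ext h
  obtain rfl : j = j' := Units.ext hj
  rfl

/-- `f[ε] : S[ε] → T[ε]`. -/
noncomputable def dualMap {S T : CommAlgCat.{0} A} (f : S ⟶ T) : Disc.dual S ⟶ Disc.dual T :=
  CommAlgCat.ofHom (X := DualNumber S) (Y := DualNumber T)
    { toFun := fun x => TrivSqZeroExt.inl (f.hom x.fst) + TrivSqZeroExt.inr (f.hom x.snd)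
      map_one' := by ext <;> simp
      map_zero' := by ext <;> simp
      map_add' := fun x y => by ext <;> simp
      map_mul' := fun x y => by
        ext
        · simp
        · simp [mul_comm]
      commutes' := fun a => by
        ext
        · simp [TrivSqZeroExt.algebraMap_eq_inl']
        · simp [TrivSqZeroExt.algebraMap_eq_inl'] }

theorem infMove_baseChange (h : 𝔻.obj (Disc.base A)) {S T : CommAlgCat.{0} A} (f : S ⟶ T)
    (x : OpOn B 𝔻 S) :
    infMove B 𝔻 h T (Op.pull B (𝔻.baseChange f) x) =
      Op.pull B (𝔻.baseChange (dualMap f)) (infMove B 𝔻 h S x) := by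
  unfold infMove
  obtain ⟨φ₁, h₁, j₁, e₁⟩ := Op.pull_pull B (𝔻.baseChange f) (𝔻.baseChange (Disc.toDual T)) x
  obtain ⟨φ₂, h₂, j₂, e₂⟩ := Op.pull_pull B φ₁
    (𝔻.infAut T (𝔻.map (fromBase (Disc.dual T)) h)) x
  obtain ⟨φ₃, h₃, j₃, e₃⟩ := Op.pull_pull B (𝔻.baseChange (Disc.toDual S))
    (𝔻.infAut S (𝔻.map (fromBase (Disc.dual S)) h)) x
  obtain ⟨φ₄, h₄, j₄, e₄⟩ := Op.pull_pull B φ₃ (𝔻.baseChange (dualMap f)) x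
  rw [e₁, e₂, e₃, e₄]
  congr 1
  have hε : 𝔻.map (dualMap f) (𝔻.eps S) = 𝔻.eps T := by
    rw [Disc.eps, 𝔻.map_algebraMap]
    have : (dualMap f).hom (Disc.dualEps S) = Disc.dualEps T := by
      refine TrivSqZeroExt.ext ?_ ?_
      · exact (congrArg₂ (· + ·) (map_zero f.hom) rfl).trans (add_zero 0)
      · exact (congrArg₂ (· + ·) rfl (map_one f.hom)).trans (zero_add 1)
    rw [this]; rfl
  have hh : 𝔻.map (dualMap f) (𝔻.map (fromBase (Disc.dual S)) h) =
      𝔻.map (fromBase (Disc.dual T)) h := by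
    rw [← 𝔻.map_comp]
    have : fromBase (Disc.dual S) ≫ dualMap f = fromBase (Disc.dual T) :=
      CommAlgCat.hom_ext (AlgHom.ext fun a => (dualMap f).hom.commutes a)
    rw [this]
  have hi : ∀ y, 𝔻.map (dualMap f) (𝔻.map (Disc.toDual S) y) =
      𝔻.map (Disc.toDual T) (𝔻.map f y) := by
    intro y
    rw [← 𝔻.map_comp, ← 𝔻.map_comp]
    have : Disc.toDual S ≫ dualMap f = f ≫ Disc.toDual T := by
      refine CommAlgCat.hom_ext (AlgHom.ext fun s => TrivSqZeroExt.ext ?_ ?_)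
      · exact add_zero _
      · exact (congrArg₂ (· + ·) rfl (map_zero f.hom)).trans (add_zero 0)
    rw [this]
  have jbc : ∀ {S T : CommAlgCat.{0} A} (f : S ⟶ T), (𝔻.baseChange f).jac = 1 := fun f => rfl
  have tbc : ∀ {S T : CommAlgCat.{0} A} (f : S ⟶ T) y, (𝔻.baseChange f).toHom y = 𝔻.map f y :=
    fun f y => rfl
  have tinf : ∀ (S : CommAlgCat.{0} A) k y, (𝔻.infAut S k).toHom y =
      y + 𝔻.eps S * (k * 𝔻.der (Disc.dual S) y) := fun S k y => rfl
  have jinf : ∀ (S : CommAlgCat.{0} A) k, ((𝔻.infAut S k).jac : 𝔻.obj (Disc.dual S)) =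
      1 + 𝔻.eps S * 𝔻.der (Disc.dual S) k := fun S k => rfl
  apply DiffHom.ext'
  · intro y
    rw [h₂, h₁, h₄, h₃, tinf, tinf, tbc, tbc, tbc, tbc]
    simp only [map_add, map_mul, 𝔻.map_der, hε, hh, hi]
  · rw [j₂, j₁, j₄, j₃, jbc, jbc, jbc, jbc, jinf, jinf]
    simp only [tbc, Units.val_one, map_one, map_add, map_mul, one_mul, mul_one, 𝔻.map_der, hε, hh]

/-- The (left) action of the vector field `h ∂` on functions on opers:
`F (exp (-ε h ∂) · x) = F x + ε ((h ∂) · F) x`. -/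
noncomputable def derAct (h : 𝔻.obj (Disc.base A)) (F : OpFun B 𝔻) : OpFun B 𝔻 :=
  ⟨fun S x => Disc.dualSnd (F.eval (infMove B 𝔻 (-h) S x)), by
    intro S T f x
    beta_reduce
    rw [infMove_baseChange]
    have := F.2 _ _ (dualMap f) (infMove B 𝔻 (-h) S x)
    refine (congrArg Disc.dualSnd this).trans ?_
    exact (congrArg₂ (· + ·) rfl rfl).trans (zero_add _)⟩

end Discs

/-! ### Completions and localizations -/

section Completions

variable {U : Type*} [CommRing U] (I : ℕ → Ideal U)

/-- The inverse limit of the rings `U ⧸ I N`, for a sequence of ideals `I` that is decreasing (the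
only case that is used): the families whose first entries have a common representative. -/
def limSubring : Subring (∀ N, U ⧸ I N) where
  carrier := {x | ∀ N, ∃ u : U, ∀ M ≤ N, x M = Ideal.Quotient.mk (I M) u}
  mul_mem' {x y} hx hy N := by
    obtain ⟨u, hu⟩ := hx N
    obtain ⟨v, hv⟩ := hy N
    exact ⟨u * v, fun M hM => by rw [Pi.mul_apply, hu M hM, hv M hM, map_mul]⟩
  one_mem' N := ⟨1, fun M _ => by simp⟩
  add_mem' {x y} hx hy N := by
    obtain ⟨u, hu⟩ := hx N
    obtain ⟨v, hv⟩ := hy N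
    exact ⟨u + v, fun M hM => by rw [Pi.add_apply, hu M hM, hv M hM, map_add]⟩
  zero_mem' N := ⟨0, fun M _ => by simp⟩
  neg_mem' {x} hx N := by
    obtain ⟨u, hu⟩ := hx N
    exact ⟨-u, fun M hM => by rw [Pi.neg_apply, hu M hM, map_neg]⟩

/-- The completion of `U` with respect to a decreasing sequence of ideals. -/
def Completion : Type _ := limSubring I

namespace Completion

noncomputable instance : CommRing (Completion I) := inferInstanceAs (CommRing (limSubring I))

/-- The inverse limit topology, each `U ⧸ I N` being discrete. -/
instance : TopologicalSpace (Completion I) :=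
  letI : ∀ N, TopologicalSpace (U ⧸ I N) := fun _ => ⊥
  inferInstanceAs (TopologicalSpace (limSubring I))

instance : IsTopologicalRing (Completion I) :=
  letI : ∀ N, TopologicalSpace (U ⧸ I N) := fun _ => ⊥
  haveI : ∀ N, DiscreteTopology (U ⧸ I N) := fun _ => ⟨rfl⟩
  inferInstanceAs (IsTopologicalRing (limSubring I))

/-- The canonical map `U → lim U ⧸ I N`. -/
noncomputable def of : U →+* Completion I :=
  (RingHom.pi fun N => Ideal.Quotient.mk (I N)).codRestrict (limSubring I)
    (fun u _ => ⟨u, fun _ _ => rfl⟩)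

noncomputable instance {A : Type*} [CommRing A] [Algebra A U] : Algebra A (Completion I) :=
  ((of I).comp (algebraMap A U)).toAlgebra

variable {I}

/-- A lift to `U` of the image of `x` in `U ⧸ I N` (and in `U ⧸ I M` for all `M ≤ N`). -/
noncomputable def rep (x : Completion I) (N : ℕ) : U := (x.2 N).choose

theorem rep_spec (x : Completion I) (N : ℕ) {M : ℕ} (h : M ≤ N) :
    x.1 M = Ideal.Quotient.mk (I M) (x.rep N) := (x.2 N).choose_spec M h

theorem ext {x y : Completion I} (h : ∀ N, x.1 N = y.1 N) : x = y := Subtype.ext (funext h)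

/-- The map of completions induced by a ring homomorphism `g` with `g (I N) ⊆ I' N`. -/
noncomputable def map {U' : Type*} [CommRing U'] {I' : ℕ → Ideal U'} (g : U →+* U')
    (hg : ∀ N, I N ≤ (I' N).comap g) : Completion I →+* Completion I' :=
  (RingHom.pi fun N => (Ideal.quotientMap (I' N) g (hg N)).comp
    ((Pi.evalRingHom _ N).comp (limSubring I).subtype)).codRestrict (limSubring I')
    (fun x N => by
      obtain ⟨u, hu⟩ := x.2 N
      refine ⟨g u, fun M hM => ?_⟩
      change Ideal.quotientMap (I' M) g (hg M) (x.1 M) = _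
      rw [hu M hM, Ideal.quotientMap_mk])

theorem map_val {U' : Type*} [CommRing U'] {I' : ℕ → Ideal U'} (g : U →+* U')
    (hg : ∀ N, I N ≤ (I' N).comap g) (x : Completion I) (N : ℕ) :
    (map g hg x).1 N = Ideal.quotientMap (I' N) g (hg N) (x.1 N) := rfl

theorem map_of {U' : Type*} [CommRing U'] {I' : ℕ → Ideal U'} (g : U →+* U')
    (hg : ∀ N, I N ≤ (I' N).comap g) (u : U) : map g hg (of I u) = of I' (g u) := rfl

variable {A : Type*} [CommRing A] [Algebra A U]

/-- The continuous extension to the completion of a derivation `δ` with `δ (I (N + 1)) ⊆ I N`. -/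
noncomputable def der (δ : Derivation A U U) (hδ : ∀ N, ∀ u ∈ I (N + 1), δ u ∈ I N) :
    Derivation A (Completion I) (Completion I) :=
  have key : ∀ (x : Completion I) (N : ℕ) (u : U), x.1 (N + 1) = Ideal.Quotient.mk _ u →
      Ideal.Quotient.mk (I N) (δ (x.rep (N + 1))) = Ideal.Quotient.mk (I N) (δ u) := by
    intro x N u hu
    rw [Ideal.Quotient.eq, ← map_sub]
    apply hδ
    rw [← Ideal.Quotient.eq, ← hu, ← rep_spec x (N + 1) le_rfl]
  Derivation.mk'
    { toFun := fun x => ⟨fun N => Ideal.Quotient.mk (I N) (δ (x.rep (N + 1))), fun N =>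
        ⟨δ (x.rep (N + 1)), fun M hM => key x M _ (rep_spec x (N + 1) (by omega))⟩⟩
      map_add' := fun x y => ext fun N => by
        refine (key (x + y) N (x.rep (N + 1) + y.rep (N + 1)) ?_).trans (by simp; rfl)
        rw [map_add, ← rep_spec x _ le_rfl, ← rep_spec y _ le_rfl]; rfl
      map_smul' := fun a x => ext fun N => by
        refine (key (a • x) N (a • x.rep (N + 1)) ?_).trans ?_
        · rw [Algebra.smul_def, Algebra.smul_def, map_mul, ← rep_spec x _ le_rfl]; rfl
        · change _ = Ideal.Quotient.mk (I N) (algebraMap A U a) *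
            Ideal.Quotient.mk (I N) (δ (x.rep (N + 1)))
          rw [δ.map_smul, Algebra.smul_def, map_mul] }
    (fun x y => ext fun N => by
      refine (key (x * y) N (x.rep (N + 1) * y.rep (N + 1)) ?_).trans ?_
      · rw [map_mul, ← rep_spec x _ le_rfl, ← rep_spec y _ le_rfl]; rfl
      · rw [Derivation.leibniz, map_add, smul_eq_mul, smul_eq_mul, map_mul, map_mul,
          ← rep_spec x (N + 1) (Nat.le_succ N), ← rep_spec y (N + 1) (Nat.le_succ N)]
        rfl)

theorem der_val (δ : Derivation A U U) (hδ : ∀ N, ∀ u ∈ I (N + 1), δ u ∈ I N)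
    (x : Completion I) (N : ℕ) (u : U) (hu : x.1 (N + 1) = Ideal.Quotient.mk _ u) :
    (der δ hδ x).1 N = Ideal.Quotient.mk (I N) (δ u) := by
  change Ideal.Quotient.mk (I N) (δ (x.rep (N + 1))) = _
  rw [Ideal.Quotient.eq, ← map_sub]
  apply hδ
  rw [← Ideal.Quotient.eq, ← hu, ← rep_spec x (N + 1) le_rfl]

end Completion

end Completions

section Localizations

variable {S R : Type*} [CommRing S] [CommRing R] [Algebra S R]

/-- The ring homomorphism `r ↦ r + ε D r` from the localization of `R` at `x` to its dual
numbers. -/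
noncomputable def locDual (x : R) (D : Derivation S R R) :
    Localization.Away x →+* DualNumber (Localization.Away x) :=
  let g : R →+* DualNumber (Localization.Away x) :=
    { toFun := fun r => TrivSqZeroExt.inl (algebraMap R _ r) + TrivSqZeroExt.inr (algebraMap R _ (D r))
      map_one' := by ext <;> simp
      map_zero' := by ext <;> simp
      map_add' := fun a b => by ext <;> simp [Algebra.smul_def]
      map_mul' := fun a b => by
        ext
        · simp
        · simp only [TrivSqZeroExt.snd_add, TrivSqZeroExt.snd_inl, TrivSqZeroExt.snd_inr,
            TrivSqZeroExt.snd_mul, TrivSqZeroExt.fst_add, TrivSqZeroExt.fst_inl,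
            TrivSqZeroExt.fst_inr, Derivation.leibniz, smul_eq_mul, map_add, map_mul,
            op_smul_eq_smul, zero_add, add_zero] }
  IsLocalization.Away.lift (g := g) x (by
    rw [TrivSqZeroExt.isUnit_iff_isUnit_fst]
    simpa [g] using IsLocalization.Away.algebraMap_isUnit x)

theorem locDual_algebraMap (x : R) (D : Derivation S R R) (r : R) :
    locDual x D (algebraMap R _ r) =
      TrivSqZeroExt.inl (algebraMap R _ r) + TrivSqZeroExt.inr (algebraMap R _ (D r)) :=
  IsLocalization.Away.lift_eq x (by
    rw [TrivSqZeroExt.isUnit_iff_isUnit_fst]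
    simpa using IsLocalization.Away.algebraMap_isUnit x) r

theorem fst_locDual (x : R) (D : Derivation S R R) (f : Localization.Away x) :
    (locDual x D f).fst = f := by
  have : (TrivSqZeroExt.fstHom S (Localization.Away x) (Localization.Away x)).toRingHom.comp
      (locDual x D) = RingHom.id _ := by
    apply IsLocalization.ringHom_ext (Submonoid.powers x)
    ext r
    simp [locDual_algebraMap]
  exact RingHom.congr_fun this f

/-- The extension of a derivation to a localization, by the quotient rule. -/
noncomputable def locDer (x : R) (D : Derivation S R R) :
    Derivation S (Localization.Away x) (Localization.Away x) :=
  Derivation.mk'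
    { toFun := fun f => (locDual x D f).snd
      map_add' := fun f g => by simp
      map_smul' := fun s f => by
        rw [Algebra.smul_def, IsScalarTower.algebraMap_apply S R (Localization.Away x), map_mul,
          TrivSqZeroExt.snd_mul, locDual_algebraMap, fst_locDual]
        simp [Algebra.smul_def, IsScalarTower.algebraMap_apply S R (Localization.Away x)] }
    (fun f g => by
      change (locDual x D (f * g)).snd = f * (locDual x D g).snd + g * (locDual x D f).snd
      rw [map_mul, TrivSqZeroExt.snd_mul, fst_locDual, fst_locDual]
      simp [mul_comm])

theorem locDer_algebraMap (x : R) (D : Derivation S R R) (r : R) :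
    locDer x D (algebraMap R _ r) = algebraMap R _ (D r) := by
  change (locDual x D _).snd = _
  rw [locDual_algebraMap, TrivSqZeroExt.snd_add, TrivSqZeroExt.snd_inl, TrivSqZeroExt.snd_inr,
    zero_add]

end Localizations

/-! ### The formal disc and the formal disc with `n` punctures -/

section Punctured

open Polynomial CategoryTheory

variable {A : Type} [CommRing A] (φ : A[X])

section Rings

variable (S : Type) [CommRing S] [Algebra A S]

/-- The image of `φ` in `S[z]`. -/
noncomputable def phiOver : S[X] := φ.map (algebraMap A S)

/-- The ideals `(φ ^ N)` of `S[z]`. -/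
noncomputable def phiIdeal (N : ℕ) : Ideal S[X] := Ideal.span {phiOver φ S ^ N}

/-- `S(R)`: the completion of `S[z]` along `φ`. -/
abbrev RRing : Type := Completion (phiIdeal φ S)

/-- The image of `φ` in `S(R)`. -/
noncomputable def phiR : RRing φ S := Completion.of (phiIdeal φ S) (phiOver φ S)

/-- `S(K) = S(R)[φ⁻¹]`. -/
abbrev KRing : Type := Localization.Away (phiR φ S)

theorem derivative_mem (N : ℕ) (u : S[X]) (hu : u ∈ phiIdeal φ S (N + 1)) :
    (derivative' : Derivation S S[X] S[X]) u ∈ phiIdeal φ S N := by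
  obtain ⟨q, rfl⟩ := Ideal.mem_span_singleton.1 hu
  refine Ideal.mem_span_singleton.2 ?_
  rw [derivative'_apply, derivative_mul, derivative_pow_succ, pow_succ]
  exact dvd_add (Dvd.dvd.mul_right (Dvd.dvd.mul_right (Dvd.dvd.mul_left dvd_rfl _) _) _)
    (Dvd.dvd.mul_right (Dvd.dvd.mul_right dvd_rfl _) _)

/-- The derivation `∂ = d/dz` of `S(K)`. -/
noncomputable def derK : Derivation S (KRing φ S) (KRing φ S) :=
  locDer (phiR φ S) (Completion.der derivative' (derivative_mem φ S))

/-- The image of a polynomial in `S(K)`. -/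
noncomputable def polyK (p : S[X]) : KRing φ S := algebraMap (RRing φ S) _ (Completion.of _ p)

/-- `φ` as a unit of `S(K)`. -/
noncomputable def unitK : (KRing φ S)ˣ :=
  (IsLocalization.Away.algebraMap_isUnit (S := KRing φ S) (phiR φ S)).unit

/-- `g ∈ φ ^ k S(R)`, for an integer `k`. -/
def InPow (k : ℤ) (g : KRing φ S) : Prop :=
  ∃ r : RRing φ S, g = ((unitK φ S ^ k : (KRing φ S)ˣ) : KRing φ S) * algebraMap _ _ r

end Rings

section Functoriality

variable {S T : Type} [CommRing S] [Algebra A S] [CommRing T] [Algebra A T] (f : S →ₐ[A] T)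

theorem map_phiOver : mapRingHom (f : S →+* T) (phiOver φ S) = phiOver φ T := by
  rw [coe_mapRingHom, phiOver, phiOver, Polynomial.map_map, f.comp_algebraMap]

/-- The map `S(R) → T(R)` induced by `S → T`. -/
noncomputable def mapR : RRing φ S →+* RRing φ T :=
  Completion.map (mapRingHom (f : S →+* T)) (fun N => by
    rw [phiIdeal, Ideal.span_le, Set.singleton_subset_iff, SetLike.mem_coe, Ideal.mem_comap,
      map_pow, map_phiOver]
    exact Ideal.mem_span_singleton_self _)

theorem mapR_phiR : mapR φ f (phiR φ S) = phiR φ T := by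
  rw [mapR, phiR, Completion.map_of, map_phiOver]; rfl

/-- The map `S(K) → T(K)` induced by `S → T`. -/
noncomputable def mapK : KRing φ S →+* KRing φ T :=
  IsLocalization.Away.lift (g := (algebraMap (RRing φ T) (KRing φ T)).comp (mapR φ f))
    (phiR φ S) (by
      rw [RingHom.comp_apply, mapR_phiR]
      exact IsLocalization.Away.algebraMap_isUnit _)

theorem mapK_algebraMap (r : RRing φ S) :
    mapK φ f (algebraMap _ _ r) = algebraMap _ _ (mapR φ f r) :=
  IsLocalization.Away.lift_eq _ _ r

theorem mapR_der (r : RRing φ S) :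
    mapR φ f (Completion.der derivative' (derivative_mem φ S) r) =
      Completion.der derivative' (derivative_mem φ T) (mapR φ f r) := by
  refine Completion.ext fun N => ?_
  have h := r.rep_spec (N + 1) le_rfl
  rw [Completion.der_val derivative' (derivative_mem φ T) (mapR φ f r) N
    (mapRingHom (f : S →+* T) (r.rep (N + 1)))
    (by rw [mapR, Completion.map_val, h, Ideal.quotientMap_mk])]
  rw [mapR, Completion.map_val,
    Completion.der_val derivative' (derivative_mem φ S) r N _ h, Ideal.quotientMap_mk]
  simp [derivative_map]

theorem mapK_der (x : KRing φ S) : mapK φ f (derK φ S x) = derK φ T (mapK φ f x) := by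
  obtain ⟨k, r, hr⟩ := IsLocalization.Away.surj (phiR φ S) x
  have h1 := congrArg (derK φ S) hr
  rw [Derivation.leibniz, derK, locDer_algebraMap, ← map_pow, locDer_algebraMap] at h1
  have h2 := congrArg (derK φ T) (congrArg (mapK φ f) hr)
  rw [map_mul, Derivation.leibniz, ← map_pow, mapK_algebraMap, mapK_algebraMap, derK,
    locDer_algebraMap, locDer_algebraMap, ← mapR_der, ← mapR_der] at h2
  have h3 := congrArg (mapK φ f) h1
  rw [smul_eq_mul, smul_eq_mul, map_add, map_mul, map_mul, mapK_algebraMap, mapK_algebraMap,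
    mapK_algebraMap, ← h2, smul_eq_mul, smul_eq_mul, add_right_inj] at h3
  have hu : IsUnit (algebraMap (RRing φ T) (KRing φ T) (mapR φ f (phiR φ S ^ k))) := by
    rw [map_pow, map_pow, mapR_phiR]
    exact (IsLocalization.Away.algebraMap_isUnit _).pow k
  exact hu.mul_left_cancel h3

end Functoriality

variable [Algebra ℂ A]

/-- The disc `Spec R` without the zero locus of `φ`, in families: `S ↦ (S(K), ∂)`. -/
noncomputable def punct : Disc A where
  obj S := KRing φ S
  der S := derK φ S
  map f := mapK φ f.hom
  map_algebraMap {S T} f s := by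
    rw [IsScalarTower.algebraMap_apply S (RRing φ S) (KRing φ S), mapK_algebraMap,
      IsScalarTower.algebraMap_apply T (RRing φ T) (KRing φ T)]
    congr 1
    change mapR φ f.hom (Completion.of _ (algebraMap S S[X] s)) =
      Completion.of _ (algebraMap T T[X] (f.hom s))
    rw [mapR, Completion.map_of]
    simp
  map_der f x := mapK_der φ f.hom x
  map_id S x := by
    have : mapK φ (AlgHom.id A S) = RingHom.id _ := by
      apply IsLocalization.ringHom_ext (Submonoid.powers (phiR φ S))
      ext r
      rw [RingHom.comp_apply, mapK_algebraMap, RingHom.id_comp]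
      congr 1
      refine Completion.ext fun N => ?_
      rw [mapR, Completion.map_val, r.rep_spec N le_rfl, Ideal.quotientMap_mk]
      simp
    exact RingHom.congr_fun this x
  map_comp {S T U} f g x := by
    have : mapK φ (g.hom.comp f.hom) = (mapK φ g.hom).comp (mapK φ f.hom) := by
      apply IsLocalization.ringHom_ext (Submonoid.powers (phiR φ S))
      ext r
      simp only [RingHom.comp_apply, mapK_algebraMap]
      congr 1
      refine Completion.ext fun N => ?_
      have h := r.rep_spec N le_rfl
      simp only [mapR, Completion.map_val]
      rw [h, Ideal.quotientMap_mk, Ideal.quotientMap_mk, Ideal.quotientMap_mk]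
      simp only [coe_mapRingHom, Polynomial.map_map]
      rfl
    exact RingHom.congr_fun this x

/-- The formal disc, in families: `S ↦ (S⟦t⟧, d/dt)`. -/
noncomputable def disc : Disc ℂ where
  obj S := PowerSeries S
  der S := PowerSeries.derivative S
  map f := PowerSeries.map (f.hom : _ →+* _)
  map_algebraMap f s := by
    ext n
    simp
  map_der f x := by
    ext n
    simp [PowerSeries.coeff_derivative]
  map_id S x := by ext n; simp
  map_comp f g x := by ext n; simp

end Punctured

section Residues

open Polynomial

variable {A : Type} [CommRing A] (φ : A[X]) (S : Type) [CommRing S] [Algebra A S]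

/-- For `r ∈ S(R)` and a representative `u ∈ S[z]` of `r` modulo `φ ^ k`, the sum of the residues of
`u / φ ^ k` at the zeros of `φ`, computed as minus the residue at infinity. -/
noncomputable def resAux (k : ℕ) (u : S[X]) : S :=
  (u %ₘ (phiOver φ S ^ k)).coeff (φ.natDegree * k - 1)

/-- The residue `∫ : S(K) → S` (for `φ` monic): the continuous `S`-linear map that sends `u / φ ^ k`,
for a polynomial `u`, to the sum of its residues at the zeros of `φ`. -/
noncomputable def residue (f : KRing φ S) : S :=
  resAux φ S (IsLocalization.Away.surj (phiR φ S) f).choose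
    ((IsLocalization.Away.surj (phiR φ S) f).choose_spec.choose.rep
      (IsLocalization.Away.surj (phiR φ S) f).choose)

variable {φ S}

theorem resAux_congr (hφ : φ.Monic) {k : ℕ} {u v : S[X]}
    (h : Ideal.Quotient.mk (phiIdeal φ S k) u = Ideal.Quotient.mk _ v) :
    resAux φ S k u = resAux φ S k v := by
  have hm : (phiOver φ S ^ k).Monic := (hφ.map _).pow k
  rw [Ideal.Quotient.eq, phiIdeal, Ideal.mem_span_singleton] at h
  rw [resAux, resAux, ← sub_eq_zero, ← coeff_sub, ← sub_modByMonic,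
    (modByMonic_eq_zero_iff_dvd hm).2 h, coeff_zero]

theorem resAux_mul (hφ : φ.Monic) (k j : ℕ) (u : S[X]) :
    resAux φ S (k + j) (u * phiOver φ S ^ j) = resAux φ S k u := by
  nontriviality S
  have hm : ∀ k, (phiOver φ S ^ k).Monic := fun k => (hφ.map _).pow k
  have hd : ∀ k, (phiOver φ S ^ k).natDegree = φ.natDegree * k := fun k => by
    rw [phiOver, (hφ.map _).natDegree_pow, hφ.natDegree_map, mul_comm]
  have h1 : (u * phiOver φ S ^ j) %ₘ (phiOver φ S ^ (k + j)) =
      (u %ₘ (phiOver φ S ^ k)) * phiOver φ S ^ j := by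
    refine (div_modByMonic_unique (u /ₘ (phiOver φ S ^ k)) _ (hm _) ⟨?_, ?_⟩).2
    · conv_rhs => rw [← modByMonic_add_div u (phiOver φ S ^ k)]
      ring
    · rw [pow_add, (hm j).degree_mul, (hm j).degree_mul]
      have := degree_modByMonic_lt u (hm k)
      have hb : (phiOver φ S ^ j).degree ≠ ⊥ := by
        rw [Ne, degree_eq_bot]; exact (hm j).ne_zero
      exact WithBot.add_lt_add_right hb this
  rw [resAux, resAux, h1]
  by_cases hk : φ.natDegree * k = 0
  · have h0 : u %ₘ (phiOver φ S ^ k) = 0 := by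
      have : phiOver φ S ^ k = 1 := by
        rw [← (hm k).natDegree_eq_zero, hd, hk]
      rw [this, modByMonic_one]
    rw [h0]; simp
  · have h2 : φ.natDegree * (k + j) - 1 = (φ.natDegree * k - 1) + φ.natDegree * j := by
      rw [mul_add]; omega
    have h3 : (u %ₘ (phiOver φ S ^ k)).natDegree ≤ φ.natDegree * k - 1 := by
      have := natDegree_modByMonic_lt u (hm k) (by
        intro h; apply hk; rw [← hd, h, natDegree_one])
      rw [hd] at this; omega
    rw [h2, coeff_mul_add_eq_of_natDegree_le h3 (hd j).le, ← hd j,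
      (hm j).coeff_natDegree, mul_one]

/-- The residue does not depend on the chosen presentation. -/
theorem residue_spec (hφ : φ.Monic) (f : KRing φ S) (k : ℕ) (r : RRing φ S) (u : S[X])
    (hr : f * algebraMap _ _ (phiR φ S) ^ k = algebraMap _ _ r)
    (hu : r.1 k = Ideal.Quotient.mk _ u) : residue φ S f = resAux φ S k u := by
  set k' := (IsLocalization.Away.surj (phiR φ S) f).choose with hk'
  set r' := (IsLocalization.Away.surj (phiR φ S) f).choose_spec.choose with hr'
  have h : f * algebraMap _ _ (phiR φ S) ^ k' = algebraMap _ _ r' :=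
    (IsLocalization.Away.surj (phiR φ S) f).choose_spec.choose_spec
  change resAux φ S k' (r'.rep k') = _
  have e : algebraMap (RRing φ S) (KRing φ S) (r * phiR φ S ^ k') =
      algebraMap _ _ (r' * phiR φ S ^ k) := by
    rw [map_mul, map_mul, map_pow, map_pow, ← hr, ← h]; ring
  obtain ⟨m, hm⟩ := IsLocalization.Away.exists_of_eq (phiR φ S) e
  have ha : r.1 k = Ideal.Quotient.mk _ (r.rep (k + k' + m)) := r.rep_spec _ (by omega)
  have hb : r'.1 k' = Ideal.Quotient.mk _ (r'.rep (k + k' + m)) := r'.rep_spec _ (by omega)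
  rw [resAux_congr hφ ((r'.rep_spec k' le_rfl).symm.trans hb), resAux_congr hφ (hu.symm.trans ha),
    ← resAux_mul hφ k' (k + m), ← resAux_mul hφ k (k' + m)]
  have e2 : k' + (k + m) = k + (k' + m) := by omega
  rw [e2]
  apply resAux_congr hφ
  have h3 := congrArg (fun x : RRing φ S => x.1 (k + (k' + m))) hm
  have h4 : ∀ (x : RRing φ S) (a b : ℕ), (phiR φ S ^ a * (x * phiR φ S ^ b)).1 (k + (k' + m)) =
      Ideal.Quotient.mk (phiIdeal φ S (k + (k' + m)))
        (x.rep (k + (k' + m)) * phiOver φ S ^ (b + a)) := by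
    intro x a b
    rw [pow_add, map_mul, map_mul, map_pow, map_pow, ← x.rep_spec _ le_rfl,
      mul_comm (_ ^ b) (_ ^ a), mul_left_comm]
    rfl
  have e3 : k + k' + m = k + (k' + m) := by omega
  rw [e3]
  exact ((h4 r' m k).symm.trans h3.symm).trans (h4 r m k')

end Residues

/-! ### The algebra `Ũ_K(V)` of a commutative vertex algebra -/

section Envelope

open Polynomial

variable {A : Type} [CommRing A] [Algebra ℂ A] (φ : A[X])

instance : SMulCommClass ℂ A (KRing φ A) where
  smul_comm z a x := by simp only [Algebra.smul_def]; ring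

variable {V : Type*} [CommRing V] [Algebra ℂ V] (Lop : ℕ → V → V)

/-- The image of `T + ∂` in `V ⊗ K`, where `T = Lop 0`. -/
noncomputable def lieRel : Submodule A (KRing φ A ⊗[ℂ] V) :=
  Submodule.span A {x | ∃ (f : KRing φ A) (a : V), x = derK φ A f ⊗ₜ a + f ⊗ₜ Lop 0 a}

/-- `Lie_K(V)`, the quotient of `V ⊗ K` by the image of `T + ∂`. As `V` is a commutative vertex
algebra (`a₍ₖ₎b = 0` for `k ≥ 0`), its Lie bracket vanishes. -/
abbrev LieK : Type _ := (KRing φ A ⊗[ℂ] V) ⧸ lieRel φ Lop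

/-- The element `a g` of `Lie_K(V)`. -/
noncomputable def lieGen (a : V) (g : KRing φ A) : LieK φ Lop :=
  Submodule.Quotient.mk (g ⊗ₜ[ℂ] a)

/-- The elements `vac g - ∫ g`. -/
noncomputable def vacIdeal : Ideal (SymmetricAlgebra A (LieK φ Lop)) :=
  Ideal.span {x | ∃ g : KRing φ A, x = SymmetricAlgebra.ι A (LieK φ Lop) (lieGen φ Lop 1 g) -
    algebraMap A _ (residue φ A g)}

/-- `U⁰`: the universal enveloping algebra over `A` of the abelian Lie algebra `Lie_K(V)`, modulo the
elements `vac g - ∫ g`. -/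
abbrev UZero : Type _ := SymmetricAlgebra A (LieK φ Lop) ⧸ vacIdeal φ Lop

/-- The element `a g` of `U⁰`. -/
noncomputable def zeroGen (a : V) (g : KRing φ A) : UZero φ Lop :=
  Ideal.Quotient.mk _ (SymmetricAlgebra.ι A (LieK φ Lop) (lieGen φ Lop a g))

/-- The ideal of `U⁰` generated by the `a g` with `a` of degree `m` (for the operator
`L₀ = Lop 1`) and `g ∈ φ ^ k R` for some `k ≥ N m`. -/
noncomputable def degIdeal (N : ℕ) : Ideal (UZero φ Lop) :=
  Ideal.span {x | ∃ (a : V) (g : KRing φ A) (m k : ℤ), Lop 1 a = (m : ℂ) • a ∧ N * m ≤ k ∧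
    InPow φ A k g ∧ x = zeroGen φ Lop a g}

/-- `U'`: the completion of `U⁰`. -/
abbrev UPrime : Type _ := Completion (degIdeal φ Lop)

/-- The field `ã : g ↦ a g`, with values in `U'`. -/
noncomputable def fieldOf (a : V) (g : KRing φ A) : UPrime φ Lop :=
  Completion.of _ (zeroGen φ Lop a g)

/-- The `m`-th term of the series that defines the `(-1)`-product `(ã₍₋₁₎ b̃)(g)`, which is
`((z - w)⁻¹ ã(z) b̃(w))(1 ⊗ g) - ((z - w)⁻¹ b̃(w) ã(z))(1 ⊗ g)`. With
`H(z, w) = (φ(z) - φ(w)) / (z - w)`, the first `(z - w)⁻¹` is expanded as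
`∑ₘ H(z, w) φ(z)⁻ᵐ⁻¹ φ(w)ᵐ`, and the second one as `-∑ₘ H(z, w) φ(z)ᵐ φ(w)⁻ᵐ⁻¹`. If `φ = ∑ cₖ zᵏ`, then
`H(z, w) = ∑ₖ cₖ ∑_{i < k} zⁱ wᵏ⁻¹⁻ⁱ`. -/
noncomputable def minusOneTerm (a b : V) (g : KRing φ A) (m : ℕ) : UPrime φ Lop :=
  ∑ k ∈ Finset.range (φ.natDegree + 1), ∑ i ∈ Finset.range k, φ.coeff k •
    (fieldOf φ Lop a (polyK φ A (X ^ i) * ((unitK φ A ^ (-(m : ℤ) - 1) : (KRing φ A)ˣ) : KRing φ A)) *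
        fieldOf φ Lop b (polyK φ A (X ^ (k - 1 - i)) *
          ((unitK φ A ^ m : (KRing φ A)ˣ) : KRing φ A) * g) +
      fieldOf φ Lop a (polyK φ A (X ^ i) * ((unitK φ A ^ m : (KRing φ A)ˣ) : KRing φ A)) *
        fieldOf φ Lop b (polyK φ A (X ^ (k - 1 - i)) *
          ((unitK φ A ^ (-(m : ℤ) - 1) : (KRing φ A)ˣ) : KRing φ A) * g))

/-- The closure of the ideal generated by the elements `(a₍₋₁₎ b) g - (ã₍₋₁₎ b̃)(g)`, where
`a₍₋₁₎ b = a * b` in the commutative vertex algebra `V`. -/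
noncomputable def prodIdeal : Ideal (UPrime φ Lop) :=
  (Ideal.span {x : UPrime φ Lop | ∃ (a b : V) (g : KRing φ A) (s : UPrime φ Lop),
    HasSum (minusOneTerm φ Lop a b g) s ∧ x = fieldOf φ Lop (a * b) g - s}).closure

/-- `Ũ_K(V)`. -/
def UTilde : Type _ := UPrime φ Lop ⧸ prodIdeal φ Lop

noncomputable instance : CommRing (UTilde φ Lop) :=
  inferInstanceAs (CommRing (UPrime φ Lop ⧸ prodIdeal φ Lop))

noncomputable instance : Algebra A (UTilde φ Lop) :=
  inferInstanceAs (Algebra A (UPrime φ Lop ⧸ prodIdeal φ Lop))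

noncomputable instance : TopologicalSpace (UTilde φ Lop) :=
  inferInstanceAs (TopologicalSpace (UPrime φ Lop ⧸ prodIdeal φ Lop))

/-- The element `a g` of `Ũ_K(V)`. -/
noncomputable def gen (a : V) (g : KRing φ A) : UTilde φ Lop :=
  Ideal.Quotient.mk (prodIdeal φ Lop) (fieldOf φ Lop a g)

/-- `δ` is the action of the vector field `h ∂` on `Ũ_K(V)`: the continuous `A`-linear derivation with
`(h ∂) · (a g) = - ∑_{k ≥ -1} (L_k a) (g ∂^{k+1} h) / (k + 1)!`, where `L_k = Lop (k + 1)`. -/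
def IsDerAction (h : KRing φ A) (δ : Derivation A (UTilde φ Lop) (UTilde φ Lop)) : Prop :=
  Continuous δ ∧ ∀ (a : V) (g : KRing φ A), δ (gen φ Lop a g) =
    -∑ᶠ l : ℕ, gen φ Lop (Lop l a) ((l.factorial : ℂ)⁻¹ • (g * (derK φ A)^[l] h))

end Envelope

/-! ### Functions on opers on the (punctured) disc -/

section Main

open Polynomial

variable {𝔤 : Type*} [LieRing 𝔤] [LieAlgebra ℂ 𝔤] {ι : Type*} [Fintype ι]
  {H : LieSubalgebra ℂ 𝔤} (B : LieAlgebra.Basis ι H)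

/-- The oper `x` is the class of `d + (p₋₁ + ∑ cᵢ vᵢ) dt`. -/
def IsCanForm {L : Type*} [CommRing L] [Algebra ℂ L] {D : Derivation ℂ L L} {l : ℕ}
    (v : Fin l → 𝔤) (x : Op B D) (c : Fin l → L) : Prop :=
  ∃ h : IsOper B L (1 ⊗ₜ[ℂ] pMinus B + ∑ i, c i ⊗ₜ[ℂ] v i),
    x = Quotient.mk (operSetoid B D) ⟨_, h⟩

/-- `ℂ[Op(D)]`, the algebra of functions on the space of opers on the formal disc. -/
abbrev DiscFun : Type _ := OpFun B disc

/-- The operator `L_{l-1} = -t^l d/dt` of `ℂ[Op(D)]`. -/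
noncomputable def discL (l : ℕ) (F : DiscFun B) : DiscFun B :=
  derAct B disc (-(PowerSeries.X ^ l : PowerSeries ℂ)) F

variable {B} in
/-- `F` is the function `v*_{i,-1}`, which sends `d + (p₋₁ + ∑ cⱼ(t) vⱼ) dt` to
`∫ cᵢ(t) t⁻¹ dt = cᵢ(0)`. -/
def IsDiskCoord {l : ℕ} (v : Fin l → 𝔤) (i : Fin l) (F : DiscFun B) : Prop :=
  ∀ (S : CommAlgCat.{0} ℂ) (x : OpOn B disc S) (c : Fin l → PowerSeries S),
    IsCanForm B (L := disc.obj S) v x c → F.eval x = PowerSeries.constantCoeff (c i)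

variable {A : Type} [CommRing A] [Algebra ℂ A] (φ : A[X])

/-- `A[Op]`, the algebra of functions on the space of opers on the punctured disc. -/
abbrev PunctFun : Type _ := OpFun B (punct φ)

variable {B φ} in
/-- `F` is the function `v*_i(g)`, which sends `d + (p₋₁ + ∑ cⱼ vⱼ) dt` to `∫ cᵢ g dt`. -/
def IsCoord {l : ℕ} (v : Fin l → 𝔤) (i : Fin l) (g : KRing φ A) (F : PunctFun B φ) : Prop :=
  ∀ (S : CommAlgCat.{0} A) (x : OpOn B (punct φ) S) (c : Fin l → KRing φ S),
    IsCanForm B (L := (punct φ).obj S) v x c →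
      F.eval x = residue φ S (c i * mapK φ (Algebra.ofId A S) g)

/-- The ideal of the functions that vanish on all opers `d + (p₋₁ + ∑ cᵢ vᵢ) dt` such that
`φ ^ N cᵢ` is regular for all `i`. -/
noncomputable def polarIdeal {l : ℕ} (v : Fin l → 𝔤) (N : ℕ) : Ideal (PunctFun B φ) where
  carrier := {F | ∀ (S : CommAlgCat.{0} A) (x : OpOn B (punct φ) S) (c : Fin l → KRing φ S),
    IsCanForm B (L := (punct φ).obj S) v x c → (∀ i, InPow φ S (-(N : ℤ)) (c i)) → F.eval x = 0}
  add_mem' {F G} hF hG S x c hx hc := by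
    refine (congrArg₂ (· + ·) (hF S x c hx hc) (hG S x c hx hc)).trans (add_zero 0)
  zero_mem' S x c _ _ := rfl
  smul_mem' F G hG S x c hx hc := by
    refine (congrArg₂ (· * ·) rfl (hG S x c hx hc)).trans (mul_zero _)

/-- The topology of `A[Op]` as the inverse limit of the discrete algebras of functions on the
spaces of opers with poles of bounded order. -/
noncomputable def opFunTopology {l : ℕ} (v : Fin l → 𝔤) : TopologicalSpace (PunctFun B φ) :=
  ⨅ N : ℕ, TopologicalSpace.induced (Ideal.Quotient.mk (polarIdeal B φ v N)) ⊥

/-- `ℂ[[a₁, …, aₙ]]`. -/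
abbrev BaseRing (n : ℕ) : Type := MvPowerSeries (Fin n) ℂ

/-- `φₙ = ∏ (z - aᵢ)`. -/
noncomputable def phi (n : ℕ) : (BaseRing n)[X] := ∏ i : Fin n, (X - C (MvPowerSeries.X i))

/-- `Φ : Ũ_K(ℂ[Op(D)]) → A[Op]` is an isomorphism of topological algebras that maps `w i · g` to
`c i g`. -/
def IsOperIso {l : ℕ} (v : Fin l → 𝔤) (w : Fin l → DiscFun B) (c : Fin l → KRing φ A → PunctFun B φ)
    (Φ : UTilde φ (discL B) ≃ₐ[A] PunctFun B φ) : Prop :=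
  Continuous[inferInstance, opFunTopology B φ v] Φ ∧
    Continuous[opFunTopology B φ v, inferInstance] Φ.symm ∧
    ∀ i g, Φ (gen φ (discL B) (w i) g) = c i g

end Main

end OperFF

open OperFF

set_option linter.unusedSectionVars false

/-! Everything rests on canonical coordinates. Grade 𝔤 by ρ. By 𝔰𝔩₂-theory, 𝔤ₖ = [p₋₁, 𝔤ₖ₊₁] ⊕ Vₖ
for k ≥ 0, where V = V^can, and ad p₁ ∘ ad p₋₁ is injective in positive degrees. Over any
differential ring L, an oper connection is first brought by the torus to the form p₋₁ + (degree ≥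
0), and then normalized degree by degree with gauge transformations exp(ad u); this gives p₋₁ + ∑ cᵢ
vᵢ (`exists_canForm`), and the same injectivity shows that c is unique (`canForm_unique`). An oper
over L is thus a tuple c ∈ Lˡ, and a function on opers is a natural function of c, determined by its
values at universal points.

On the formal disc this means that ℂ[Op(D)] is generated by the Taylor coefficients of the cᵢ
(`adjoin_discCoord`). On the punctured disc, elements of S(K) are expanded in the zʲ φᵏ with 0 ≤ j <
deg φ; the residue pairing makes the coefficients of (φ(z) - φ(w))/(z - w) dual to the zʲ
(`residue_dualPoly`, `residue_mul_eq_sum`). The universal oper with poles of order at most M has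
independent variables as coefficients.

The map Φ sends a g to the function c ↦ ∫ a(c) g dt, where a(c) is the value of a at the Taylor
series of c (`fieldFun`). The relation for T + ∂ is integration by parts (`residue_derK`). The
relation for (ã₍₋₁₎ b̃)(g) holds because, at a given c, its series is the expansion of ∫ a(c) b(c) g
dt in a pair of dual bases (`evalK_sum_minusOneTerm`). If a has degree m and c has poles of order at
most N > 0, then a(c) has poles of order at most N m (`mem_weightPart`); hence Φ is defined on the
completion and continuous.

For the inverse, a function is evaluated at the universal point with poles of order at most M, and
each variable in the resulting polynomial is replaced by the corresponding element of U⁰. Modulo the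
N-th ideal the result does not depend on M once M is large (`coordHom_evalK_sub_mem`), so a map
A[Op] → U' arises. It is inverse to Φ after passage to Ũ, because T and the product relation show
that the elements v*_{i,-1} g generate Ũ topologically (`fieldOf_mem`, `tilde_mem_of_isClosed`). The
same fact gives all uniqueness statements.

For vector fields, exp(ε h ∂) followed by two infinitesimal gauge transformations maps cᵢ to cᵢ + ε
(h ∂cᵢ + (dᵢ + 1) ∂h cᵢ - κᵢ ∂³h / 2), where p₁ = ∑ κᵢ vᵢ (`gaugeEquiv_smul_canForm`,
`infMove_canOp`). This is linear in h, so expanding h in its Taylor series writes the variation of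
a(c) as ∑ₘ (Lₘ₋₁ a)(c) ∂ᵐh / m! (`jet_add_eps`), which is the formula required on Ũ. The derivation
of Ũ is therefore the transport of the one of A[Op] by Φ, and equivariance is built in. -/

namespace OperFF

/-! ### Gradings by an ad-diagonalizable element -/

/-- A decomposition of `𝔊` into eigenspaces of `ad x` with integer eigenvalues, given by the
projections onto the eigenspaces. -/
structure Grading (R : Type*) {𝔊 : Type*} [CommRing R] [LieRing 𝔊] [LieAlgebra R 𝔊] (x : 𝔊) where
  supp : Finset ℤ
  proj : ℤ → 𝔊 →ₗ[R] 𝔊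
  lie_proj : ∀ k y, ⁅x, proj k y⁆ = (k : R) • proj k y
  proj_proj : ∀ k j y, proj k (proj j y) = if k = j then proj j y else 0
  sum_proj : ∀ y, ∑ k ∈ supp, proj k y = y

namespace Grading

section Basic

variable {R 𝔊 : Type*} [CommRing R] [LieRing 𝔊] [LieAlgebra R 𝔊] {x : 𝔊} (G : Grading R x)

theorem proj_eq_zero {k : ℤ} (hk : k ∉ G.supp) (y : 𝔊) : G.proj k y = 0 := by
  conv_lhs => rw [← G.sum_proj y]
  rw [map_sum]
  refine Finset.sum_eq_zero fun j hj => ?_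
  rw [G.proj_proj, if_neg]
  rintro rfl
  exact hk hj

theorem proj_lie_self (k : ℤ) (y : 𝔊) : G.proj k ⁅x, y⁆ = (k : R) • G.proj k y := by
  conv_lhs => rw [← G.sum_proj y]
  simp only [lie_sum, G.lie_proj, map_sum, map_smul, G.proj_proj, smul_ite, smul_zero]
  rw [Finset.sum_ite_eq]
  split_ifs with h
  · rfl
  · rw [G.proj_eq_zero h, smul_zero]

theorem ext_proj {y z : 𝔊} (h : ∀ k, G.proj k y = G.proj k z) : y = z := by
  rw [← G.sum_proj y, ← G.sum_proj z]
  exact Finset.sum_congr rfl fun k _ => h k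

/-- The elements of degree at least `r`. -/
def fil (r : ℤ) : Submodule R 𝔊 where
  carrier := {y | ∀ k < r, G.proj k y = 0}
  add_mem' hy hz k hk := by rw [map_add, hy k hk, hz k hk, add_zero]
  zero_mem' k _ := map_zero _
  smul_mem' a y hy k hk := by rw [map_smul, hy k hk, smul_zero]

theorem fil_mono {r s : ℤ} (h : s ≤ r) : G.fil r ≤ G.fil s :=
  fun _ hy k hk => hy k (lt_of_lt_of_le hk h)

theorem proj_mem_fil (r k : ℤ) (h : r ≤ k) (y : 𝔊) : G.proj k y ∈ G.fil r := by
  intro j hj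
  rw [G.proj_proj, if_neg (by omega)]

theorem fil_induction {r : ℤ} {P : 𝔊 → Prop} (h0 : P 0) (hadd : ∀ y z, P y → P z → P (y + z))
    (h : ∀ k ≥ r, ∀ y, P (G.proj k y)) {y : 𝔊} (hy : y ∈ G.fil r) : P y := by
  classical
  rw [← G.sum_proj y]
  refine Finset.sum_induction _ P (fun a b => hadd a b) h0 fun k _ => ?_
  by_cases hk : k < r
  · rw [hy k hk]; exact h0
  · exact h k (by omega) y

/-- The support is finite. Together with the opposite bound below, this makes degree-raising
operators nilpotent and lets constructions by increasing degree terminate. -/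
theorem exists_fil_eq_bot : ∃ r : ℤ, ∀ y ∈ G.fil r, y = 0 := by
  obtain ⟨r, hr⟩ := G.supp.bddAbove
  refine ⟨r + 1, fun y hy => ?_⟩
  rw [← G.sum_proj y]
  exact Finset.sum_eq_zero fun k hk => hy k (by have := hr hk; omega)

theorem exists_fil_eq_top : ∃ r : ℤ, ∀ y, y ∈ G.fil r := by
  obtain ⟨r, hr⟩ := G.supp.bddBelow
  refine ⟨r, fun y k hk => G.proj_eq_zero (fun h => ?_) y⟩
  have := hr h
  omega

theorem sub_proj_mem_fil {r : ℤ} {y : 𝔊} (hy : y ∈ G.fil r) : y - G.proj r y ∈ G.fil (r + 1) := by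
  intro k hk
  rw [map_sub, G.proj_proj]
  split_ifs with h
  · rw [h, sub_self]
  · rw [hy k (by omega), sub_zero]

variable [Algebra ℂ R]

theorem eq_zero_of_intCast_smul {k : ℤ} (hk : k ≠ 0) {y : 𝔊} (h : (k : R) • y = 0) : y = 0 := by
  have h1 : algebraMap ℂ R ((k : ℂ)⁻¹) * (k : R) = 1 := by
    rw [← map_intCast (algebraMap ℂ R), ← map_mul, inv_mul_cancel₀ (by exact_mod_cast hk), map_one]
  rw [← one_smul R y, ← h1, mul_smul, h, smul_zero]

/-- On the component of degree k, ad x gives both the factor j and the factor k, so j - k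
annihilates it; nonzero integers are invertible because R is a ℂ-algebra. -/
theorem proj_of_lie {j : ℤ} {y : 𝔊} (h : ⁅x, y⁆ = (j : R) • y) (k : ℤ) :
    G.proj k y = if k = j then y else 0 := by
  have h1 : ∀ k ≠ j, G.proj k y = 0 := fun k hk => by
    have h2 := G.proj_lie_self k y
    rw [h, map_smul, ← sub_eq_zero, ← sub_smul, ← Int.cast_sub] at h2
    exact eq_zero_of_intCast_smul (by omega) h2
  split_ifs with hk
  · subst hk
    conv_rhs => rw [← G.sum_proj y]
    rw [Finset.sum_eq_single k (fun i _ hi => h1 i hi) (fun hk => G.proj_eq_zero hk y)]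
  · exact h1 k hk

theorem mem_fil_of_lie {j r : ℤ} (hr : r ≤ j) {y : 𝔊} (h : ⁅x, y⁆ = (j : R) • y) : y ∈ G.fil r := by
  intro k hk
  rw [G.proj_of_lie h, if_neg (by omega)]

theorem lie_lie_proj {a b : ℤ} {y z : 𝔊} (hy : ⁅x, y⁆ = (a : R) • y) (hz : ⁅x, z⁆ = (b : R) • z) :
    ⁅x, ⁅y, z⁆⁆ = ((a + b : ℤ) : R) • ⁅y, z⁆ := by
  rw [leibniz_lie, hy, hz, smul_lie, lie_smul, ← add_smul, Int.cast_add]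

theorem lie_mem_fil {a b : ℤ} {y z : 𝔊} (hy : y ∈ G.fil a) (hz : z ∈ G.fil b) :
    ⁅y, z⁆ ∈ G.fil (a + b) := by
  refine G.fil_induction (P := fun y => ⁅y, z⁆ ∈ G.fil (a + b)) (by simp)
    (fun y y' h h' => by rw [add_lie]; exact add_mem h h') (fun i hi y => ?_) hy
  refine G.fil_induction (P := fun z => ⁅_, z⁆ ∈ G.fil (a + b)) (by simp)
    (fun y y' h h' => by rw [lie_add]; exact add_mem h h') (fun j hj z => ?_) hz
  exact G.mem_fil_of_lie (add_le_add hi hj) (lie_lie_proj (G.lie_proj i y) (G.lie_proj j z))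

theorem proj_lie_homogeneous {a : ℤ} {u : 𝔊} (hu : ⁅x, u⁆ = (a : R) • u) (k : ℤ) (y : 𝔊) :
    G.proj k ⁅u, y⁆ = ⁅u, G.proj (k - a) y⁆ := by
  conv_lhs => rw [← G.sum_proj y]
  rw [lie_sum, map_sum]
  have h1 : ∀ j, G.proj k ⁅u, G.proj j y⁆ = if j = k - a then ⁅u, G.proj (k - a) y⁆ else 0 := by
    intro j
    rw [G.proj_of_lie (lie_lie_proj hu (G.lie_proj j y))]
    by_cases h : j = k - a
    · subst h; simp
    · rw [if_neg (by omega), if_neg h]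
  simp only [h1, Finset.sum_ite_eq']
  split_ifs with h
  · rfl
  · rw [G.proj_eq_zero h, lie_zero]

/-! #### Scaling by powers of a unit -/

/-- The operator `c ^ (ad x)`. -/
noncomputable def scaleMap (c : Rˣ) : 𝔊 →ₗ[R] 𝔊 := ∑ k ∈ G.supp, ((c ^ k : Rˣ) : R) • G.proj k

theorem scaleMap_of_lie (c : Rˣ) {j : ℤ} {y : 𝔊} (h : ⁅x, y⁆ = (j : R) • y) :
    G.scaleMap c y = ((c ^ j : Rˣ) : R) • y := by
  have h1 := G.proj_of_lie h
  simp only [scaleMap, LinearMap.sum_apply, LinearMap.smul_apply, h1, smul_ite, smul_zero,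
    Finset.sum_ite_eq']
  split_ifs with hj
  · rfl
  · have h2 := h1 j
    rw [if_pos rfl, G.proj_eq_zero hj] at h2
    rw [← h2, smul_zero]

theorem hom_induction (G : Grading R x) {P : 𝔊 → Prop} (h0 : P 0) (hadd : ∀ y z, P y → P z → P (y + z))
    (h : ∀ (k : ℤ) y, ⁅x, y⁆ = (k : R) • y → P y) (y : 𝔊) : P y := by
  rw [← G.sum_proj y]
  exact Finset.sum_induction _ P (fun a b => hadd a b) h0 fun k _ => h k _ (G.lie_proj k y)

theorem scaleMap_scaleMap (c d : Rˣ) (y : 𝔊) :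
    G.scaleMap c (G.scaleMap d y) = G.scaleMap (c * d) y := by
  refine G.hom_induction (P := fun y => G.scaleMap c (G.scaleMap d y) = G.scaleMap (c * d) y)
    (by simp) (fun y z hy hz => by simp only [map_add, hy, hz]) (fun k y h => ?_) y
  rw [G.scaleMap_of_lie d h, map_smul, G.scaleMap_of_lie c h, G.scaleMap_of_lie _ h, smul_smul,
    mul_zpow, Units.val_mul, mul_comm]

theorem scaleMap_one (y : 𝔊) : G.scaleMap 1 y = y := by
  simp [scaleMap, G.sum_proj]

theorem scaleMap_lie (c : Rˣ) (y z : 𝔊) : G.scaleMap c ⁅y, z⁆ = ⁅G.scaleMap c y, G.scaleMap c z⁆ := by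
  refine G.hom_induction (P := fun y => G.scaleMap c ⁅y, z⁆ = ⁅G.scaleMap c y, G.scaleMap c z⁆)
    (by simp) (fun y z hy hz => by simp only [map_add, add_lie, hy, hz]) (fun k y h => ?_) y
  refine G.hom_induction (P := fun z => G.scaleMap c ⁅y, z⁆ = ⁅G.scaleMap c y, G.scaleMap c z⁆)
    (by simp) (fun y z hy hz => by simp only [map_add, lie_add, hy, hz]) (fun j z h' => ?_) z
  rw [G.scaleMap_of_lie c (lie_lie_proj h h'), G.scaleMap_of_lie c h, G.scaleMap_of_lie c h',
    smul_lie, lie_smul, smul_smul, zpow_add, Units.val_mul]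

/-- The automorphism `c ^ (ad x)`. -/
noncomputable def scale (c : Rˣ) : 𝔊 ≃ₗ[R] 𝔊 :=
  LinearEquiv.ofLinearMap (G.scaleMap c) (G.scaleMap c⁻¹)
    (LinearMap.ext fun y => by
      rw [LinearMap.comp_apply, scaleMap_scaleMap, mul_inv_cancel, scaleMap_one]; rfl)
    (LinearMap.ext fun y => by
      rw [LinearMap.comp_apply, scaleMap_scaleMap, inv_mul_cancel, scaleMap_one]; rfl)

theorem scale_apply (c : Rˣ) (y : 𝔊) : G.scale c y = G.scaleMap c y := rfl

end Basic

section BaseChange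

variable {𝔤 : Type*} [LieRing 𝔤] [LieAlgebra ℂ 𝔤] {x : 𝔤} (G : Grading ℂ x)
  (L : Type*) [CommRing L] [Algebra ℂ L]

/-- The grading of `L ⊗ 𝔤`. -/
noncomputable def baseChange : Grading L ((1 : L) ⊗ₜ[ℂ] x) where
  supp := G.supp
  proj k := (G.proj k).baseChange L
  lie_proj k y := by
    induction y using TensorProduct.induction_on with
    | zero => simp
    | tmul a y =>
      have h1 : ((k : L)) = algebraMap ℂ L (k : ℂ) := by simp
      rw [LinearMap.baseChange_tmul, LieAlgebra.ExtendScalars.bracket_tmul, G.lie_proj, one_mul,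
        TensorProduct.smul_tmul', h1, TensorProduct.tmul_smul, TensorProduct.smul_tmul', smul_eq_mul,
        Algebra.smul_def]
    | add y z hy hz => simp only [map_add, lie_add, smul_add, hy, hz]
  proj_proj k j y := by
    induction y using TensorProduct.induction_on with
    | zero => simp
    | tmul a y =>
      simp only [LinearMap.baseChange_tmul, G.proj_proj]
      split_ifs <;> simp
    | add y z hy hz =>
      simp only [map_add, hy, hz]
      split_ifs <;> simp
  sum_proj y := by
    induction y using TensorProduct.induction_on with
    | zero => simp
    | tmul a y =>
      simp only [LinearMap.baseChange_tmul]
      rw [← TensorProduct.tmul_sum, G.sum_proj]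
    | add y z hy hz => simp only [map_add, Finset.sum_add_distrib, hy, hz]

variable {L}

theorem baseChange_proj_tmul (k : ℤ) (a : L) (y : 𝔤) :
    (G.baseChange L).proj k (a ⊗ₜ y) = a ⊗ₜ G.proj k y := rfl

theorem tmul_mem_fil {r : ℤ} (a : L) {y : 𝔤} (hy : y ∈ G.fil r) :
    a ⊗ₜ[ℂ] y ∈ (G.baseChange L).fil r := fun k hk => by
  rw [baseChange_proj_tmul, hy k hk, TensorProduct.tmul_zero]

theorem baseChange_le_fil {r : ℤ} {N : Submodule ℂ 𝔤} (h : N ≤ G.fil r) :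
    N.baseChange L ≤ (G.baseChange L).fil r := by
  rw [Submodule.baseChange_eq_span, Submodule.span_le]
  rintro _ ⟨y, hy, rfl⟩
  exact G.tmul_mem_fil 1 (h hy)

theorem proj_mem_baseChange {k : ℤ} {N : Submodule ℂ 𝔤} (h : ∀ y, G.proj k y ∈ N) (y : L ⊗[ℂ] 𝔤) :
    (G.baseChange L).proj k y ∈ N.baseChange L := by
  induction y using TensorProduct.induction_on with
  | zero => simp
  | tmul a y => exact Submodule.tmul_mem_baseChange_of_mem a (h y)
  | add y z hy hz => rw [map_add]; exact add_mem hy hz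

theorem fil_le_baseChange {r : ℤ} {N : Submodule ℂ 𝔤} (h : G.fil r ≤ N) :
    (G.baseChange L).fil r ≤ N.baseChange L := fun _ hy =>
  (G.baseChange L).fil_induction (zero_mem _) (fun _ _ => add_mem)
    (fun k hk y => G.proj_mem_baseChange (fun y => h (G.proj_mem_fil r k hk y)) y) hy

end BaseChange

end Grading

/-! ### Grading elements of the Cartan subalgebra -/

section GradingElements

variable {𝔤 : Type*} [LieRing 𝔤] [LieAlgebra ℂ 𝔤] {ι : Type*} [Fintype ι]
  {H : LieSubalgebra ℂ 𝔤} (B : LieAlgebra.Basis ι H)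

theorem mem_cartan_iff_exists {x : 𝔤} : x ∈ H ↔ ∃ r : ι → ℂ, ∑ j, r j • B.h j = x := by
  rw [← LieSubalgebra.mem_toSubmodule, B.coe_cartan_eq_span, Submodule.mem_span_range_iff_exists_fun]

theorem lie_cartan_e (r : ι → ℂ) (i : ι) :
    ⁅∑ j, r j • B.h j, B.e i⁆ = (∑ j, r j * (B.A i j : ℂ)) • B.e i := by
  simp only [sum_lie, smul_lie, B.lie_h_e, Finset.sum_smul, mul_smul, Int.cast_smul_eq_zsmul]

theorem lie_cartan_f (r : ι → ℂ) (i : ι) :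
    ⁅∑ j, r j • B.h j, B.f i⁆ = -((∑ j, r j * (B.A i j : ℂ)) • B.f i) := by
  simp only [sum_lie, smul_lie, B.lie_h_f, Finset.sum_smul, mul_smul,
    Int.cast_smul_eq_zsmul, neg_smul, smul_neg, Finset.sum_neg_distrib]

/-- For x = ∑ rⱼ hⱼ both eigenvalues are given by the same number ∑ rⱼ Aᵢⱼ, with opposite signs. -/
theorem lie_cartan_f_of_lie_cartan_e {x : 𝔤} (hx : x ∈ H) {i : ι} {a : ℂ}
    (h : ⁅x, B.e i⁆ = a • B.e i) : ⁅x, B.f i⁆ = -(a • B.f i) := by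
  obtain ⟨r, rfl⟩ := (mem_cartan_iff_exists B).1 hx
  rw [lie_cartan_e, ← sub_eq_zero, ← sub_smul, smul_eq_zero_iff_left (B.sl2 i).e_ne_zero,
    sub_eq_zero] at h
  rw [lie_cartan_f, h]

theorem eigenspace_lie {x : 𝔤} {a b : ℂ} {y z : 𝔤} (hy : ⁅x, y⁆ = a • y) (hz : ⁅x, z⁆ = b • z) :
    ⁅x, ⁅y, z⁆⁆ = (a + b) • ⁅y, z⁆ := by
  rw [leibniz_lie, hy, hz, smul_lie, lie_smul, ← add_smul]

/-- The sum of the eigenspaces with integral eigenvalues is closed under the bracket and contains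
the generators eᵢ and fᵢ. -/
theorem iSup_eigenspace_ad_eq_top {x : 𝔤} (hx : x ∈ H) (a : ι → ℤ)
    (h : ∀ i, ⁅x, B.e i⁆ = (a i : ℂ) • B.e i) :
    ⨆ k : ℤ, Module.End.eigenspace (LieAlgebra.ad ℂ 𝔤 x) (k : ℂ) = ⊤ := by
  set N := ⨆ k : ℤ, Module.End.eigenspace (LieAlgebra.ad ℂ 𝔤 x) (k : ℂ) with hN
  have hmem : ∀ (k : ℤ) (y : 𝔤), ⁅x, y⁆ = (k : ℂ) • y → y ∈ N := fun k y hy =>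
    Submodule.mem_iSup_of_mem k (Module.End.mem_eigenspace_iff.2 hy)
  let M : LieSubalgebra ℂ 𝔤 :=
    { N with
      lie_mem' := by
        intro y z hy hz
        change ⁅y, z⁆ ∈ N
        replace hy : y ∈ N := hy
        replace hz : z ∈ N := hz
        rw [hN] at hy
        induction hy using Submodule.iSup_induction' with
        | mem i y hy =>
          rw [hN] at hz
          induction hz using Submodule.iSup_induction' with
          | mem j z hz =>
            rw [Module.End.mem_eigenspace_iff] at hy hz
            apply hmem (i + j)
            rw [Int.cast_add]
            exact eigenspace_lie hy hz
          | zero => simp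
          | add z z' _ _ h h' => rw [lie_add]; exact add_mem h h'
        | zero => simp
        | add z z' _ _ h h' => rw [add_lie]; exact add_mem h h' }
  have hM : M = ⊤ := by
    rw [eq_top_iff, ← B.span_ef, LieSubalgebra.lieSpan_le]
    rintro _ (⟨i, rfl⟩ | ⟨i, rfl⟩)
    · exact hmem (a i) _ (h i)
    · refine hmem (-a i) _ ?_
      rw [lie_cartan_f_of_lie_cartan_e B hx (h i), Int.cast_neg, neg_smul]
  rw [eq_top_iff]
  intro y _
  have : y ∈ M := hM ▸ LieSubalgebra.mem_top y
  exact this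

/-- The eigenspaces are independent and span 𝔤, which gives the projections; by finite dimension
only finitely many eigenspaces are nonzero, and these form the support. -/
theorem exists_grading [FiniteDimensional ℂ 𝔤] {x : 𝔤} (hx : x ∈ H) (a : ι → ℤ)
    (h : ∀ i, ⁅x, B.e i⁆ = (a i : ℂ) • B.e i) : Nonempty (Grading ℂ x) := by
  classical
  set E : ℤ → Submodule ℂ 𝔤 := fun k => Module.End.eigenspace (LieAlgebra.ad ℂ 𝔤 x) (k : ℂ) with hE
  have hind : iSupIndep E :=
    (Module.End.eigenspaces_iSupIndep (LieAlgebra.ad ℂ 𝔤 x)).comp Int.cast_injective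
  have hint : DirectSum.IsInternal E :=
    DirectSum.isInternal_submodule_of_iSupIndep_of_iSup_eq_top hind
      (iSup_eigenspace_ad_eq_top B hx a h)
  let := hint.chooseDecomposition
  let p : ℤ → 𝔤 →ₗ[ℂ] 𝔤 := fun k => (E k).subtype ∘ₗ DirectSum.component ℂ ℤ (fun k => E k) k ∘ₗ
    (DirectSum.decomposeLinearEquiv E : 𝔤 →ₗ[ℂ] _)
  have hp : ∀ k y, p k y = (DirectSum.decompose E y k : 𝔤) := fun k y => rfl
  have hfin : (Set.univ ∩ {k : ℤ | E k ≠ ⊥}).Finite := by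
    simpa using! WellFoundedGT.finite_ne_bot_of_iSupIndep hind
  have hfin' : {k : ℤ | E k ≠ ⊥}.Finite := by simpa using hfin
  refine ⟨⟨hfin'.toFinset, p, fun k y => ?_, fun k j y => ?_, fun y => ?_⟩⟩
  · exact Module.End.mem_eigenspace_iff.1 (DirectSum.decompose E y k).2
  · rw [hp, hp]
    split_ifs with hkj
    · subst hkj
      rw [DirectSum.decompose_coe, DirectSum.of_eq_same]
    · rw [DirectSum.decompose_coe, DirectSum.of_eq_of_ne _ _ _ hkj]; rfl
  · conv_rhs => rw [← DirectSum.sum_support_decompose E y]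
    symm
    refine Finset.sum_subset (fun k hk => ?_) (fun k _ hk => ?_)
    · rw [Set.Finite.mem_toFinset]
      intro hb
      rw [DFinsupp.mem_support_toFun] at hk
      apply hk
      apply Subtype.ext
      exact (Submodule.eq_bot_iff _).1 hb _ (DirectSum.decompose E y k).2
    · rw [DFinsupp.notMem_support_iff] at hk
      rw [hk]; rfl

/-- The fundamental coweights. -/
theorem exists_coweight [DecidableEq ι] (i : ι) :
    ∃ x ∈ H, ∀ j, ⁅x, B.e j⁆ = (((if j = i then 1 else 0 : ℤ)) : ℂ) • B.e j := by
  have hdet : IsUnit (B.A.map (Int.castRingHom ℂ)).det := by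
    rw [isUnit_iff_ne_zero, ← RingHom.mapMatrix_apply, ← RingHom.map_det]
    simpa using Matrix.nondegenerate_iff_det_ne_zero.1 B.nondegen
  set M := B.A.map (Int.castRingHom ℂ)
  -- The coefficients form column `i` of the inverse Cartan matrix, so the eigenvalue on eⱼ is an
  -- entry of M M⁻¹ = 1.
  refine ⟨∑ j, (M⁻¹ j i) • B.h j, (mem_cartan_iff_exists B).2 ⟨_, rfl⟩, fun j => ?_⟩
  rw [lie_cartan_e]
  congr 1
  have h1 : (M * M⁻¹) j i = (1 : Matrix ι ι ℂ) j i := by rw [Matrix.mul_nonsing_inv _ hdet]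
  rw [Matrix.mul_apply, Matrix.one_apply] at h1
  push_cast
  rw [← h1]
  exact Finset.sum_congr rfl fun k _ => mul_comm _ _

end GradingElements

end OperFF

namespace OperFF

/-! ### Consequences of the representation theory of `𝔰𝔩₂` -/

section Sl2

variable {𝔊 : Type*} [LieRing 𝔊] [LieAlgebra ℂ 𝔊] {h e f : 𝔊}

theorem lie_h_ad_e_pow (hhe : ⁅h, e⁆ = (2 : ℂ) • e) {a : ℂ} {y : 𝔊}
    (hy : ⁅h, y⁆ = a • y) (n : ℕ) :
    ⁅h, ((LieAlgebra.ad ℂ 𝔊 e) ^ n) y⁆ = (a + 2 * n) • ((LieAlgebra.ad ℂ 𝔊 e) ^ n) y := by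
  induction n with
  | zero => simpa using hy
  | succ n ih =>
    rw [pow_succ', Module.End.mul_apply, LieAlgebra.ad_apply, leibniz_lie, ih, hhe,
      smul_lie, lie_smul, ← add_smul]
    congr 1
    push_cast
    ring

/-- The commutation relation of eⁿ⁺¹ and f on a weight vector. What matters below is that the factor
(n + 1)(a + n) is nonzero for positive weights a. -/
theorem ad_e_pow_lie_f (hef : ⁅e, f⁆ = h) (hhe : ⁅h, e⁆ = (2 : ℂ) • e) {a : ℂ} {y : 𝔊}
    (hy : ⁅h, y⁆ = a • y) (n : ℕ) :
    ((LieAlgebra.ad ℂ 𝔊 e) ^ (n + 1)) ⁅f, y⁆ = ⁅f, ((LieAlgebra.ad ℂ 𝔊 e) ^ (n + 1)) y⁆ +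
      ((n + 1) * (a + n)) • ((LieAlgebra.ad ℂ 𝔊 e) ^ n) y := by
  have key : ∀ z : 𝔊, ⁅e, ⁅f, z⁆⁆ = ⁅f, ⁅e, z⁆⁆ + ⁅h, z⁆ := fun z => by
    rw [leibniz_lie, hef, add_comm]
  induction n with
  | zero => simp [key, hy]
  | succ n ih =>
    rw [pow_succ' _ (n + 1), Module.End.mul_apply, ih, LieAlgebra.ad_apply, lie_add, key,
      Module.End.mul_apply, LieAlgebra.ad_apply, lie_smul, lie_h_ad_e_pow hhe hy, add_assoc]
    congr 1
    rw [pow_succ' _ n, Module.End.mul_apply, LieAlgebra.ad_apply, ← add_smul]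
    congr 1
    push_cast
    ring

/-- On the subspaces of positive weight, `ad e ∘ ad f` is injective. -/
theorem eq_zero_of_lie_e_lie_f (hef : ⁅e, f⁆ = h) (hhe : ⁅h, e⁆ = (2 : ℂ) • e)
    {r : ℕ} (hr : 0 < r) {y : 𝔊}
    (hy : ⁅h, y⁆ = (2 * r : ℂ) • y) {n : ℕ} (hn : ((LieAlgebra.ad ℂ 𝔊 e) ^ n) y = 0)
    (h0 : ⁅e, ⁅f, y⁆⁆ = 0) : y = 0 := by
  induction n with
  | zero => simpa using hn
  | succ n ih =>
    -- Descent on the exponent: eⁿ⁺¹ f y = eⁿ (e f y) = 0 and eⁿ⁺¹ y = 0 leave (n + 1)(2r + n) eⁿ y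
    -- = 0.
    apply ih
    have h1 := ad_e_pow_lie_f hef hhe hy n
    rw [hn, lie_zero, zero_add, pow_succ, Module.End.mul_apply, LieAlgebra.ad_apply, h0, map_zero]
      at h1
    refine (smul_eq_zero.1 h1.symm).resolve_left ?_
    have : ((n + 1) * (2 * r + n) : ℂ) = (((n + 1) * (2 * r + n) : ℕ) : ℂ) := by push_cast; ring
    rw [this]
    exact Nat.cast_ne_zero.2 (by positivity)

end Sl2

/-! ### Derivations of `L ⊗ 𝔤` -/

section Derivations

variable {𝔤 : Type*} [LieRing 𝔤] [LieAlgebra ℂ 𝔤] {L : Type*} [CommRing L] [Algebra ℂ L]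

/-- The coordinates of an element of `L ⊗ 𝔤` with respect to a basis of `L`. -/
noncomputable def tensorCoord {s : Type*} (b : Module.Basis s ℂ L) (i : s) : L ⊗[ℂ] 𝔤 →ₗ[ℂ] 𝔤 :=
  (TensorProduct.lid ℂ 𝔤).toLinearMap ∘ₗ LinearMap.rTensor 𝔤 (b.coord i)

theorem tensorCoord_tmul {s : Type*} (b : Module.Basis s ℂ L) (i : s) (a : L) (y : 𝔤) :
    tensorCoord b i (a ⊗ₜ y) = b.repr a i • y := by
  simp [tensorCoord]

/-- All larger index sets are allowed so that several elements can be expanded over a common finite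
set. -/
theorem exists_sum_tensorCoord {s : Type*} (b : Module.Basis s ℂ L) (y : L ⊗[ℂ] 𝔤) :
    ∃ t : Finset s, ∀ t' : Finset s, t ⊆ t' → y = ∑ i ∈ t', b i ⊗ₜ tensorCoord b i y := by
  classical
  induction y using TensorProduct.induction_on with
  | zero => exact ⟨∅, fun _ _ => by simp⟩
  | tmul a y =>
    refine ⟨(b.repr a).support, fun t' ht => ?_⟩
    have h1 : ∑ i ∈ t', b.repr a i • b i = a := by
      conv_rhs => rw [← b.linearCombination_repr a, Finsupp.linearCombination_apply, Finsupp.sum]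
      symm
      exact Finset.sum_subset ht fun i _ hi => by
        rw [Finsupp.notMem_support_iff.1 hi, zero_smul]
    conv_lhs => rw [← h1]
    rw [TensorProduct.sum_tmul]
    refine Finset.sum_congr rfl fun i _ => ?_
    rw [tensorCoord_tmul, TensorProduct.smul_tmul]
  | add y z hy hz =>
    obtain ⟨t, ht⟩ := hy
    obtain ⟨u, hu⟩ := hz
    refine ⟨t ∪ u, fun t' h => ?_⟩
    simp only [map_add, TensorProduct.tmul_add, Finset.sum_add_distrib]
    rw [← ht t' (Finset.union_subset_left h), ← hu t' (Finset.union_subset_right h)]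

theorem tensorCoord_ext {s : Type*} (b : Module.Basis s ℂ L) {y z : L ⊗[ℂ] 𝔤}
    (h : ∀ i, tensorCoord b i y = tensorCoord b i z) : y = z := by
  classical
  obtain ⟨t, ht⟩ := exists_sum_tensorCoord b y
  obtain ⟨u, hu⟩ := exists_sum_tensorCoord b z
  rw [ht (t ∪ u) Finset.subset_union_left, hu (t ∪ u) Finset.subset_union_right]
  simp only [h]

theorem tensorCoord_lie_right {s : Type*} (b : Module.Basis s ℂ L) (i : s) (y : L ⊗[ℂ] 𝔤) (z : 𝔤) :
    tensorCoord b i ⁅y, (1 : L) ⊗ₜ[ℂ] z⁆ = ⁅tensorCoord b i y, z⁆ := by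
  induction y using TensorProduct.induction_on with
  | zero => simp
  | tmul a y => simp [tensorCoord_tmul]
  | add y z hy hz => simp only [map_add, add_lie, hy, hz]

theorem tensorCoord_lie_left {s : Type*} (b : Module.Basis s ℂ L) (i : s) (y : L ⊗[ℂ] 𝔤) (z : 𝔤) :
    tensorCoord b i ⁅(1 : L) ⊗ₜ[ℂ] z, y⁆ = ⁅z, tensorCoord b i y⁆ := by
  rw [← lie_skew, map_neg, tensorCoord_lie_right, lie_skew]

variable [FiniteDimensional ℂ 𝔤] [LieAlgebra.IsKilling ℂ 𝔤]

/-- Each coordinate over a basis of L lies in the center of 𝔤, which is zero. -/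
theorem eq_zero_of_lie_tensor {a : L ⊗[ℂ] 𝔤} (h : ∀ y : 𝔤, ⁅a, (1 : L) ⊗ₜ[ℂ] y⁆ = 0) : a = 0 := by
  refine tensorCoord_ext (Module.Basis.ofVectorSpace ℂ L) fun i => ?_
  rw [map_zero]
  have h1 : ∀ y : 𝔤, ⁅tensorCoord (Module.Basis.ofVectorSpace ℂ L) i a, y⁆ = 0 := fun y => by
    rw [← tensorCoord_lie_right, h, map_zero]
  have h2 : tensorCoord (Module.Basis.ofVectorSpace ℂ L) i a ∈ LieAlgebra.center ℂ 𝔤 := by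
    rw [LieModule.mem_maxTrivSubmodule]
    intro y
    rw [← lie_skew, h1, neg_zero]
  simpa using h2

theorem linearMap_ext_one_tmul {M : Type*} [AddCommGroup M] [Module L M] {σ τ : (L ⊗[ℂ] 𝔤) →ₗ[L] M}
    (h : ∀ y : 𝔤, σ (1 ⊗ₜ y) = τ (1 ⊗ₜ y)) (x : L ⊗[ℂ] 𝔤) : σ x = τ x := by
  induction x using TensorProduct.induction_on with
  | zero => simp
  | tmul a u =>
    have : a ⊗ₜ[ℂ] u = a • ((1 : L) ⊗ₜ[ℂ] u) := by simp [TensorProduct.smul_tmul']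
    rw [this, map_smul, map_smul, h]
  | add x z hx hz => simp only [map_add, hx, hz]

/-- Every `L`-linear derivation of `L ⊗ 𝔤` is inner. -/
theorem exists_eq_lie_of_derivation (δ : (L ⊗[ℂ] 𝔤) →ₗ[L] (L ⊗[ℂ] 𝔤))
    (hδ : ∀ y z : 𝔤, δ ⁅(1 : L) ⊗ₜ[ℂ] y, (1 : L) ⊗ₜ[ℂ] z⁆ =
      ⁅δ (1 ⊗ₜ y), (1 : L) ⊗ₜ[ℂ] z⁆ + ⁅(1 : L) ⊗ₜ[ℂ] y, δ (1 ⊗ₜ z)⁆) :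
    ∃ a : L ⊗[ℂ] 𝔤, ∀ x, δ x = ⁅a, x⁆ := by
  classical
  set b := Module.Basis.ofVectorSpace ℂ L
  -- The coordinates of δ over a basis of L are derivations of 𝔤, and these are inner because the
  -- Killing form is nondegenerate.
  have hD : ∀ i, ∃ a : 𝔤, ∀ y, tensorCoord b i (δ (1 ⊗ₜ y)) = ⁅a, y⁆ := by
    intro i
    let D : LieDerivation ℂ 𝔤 𝔤 :=
      { toLinearMap := tensorCoord b i ∘ₗ (δ.restrictScalars ℂ) ∘ₗ TensorProduct.mk ℂ L 𝔤 1
        leibniz' := fun y z => by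
          have h1 := congrArg (tensorCoord b i) (hδ y z)
          rw [LieAlgebra.ExtendScalars.bracket_tmul, one_mul, map_add, tensorCoord_lie_right,
            tensorCoord_lie_left] at h1
          change tensorCoord b i (δ (1 ⊗ₜ ⁅y, z⁆)) = ⁅y, tensorCoord b i (δ (1 ⊗ₜ z))⁆ -
            ⁅z, tensorCoord b i (δ (1 ⊗ₜ y))⁆
          rw [h1, ← lie_skew z]; abel }
    obtain ⟨a, ha⟩ := LieDerivation.IsKilling.exists_eq_ad D
    refine ⟨a, fun y => ?_⟩
    have h1 := congrArg (fun D : LieDerivation ℂ 𝔤 𝔤 => D y) ha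
    change D y = _
    simpa using h1.symm
  choose a ha using hD
  set c := Module.finBasis ℂ 𝔤
  choose t ht using fun j => exists_sum_tensorCoord b (δ (1 ⊗ₜ c j))
  -- As 𝔤 has a finite basis, finitely many coordinates determine δ, so the sum over them is an
  -- honest element of L ⊗ 𝔤.
  set u := Finset.univ.biUnion t
  refine ⟨∑ i ∈ u, b i ⊗ₜ a i, fun x => ?_⟩
  refine linearMap_ext_one_tmul (τ := LieAlgebra.ad L _ (∑ i ∈ u, b i ⊗ₜ a i)) (fun y => ?_) x
  have h2 : (δ.restrictScalars ℂ) ∘ₗ TensorProduct.mk ℂ L 𝔤 1 =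
      ((LieAlgebra.ad L _ (∑ i ∈ u, b i ⊗ₜ a i)).restrictScalars ℂ) ∘ₗ
        TensorProduct.mk ℂ L 𝔤 1 := by
    refine c.ext fun j => ?_
    change δ (1 ⊗ₜ c j) = ⁅∑ i ∈ u, b i ⊗ₜ[ℂ] a i, (1 : L) ⊗ₜ[ℂ] c j⁆
    rw [ht j u (Finset.subset_biUnion_of_mem t (Finset.mem_univ j)), sum_lie]
    refine Finset.sum_congr rfl fun i _ => ?_
    rw [LieAlgebra.ExtendScalars.bracket_tmul, mul_one, ha]
  exact LinearMap.congr_fun h2 y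

end Derivations

/-! ### The principal grading -/

section Principal

variable {𝔤 : Type*} [LieRing 𝔤] [LieAlgebra ℂ 𝔤] {ι : Type*} [Fintype ι]
  {H : LieSubalgebra ℂ 𝔤} (B : LieAlgebra.Basis ι H)

variable {ρ p₁ : 𝔤}

theorem lie_rho_f (hρ : ρ ∈ H) (hρe : ∀ i, ⁅ρ, B.e i⁆ = B.e i) (i : ι) : ⁅ρ, B.f i⁆ = -B.f i := by
  have := lie_cartan_f_of_lie_cartan_e B hρ (i := i) (a := 1) (by rw [hρe, one_smul])
  rwa [one_smul] at this

theorem lie_cartan_cartan (B : LieAlgebra.Basis ι H) {x y : 𝔤} (hx : x ∈ H) (hy : y ∈ H) :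
    ⁅x, y⁆ = 0 := by
  obtain ⟨r, rfl⟩ := (mem_cartan_iff_exists B).1 hx
  obtain ⟨s, rfl⟩ := (mem_cartan_iff_exists B).1 hy
  simp [sum_lie, lie_sum, B.lie_h_h]

variable (G : Grading ℂ ρ)

theorem cartan_le_fil (B : LieAlgebra.Basis ι H) (G : Grading ℂ ρ) (hρ : ρ ∈ H) :
    H.toSubmodule ≤ G.fil 0 := fun x hx =>
  G.mem_fil_of_lie le_rfl (by rw [lie_cartan_cartan B hρ hx]; simp)

theorem nilradical_le_fil (hρe : ∀ i, ⁅ρ, B.e i⁆ = B.e i) : nilradical B ≤ G.fil 1 := by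
  let M : LieSubalgebra ℂ 𝔤 :=
    { G.fil 1 with
      lie_mem' := fun {y z} hy hz => G.fil_mono (by norm_num) (G.lie_mem_fil hy hz) }
  have : LieSubalgebra.lieSpan ℂ 𝔤 (range B.e) ≤ M := by
    rw [LieSubalgebra.lieSpan_le]
    rintro _ ⟨i, rfl⟩
    exact G.mem_fil_of_lie (j := 1) le_rfl (by rw [hρe, Int.cast_one, one_smul])
  exact this

theorem borel_le_fil (hρ : ρ ∈ H) (hρe : ∀ i, ⁅ρ, B.e i⁆ = B.e i) : borel B ≤ G.fil 0 :=
  sup_le (cartan_le_fil B G hρ) ((nilradical_le_fil B G hρe).trans (G.fil_mono (by norm_num)))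

/-- The eigenspaces of ad ρ with negative eigenvalues span a subalgebra, and it contains the fᵢ. -/
theorem lieSpan_f_proj (hρ : ρ ∈ H) (hρe : ∀ i, ⁅ρ, B.e i⁆ = B.e i) {y : 𝔤}
    (hy : y ∈ LieSubalgebra.lieSpan ℂ 𝔤 (range B.f)) {k : ℤ} (hk : 0 ≤ k) : G.proj k y = 0 := by
  have hsum : ∀ y ∈ LieSubalgebra.lieSpan ℂ 𝔤 (range B.f),
      y ∈ ⨆ k : {k : ℤ // k < 0}, LinearMap.ker (LieAlgebra.ad ℂ 𝔤 ρ - (k.1 : ℂ) • 1) := by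
    set N := ⨆ k : {k : ℤ // k < 0}, LinearMap.ker (LieAlgebra.ad ℂ 𝔤 ρ - (k.1 : ℂ) • 1) with hN
    have hmem : ∀ (k : ℤ) (y : 𝔤), k < 0 → ⁅ρ, y⁆ = (k : ℂ) • y → y ∈ N := fun k y hk hy =>
      Submodule.mem_iSup_of_mem ⟨k, hk⟩ (by simp [hy])
    let M : LieSubalgebra ℂ 𝔤 :=
      { N with
        lie_mem' := by
          intro y z hy hz
          change ⁅y, z⁆ ∈ N
          replace hy : y ∈ N := hy
          replace hz : z ∈ N := hz
          rw [hN] at hy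
          induction hy using Submodule.iSup_induction' with
          | mem i y hy =>
            rw [hN] at hz
            induction hz using Submodule.iSup_induction' with
            | mem j z hz =>
              simp only [LinearMap.mem_ker, LinearMap.sub_apply, LieAlgebra.ad_apply,
                LinearMap.smul_apply, Module.End.one_apply, sub_eq_zero] at hy hz
              refine hmem (i + j) _ (by have := i.2; have := j.2; omega) ?_
              rw [Int.cast_add]
              exact eigenspace_lie hy hz
            | zero => simp
            | add z z' _ _ h h' => rw [lie_add]; exact add_mem h h'
          | zero => simp
          | add z z' _ _ h h' => rw [add_lie]; exact add_mem h h' }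
    have hM : LieSubalgebra.lieSpan ℂ 𝔤 (range B.f) ≤ M := by
      rw [LieSubalgebra.lieSpan_le]
      rintro _ ⟨i, rfl⟩
      exact hmem (-1) _ (by norm_num) (by rw [lie_rho_f B hρ hρe]; simp)
    exact fun y hy => hM hy
  have := hsum y hy
  clear hy
  induction this using Submodule.iSup_induction' with
  | mem i y hy =>
    simp only [LinearMap.mem_ker, LinearMap.sub_apply, LieAlgebra.ad_apply,
      LinearMap.smul_apply, Module.End.one_apply, sub_eq_zero] at hy
    rw [G.proj_of_lie hy, if_neg]
    have := i.2
    omega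
  | zero => simp
  | add y z _ _ h h' => rw [map_add, h, h', add_zero]

theorem exists_triangular (y : 𝔤) : ∃ a ∈ H, ∃ b ∈ LieSubalgebra.lieSpan ℂ 𝔤 (range B.f),
    ∃ c ∈ nilradical B, a + b + c = y := by
  have h1 := B.iSup_cartan_borelLower_borelUpper_eq_top
  have h2 : y ∈ H.toLieSubmodule ⊔ B.borelLower ⊔ B.borelUpper := by
    have h3 : H.toLieSubmodule ⊔ B.borelLower ⊔ B.borelUpper = ⊤ := by simpa using h1
    exact h3 ▸ LieSubmodule.mem_top y
  rw [LieSubmodule.mem_sup] at h2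
  obtain ⟨z, hz, c, hc, rfl⟩ := h2
  rw [LieSubmodule.mem_sup] at hz
  obtain ⟨a, ha, b, hb, rfl⟩ := hz
  exact ⟨a, ha, b, hb, c, hc, rfl⟩

/-- Degrees separate the triangular decomposition: the Cartan part has degree 0, the lower part
negative and the upper part positive degrees. The first two must vanish together if only positive
degrees occur. -/
theorem fil_le_nilradical (hρ : ρ ∈ H) (hρe : ∀ i, ⁅ρ, B.e i⁆ = B.e i) :
    G.fil 1 ≤ nilradical B := by
  intro y hy
  obtain ⟨a, ha, b, hb, c, hc, rfl⟩ := exists_triangular B y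
  have hab : a + b = 0 := by
    refine G.ext_proj fun k => ?_
    rw [map_zero]
    by_cases hk : k < 1
    · have h1 := hy k hk
      rwa [map_add, nilradical_le_fil B G hρe hc k hk, add_zero] at h1
    · rw [map_add, lieSpan_f_proj B G hρ hρe hb (by omega), add_zero, G.proj_of_lie (j := 0),
        if_neg (by omega)]
      rw [lie_cartan_cartan B hρ ha]; simp
  rw [hab, zero_add]
  exact hc

theorem fil_le_borel (hρ : ρ ∈ H) (hρe : ∀ i, ⁅ρ, B.e i⁆ = B.e i) : G.fil 0 ≤ borel B := by
  intro y hy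
  obtain ⟨a, ha, b, hb, c, hc, rfl⟩ := exists_triangular B y
  have hb0 : b = 0 := by
    refine G.ext_proj fun k => ?_
    rw [map_zero]
    by_cases hk : k < 0
    · have h1 := hy k hk
      rwa [map_add, map_add, nilradical_le_fil B G hρe hc k (by omega), add_zero,
        cartan_le_fil B G hρ ha k hk, zero_add] at h1
    · exact lieSpan_f_proj B G hρ hρe hb (by omega)
  rw [hb0, add_zero]
  exact Submodule.add_mem_sup ha hc

theorem lie_rho_p₁ (hp : IsSl2Triple ((2 : ℂ) • ρ) p₁ (pMinus B)) : ⁅ρ, p₁⁆ = p₁ := by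
  have := hp.lie_h_e_smul ℂ
  rw [smul_lie] at this
  exact smul_right_injective 𝔤 (two_ne_zero' ℂ) this

end Principal

end OperFF

namespace OperFF

/-! ### The canonical form of opers -/

/-- The principal grading element, the principal `𝔰𝔩₂`-triple and a homogeneous basis of `V^can`. -/
structure OperFrame {𝔤 : Type*} [LieRing 𝔤] [LieAlgebra ℂ 𝔤] {ι : Type*} [Fintype ι]
    {H : LieSubalgebra ℂ 𝔤} (B : LieAlgebra.Basis ι H) (l : ℕ) where
  ρ : 𝔤
  p₁ : 𝔤
  mem : ρ ∈ H
  lie_e : ∀ i, ⁅ρ, B.e i⁆ = B.e i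
  sl2 : IsSl2Triple ((2 : ℂ) • ρ) p₁ (pMinus B)
  v : Module.Basis (Fin l) ℂ (canSpace p₁)
  d : Fin l → ℕ
  lie_v : ∀ i, ⁅ρ, (v i : 𝔤)⁆ = (d i : ℂ) • (v i : 𝔤)
  grading : Grading ℂ ρ

namespace OperFrame

variable {𝔤 : Type*} [LieRing 𝔤] [LieAlgebra ℂ 𝔤] {ι : Type*} [Fintype ι]
  {H : LieSubalgebra ℂ 𝔤} {B : LieAlgebra.Basis ι H} {l : ℕ} (P : OperFrame B l)
  {L : Type*} [CommRing L] [Algebra ℂ L]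

variable (L) in
/-- The grading of `L ⊗ 𝔤`. -/
noncomputable abbrev gr : Grading L ((1 : L) ⊗ₜ[ℂ] P.ρ) := P.grading.baseChange L

theorem one_tmul_lie_homogeneous {a : ℤ} {y : 𝔤} (h : ⁅P.ρ, y⁆ = (a : ℂ) • y) :
    ⁅(1 : L) ⊗ₜ[ℂ] P.ρ, (1 : L) ⊗ₜ[ℂ] y⁆ = (a : L) • ((1 : L) ⊗ₜ[ℂ] y) := by
  rw [LieAlgebra.ExtendScalars.bracket_tmul, h, one_mul, TensorProduct.tmul_smul,
    TensorProduct.smul_tmul', TensorProduct.smul_tmul', ← map_intCast (algebraMap ℂ L),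
    smul_eq_mul, mul_one, Algebra.smul_def, mul_one]

theorem lie_f (i : ι) : ⁅P.ρ, B.f i⁆ = ((-1 : ℤ) : ℂ) • B.f i := by
  rw [lie_rho_f B P.mem P.lie_e]; simp

theorem lie_pMinus : ⁅P.ρ, pMinus B⁆ = ((-1 : ℤ) : ℂ) • pMinus B := by
  rw [pMinus, lie_sum, Finset.smul_sum]
  exact Finset.sum_congr rfl fun i _ => P.lie_f i

theorem lie_p₁ : ⁅P.ρ, P.p₁⁆ = ((1 : ℤ) : ℂ) • P.p₁ := by
  rw [lie_rho_p₁ B P.sl2]; simp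

theorem lie_p₁_v (i : Fin l) : ⁅P.p₁, (P.v i : 𝔤)⁆ = 0 := (P.v i).2

/-- With this and the next lemma, membership in L ⊗ 𝔟 and L ⊗ 𝔫 becomes a question of degrees. -/
theorem borel_baseChange : (borel B).baseChange L = (P.gr L).fil 0 :=
  le_antisymm (P.grading.baseChange_le_fil (borel_le_fil B P.grading P.mem P.lie_e))
    (P.grading.fil_le_baseChange (fil_le_borel B P.grading P.mem P.lie_e))

theorem nilradical_baseChange : (nilradical B).baseChange L = (P.gr L).fil 1 :=
  le_antisymm (P.grading.baseChange_le_fil (nilradical_le_fil B P.grading P.lie_e))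
    (P.grading.fil_le_baseChange (fil_le_nilradical B P.grading P.mem P.lie_e))

/-- The connection form `p₋₁ + ∑ cᵢ vᵢ`. -/
noncomputable def canForm (c : Fin l → L) : L ⊗[ℂ] 𝔤 :=
  1 ⊗ₜ[ℂ] pMinus B + ∑ i, c i ⊗ₜ[ℂ] (P.v i : 𝔤)

theorem sum_v_mem_fil (c : Fin l → L) : ∑ i, c i ⊗ₜ[ℂ] (P.v i : 𝔤) ∈ (P.gr L).fil 0 :=
  sum_mem fun i _ => P.grading.tmul_mem_fil _ (P.grading.mem_fil_of_lie (j := P.d i) (by omega)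
    (by rw [P.lie_v]; simp))

theorem lie_p₁_sum_v (c : Fin l → L) :
    ⁅(1 : L) ⊗ₜ[ℂ] P.p₁, ∑ i, c i ⊗ₜ[ℂ] (P.v i : 𝔤)⁆ = 0 := by
  rw [lie_sum]
  refine Finset.sum_eq_zero fun i _ => ?_
  rw [LieAlgebra.ExtendScalars.bracket_tmul, P.lie_p₁_v, TensorProduct.tmul_zero]

theorem isOper_canForm (c : Fin l → L) : IsOper B L (P.canForm c) := by
  refine ⟨1, _, (P.borel_baseChange (L := L)).symm ▸ P.sum_v_mem_fil c, ?_⟩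
  simp [canForm, pMinus, TensorProduct.tmul_sum]

theorem sum_v_injective {c c' : Fin l → L}
    (h : ∑ i, c i ⊗ₜ[ℂ] (P.v i : 𝔤) = ∑ i, c' i ⊗ₜ[ℂ] (P.v i : 𝔤)) : c = c' := by
  funext j
  obtain ⟨g, hg⟩ := LinearMap.exists_extend (P.v.coord j)
  have hg' : ∀ i, g (P.v i : 𝔤) = if i = j then 1 else 0 := fun i => by
    have := LinearMap.congr_fun hg (P.v i)
    simpa [Finsupp.single_apply] using this
  have h1 := congrArg (TensorProduct.rid ℂ L ∘ LinearMap.lTensor L g) h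
  simpa [hg'] using h1

theorem exists_eq_sum_v {w : L ⊗[ℂ] 𝔤} (hw : w ∈ (canSpace P.p₁).baseChange L) :
    ∃ c : Fin l → L, w = ∑ i, c i ⊗ₜ[ℂ] (P.v i : 𝔤) := by
  rw [Submodule.baseChange_eq_span] at hw
  induction hw using Submodule.span_induction with
  | mem y hy =>
    obtain ⟨y, hy, rfl⟩ := hy
    refine ⟨fun i => algebraMap ℂ L (P.v.repr ⟨y, hy⟩ i), ?_⟩
    have h1 := congrArg Subtype.val (P.v.sum_repr ⟨y, hy⟩)
    rw [AddSubmonoidClass.coe_finsetSum] at h1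
    refine (congrArg (fun z => (1 : L) ⊗ₜ[ℂ] z) h1.symm).trans ?_
    rw [TensorProduct.tmul_sum]
    refine Finset.sum_congr rfl fun i _ => ?_
    beta_reduce
    rw [Submodule.coe_smul, TensorProduct.tmul_smul, TensorProduct.smul_tmul',
      Algebra.algebraMap_eq_smul_one]
  | zero => exact ⟨0, by simp⟩
  | add y z _ _ hy hz =>
    obtain ⟨c, rfl⟩ := hy
    obtain ⟨c', rfl⟩ := hz
    exact ⟨c + c', by simp [TensorProduct.add_tmul, Finset.sum_add_distrib]⟩
  | smul a y _ hy =>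
    obtain ⟨c, rfl⟩ := hy
    exact ⟨a • c, by simp [Finset.smul_sum, TensorProduct.smul_tmul']⟩

/-! #### Torus and unipotent elements -/

/-- The automorphism is the product of the cᵢ ^ (ad ωᵢ) for the fundamental coweights ωᵢ. Their
eigenvalues on 𝔤 are integers, so powers of units make sense. -/
theorem exists_torus [FiniteDimensional ℂ 𝔤] (B : LieAlgebra.Basis ι H) (c : ι → Lˣ) :
    ∃ σ : (L ⊗[ℂ] 𝔤) ≃ₗ[L] (L ⊗[ℂ] 𝔤), (∀ x y, σ ⁅x, y⁆ = ⁅σ x, σ y⁆) ∧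
      ∀ i, σ (1 ⊗ₜ B.e i) = (c i : L) ⊗ₜ B.e i ∧ σ (1 ⊗ₜ B.f i) = (((c i)⁻¹ : Lˣ) : L) ⊗ₜ B.f i := by
  classical
  have key : ∀ s : Finset ι, ∃ σ : (L ⊗[ℂ] 𝔤) ≃ₗ[L] (L ⊗[ℂ] 𝔤), (∀ x y, σ ⁅x, y⁆ = ⁅σ x, σ y⁆) ∧
      ∀ i, σ (1 ⊗ₜ B.e i) = ((if i ∈ s then c i else 1 : Lˣ) : L) ⊗ₜ B.e i ∧
        σ (1 ⊗ₜ B.f i) = (((if i ∈ s then c i else 1)⁻¹ : Lˣ) : L) ⊗ₜ B.f i := by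
    intro s
    induction s using Finset.induction_on with
    | empty => exact ⟨LinearEquiv.refl _ _, fun _ _ => rfl, fun i => by simp⟩
    | insert j s hj ih =>
      obtain ⟨σ, hσ, h⟩ := ih
      obtain ⟨x, hx, hxe⟩ := exists_coweight B j
      obtain ⟨G⟩ := exists_grading B hx (fun i => if i = j then 1 else 0) hxe
      have hs : ∀ (k : ℤ) (a : L) (y : 𝔤), ⁅x, y⁆ = (k : ℂ) • y →
          (G.baseChange L).scaleMap (c j) (a ⊗ₜ y) = (a * ((c j ^ k : Lˣ) : L)) ⊗ₜ y := by
        intro k a y hy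
        rw [Grading.scaleMap_of_lie _ _ (j := k), TensorProduct.smul_tmul', smul_eq_mul, mul_comm]
        rw [LieAlgebra.ExtendScalars.bracket_tmul, hy, one_mul, TensorProduct.tmul_smul,
          TensorProduct.smul_tmul', TensorProduct.smul_tmul', ← map_intCast (algebraMap ℂ L),
          smul_eq_mul, Algebra.smul_def]
      refine ⟨σ.trans ((G.baseChange L).scale (c j)), fun y z => ?_, fun i => ⟨?_, ?_⟩⟩
      · simp only [LinearEquiv.trans_apply, hσ, Grading.scale_apply, Grading.scaleMap_lie]
      · rw [LinearEquiv.trans_apply, (h i).1, Grading.scale_apply, hs _ _ _ (hxe i)]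
        by_cases hij : i = j
        · subst hij; simp [hj]
        · simp [hij]
      · have hf := lie_cartan_f_of_lie_cartan_e B hx (hxe i)
        rw [← neg_smul, ← Int.cast_neg] at hf
        rw [LinearEquiv.trans_apply, (h i).2, Grading.scale_apply, hs _ _ _ hf]
        by_cases hij : i = j
        · subst hij; simp [hj]
        · simp [hij]
  obtain ⟨σ, hσ, h⟩ := key Finset.univ
  exact ⟨σ, hσ, fun i => by simpa using h i⟩

/-- A torus element fixes every hᵢ = [eᵢ, fᵢ], hence ρ, and so it commutes with ad ρ. -/
theorem torus_proj {σ : (L ⊗[ℂ] 𝔤) ≃ₗ[L] (L ⊗[ℂ] 𝔤)} (hσ : IsTorus B L σ) (k : ℤ)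
    (y : L ⊗[ℂ] 𝔤) : (P.gr L).proj k (σ y) = σ ((P.gr L).proj k y) := by
  obtain ⟨hl, c, hc⟩ := hσ
  have hh : ∀ i, σ (1 ⊗ₜ B.h i) = 1 ⊗ₜ B.h i := fun i => by
    have h1 : (1 : L) ⊗ₜ[ℂ] B.h i = ⁅(1 : L) ⊗ₜ[ℂ] B.e i, (1 : L) ⊗ₜ[ℂ] B.f i⁆ := by
      rw [LieAlgebra.ExtendScalars.bracket_tmul, one_mul, (B.sl2 i).lie_e_f]
    rw [h1, hl, (hc i).1, (hc i).2, LieAlgebra.ExtendScalars.bracket_tmul,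
      LieAlgebra.ExtendScalars.bracket_tmul, Units.mul_inv, one_mul]
  have hρ : σ (1 ⊗ₜ P.ρ) = 1 ⊗ₜ P.ρ := by
    obtain ⟨r, hr⟩ := (mem_cartan_iff_exists B).1 P.mem
    rw [← hr, TensorProduct.tmul_sum, map_sum]
    refine Finset.sum_congr rfl fun i _ => ?_
    have : (1 : L) ⊗ₜ[ℂ] (r i • B.h i) = algebraMap ℂ L (r i) • ((1 : L) ⊗ₜ[ℂ] B.h i) := by
      rw [TensorProduct.tmul_smul, TensorProduct.smul_tmul', TensorProduct.smul_tmul',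
        Algebra.smul_def, smul_eq_mul]
    rw [this, map_smul, hh]
  refine (P.gr L).hom_induction (P := fun y => (P.gr L).proj k (σ y) = σ ((P.gr L).proj k y))
    (by simp) (fun y z hy hz => by simp only [map_add, hy, hz]) (fun j y h => ?_) y
  rw [(P.gr L).proj_of_lie h, (P.gr L).proj_of_lie (j := j)]
  · split_ifs <;> simp
  · rw [← hρ, ← hl, h, map_smul]

theorem torus_mem_fil {σ : (L ⊗[ℂ] 𝔤) ≃ₗ[L] (L ⊗[ℂ] 𝔤)} (hσ : IsTorus B L σ) {k : ℤ}
    {y : L ⊗[ℂ] 𝔤} (hy : y ∈ (P.gr L).fil k) : σ y ∈ (P.gr L).fil k := fun j hj => by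
  rw [P.torus_proj hσ, hy j hj, map_zero]

theorem lie_symm {σ : (L ⊗[ℂ] 𝔤) ≃ₗ[L] (L ⊗[ℂ] 𝔤)} (hσ : ∀ x y, σ ⁅x, y⁆ = ⁅σ x, σ y⁆)
    (x y : L ⊗[ℂ] 𝔤) : σ⁻¹ ⁅x, y⁆ = ⁅σ⁻¹ x, σ⁻¹ y⁆ := by
  apply σ.injective
  rw [hσ]
  change σ (σ.symm _) = ⁅σ (σ.symm x), σ (σ.symm y)⁆
  simp

theorem isTorus_inv {σ : (L ⊗[ℂ] 𝔤) ≃ₗ[L] (L ⊗[ℂ] 𝔤)} (hσ : IsTorus B L σ) : IsTorus B L σ⁻¹ := by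
  obtain ⟨hl, c, hc⟩ := hσ
  refine ⟨lie_symm hl, fun i => (c i)⁻¹, fun i => ⟨?_, ?_⟩⟩
  · apply σ.injective
    change σ (σ.symm _) = _
    rw [LinearEquiv.apply_symm_apply]
    have : (((c i)⁻¹ : Lˣ) : L) ⊗ₜ[ℂ] B.e i = (((c i)⁻¹ : Lˣ) : L) • ((1 : L) ⊗ₜ[ℂ] B.e i) := by
      rw [TensorProduct.smul_tmul', smul_eq_mul, mul_one]
    rw [this, map_smul, (hc i).1, TensorProduct.smul_tmul', smul_eq_mul, Units.inv_mul]
  · apply σ.injective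
    change σ (σ.symm _) = _
    rw [LinearEquiv.apply_symm_apply, inv_inv]
    have : (c i : L) ⊗ₜ[ℂ] B.f i = (c i : L) • ((1 : L) ⊗ₜ[ℂ] B.f i) := by
      rw [TensorProduct.smul_tmul', smul_eq_mul, mul_one]
    rw [this, map_smul, (hc i).2, TensorProduct.smul_tmul', smul_eq_mul, Units.mul_inv]

theorem isTorus_mul {σ τ : (L ⊗[ℂ] 𝔤) ≃ₗ[L] (L ⊗[ℂ] 𝔤)} (hσ : IsTorus B L σ) (hτ : IsTorus B L τ) :
    IsTorus B L (σ * τ) := by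
  obtain ⟨hl, c, hc⟩ := hσ
  obtain ⟨hl', c', hc'⟩ := hτ
  have key : ∀ (a : L) (y : 𝔤), a ⊗ₜ[ℂ] y = a • ((1 : L) ⊗ₜ[ℂ] y) := fun a y => by
    rw [TensorProduct.smul_tmul', smul_eq_mul, mul_one]
  refine ⟨fun x y => ?_, c * c', fun i => ⟨?_, ?_⟩⟩
  · simp only [LinearEquiv.mul_apply, hl, hl']
  · rw [LinearEquiv.mul_apply, (hc' i).1, key, map_smul, (hc i).1, TensorProduct.smul_tmul',
      smul_eq_mul, mul_comm]; rfl
  · rw [LinearEquiv.mul_apply, (hc' i).2, key, map_smul, (hc i).2, TensorProduct.smul_tmul',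
      smul_eq_mul, ← Units.val_mul, ← mul_inv_rev]; rfl

theorem ad_pow_mem_fil {u : L ⊗[ℂ] 𝔤} {r k : ℤ} (hu : u ∈ (P.gr L).fil r) {y : L ⊗[ℂ] 𝔤}
    (hy : y ∈ (P.gr L).fil k) (n : ℕ) :
    ((LieAlgebra.ad L (L ⊗[ℂ] 𝔤) u) ^ n) y ∈ (P.gr L).fil (k + n * r) := by
  induction n with
  | zero => simpa using hy
  | succ n ih =>
    rw [pow_succ', Module.End.mul_apply, LieAlgebra.ad_apply]
    refine (P.gr L).fil_mono (le_of_eq ?_) ((P.gr L).lie_mem_fil hu ih)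
    push_cast; ring

/-- The operator ad u raises degrees by at least 1, and only finitely many degrees occur. -/
theorem exists_ad_pow_eq_zero {u : L ⊗[ℂ] 𝔤} (hu : u ∈ (P.gr L).fil 1) :
    ∃ n : ℕ, ∀ m ≥ n, (LieAlgebra.ad L (L ⊗[ℂ] 𝔤) u) ^ m = 0 := by
  obtain ⟨a, ha⟩ := (P.gr L).exists_fil_eq_bot
  obtain ⟨b, hb⟩ := (P.gr L).exists_fil_eq_top
  refine ⟨(a - b).toNat, fun m hm => LinearMap.ext fun y => ha _ ?_⟩
  exact (P.gr L).fil_mono (by omega) (P.ad_pow_mem_fil hu (hb y) m)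

/-- `exp (ad u)` modulo terms of higher degree. -/
theorem unipotent_sub_mem_fil {σ : (L ⊗[ℂ] 𝔤) ≃ₗ[L] (L ⊗[ℂ] 𝔤)} {u : L ⊗[ℂ] 𝔤} {k : ℕ}
    (hk : ∀ x, ((LieAlgebra.ad L (L ⊗[ℂ] 𝔤) u) ^ k) x = 0)
    (hσ : ∀ x, σ x = ∑ j ∈ Finset.range k,
      ((j.factorial : ℂ)⁻¹) • ((LieAlgebra.ad L (L ⊗[ℂ] 𝔤) u) ^ j) x) {r a : ℤ} (hr : 0 ≤ r)
    (hu : u ∈ (P.gr L).fil r) {y : L ⊗[ℂ] 𝔤} (hy : y ∈ (P.gr L).fil a) :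
    σ y - y - ⁅u, y⁆ ∈ (P.gr L).fil (a + 2 * r) := by
  -- Two vanishing terms are appended, so that the terms of order 0 and 1 can be split off even when
  -- k < 2.
  have h1 : σ y = ∑ j ∈ Finset.range (k + 2),
      ((j.factorial : ℂ)⁻¹) • ((LieAlgebra.ad L (L ⊗[ℂ] 𝔤) u) ^ j) y := by
    rw [hσ, Finset.sum_range_succ, Finset.sum_range_succ, pow_succ', Module.End.mul_apply, hk]
    simp
  rw [h1, Finset.sum_range_succ', Finset.sum_range_succ']
  simp only [zero_add, pow_one, Nat.factorial_one, Nat.cast_one, inv_one, one_smul, pow_zero,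
    Nat.factorial_zero, LieAlgebra.ad_apply, Module.End.one_apply]
  rw [add_sub_cancel_right, add_sub_cancel_right]
  refine sum_mem fun j _ => ?_
  rw [← algebraMap_smul L]
  refine Submodule.smul_mem _ _ ((P.gr L).fil_mono ?_ (P.ad_pow_mem_fil hu hy (j + 1 + 1)))
  push_cast
  nlinarith [mul_nonneg (Int.natCast_nonneg j) hr]

/-- The exponential of a nilpotent derivation is an automorphism, with the exponential of the
opposite derivation as inverse. One exponent `k` serves for both sums. -/
theorem exists_exp {u : L ⊗[ℂ] 𝔤} (hu : u ∈ (P.gr L).fil 1) :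
    ∃ σ : (L ⊗[ℂ] 𝔤) ≃ₗ[L] (L ⊗[ℂ] 𝔤), (∀ x y, σ ⁅x, y⁆ = ⁅σ x, σ y⁆) ∧
      ∃ k : ℕ, (∀ x, ((LieAlgebra.ad L (L ⊗[ℂ] 𝔤) u) ^ k) x = 0) ∧
        (∀ x, σ x = ∑ j ∈ Finset.range k,
          ((j.factorial : ℂ)⁻¹) • ((LieAlgebra.ad L (L ⊗[ℂ] 𝔤) u) ^ j) x) ∧
        ∀ x, σ⁻¹ x = ∑ j ∈ Finset.range k,
          ((j.factorial : ℂ)⁻¹) • ((LieAlgebra.ad L (L ⊗[ℂ] 𝔤) (-u)) ^ j) x := by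
  obtain ⟨k, hk⟩ := P.exists_ad_pow_eq_zero hu
  -- The exponential is formed with rational scalars; they act through ℂ, so its coefficients agree
  -- with the complex ones of the statement.
  let _ : Module ℚ (L ⊗[ℂ] 𝔤) := Module.compHom _ (algebraMap ℚ ℂ)
  let _ : LieAlgebra ℚ (L ⊗[ℂ] 𝔤) :=
    { lie_smul := fun t x y => lie_smul (algebraMap ℚ ℂ t) x y }
  let D : LieDerivation L (L ⊗[ℂ] 𝔤) (L ⊗[ℂ] 𝔤) := LieDerivation.ad L _ u
  have hD : D.toLinearMap = LieAlgebra.ad L (L ⊗[ℂ] 𝔤) u := by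
    ext x; simp [D]
  have hD0 : D.toLinearMap ^ k = 0 := by rw [hD, hk k le_rfl]
  have hn : IsNilpotent D.toLinearMap := ⟨k, hD0⟩
  have hq : ∀ (j : ℕ) (z : L ⊗[ℂ] 𝔤), ((j.factorial : ℚ)⁻¹) • z = ((j.factorial : ℂ)⁻¹) • z := by
    intro j z
    change algebraMap ℚ ℂ _ • z = _
    simp
  refine ⟨(LieDerivation.exp D hn).toLinearEquiv, fun x y => (LieDerivation.exp D hn).map_lie x y,
    k, fun x => by rw [hk k le_rfl]; rfl, fun x => ?_, fun x => ?_⟩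
  · change LieDerivation.exp D hn x = _
    rw [LieDerivation.exp_map_apply, IsNilpotent.exp_eq_sum hD0, hD]
    simp [LinearMap.sum_apply, hq]
  · change IsNilpotent.exp (-D.toLinearMap) x = _
    have : (-D.toLinearMap) ^ k = 0 := by rw [neg_pow, hD0, mul_zero]
    rw [IsNilpotent.exp_eq_sum this, hD, ← map_neg]
    simp [LinearMap.sum_apply, hq]

end OperFrame

end OperFF

/-! ### Covariant derivatives and gauge transformations on L ⊗ 𝔤 -/

namespace OperFF

section CovDer

variable {𝔤 : Type*} [LieRing 𝔤] [LieAlgebra ℂ 𝔤] {L : Type*} [CommRing L] [Algebra ℂ L]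
  (D : Derivation ℂ L L)

/-- The derivation of `L ⊗ 𝔤` that extends a derivation of `L`. -/
noncomputable def derTensor : L ⊗[ℂ] 𝔤 →ₗ[ℂ] L ⊗[ℂ] 𝔤 := LinearMap.rTensor 𝔤 (D : L →ₗ[ℂ] L)

theorem derTensor_tmul (a : L) (y : 𝔤) : derTensor D (a ⊗ₜ[ℂ] y) = D a ⊗ₜ y := rfl

theorem covDer_eq (A x : L ⊗[ℂ] 𝔤) : covDer D A x = derTensor D x + ⁅A, x⁆ := rfl

theorem derTensor_smul (a : L) (y : L ⊗[ℂ] 𝔤) :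
    derTensor D (a • y) = D a • y + a • derTensor D y := by
  induction y using TensorProduct.induction_on with
  | zero => simp
  | tmul b u =>
    simp [derTensor_tmul, TensorProduct.smul_tmul', ← TensorProduct.add_tmul, mul_comm, add_comm]
  | add x z hx hz => simp only [smul_add, map_add, hx, hz]; abel

theorem derTensor_lie (x y : L ⊗[ℂ] 𝔤) :
    derTensor D ⁅x, y⁆ = ⁅derTensor D x, y⁆ + ⁅x, derTensor D y⁆ := by
  induction x using TensorProduct.induction_on with
  | zero => simp
  | tmul a u =>
    induction y using TensorProduct.induction_on with
    | zero => simp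
    | tmul b w =>
      simp [derTensor_tmul, ← TensorProduct.add_tmul, mul_comm, add_comm]
    | add y z hy hz => simp only [lie_add, map_add, hy, hz]; abel
  | add x z hx hz => simp only [add_lie, map_add, hx, hz]; abel

end CovDer

namespace OperFrame

variable {𝔤 : Type*} [LieRing 𝔤] [LieAlgebra ℂ 𝔤] {ι : Type*} [Fintype ι]
  {H : LieSubalgebra ℂ 𝔤} {B : LieAlgebra.Basis ι H} {l : ℕ} (P : OperFrame B l)
  {L : Type*} [CommRing L] [Algebra ℂ L] (D : Derivation ℂ L L)
  [FiniteDimensional ℂ 𝔤] [LieAlgebra.IsKilling ℂ 𝔤]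

theorem derTensor_proj (k : ℤ) (y : L ⊗[ℂ] 𝔤) :
    derTensor D ((P.gr L).proj k y) = (P.gr L).proj k (derTensor D y) := by
  induction y using TensorProduct.induction_on with
  | zero => simp
  | tmul a y => rfl
  | add y z hy hz => simp only [map_add, hy, hz]

theorem derTensor_mem_fil {k : ℤ} {y : L ⊗[ℂ] 𝔤} (hy : y ∈ (P.gr L).fil k) :
    derTensor D y ∈ (P.gr L).fil k := fun j hj => by
  rw [← P.derTensor_proj, hy j hj, map_zero]

theorem one_tmul_lie_proj (k : ℤ) (y : 𝔤) : ⁅(1 : L) ⊗ₜ[ℂ] P.ρ, (1 : L) ⊗ₜ[ℂ] P.grading.proj k y⁆ =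
    (k : L) • ((1 : L) ⊗ₜ[ℂ] P.grading.proj k y) :=
  P.one_tmul_lie_homogeneous (P.grading.lie_proj k y)

theorem proj_lie_right (k j : ℤ) (a : L ⊗[ℂ] 𝔤) (y : 𝔤) :
    (P.gr L).proj k ⁅a, (1 : L) ⊗ₜ[ℂ] P.grading.proj j y⁆ =
      ⁅(P.gr L).proj (k - j) a, (1 : L) ⊗ₜ[ℂ] P.grading.proj j y⁆ := by
  rw [← lie_skew, map_neg, (P.gr L).proj_lie_homogeneous (P.one_tmul_lie_proj j y), lie_skew]

theorem eq_zero_of_lie_proj {a : L ⊗[ℂ] 𝔤}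
    (h : ∀ (k : ℤ) (y : 𝔤), ⁅a, (1 : L) ⊗ₜ[ℂ] P.grading.proj k y⁆ = 0) : a = 0 := by
  refine eq_zero_of_lie_tensor fun y => ?_
  rw [← P.grading.sum_proj y, TensorProduct.tmul_sum, lie_sum]
  exact Finset.sum_eq_zero fun k _ => h k y

/-- An element is of degree at least `r` if it raises degrees by at least `r`. -/
theorem mem_fil_of_lie_mem {a : L ⊗[ℂ] 𝔤} {r : ℤ}
    (h : ∀ (k : ℤ) (y : 𝔤), ⁅a, (1 : L) ⊗ₜ[ℂ] P.grading.proj k y⁆ ∈ (P.gr L).fil (k + r)) :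
    a ∈ (P.gr L).fil r := fun j hj => P.eq_zero_of_lie_proj fun k y => by
  have h1 := h k y (j + k) (by omega)
  rwa [P.proj_lie_right, add_sub_cancel_right] at h1

/-- The gauge transformation by an automorphism `b`. -/
theorem exists_gauge {b : (L ⊗[ℂ] 𝔤) ≃ₗ[L] (L ⊗[ℂ] 𝔤)} (hb : ∀ x y, b ⁅x, y⁆ = ⁅b x, b y⁆) :
    ∃ a : L ⊗[ℂ] 𝔤, (∀ A x, b (covDer D A x) = covDer D (b A + a) (b x)) ∧
      ∀ y : 𝔤, ⁅a, (1 : L) ⊗ₜ[ℂ] y⁆ = b (derTensor D (b⁻¹ (1 ⊗ₜ y))) := by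
  have hbb : ∀ x, b (b⁻¹ x) = x := fun x => b.apply_symm_apply x
  have hbb' : ∀ x, b⁻¹ (b x) = x := fun x => b.symm_apply_apply x
  have hb' := lie_symm hb
  -- In b ∂ b⁻¹ - ∂ the derivatives of scalars cancel, so this is an L-linear derivation and hence
  -- inner. The element that gives it plays the role of -(∂b) b⁻¹.
  let δ : (L ⊗[ℂ] 𝔤) →ₗ[L] (L ⊗[ℂ] 𝔤) :=
    { toFun := fun x => b (derTensor D (b⁻¹ x)) - derTensor D x
      map_add' := fun x y => by simp only [map_add]; abel
      map_smul' := fun a x => by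
        have : b⁻¹ (a • x) = a • b⁻¹ x := map_smul b.symm a x
        simp only [this, derTensor_smul, map_add, map_smul, hbb, RingHom.id_apply, smul_sub]
        abel }
  have h1 : ∀ y : 𝔤, derTensor D ((1 : L) ⊗ₜ[ℂ] y) = 0 := fun y => by
    rw [derTensor_tmul, Derivation.map_one_eq_zero, TensorProduct.zero_tmul]
  obtain ⟨a, ha⟩ := exists_eq_lie_of_derivation δ fun y z => by
    change b (derTensor D (b⁻¹ _)) - derTensor D _ = ⁅b (derTensor D (b⁻¹ _)) - derTensor D _, _⁆ +
      ⁅_, b (derTensor D (b⁻¹ _)) - derTensor D _⁆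
    rw [hb', derTensor_lie, map_add, hb, hb, hbb, hbb, derTensor_lie, h1, h1]
    simp
  refine ⟨a, fun A x => ?_, fun y => ?_⟩
  · have h2 : b (derTensor D (b⁻¹ (b x))) - derTensor D (b x) = ⁅a, b x⁆ := ha (b x)
    rw [hbb', sub_eq_iff_eq_add] at h2
    rw [covDer_eq, covDer_eq, map_add, hb, h2, add_lie]
    abel
  · have h2 : b (derTensor D (b⁻¹ (1 ⊗ₜ y))) - derTensor D (1 ⊗ₜ y) = ⁅a, (1 : L) ⊗ₜ[ℂ] y⁆ :=
      ha (1 ⊗ₜ y)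
    rw [← h2, h1, sub_zero]

/-- As `b` is surjective, A - A' commutes with all of 𝔤, and ad is faithful. -/
theorem covDer_injective {A A' : L ⊗[ℂ] 𝔤} {b : (L ⊗[ℂ] 𝔤) ≃ₗ[L] (L ⊗[ℂ] 𝔤)}
    (h : ∀ x, covDer D A (b x) = covDer D A' (b x)) : A = A' := by
  rw [← sub_eq_zero]
  refine eq_zero_of_lie_tensor fun y => ?_
  obtain ⟨x, hx⟩ := b.surjective (1 ⊗ₜ y)
  have h1 := h x
  rw [covDer_eq, covDer_eq, add_right_inj, hx] at h1
  rw [sub_lie, h1, sub_self]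

/-- Gauge equivalence of connections under `B(L)`. -/
def GaugeEquiv (B : LieAlgebra.Basis ι H) (A A' : L ⊗[ℂ] 𝔤) : Prop :=
  ∃ b ∈ borelGroup B L, ∀ x, b (covDer D A x) = covDer D A' (b x)

variable {D} in
theorem GaugeEquiv.trans {A A' A'' : L ⊗[ℂ] 𝔤} (h : GaugeEquiv D B A A')
    (h' : GaugeEquiv D B A' A'') : GaugeEquiv D B A A'' := by
  obtain ⟨b, hb, h⟩ := h
  obtain ⟨b', hb', h'⟩ := h'
  exact ⟨b' * b, mul_mem hb' hb, fun x => by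
    rw [LinearEquiv.mul_apply, LinearEquiv.mul_apply, h, h']⟩

/-! #### The decomposition `𝔤ₖ = [p₋₁, 𝔤ₖ₊₁] ⊕ Vₖ` -/

theorem ad_p₁_pow_eq_zero (y : L ⊗[ℂ] 𝔤) :
    ∃ n : ℕ, ((LieAlgebra.ad ℂ (L ⊗[ℂ] 𝔤) (1 ⊗ₜ P.p₁)) ^ n) y = 0 := by
  have h1 : (1 : L) ⊗ₜ[ℂ] P.p₁ ∈ (P.gr L).fil 1 :=
    (P.gr L).mem_fil_of_lie (j := 1) le_rfl (P.one_tmul_lie_homogeneous P.lie_p₁)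
  obtain ⟨n, hn⟩ := P.exists_ad_pow_eq_zero h1
  refine ⟨n, ?_⟩
  have h2 : ∀ m : ℕ, ((LieAlgebra.ad ℂ (L ⊗[ℂ] 𝔤) (1 ⊗ₜ P.p₁)) ^ m) y =
      ((LieAlgebra.ad L (L ⊗[ℂ] 𝔤) (1 ⊗ₜ P.p₁)) ^ m) y := fun m => by
    induction m with
    | zero => rfl
    | succ m ih => rw [pow_succ', pow_succ', Module.End.mul_apply, Module.End.mul_apply, ih]; rfl
  rw [h2, hn n le_rfl]; rfl

/-- Degree r for ρ is weight 2r for h = 2ρ. The 𝔰𝔩₂-argument needs no finite dimension, only the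
nilpotency of ad p₁, so it applies to L ⊗ 𝔤 directly. -/
theorem eq_zero_of_lie_p₁_lie_pMinus {r : ℕ} (hr : 0 < r) {u : L ⊗[ℂ] 𝔤}
    (hu : ⁅(1 : L) ⊗ₜ[ℂ] P.ρ, u⁆ = ((r : ℤ) : L) • u)
    (h0 : ⁅(1 : L) ⊗ₜ[ℂ] P.p₁, ⁅(1 : L) ⊗ₜ[ℂ] pMinus B, u⁆⁆ = 0) : u = 0 := by
  obtain ⟨n, hn⟩ := P.ad_p₁_pow_eq_zero u
  refine eq_zero_of_lie_e_lie_f (h := (1 : L) ⊗ₜ[ℂ] ((2 : ℂ) • P.ρ)) (e := (1 : L) ⊗ₜ[ℂ] P.p₁)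
    (f := (1 : L) ⊗ₜ[ℂ] pMinus B) ?_ ?_ hr ?_ hn h0
  · rw [LieAlgebra.ExtendScalars.bracket_tmul, one_mul, P.sl2.lie_e_f]
  · rw [LieAlgebra.ExtendScalars.bracket_tmul, one_mul, P.sl2.lie_h_e_smul ℂ,
      TensorProduct.tmul_smul]
  · rw [TensorProduct.tmul_smul, smul_lie, hu, mul_smul, ← algebraMap_smul L (r : ℂ), map_natCast,
      Int.cast_natCast]

/-- The operator ad p₁ ∘ ad p₋₁ is injective on 𝔤ₖ₊₁, hence bijective by finite dimension. Solving
[p₁, [p₋₁, u]] = [p₁, yₖ] for u leaves a remainder yₖ - [p₋₁, u] that is killed by p₁. -/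
theorem exists_proj_eq_lie_pMinus_add {k : ℕ} (y : 𝔤) :
    ∃ u w : 𝔤, ⁅P.ρ, u⁆ = (((k + 1 : ℕ) : ℤ) : ℂ) • u ∧ ⁅P.p₁, w⁆ = 0 ∧
      P.grading.proj k y = ⁅pMinus B, u⁆ + w := by
  set N := LinearMap.ker (LieAlgebra.ad ℂ 𝔤 P.ρ - (((k + 1 : ℕ) : ℤ) : ℂ) • 1)
  have hN : ∀ u, u ∈ N ↔ ⁅P.ρ, u⁆ = (((k + 1 : ℕ) : ℤ) : ℂ) • u := fun u => by
    simp [N, sub_eq_zero]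
  have hef : ∀ u ∈ N, (LieAlgebra.ad ℂ 𝔤 P.p₁ ∘ₗ LieAlgebra.ad ℂ 𝔤 (pMinus B)) u ∈ N := fun u hu => by
    rw [hN] at hu ⊢
    have h1 := Grading.lie_lie_proj (R := ℂ) P.lie_p₁
      (Grading.lie_lie_proj (R := ℂ) P.lie_pMinus hu)
    rwa [add_neg_cancel_left] at h1
  set T := (LieAlgebra.ad ℂ 𝔤 P.p₁ ∘ₗ LieAlgebra.ad ℂ 𝔤 (pMinus B)).restrict hef
  have hinj : Function.Injective T := by
    rw [← LinearMap.ker_eq_bot, LinearMap.ker_eq_bot']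
    intro u hu
    have h1 : ⁅P.p₁, ⁅pMinus B, (u : 𝔤)⁆⁆ = 0 := congrArg Subtype.val hu
    have h2 := (hN u).1 u.2
    obtain ⟨n, hn⟩ := P.ad_p₁_pow_eq_zero ((1 : ℂ) ⊗ₜ[ℂ] (u : 𝔤))
    have h3 := P.eq_zero_of_lie_p₁_lie_pMinus (L := ℂ) (r := k + 1) (by omega)
      (u := 1 ⊗ₜ (u : 𝔤)) (P.one_tmul_lie_homogeneous h2) (by
        simp only [LieAlgebra.ExtendScalars.bracket_tmul, h1, TensorProduct.tmul_zero])
    have h4 := congrArg (TensorProduct.lid ℂ 𝔤) h3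
    exact Subtype.ext (by simpa using h4)
  have hsurj := LinearMap.surjective_of_injective hinj
  have hy : ⁅P.p₁, P.grading.proj k y⁆ ∈ N := by
    rw [hN]
    have h1 := Grading.lie_lie_proj (R := ℂ) P.lie_p₁ (P.grading.lie_proj k y)
    rwa [add_comm, ← Nat.cast_succ] at h1
  obtain ⟨u, hu⟩ := hsurj ⟨_, hy⟩
  have hu' : ⁅P.p₁, ⁅pMinus B, (u : 𝔤)⁆⁆ = ⁅P.p₁, P.grading.proj k y⁆ := congrArg Subtype.val hu
  refine ⟨u, P.grading.proj k y - ⁅pMinus B, (u : 𝔤)⁆, (hN u).1 u.2, ?_, by abel⟩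
  rw [lie_sub, hu', sub_self]

theorem exists_proj_eq_lie_pMinus_add_sum {k : ℕ} (y : L ⊗[ℂ] 𝔤) :
    ∃ (u : L ⊗[ℂ] 𝔤) (c : Fin l → L), ⁅(1 : L) ⊗ₜ[ℂ] P.ρ, u⁆ = (((k + 1 : ℕ) : ℤ) : L) • u ∧
      (P.gr L).proj k y = ⁅(1 : L) ⊗ₜ[ℂ] pMinus B, u⁆ + ∑ i, c i ⊗ₜ[ℂ] (P.v i : 𝔤) := by
  induction y using TensorProduct.induction_on with
  | zero => exact ⟨0, 0, by simp⟩
  | tmul a y =>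
    obtain ⟨u, w, hu, hw, h⟩ := P.exists_proj_eq_lie_pMinus_add (k := k) y
    obtain ⟨c, hc⟩ := P.exists_eq_sum_v (Submodule.tmul_mem_baseChange_of_mem a
      (show w ∈ canSpace P.p₁ from hw))
    refine ⟨a ⊗ₜ u, c, ?_, ?_⟩
    · have : a ⊗ₜ[ℂ] u = a • ((1 : L) ⊗ₜ[ℂ] u) := by rw [TensorProduct.smul_tmul', smul_eq_mul, mul_one]
      rw [this, lie_smul, P.one_tmul_lie_homogeneous hu, smul_comm]
    · rw [← hc, Grading.baseChange_proj_tmul, h, TensorProduct.tmul_add,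
        LieAlgebra.ExtendScalars.bracket_tmul, one_mul]
  | add y z hy hz =>
    obtain ⟨u, c, hu, h⟩ := hy
    obtain ⟨u', c', hu', h'⟩ := hz
    refine ⟨u + u', c + c', by rw [lie_add, hu, hu', smul_add], ?_⟩
    rw [map_add, h, h', lie_add]
    simp only [Pi.add_apply, TensorProduct.add_tmul, Finset.sum_add_distrib]
    abel

/-! #### Existence of the canonical form -/

theorem one_tmul_pMinus_mem_fil : (1 : L) ⊗ₜ[ℂ] pMinus B ∈ (P.gr L).fil (-1) :=
  (P.gr L).mem_fil_of_lie le_rfl (P.one_tmul_lie_homogeneous P.lie_pMinus)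

/-- The degree of the gauge term a = -(∂b) b⁻¹ is measured by its brackets with constant vectors,
where [a, y] = b ∂(b⁻¹ y). -/
theorem gauge_mem_fil {b : (L ⊗[ℂ] 𝔤) ≃ₗ[L] (L ⊗[ℂ] 𝔤)} {r : ℤ}
    (hb : ∀ k, ∀ y ∈ (P.gr L).fil k, b y ∈ (P.gr L).fil k)
    (hb' : ∀ k (y : 𝔤), derTensor D (b⁻¹ (1 ⊗ₜ P.grading.proj k y)) ∈ (P.gr L).fil (k + r))
    {a : L ⊗[ℂ] 𝔤} (ha : ∀ y : 𝔤, ⁅a, (1 : L) ⊗ₜ[ℂ] y⁆ = b (derTensor D (b⁻¹ (1 ⊗ₜ y)))) :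
    a ∈ (P.gr L).fil r :=
  P.mem_fil_of_lie_mem fun k y => by
    rw [ha]
    exact hb _ _ (hb' k y)

theorem one_tmul_proj_mem_fil (k : ℤ) (y : 𝔤) :
    (1 : L) ⊗ₜ[ℂ] P.grading.proj k y ∈ (P.gr L).fil k :=
  P.grading.tmul_mem_fil 1 (P.grading.proj_mem_fil k k le_rfl y)

/-- The torus element with parameters ψᵢ multiplies fᵢ by ψᵢ⁻¹ and so turns ∑ ψᵢ fᵢ into p₋₁; its
gauge term has degree at least 0. -/
theorem exists_gauge_pMinus_add {A : L ⊗[ℂ] 𝔤} (hA : IsOper B L A) :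
    ∃ q ∈ (P.gr L).fil 0, GaugeEquiv D B A (1 ⊗ₜ pMinus B + q) := by
  obtain ⟨ψ, w, hw, rfl⟩ := hA
  rw [P.borel_baseChange] at hw
  obtain ⟨σ, hσ, h⟩ := exists_torus B ψ
  have ht : IsTorus B L σ := ⟨hσ, ψ, h⟩
  obtain ⟨a, ha, ha'⟩ := exists_gauge D hσ
  have ha0 : a ∈ (P.gr L).fil 0 := by
    refine P.gauge_mem_fil D (fun k y hy => P.torus_mem_fil ht hy) (fun k y => ?_) ha'
    rw [add_zero]
    exact P.derTensor_mem_fil D (P.torus_mem_fil (isTorus_inv ht) (P.one_tmul_proj_mem_fil k y))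
  refine ⟨σ w + a, add_mem (P.torus_mem_fil ht hw) ha0, σ, Subgroup.subset_closure (Or.inl ht),
    fun x => ?_⟩
  rw [ha]
  congr 1
  rw [map_add, map_sum, pMinus, TensorProduct.tmul_sum, add_assoc]
  congr 1
  refine Finset.sum_congr rfl fun i _ => ?_
  have : (ψ i : L) ⊗ₜ[ℂ] B.f i = (ψ i : L) • ((1 : L) ⊗ₜ[ℂ] B.f i) := by
    rw [TensorProduct.smul_tmul', smul_eq_mul, mul_one]
  rw [this, map_smul, (h i).2, TensorProduct.smul_tmul', smul_eq_mul, Units.mul_inv]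

theorem exp_mem_fil {σ : (L ⊗[ℂ] 𝔤) ≃ₗ[L] (L ⊗[ℂ] 𝔤)} {u : L ⊗[ℂ] 𝔤} {k : ℕ}
    (hk : ∀ x, ((LieAlgebra.ad L (L ⊗[ℂ] 𝔤) u) ^ k) x = 0)
    (hσ : ∀ x, σ x = ∑ j ∈ Finset.range k,
      ((j.factorial : ℂ)⁻¹) • ((LieAlgebra.ad L (L ⊗[ℂ] 𝔤) u) ^ j) x) {r a : ℤ} (hr : 0 ≤ r)
    (hu : u ∈ (P.gr L).fil r) {y : L ⊗[ℂ] 𝔤} (hy : y ∈ (P.gr L).fil a) :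
    σ y - y ∈ (P.gr L).fil (a + r) := by
  have h1 := (P.gr L).fil_mono (s := a + r) (by omega) (P.unipotent_sub_mem_fil hk hσ hr hu hy)
  have h2 := add_mem h1 ((P.gr L).fil_mono (s := a + r) (by omega) ((P.gr L).lie_mem_fil hu hy))
  rwa [sub_add_cancel] at h2

/-- Write the degree r part of q as [p₋₁, u] + ∑ wᵢ vᵢ with u of degree r + 1. The transformation
exp(ad u) adds [u, p₋₁], which cancels the first summand, and the second is absorbed into c. All
other new terms, including the one with the derivative of u, have degree at least r + 1. -/
theorem exists_gauge_step (r : ℕ) (c : Fin l → L) {q : L ⊗[ℂ] 𝔤} (hq : q ∈ (P.gr L).fil r) :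
    ∃ (c' : Fin l → L), ∃ q' ∈ (P.gr L).fil (r + 1 : ℕ),
      GaugeEquiv D B (P.canForm c + q) (P.canForm c' + q') := by
  obtain ⟨u, w, hu, h⟩ := P.exists_proj_eq_lie_pMinus_add_sum (k := r) q
  have hur : u ∈ (P.gr L).fil (r + 1 : ℕ) := (P.gr L).mem_fil_of_lie le_rfl hu
  have hu1 : u ∈ (P.gr L).fil 1 := (P.gr L).fil_mono (by omega) hur
  obtain ⟨σ, hσ, k, hk, hs, hs'⟩ := P.exists_exp hu1
  have hk' : ∀ x, ((LieAlgebra.ad L (L ⊗[ℂ] 𝔤) (-u)) ^ k) x = 0 := fun x => by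
    rw [map_neg, neg_pow]
    simp [Module.End.mul_apply, hk]
  obtain ⟨a, ha, ha'⟩ := exists_gauge D hσ
  have hadd : ∀ m, ∀ y ∈ (P.gr L).fil m, σ y ∈ (P.gr L).fil m := fun m y hy => by
    have h1 := (P.gr L).fil_mono (s := m) (by omega) (P.exp_mem_fil hk hs (by omega) hur hy)
    simpa using add_mem h1 hy
  have ha0 : a ∈ (P.gr L).fil (r + 1 : ℕ) := by
    refine P.gauge_mem_fil D hadd (fun m y => ?_) ha'
    -- The derivation kills the constant vector y, so σ⁻¹ y may be replaced by σ⁻¹ y - y, whose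
    -- degree is higher by at least r + 1.
    have h1 := P.derTensor_mem_fil D (P.exp_mem_fil hk' hs' (r := (r + 1 : ℕ)) (by omega)
      (neg_mem hur) (P.one_tmul_proj_mem_fil m y))
    rwa [map_sub, derTensor_tmul, Derivation.map_one_eq_zero, TensorProduct.zero_tmul, sub_zero]
      at h1
  refine ⟨c + w, σ (P.canForm c + q) + a - P.canForm (c + w), ?_, σ,
    Subgroup.subset_closure (Or.inr ⟨u, P.nilradical_baseChange (L := L) ▸ hu1, k, hk, hs⟩),
    fun x => by rw [ha]; congr 1; abel⟩
  set s := ∑ i, c i ⊗ₜ[ℂ] (P.v i : 𝔤) with hsdef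
  have hs0 : s + q ∈ (P.gr L).fil 0 :=
    add_mem (P.sum_v_mem_fil c) ((P.gr L).fil_mono (by omega) hq)
  have hA : P.canForm c + q = 1 ⊗ₜ pMinus B + (s + q) := by rw [canForm, add_assoc]
  have hA1 : P.canForm c + q ∈ (P.gr L).fil (-1) := by
    rw [hA]
    exact add_mem P.one_tmul_pMinus_mem_fil ((P.gr L).fil_mono (by omega) hs0)
  have h1 := (P.gr L).fil_mono (s := (r + 1 : ℕ)) (by omega)
    (P.unipotent_sub_mem_fil hk hs (r := (r + 1 : ℕ)) (by omega) hur hA1)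
  have h2 := (P.gr L).fil_mono (s := (r + 1 : ℕ)) (by omega) ((P.gr L).lie_mem_fil hur hs0)
  have h3 := (P.gr L).sub_proj_mem_fil hq
  have h4 : σ (P.canForm c + q) + a - P.canForm (c + w) =
      (σ (P.canForm c + q) - (P.canForm c + q) - ⁅u, P.canForm c + q⁆) + ⁅u, s + q⁆ +
        (q - (P.gr L).proj r q) + a := by
    have h5 : P.canForm (c + w) = P.canForm c + ∑ i, w i ⊗ₜ[ℂ] (P.v i : 𝔤) := by
      simp only [canForm, Pi.add_apply, TensorProduct.add_tmul, Finset.sum_add_distrib, add_assoc]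
    have h6 : ⁅u, P.canForm c + q⁆ = -⁅(1 : L) ⊗ₜ[ℂ] pMinus B, u⁆ + ⁅u, s + q⁆ := by
      rw [hA, lie_add, ← lie_skew u]
    rw [h5, h6, h]
    abel
  rw [h4]
  refine add_mem (add_mem (add_mem h1 h2) ?_) ha0
  exact_mod_cast h3

/-- The remainder is moved to higher and higher degrees until it leaves the finite support of the
grading. -/
theorem exists_canForm {A : L ⊗[ℂ] 𝔤} (hA : IsOper B L A) :
    ∃ c : Fin l → L, GaugeEquiv D B A (P.canForm c) := by
  have key : ∀ r : ℕ, ∃ (c : Fin l → L), ∃ q ∈ (P.gr L).fil r,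
      GaugeEquiv D B A (P.canForm c + q) := by
    intro r
    induction r with
    | zero =>
      obtain ⟨q, hq, h⟩ := P.exists_gauge_pMinus_add D hA
      exact ⟨0, q, hq, by simpa [canForm] using h⟩
    | succ r ih =>
      obtain ⟨c, q, hq, h⟩ := ih
      obtain ⟨c', q', hq', h'⟩ := P.exists_gauge_step D r c hq
      exact ⟨c', q', hq', h.trans h'⟩
  obtain ⟨a, ha⟩ := (P.gr L).exists_fil_eq_bot
  obtain ⟨c, q, hq, h⟩ := key a.toNat
  have : q = 0 := ha q ((P.gr L).fil_mono (by omega) hq)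
  rw [this, add_zero] at h
  exact ⟨c, h⟩

end OperFrame

end OperFF

namespace OperFF

namespace OperFrame

variable {𝔤 : Type*} [LieRing 𝔤] [LieAlgebra ℂ 𝔤] {ι : Type*} [Fintype ι]
  {H : LieSubalgebra ℂ 𝔤} {B : LieAlgebra.Basis ι H} {l : ℕ} (P : OperFrame B l)
  {L : Type*} [CommRing L] [Algebra ℂ L] (D : Derivation ℂ L L)
  [FiniteDimensional ℂ 𝔤] [LieAlgebra.IsKilling ℂ 𝔤]

/-! #### Uniqueness of the canonical form -/

/-- A Lie algebra automorphism that acts on the associated graded as an element of the torus. -/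
def IsTriangular (b : (L ⊗[ℂ] 𝔤) ≃ₗ[L] (L ⊗[ℂ] 𝔤)) : Prop :=
  (∀ x y, b ⁅x, y⁆ = ⁅b x, b y⁆) ∧ ∃ τ, IsTorus B L τ ∧
    ∀ k, ∀ y ∈ (P.gr L).fil k, b y - τ y ∈ (P.gr L).fil (k + 1)

variable {P} in
theorem IsTriangular.mem_fil {b : (L ⊗[ℂ] 𝔤) ≃ₗ[L] (L ⊗[ℂ] 𝔤)} (hb : P.IsTriangular b) {k : ℤ}
    {y : L ⊗[ℂ] 𝔤} (hy : y ∈ (P.gr L).fil k) : b y ∈ (P.gr L).fil k := by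
  obtain ⟨_, τ, hτ, h⟩ := hb
  have h1 := add_mem ((P.gr L).fil_mono (by omega) (h k y hy)) (P.torus_mem_fil hτ hy)
  rwa [sub_add_cancel] at h1

theorem IsTriangular.mul {b b' : (L ⊗[ℂ] 𝔤) ≃ₗ[L] (L ⊗[ℂ] 𝔤)} (hb : P.IsTriangular b)
    (hb' : P.IsTriangular b') : P.IsTriangular (b * b') := by
  have hfil : ∀ {k : ℤ} {y}, y ∈ (P.gr L).fil k → b y ∈ (P.gr L).fil k := fun hy => hb.mem_fil hy
  obtain ⟨h1, τ, hτ, h⟩ := hb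
  obtain ⟨h1', τ', hτ', h'⟩ := hb'
  refine ⟨fun x y => by simp only [LinearEquiv.mul_apply, h1, h1'], τ * τ', isTorus_mul hτ hτ',
    fun k y hy => ?_⟩
  have : (b * b') y - (τ * τ') y = b (b' y - τ' y) + (b (τ' y) - τ (τ' y)) := by
    simp only [LinearEquiv.mul_apply, map_sub]; abel
  rw [this]
  exact add_mem (hfil (h' k y hy)) (h k _ (P.torus_mem_fil hτ' hy))

theorem isTriangular_torus {τ : (L ⊗[ℂ] 𝔤) ≃ₗ[L] (L ⊗[ℂ] 𝔤)} (hτ : IsTorus B L τ) :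
    P.IsTriangular τ :=
  ⟨hτ.1, τ, hτ, fun k y _ => by rw [sub_self]; exact zero_mem _⟩

theorem isTorus_one : IsTorus B L (1 : (L ⊗[ℂ] 𝔤) ≃ₗ[L] (L ⊗[ℂ] 𝔤)) :=
  ⟨fun _ _ => rfl, 1, fun i => by simp⟩

theorem isTriangular_exp {σ : (L ⊗[ℂ] 𝔤) ≃ₗ[L] (L ⊗[ℂ] 𝔤)} (hσ : ∀ x y, σ ⁅x, y⁆ = ⁅σ x, σ y⁆)
    {u : L ⊗[ℂ] 𝔤} (hu : u ∈ (P.gr L).fil 1) {k : ℕ}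
    (hk : ∀ x, ((LieAlgebra.ad L (L ⊗[ℂ] 𝔤) u) ^ k) x = 0)
    (hs : ∀ x, σ x = ∑ j ∈ Finset.range k,
      ((j.factorial : ℂ)⁻¹) • ((LieAlgebra.ad L (L ⊗[ℂ] 𝔤) u) ^ j) x) : P.IsTriangular σ :=
  ⟨hσ, 1, isTorus_one, fun _ _ hy => P.exp_mem_fil hk hs (by norm_num) hu hy⟩

theorem sum_range_ad_pow {u : L ⊗[ℂ] 𝔤} {k m : ℕ} (hkm : k ≤ m)
    (hk : ∀ x, ((LieAlgebra.ad L (L ⊗[ℂ] 𝔤) u) ^ k) x = 0) (x : L ⊗[ℂ] 𝔤) :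
    ∑ j ∈ Finset.range k, ((j.factorial : ℂ)⁻¹) • ((LieAlgebra.ad L (L ⊗[ℂ] 𝔤) u) ^ j) x =
      ∑ j ∈ Finset.range m, ((j.factorial : ℂ)⁻¹) • ((LieAlgebra.ad L (L ⊗[ℂ] 𝔤) u) ^ j) x := by
  refine Finset.sum_subset (Finset.range_mono hkm) fun j _ hj => ?_
  rw [Finset.mem_range, not_lt] at hj
  obtain ⟨i, rfl⟩ := Nat.exists_eq_add_of_le hj
  rw [pow_add, Module.End.mul_apply, ← Module.End.mul_apply, ← pow_add, add_comm, pow_add,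
    Module.End.mul_apply, hk, map_zero, smul_zero]

/-- Checked on generators. The inverse is carried along, both for the induction over the generated
subgroup and because the gauge term involves b⁻¹. -/
theorem isTriangular_of_mem_borelGroup {b : (L ⊗[ℂ] 𝔤) ≃ₗ[L] (L ⊗[ℂ] 𝔤)}
    (hb : b ∈ borelGroup B L) : P.IsTriangular b ∧ P.IsTriangular b⁻¹ := by
  induction hb using Subgroup.closure_induction with
  | mem σ hσ =>
    rcases hσ with h | ⟨u, hu, k, hk, hs⟩
    · exact ⟨P.isTriangular_torus h, P.isTriangular_torus (isTorus_inv h)⟩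
    · rw [P.nilradical_baseChange] at hu
      obtain ⟨σ', hσ', k', hk', hs', hs''⟩ := P.exists_exp hu
      -- The definition of a unipotent element does not say that it preserves the bracket. It
      -- coincides with the exponential automorphism, although the two sums may be cut off at
      -- different exponents.
      obtain rfl : σ = σ' := LinearEquiv.ext fun x => by
        rw [hs, hs', sum_range_ad_pow (le_max_left k k') hk, sum_range_ad_pow (le_max_right k k') hk']
      refine ⟨P.isTriangular_exp hσ' hu hk hs, P.isTriangular_exp (lie_symm hσ') (neg_mem hu)
        (k := k') (fun x => ?_) hs''⟩
      rw [map_neg, neg_pow]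
      simp [Module.End.mul_apply, hk']
  | one => exact ⟨P.isTriangular_torus isTorus_one, by
      rw [inv_one]; exact P.isTriangular_torus isTorus_one⟩
  | mul a b _ _ ha hb => exact ⟨ha.1.mul P hb.1, by rw [mul_inv_rev]; exact hb.2.mul P ha.2⟩
  | inv a _ ha => exact ⟨ha.2, by rw [inv_inv]; exact ha.1⟩

/-- The bracket with the i-th fundamental coweight isolates the i-th term. -/
theorem eq_one_of_sum_f {c : ι → L} (h : ∑ i, c i ⊗ₜ[ℂ] B.f i = 0) (i : ι) : c i = 0 := by
  classical
  obtain ⟨x, hx, hxe⟩ := exists_coweight B i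
  have h1 : ∀ j, ⁅x, B.f j⁆ = if j = i then -B.f i else 0 := fun j => by
    rw [lie_cartan_f_of_lie_cartan_e B hx (hxe j)]
    split_ifs with hj
    · subst hj; simp
    · simp
  have h2 := congrArg (fun y => ⁅(1 : L) ⊗ₜ[ℂ] x, y⁆) h
  simp only [lie_sum, LieAlgebra.ExtendScalars.bracket_tmul, one_mul, h1, lie_zero] at h2
  rw [Finset.sum_eq_single i (fun j _ hj => by simp [hj]) (by simp)] at h2
  simp only [if_true] at h2
  obtain ⟨g, hg⟩ := Module.Projective.exists_dual_ne_zero ℂ (neg_ne_zero.2 (B.sl2 i).f_ne_zero)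
  have h3 := congrArg (TensorProduct.rid ℂ L ∘ LinearMap.lTensor L g) h2
  simp only [Function.comp_apply, LinearMap.lTensor_tmul, TensorProduct.rid_tmul, map_zero] at h3
  exact (smul_eq_zero.1 h3).resolve_left hg

/-- Both p₋₁ and its image have degree -1, so a congruence modulo degree 0 is an equality. Then all
parameters are 1, and τ fixes the generators eᵢ and fᵢ. -/
theorem torus_eq_one {τ : (L ⊗[ℂ] 𝔤) ≃ₗ[L] (L ⊗[ℂ] 𝔤)} (hτ : IsTorus B L τ)
    (h : (1 : L) ⊗ₜ[ℂ] pMinus B - τ (1 ⊗ₜ pMinus B) ∈ (P.gr L).fil 0) (x : L ⊗[ℂ] 𝔤) : τ x = x := by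
  obtain ⟨hl, c, hc⟩ := hτ
  have h1 : (1 : L) ⊗ₜ[ℂ] pMinus B - τ (1 ⊗ₜ pMinus B) =
      ∑ i, (1 - (((c i)⁻¹ : Lˣ) : L)) ⊗ₜ[ℂ] B.f i := by
    simp only [pMinus, TensorProduct.tmul_sum, map_sum, (hc _).2, TensorProduct.sub_tmul,
      Finset.sum_sub_distrib]
  have h2 : ∑ i, (1 - (((c i)⁻¹ : Lˣ) : L)) ⊗ₜ[ℂ] B.f i = 0 := by
    rw [h1] at h
    refine (P.gr L).ext_proj fun k => ?_
    rw [map_zero]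
    by_cases hk : k < 0
    · exact h k hk
    · rw [map_sum]
      refine Finset.sum_eq_zero fun i _ => ?_
      rw [Grading.baseChange_proj_tmul, P.grading.proj_of_lie (P.lie_f i), if_neg (by omega),
        TensorProduct.tmul_zero]
  have hc1 : ∀ i, c i = 1 := fun i => by
    have h3 := eq_one_of_sum_f h2 i
    rw [sub_eq_zero] at h3
    exact inv_eq_one.1 (Units.ext h3.symm)
  let M : LieSubalgebra ℂ 𝔤 :=
    { carrier := {y | τ (1 ⊗ₜ y) = 1 ⊗ₜ y}
      add_mem' := fun {y z} hy hz => by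
        change τ (1 ⊗ₜ (y + z)) = 1 ⊗ₜ (y + z)
        rw [TensorProduct.tmul_add, map_add, hy, hz]
      zero_mem' := by
        change τ (1 ⊗ₜ 0) = 1 ⊗ₜ 0
        simp
      smul_mem' := fun a y hy => by
        change τ (1 ⊗ₜ (a • y)) = 1 ⊗ₜ (a • y)
        have : (1 : L) ⊗ₜ[ℂ] (a • y) = algebraMap ℂ L a • ((1 : L) ⊗ₜ[ℂ] y) := by
          rw [TensorProduct.tmul_smul, TensorProduct.smul_tmul', TensorProduct.smul_tmul',
            Algebra.smul_def, smul_eq_mul]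
        rw [this, map_smul, hy]
      lie_mem' := fun {y z} hy hz => by
        change τ (1 ⊗ₜ ⁅y, z⁆) = 1 ⊗ₜ ⁅y, z⁆
        have : (1 : L) ⊗ₜ[ℂ] ⁅y, z⁆ = ⁅(1 : L) ⊗ₜ[ℂ] y, (1 : L) ⊗ₜ[ℂ] z⁆ := by
          rw [LieAlgebra.ExtendScalars.bracket_tmul, one_mul]
        rw [this, hl, hy, hz] }
  have hM : M = ⊤ := by
    rw [eq_top_iff, ← B.span_ef, LieSubalgebra.lieSpan_le]
    rintro _ (⟨i, rfl⟩ | ⟨i, rfl⟩)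
    · exact (hc i).1.trans (by rw [hc1]; rfl)
    · exact (hc i).2.trans (by rw [hc1]; simp)
  exact linearMap_ext_one_tmul (σ := (τ : (L ⊗[ℂ] 𝔤) →ₗ[L] (L ⊗[ℂ] 𝔤))) (τ := LinearMap.id)
    (fun y => (hM ▸ LieSubalgebra.mem_top y : y ∈ M)) x

/-- The leading part of an automorphism that is congruent to `1` is an inner derivation. -/
theorem exists_leading {b : (L ⊗[ℂ] 𝔤) ≃ₗ[L] (L ⊗[ℂ] 𝔤)} (hl : ∀ x y, b ⁅x, y⁆ = ⁅b x, b y⁆)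
    {r : ℤ} (hr : 0 < r) (hb : ∀ k, ∀ y ∈ (P.gr L).fil k, b y - y ∈ (P.gr L).fil (k + r)) :
    ∃ u : L ⊗[ℂ] 𝔤, ⁅(1 : L) ⊗ₜ[ℂ] P.ρ, u⁆ = (r : L) • u ∧
      ∀ k, ∀ y ∈ (P.gr L).fil k, b y - y - ⁅u, y⁆ ∈ (P.gr L).fil (k + r + 1) := by
  set β : (L ⊗[ℂ] 𝔤) →ₗ[L] (L ⊗[ℂ] 𝔤) := (b : (L ⊗[ℂ] 𝔤) →ₗ[L] (L ⊗[ℂ] 𝔤)) - LinearMap.id with hβ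
  have hβa : ∀ y, β y = b y - y := fun y => rfl
  have hβl : ∀ y z : L ⊗[ℂ] 𝔤, β ⁅y, z⁆ = ⁅β y, z⁆ + ⁅y, β z⁆ + ⁅β y, β z⁆ := fun y z => by
    simp only [hβa, hl, sub_lie, lie_sub]; abel
  -- The component of b - 1 that raises degrees by exactly r.
  set δ : (L ⊗[ℂ] 𝔤) →ₗ[L] (L ⊗[ℂ] 𝔤) :=
    ∑ k ∈ (P.gr L).supp, (P.gr L).proj (k + r) ∘ₗ β ∘ₗ (P.gr L).proj k with hδ
  have hδh : ∀ (k : ℤ) (y : L ⊗[ℂ] 𝔤), ⁅(1 : L) ⊗ₜ[ℂ] P.ρ, y⁆ = (k : L) • y →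
      δ y = (P.gr L).proj (k + r) (β y) := by
    intro k y hy
    have h1 := (P.gr L).proj_of_lie hy
    simp only [hδ, LinearMap.sum_apply, LinearMap.comp_apply, h1]
    rw [Finset.sum_eq_single k (fun j _ hj => by simp [hj]) (fun hk => ?_), if_pos rfl]
    rw [if_pos rfl]
    have h2 := h1 k
    rw [if_pos rfl, (P.gr L).proj_eq_zero hk] at h2
    rw [← h2]; simp
  have hδl : ∀ y z : L ⊗[ℂ] 𝔤, δ ⁅y, z⁆ = ⁅δ y, z⁆ + ⁅y, δ z⁆ := by
    intro y z
    refine (P.gr L).hom_induction (P := fun y => δ ⁅y, z⁆ = ⁅δ y, z⁆ + ⁅y, δ z⁆) (by simp)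
      (fun y y' h h' => by simp only [add_lie, map_add, h, h']; abel) (fun i y hy => ?_) y
    refine (P.gr L).hom_induction (P := fun z => δ ⁅y, z⁆ = ⁅δ y, z⁆ + ⁅y, δ z⁆) (by simp)
      (fun y y' h h' => by simp only [lie_add, map_add, h, h']; abel) (fun j z hz => ?_) z
    rw [hδh _ _ (Grading.lie_lie_proj hy hz), hδh _ _ hy, hδh _ _ hz, hβl, map_add, map_add]
    -- The quadratic term has degree at least i + j + 2r, beyond i + j + r; what remains is the
    -- Leibniz rule for δ.
    have h1 : (P.gr L).proj (i + j + r) ⁅β y, β z⁆ = 0 :=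
      (P.gr L).lie_mem_fil (hb i y ((P.gr L).mem_fil_of_lie le_rfl hy))
        (hb j z ((P.gr L).mem_fil_of_lie le_rfl hz)) _ (by omega)
    have h2 : (P.gr L).proj (i + j + r) ⁅y, β z⁆ = ⁅y, (P.gr L).proj (j + r) (β z)⁆ := by
      rw [(P.gr L).proj_lie_homogeneous hy]
      congr 2; ring_nf
    have h3 : (P.gr L).proj (i + j + r) ⁅β y, z⁆ = ⁅(P.gr L).proj (i + r) (β y), z⁆ := by
      rw [← lie_skew, map_neg, (P.gr L).proj_lie_homogeneous hz, lie_skew]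
      congr 2; ring_nf
    rw [h1, h2, h3, add_zero]
  obtain ⟨u, hu⟩ := exists_eq_lie_of_derivation δ fun y z => hδl (1 ⊗ₜ y) (1 ⊗ₜ z)
  have huh : ∀ j ≠ r, (P.gr L).proj j u = 0 := fun j hj => P.eq_zero_of_lie_proj fun k y => by
    have h1 := P.proj_lie_right (L := L) (j + k) k u y
    rw [add_sub_cancel_right, ← hu, hδh k _ (P.one_tmul_lie_proj k y), (P.gr L).proj_proj,
      if_neg (by omega)] at h1
    exact h1.symm
  refine ⟨u, ?_, fun k y hy => ?_⟩
  · have h1 : (P.gr L).proj r u = u := (P.gr L).ext_proj fun j => by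
      rw [(P.gr L).proj_proj]
      split_ifs with h
      · rw [h]
      · rw [huh j h]
    rw [← h1]
    exact (P.gr L).lie_proj r u
  · refine (P.gr L).fil_induction (P := fun y => b y - y - ⁅u, y⁆ ∈ (P.gr L).fil (k + r + 1))
      (by simp) (fun y z hy hz => ?_) (fun j hj y => ?_) hy
    · have h1 := add_mem hy hz
      rw [map_add, lie_add]
      convert h1 using 1
      abel
    · refine (P.gr L).fil_mono (r := j + r + 1) (by omega) ?_
      rw [← hu, hδh j _ ((P.gr L).lie_proj j y)]
      exact (P.gr L).sub_proj_mem_fil (hb j _ ((P.gr L).proj_mem_fil j j le_rfl y))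

/-- The gauge transformation b is compared with the identity to increasing order. If b - 1 raises
degrees by at least r + 1 and has leading part ad u, the gauge equation in degree r says that the
degree r part of ∑ (c'ᵢ - cᵢ) vᵢ is [u, p₋₁]. The former is killed by ad p₁, and ad p₁ ∘ ad p₋₁ is
injective in positive degrees; so u = 0, this part vanishes, and the induction goes on. -/
theorem canForm_unique {c c' : Fin l → L} (h : GaugeEquiv D B (P.canForm c) (P.canForm c')) :
    c = c' := by
  obtain ⟨b, hb, h⟩ := h
  obtain ⟨ht, ht'⟩ := P.isTriangular_of_mem_borelGroup hb
  have hfil : ∀ {k : ℤ} {y}, y ∈ (P.gr L).fil k → b y ∈ (P.gr L).fil k := fun hy => ht.mem_fil hy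
  set w := ∑ i, c i ⊗ₜ[ℂ] (P.v i : 𝔤) with hw
  set w' := ∑ i, c' i ⊗ₜ[ℂ] (P.v i : 𝔤) with hw'
  have hA : P.canForm c = 1 ⊗ₜ pMinus B + w := rfl
  have hA' : P.canForm c' = 1 ⊗ₜ pMinus B + w' := rfl
  have hw0 := P.sum_v_mem_fil c
  have hw0' := P.sum_v_mem_fil c'
  have hl := ht.1
  obtain ⟨_, τ, hτ, hbτ⟩ := ht
  -- the torus part is trivial
  have hone : ∀ k, ∀ y ∈ (P.gr L).fil k, b y - y ∈ (P.gr L).fil (k + 1) := by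
    obtain ⟨a, ha, ha'⟩ := exists_gauge D hl
    have ha0 : a ∈ (P.gr L).fil 0 := by
      refine P.gauge_mem_fil D (fun k y hy => hfil hy) (fun k y => ?_) ha'
      rw [add_zero]
      exact P.derTensor_mem_fil D (ht'.mem_fil (P.one_tmul_proj_mem_fil k y))
    have h1 : P.canForm c' = b (P.canForm c) + a :=
      covDer_injective D (b := b) fun x => by rw [← ha, h]
    have h2 := hbτ _ _ P.one_tmul_pMinus_mem_fil
    rw [neg_add_cancel] at h2
    have h3 : (1 : L) ⊗ₜ[ℂ] pMinus B - τ (1 ⊗ₜ pMinus B) ∈ (P.gr L).fil 0 := by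
      have h4 : (1 : L) ⊗ₜ[ℂ] pMinus B - τ (1 ⊗ₜ pMinus B) =
          (b (1 ⊗ₜ pMinus B) - τ (1 ⊗ₜ pMinus B)) + b w + a - w' := by
        rw [hA, hA', map_add, ← sub_eq_zero] at h1
        rw [← sub_eq_zero, ← h1]; abel
      rw [h4]
      exact sub_mem (add_mem (add_mem h2 (hfil hw0)) ha0) hw0'
    intro k y hy
    have h5 := hbτ k y hy
    rwa [P.torus_eq_one hτ h3] at h5
  have key : ∀ r : ℕ, (∀ k, ∀ y ∈ (P.gr L).fil k, b y - y ∈ (P.gr L).fil (k + (r + 1 : ℕ))) ∧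
      w' - w ∈ (P.gr L).fil r := by
    intro r
    induction r with
    | zero => exact ⟨by simpa using hone, sub_mem hw0' hw0⟩
    | succ r ih =>
      obtain ⟨ih, ihw⟩ := ih
      obtain ⟨u, hu, hub⟩ := P.exists_leading hl (by omega) ih
      have hu1 : u ∈ (P.gr L).fil (r + 1 : ℕ) := (P.gr L).mem_fil_of_lie le_rfl hu
      have h1 : w' - w - ⁅u, (1 : L) ⊗ₜ[ℂ] pMinus B⁆ ∈ (P.gr L).fil (r + 1 : ℕ) := by
        refine P.mem_fil_of_lie_mem fun k y => ?_
        set x := (1 : L) ⊗ₜ[ℂ] P.grading.proj k y with hx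
        have hxf : x ∈ (P.gr L).fil k := P.one_tmul_proj_mem_fil k y
        have hDx : derTensor D x = 0 := by
          rw [hx, derTensor_tmul, Derivation.map_one_eq_zero, TensorProduct.zero_tmul]
        set p := (1 : L) ⊗ₜ[ℂ] pMinus B
        have hpx : ⁅p, x⁆ ∈ (P.gr L).fil (k - 1) :=
          (P.gr L).fil_mono (by omega) ((P.gr L).lie_mem_fil P.one_tmul_pMinus_mem_fil hxf)
        have e1 := P.derTensor_mem_fil D (ih k x hxf)
        have e2 := ih k _ ((P.gr L).fil_mono (s := k) (by omega) ((P.gr L).lie_mem_fil hw0 hxf))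
        have e3 := (P.gr L).fil_mono (s := k + (r + 1 : ℕ)) (by omega) (hub _ _ hpx)
        have e4 := (P.gr L).fil_mono (s := k + (r + 1 : ℕ)) (by omega)
          ((P.gr L).lie_mem_fil hw0' (ih k x hxf))
        have e5 := (P.gr L).fil_mono (s := k + (r + 1 : ℕ)) (by omega)
          ((P.gr L).lie_mem_fil P.one_tmul_pMinus_mem_fil (hub k x hxf))
        have h2 := h x
        rw [covDer_eq, covDer_eq, hA, hA', map_add, hDx, map_zero, zero_add, add_lie, add_lie,
          map_add] at h2
        -- The gauge equation at the constant vector x of degree k, rearranged so that every term on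
        -- the right has degree at least k + r + 1.
        have h3 : ⁅w' - w - ⁅u, p⁆, x⁆ = -derTensor D (b x - x) + (b ⁅w, x⁆ - ⁅w, x⁆) +
            (b ⁅p, x⁆ - ⁅p, x⁆ - ⁅u, ⁅p, x⁆⁆) - ⁅w', b x - x⁆ - ⁅p, b x - x - ⁅u, x⁆⁆ := by
          have hj := leibniz_lie u p x
          simp only [map_sub, hDx, sub_lie, lie_sub, sub_zero]
          have e := congrArg₂ (· - ·) (sub_eq_zero.2 hj) (sub_eq_zero.2 h2)
          rw [sub_zero] at e
          rw [← sub_eq_zero, ← e]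
          abel
        rw [h3]
        exact sub_mem (sub_mem (add_mem (add_mem (neg_mem e1) e2) e3) e4) e5
      have h2 : ⁅u, (1 : L) ⊗ₜ[ℂ] pMinus B⁆ = (P.gr L).proj r (w' - w) := by
        have h3 := h1 r (by omega)
        rw [map_sub, sub_eq_zero] at h3
        have h4 := Grading.lie_lie_proj hu (P.one_tmul_lie_homogeneous (L := L) P.lie_pMinus)
        rw [h3, (P.gr L).proj_of_lie h4, if_pos (by omega)]
      have hu0 : u = 0 := by
        refine P.eq_zero_of_lie_p₁_lie_pMinus (r := r + 1) (by omega) hu ?_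
        rw [← lie_skew _ u, h2, lie_neg, neg_eq_zero]
        have h5 := (P.gr L).proj_lie_homogeneous (P.one_tmul_lie_homogeneous (L := L) P.lie_p₁)
          (r + 1) (w' - w)
        rw [lie_sub, P.lie_p₁_sum_v, P.lie_p₁_sum_v, sub_zero, map_zero, add_sub_cancel_right] at h5
        exact h5.symm
      subst hu0
      simp only [zero_lie, sub_zero] at h1 hub
      refine ⟨fun k y hy => ?_, h1⟩
      exact (P.gr L).fil_mono (by omega) (hub k y hy)
  refine P.sum_v_injective ?_
  obtain ⟨r, hr⟩ := (P.gr L).exists_fil_eq_bot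
  have h1 := hr _ ((P.gr L).fil_mono (by omega) (key r.toNat).2)
  exact (sub_eq_zero.1 h1).symm

end OperFrame

end OperFF

namespace OperFF

open CategoryTheory

/-! ### Infinitesimal gauge transformations -/

section Infinitesimal

variable {𝔤 : Type*} [LieRing 𝔤] [LieAlgebra ℂ 𝔤] {L : Type*} [CommRing L] [Algebra ℂ L]

/-- The automorphism `1 + ε ad y`. -/
noncomputable def infGauge {ε : L} (hε : ε * ε = 0) (y : L ⊗[ℂ] 𝔤) : (L ⊗[ℂ] 𝔤) ≃ₗ[L] (L ⊗[ℂ] 𝔤) :=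
  have key : ∀ x : L ⊗[ℂ] 𝔤, ε • ε • ⁅y, ⁅y, x⁆⁆ = 0 := fun x => by rw [smul_smul, hε, zero_smul]
  LinearEquiv.ofLinearMap (LinearMap.id + ε • LieAlgebra.ad L _ y)
    (LinearMap.id - ε • LieAlgebra.ad L _ y)
    (LinearMap.ext fun x => by simp [key, smul_sub])
    (LinearMap.ext fun x => by simp [key])

theorem infGauge_apply {ε : L} (hε : ε * ε = 0) (y x : L ⊗[ℂ] 𝔤) :
    infGauge hε y x = x + ε • ⁅y, x⁆ := rfl

/-- The first-order formula for a gauge transformation, exact here because ε² = 0 and ∂ε = 0. -/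
theorem infGauge_covDer (D : Derivation ℂ L L) {ε : L} (hε : ε * ε = 0) (hD : D ε = 0)
    (y A x : L ⊗[ℂ] 𝔤) :
    infGauge hε y (covDer D A x) =
      covDer D (A + ε • (⁅y, A⁆ - derTensor D y)) (infGauge hε y x) := by
  have key : ∀ z : L ⊗[ℂ] 𝔤, ε • ε • z = 0 := fun z => by rw [smul_smul, hε, zero_smul]
  simp only [infGauge_apply, covDer_eq, map_add, derTensor_smul, hD, derTensor_lie, lie_add, add_lie,
    smul_lie, lie_smul, key, sub_lie, smul_sub, smul_add, zero_smul, leibniz_lie y A x]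
  abel

variable {ι : Type*} [Fintype ι] {H : LieSubalgebra ℂ 𝔤} {B : LieAlgebra.Basis ι H}

theorem infGauge_lie {ε : L} (hε : ε * ε = 0) (y x z : L ⊗[ℂ] 𝔤) :
    infGauge hε y ⁅x, z⁆ = ⁅infGauge hε y x, infGauge hε y z⁆ := by
  have key : ∀ z : L ⊗[ℂ] 𝔤, ε • ε • z = 0 := fun z => by rw [smul_smul, hε, zero_smul]
  simp only [infGauge_apply, lie_add, add_lie, smul_lie, lie_smul, key, leibniz_lie y x z, smul_add]
  abel

namespace OperFrame

variable {l : ℕ} (P : OperFrame B l) [FiniteDimensional ℂ 𝔤] [LieAlgebra.IsKilling ℂ 𝔤]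

/-- This is the torus element all of whose parameters equal the unit 1 + ε k. -/
theorem infGauge_rho_mem {ε : L} (hε : ε * ε = 0) (k : L) :
    infGauge hε (k ⊗ₜ[ℂ] P.ρ) ∈ borelGroup B L := by
  refine Subgroup.subset_closure (Or.inl ⟨infGauge_lie hε _, fun _ =>
    ⟨1 + ε * k, 1 - ε * k, by linear_combination (-k * k) * hε, by linear_combination (-k * k) * hε⟩,
    fun i => ⟨?_, ?_⟩⟩)
  · rw [infGauge_apply, LieAlgebra.ExtendScalars.bracket_tmul, P.lie_e, TensorProduct.smul_tmul',
      ← TensorProduct.add_tmul, mul_one, smul_eq_mul]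
  · rw [infGauge_apply, LieAlgebra.ExtendScalars.bracket_tmul, lie_rho_f B P.mem P.lie_e,
      TensorProduct.smul_tmul', TensorProduct.tmul_neg, ← TensorProduct.neg_tmul,
      ← TensorProduct.add_tmul, mul_one, smul_eq_mul, ← sub_eq_add_neg]
    rfl

/-- This is the exponential of ad(ε k p₁), whose square vanishes. -/
theorem infGauge_p₁_mem {ε : L} (hε : ε * ε = 0) (k : L) :
    infGauge hε (k ⊗ₜ[ℂ] P.p₁) ∈ borelGroup B L := by
  have hu : (ε * k) ⊗ₜ[ℂ] P.p₁ = ε • (k ⊗ₜ[ℂ] P.p₁) := by rw [TensorProduct.smul_tmul', smul_eq_mul]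
  refine Subgroup.subset_closure (Or.inr ⟨(ε * k) ⊗ₜ[ℂ] P.p₁, ?_, 2, fun x => ?_, fun x => ?_⟩)
  · rw [P.nilradical_baseChange]
    exact P.grading.tmul_mem_fil _ (P.grading.mem_fil_of_lie le_rfl P.lie_p₁)
  · rw [pow_two, Module.End.mul_apply, LieAlgebra.ad_apply, LieAlgebra.ad_apply, hu, smul_lie,
      smul_lie, lie_smul, smul_smul, hε, zero_smul]
  · rw [infGauge_apply, Finset.sum_range_succ, Finset.sum_range_one, hu]
    simp

/-- The coefficients of `p₁` with respect to the basis of `V^can`. -/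
noncomputable def p₁Coeff (i : Fin l) : ℂ := P.v.repr ⟨P.p₁, lie_self P.p₁⟩ i

theorem sum_p₁Coeff (a : L) :
    ∑ i, (a * algebraMap ℂ L (P.p₁Coeff i)) ⊗ₜ[ℂ] (P.v i : 𝔤) = a ⊗ₜ P.p₁ := by
  have h1 := congrArg Subtype.val (P.v.sum_repr ⟨P.p₁, lie_self P.p₁⟩)
  rw [AddSubmonoidClass.coe_finsetSum] at h1
  refine Eq.trans ?_ (congrArg (fun z => a ⊗ₜ[ℂ] z) h1)
  rw [TensorProduct.tmul_sum]
  refine Finset.sum_congr rfl fun i _ => ?_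
  rw [Submodule.coe_smul, TensorProduct.tmul_smul, TensorProduct.smul_tmul', Algebra.smul_def,
    mul_comm]
  rfl

/-- The gauge transformation 1 + ε ad(k ρ) restores the coefficient 1 of p₋₁, multiplies cᵢ by 1 +
(dᵢ + 1) ε k in total and creates the term -ε ∂k ρ. As [p₁, p₋₁] = 2ρ, the transformation 1 + ε
ad(∂k p₁ / 2) cancels this term, at the price of -ε ∂²k p₁ / 2, which lies in V^can. For a Jacobian
1 + ε ∂h, where k = ∂h, this is the Schwarzian term with ∂³h. -/
theorem gaugeEquiv_smul_canForm (D : Derivation ℂ L L) {ε : L} (hε : ε * ε = 0) (hD : D ε = 0)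
    (k : L) (c : Fin l → L) :
    GaugeEquiv D B ((1 + ε * k) • P.canForm c) (P.canForm fun i => (1 + (P.d i + 1) * (ε * k)) * c i -
      ε * D (D k) * algebraMap ℂ L (2⁻¹ * P.p₁Coeff i)) := by
  set c₁ : Fin l → L := fun i => (1 + (P.d i + 1) * (ε * k)) * c i with hc₁
  set p : L ⊗[ℂ] 𝔤 := 1 ⊗ₜ pMinus B with hp
  have hρp : ⁅P.ρ, pMinus B⁆ = -pMinus B := by rw [P.lie_pMinus]; simp
  have h1 : (1 + ε * k) • P.canForm c + ε • (⁅k ⊗ₜ[ℂ] P.ρ, (1 + ε * k) • P.canForm c⁆ -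
      derTensor D (k ⊗ₜ P.ρ)) = P.canForm c₁ - (ε * D k) ⊗ₜ P.ρ := by
    have h2 : ⁅k ⊗ₜ[ℂ] P.ρ, P.canForm c⁆ = k • (-p + ∑ i, (P.d i * c i) ⊗ₜ[ℂ] (P.v i : 𝔤)) := by
      rw [canForm, lie_add, LieAlgebra.ExtendScalars.bracket_tmul, hρp, lie_sum, smul_add,
        Finset.smul_sum]
      congr 1
      · rw [TensorProduct.tmul_neg, smul_neg, hp, TensorProduct.smul_tmul', smul_eq_mul]
      · refine Finset.sum_congr rfl fun i _ => ?_
        rw [LieAlgebra.ExtendScalars.bracket_tmul, P.lie_v, TensorProduct.tmul_smul,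
          TensorProduct.smul_tmul', TensorProduct.smul_tmul', Algebra.smul_def, smul_eq_mul,
          map_natCast]
        congr 1; ring
    have h3 : P.canForm c₁ = P.canForm c + (ε * k) • ∑ i, (P.d i * c i) ⊗ₜ[ℂ] (P.v i : 𝔤) +
        (ε * k) • ∑ i, c i ⊗ₜ[ℂ] (P.v i : 𝔤) := by
      simp only [canForm, Finset.smul_sum, TensorProduct.smul_tmul', add_assoc,
        ← Finset.sum_add_distrib, ← TensorProduct.add_tmul, hc₁, smul_eq_mul]
      congr 1
      refine Finset.sum_congr rfl fun i _ => ?_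
      congr 1; ring
    have h4 : ((ε * ε) * (k * k)) • (-p + ∑ i, (P.d i * c i) ⊗ₜ[ℂ] (P.v i : 𝔤)) = 0 := by
      rw [hε, zero_mul, zero_smul]
    have h5 : ε • (D k ⊗ₜ[ℂ] P.ρ) = (ε * D k) ⊗ₜ P.ρ := by
      rw [TensorProduct.smul_tmul', smul_eq_mul]
    rw [lie_smul, h2, h3, derTensor_tmul, smul_sub, h5]
    have h6 : P.canForm c = p + ∑ i, c i ⊗ₜ[ℂ] (P.v i : 𝔤) := rfl
    rw [h6, ← sub_eq_zero, ← h4]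
    module
  have h2 : P.canForm c₁ - (ε * D k) ⊗ₜ P.ρ + ε • (⁅(algebraMap ℂ L 2⁻¹ * D k) ⊗ₜ[ℂ] P.p₁,
      P.canForm c₁ - (ε * D k) ⊗ₜ P.ρ⁆ - derTensor D ((algebraMap ℂ L 2⁻¹ * D k) ⊗ₜ P.p₁)) =
      P.canForm fun i => c₁ i - ε * D (D k) * algebraMap ℂ L (2⁻¹ * P.p₁Coeff i) := by
    have h3 : ⁅(algebraMap ℂ L 2⁻¹ * D k) ⊗ₜ[ℂ] P.p₁, P.canForm c₁⁆ = D k ⊗ₜ P.ρ := by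
      have : (algebraMap ℂ L 2⁻¹ * D k) ⊗ₜ[ℂ] P.p₁ = (algebraMap ℂ L 2⁻¹ * D k) • (1 ⊗ₜ[ℂ] P.p₁) := by
        rw [TensorProduct.smul_tmul', smul_eq_mul, mul_one]
      rw [canForm, lie_add, this, smul_lie, smul_lie, P.lie_p₁_sum_v, smul_zero, add_zero,
        LieAlgebra.ExtendScalars.bracket_tmul, P.sl2.lie_e_f, TensorProduct.tmul_smul,
        TensorProduct.smul_tmul', TensorProduct.smul_tmul', mul_one, Algebra.smul_def (2 : ℂ),
        smul_eq_mul, mul_one]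
      congr 1
      have : algebraMap ℂ L 2⁻¹ * algebraMap ℂ L 2 = 1 := by rw [← map_mul]; simp
      linear_combination (D k) * this
    have h4 : ε • ⁅(algebraMap ℂ L 2⁻¹ * D k) ⊗ₜ[ℂ] P.p₁, (ε * D k) ⊗ₜ[ℂ] P.ρ⁆ = 0 := by
      rw [LieAlgebra.ExtendScalars.bracket_tmul, TensorProduct.smul_tmul', smul_eq_mul]
      have : ε * (algebraMap ℂ L 2⁻¹ * D k * (ε * D k)) = 0 := by
        linear_combination (algebraMap ℂ L 2⁻¹ * D k * D k) * hε
      rw [this, TensorProduct.zero_tmul]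
    have h5 : ε • derTensor D ((algebraMap ℂ L 2⁻¹ * D k) ⊗ₜ[ℂ] P.p₁) =
        ∑ i, (ε * D (D k) * algebraMap ℂ L (2⁻¹ * P.p₁Coeff i)) ⊗ₜ[ℂ] (P.v i : 𝔤) := by
      rw [derTensor_tmul, Derivation.leibniz, D.map_algebraMap, smul_zero, add_zero,
        TensorProduct.smul_tmul', ← P.sum_p₁Coeff]
      refine Finset.sum_congr rfl fun i _ => ?_
      congr 1
      simp only [smul_eq_mul, map_mul]; ring
    have h6 : (P.canForm fun i => c₁ i - ε * D (D k) * algebraMap ℂ L (2⁻¹ * P.p₁Coeff i)) =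
        P.canForm c₁ -
          ∑ i, (ε * D (D k) * algebraMap ℂ L (2⁻¹ * P.p₁Coeff i)) ⊗ₜ[ℂ] (P.v i : 𝔤) := by
      simp only [canForm, TensorProduct.sub_tmul, Finset.sum_sub_distrib]; abel
    rw [lie_sub, h3, smul_sub, smul_sub, h4, h5, h6, TensorProduct.smul_tmul', smul_eq_mul]
    abel
  rw [← h2, ← h1]
  refine GaugeEquiv.trans ⟨_, P.infGauge_rho_mem hε k, infGauge_covDer D hε hD _ _⟩
    ⟨_, P.infGauge_p₁_mem hε _, infGauge_covDer D hε hD _ _⟩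

end OperFrame

end Infinitesimal

/-! ### Canonical coordinates on opers -/

namespace OperFrame

variable {𝔤 : Type*} [LieRing 𝔤] [LieAlgebra ℂ 𝔤] {ι : Type*} [Fintype ι]
  {H : LieSubalgebra ℂ 𝔤} {B : LieAlgebra.Basis ι H} {l : ℕ} (P : OperFrame B l)
  {L : Type*} [CommRing L] [Algebra ℂ L] (D : Derivation ℂ L L)

/-- The class of `d + (p₋₁ + ∑ cᵢ vᵢ) dt`. -/
noncomputable def canOp (c : Fin l → L) : Op B D :=
  Quotient.mk (operSetoid B D) ⟨P.canForm c, P.isOper_canForm c⟩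

theorem isCanForm_iff {x : Op B D} {c : Fin l → L} :
    IsCanForm B (fun j => (P.v j : 𝔤)) x c ↔ x = P.canOp D c :=
  ⟨fun ⟨_, h⟩ => h, fun h => ⟨P.isOper_canForm c, h⟩⟩

/-- The change of the canonical coordinates under the infinitesimal change of variables `h ∂`. -/
noncomputable def act (h : L) (c : Fin l → L) (i : Fin l) : L :=
  h * D (c i) + (P.d i + 1) * D h * c i - algebraMap ℂ L (2⁻¹ * P.p₁Coeff i) * D (D (D h))

variable [FiniteDimensional ℂ 𝔤] [LieAlgebra.IsKilling ℂ 𝔤]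

theorem canOp_injective : Function.Injective (P.canOp D : (Fin l → L) → Op B D) :=
  fun _ _ h => P.canForm_unique D (Quotient.exact h)

theorem canOp_surjective : Function.Surjective (P.canOp D : (Fin l → L) → Op B D) := fun x => by
  induction x using Quotient.inductionOn with
  | h A =>
    obtain ⟨c, hc⟩ := P.exists_canForm D A.2
    exact ⟨c, (Quotient.sound hc).symm⟩

/-- The canonical coordinates of an oper. -/
noncomputable def coord (x : Op B D) : Fin l → L := (P.canOp_surjective D x).choose

theorem canOp_coord (x : Op B D) : P.canOp D (P.coord D x) = x :=
  (P.canOp_surjective D x).choose_spec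

theorem coord_canOp (c : Fin l → L) : P.coord D (P.canOp D c) = c :=
  P.canOp_injective D (P.canOp_coord D _)

variable {A : Type} [CommRing A] [Algebra ℂ A] (𝔻 : Disc A)

theorem extMap_canForm {L' : Type*} [CommRing L'] [Algebra ℂ L'] (f : L →ₐ[ℂ] L') (c : Fin l → L) :
    extMap f (P.canForm c) = P.canForm (fun i => f (c i)) := by
  simp [canForm, extMap_tmul]

theorem pull_canOp {S T : CommAlgCat.{0} A} (f : S ⟶ T) (c : Fin l → 𝔻.obj S) :
    Op.pull B (𝔻.baseChange f) (P.canOp (𝔻.cder S) c) =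
      P.canOp (𝔻.cder T) (fun i => 𝔻.map f (c i)) := by
  refine congrArg (Quotient.mk _) (Subtype.ext ?_)
  change ((1 : (𝔻.obj T)ˣ) : 𝔻.obj T) • extMap _ (P.canForm c) = _
  rw [Units.val_one, one_smul, extMap_canForm]
  rfl

theorem map_algebraMap_complex {S T : CommAlgCat.{0} A} (f : S ⟶ T) (z : ℂ) :
    𝔻.map f (algebraMap ℂ (𝔻.obj S) z) = algebraMap ℂ (𝔻.obj T) z :=
  (𝔻.baseChange f).toHom.commutes z

theorem map_act {S T : CommAlgCat.{0} A} (f : S ⟶ T) (h : 𝔻.obj S) (c : Fin l → 𝔻.obj S)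
    (i : Fin l) : 𝔻.map f (P.act (𝔻.cder S) h c i) =
      P.act (𝔻.cder T) (𝔻.map f h) (fun i => 𝔻.map f (c i)) i := by
  simp only [act, map_sub, map_add, map_mul, map_natCast, map_one, Disc.cder_apply, 𝔻.map_der,
    map_algebraMap_complex]

/-- The change of coordinate replaces c by c + ε h ∂c and multiplies the connection form by the
Jacobian 1 + ε ∂h; the factor is removed by the infinitesimal gauge transformations with k = ∂h. -/
theorem infMove_canOp (h : 𝔻.obj (Disc.base A)) (S : CommAlgCat.{0} A) (c : Fin l → 𝔻.obj S) :
    infMove B 𝔻 h S (P.canOp (𝔻.cder S) c) = P.canOp (𝔻.cder (Disc.dual S)) (fun i =>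
      𝔻.map (Disc.toDual S) (c i) + 𝔻.eps S *
        𝔻.map (Disc.toDual S) (P.act (𝔻.cder S) (𝔻.map (fromBase S) h) c i)) := by
  rw [infMove, pull_canOp]
  set h' := 𝔻.map (fromBase (Disc.dual S)) h with hh'
  have hh : 𝔻.map (Disc.toDual S) (𝔻.map (fromBase S) h) = h' := by
    rw [← 𝔻.map_comp, hh']
    congr 1
  simp only [map_act, hh]
  set c' : Fin l → 𝔻.obj (Disc.dual S) := fun i => 𝔻.map (Disc.toDual S) (c i)
  set D' := 𝔻.cder (Disc.dual S)
  set ε := 𝔻.eps S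
  have hε : ε * ε = 0 := 𝔻.eps_mul_eps S
  refine Quotient.sound (s := operSetoid B D') ?_
  have h1 := P.gaugeEquiv_smul_canForm D' hε (𝔻.der_eps S) (D' h')
    (fun i => c' i + ε * (h' * D' (c' i)))
  change GaugeEquiv D' B ((1 + ε * D' h') • extMap _ (P.canForm c')) (P.canForm _)
  rw [extMap_canForm]
  refine (congrArg (fun e => GaugeEquiv D' B _ (P.canForm e)) (funext fun i => ?_)).mpr h1
  rw [act]
  linear_combination (-(P.d i + 1) * D' h' * h' * D' (c' i)) * hε

/-- The value of a function at the oper with the given canonical coordinates. -/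
noncomputable def evalHom {S : CommAlgCat.{0} A} (c : Fin l → 𝔻.obj S) : OpFun B 𝔻 →ₐ[A] S where
  toFun F := F.eval (P.canOp (𝔻.cder S) c)
  map_one' := rfl
  map_mul' _ _ := rfl
  map_zero' := rfl
  map_add' _ _ := rfl
  commutes' _ := rfl

variable {𝔻}

theorem eval_eq_evalHom (F : OpFun B 𝔻) {S : CommAlgCat.{0} A} (x : OpOn B 𝔻 S) :
    F.eval x = P.evalHom 𝔻 (P.coord (𝔻.cder S) x) F := by
  change _ = F.eval (P.canOp _ (P.coord (𝔻.cder S) x))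
  rw [P.canOp_coord]

theorem opFun_ext {F G : OpFun B 𝔻}
    (h : ∀ (S : CommAlgCat.{0} A) (c : Fin l → 𝔻.obj S), P.evalHom 𝔻 c F = P.evalHom 𝔻 c G) :
    F = G :=
  Subtype.ext (funext fun S => funext fun x => by
    have h1 := h S (P.coord (𝔻.cder S) x)
    rw [← P.eval_eq_evalHom, ← P.eval_eq_evalHom] at h1
    exact h1)

theorem evalHom_map (F : OpFun B 𝔻) {S T : CommAlgCat.{0} A} (f : S ⟶ T) (c : Fin l → 𝔻.obj S) :
    P.evalHom 𝔻 (fun i => 𝔻.map f (c i)) F = f.hom (P.evalHom 𝔻 c F) := by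
  have h1 := F.2 S T f (P.canOp (𝔻.cder S) c)
  rw [P.pull_canOp] at h1
  exact h1

/-- The function on opers that is given by a natural function of the canonical coordinates. -/
noncomputable def opFunOf (φ : ∀ S : CommAlgCat.{0} A, (Fin l → 𝔻.obj S) → S)
    (hφ : ∀ {S T : CommAlgCat.{0} A} (f : S ⟶ T) (c : Fin l → 𝔻.obj S),
      φ T (fun i => 𝔻.map f (c i)) = f.hom (φ S c)) : OpFun B 𝔻 :=
  ⟨fun S x => φ S (P.coord (𝔻.cder S) x), fun S T f x => by
    beta_reduce
    rw [← hφ]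
    congr 1
    apply P.canOp_injective
    rw [P.canOp_coord, ← P.pull_canOp, P.canOp_coord]⟩

theorem evalHom_opFunOf {φ : ∀ S : CommAlgCat.{0} A, (Fin l → 𝔻.obj S) → S}
    (hφ : ∀ {S T : CommAlgCat.{0} A} (f : S ⟶ T) (c : Fin l → 𝔻.obj S),
      φ T (fun i => 𝔻.map f (c i)) = f.hom (φ S c)) {S : CommAlgCat.{0} A} (c : Fin l → 𝔻.obj S) :
    P.evalHom 𝔻 c (P.opFunOf φ hφ) = φ S c := by
  change φ S (P.coord (𝔻.cder S) (P.canOp (𝔻.cder S) c)) = φ S c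
  rw [P.coord_canOp]

/-! #### The action of vector fields -/

/-- The projection `S[ε] → S`. -/
noncomputable def dualFst (S : CommAlgCat.{0} A) : Disc.dual S ⟶ S :=
  CommAlgCat.ofHom (X := DualNumber S) (Y := S) (TrivSqZeroExt.fstHom A S S)

theorem map_dualFst_toDual (S : CommAlgCat.{0} A) (x : 𝔻.obj S) :
    𝔻.map (dualFst S) (𝔻.map (Disc.toDual S) x) = x := by
  rw [← 𝔻.map_comp]
  have : Disc.toDual S ≫ dualFst S = 𝟙 S := rfl
  rw [this, 𝔻.map_id]

theorem map_dualFst_eps (S : CommAlgCat.{0} A) : 𝔻.map (dualFst S) (𝔻.eps S) = 0 := by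
  rw [Disc.eps, 𝔻.map_algebraMap]
  have : (dualFst S).hom (Disc.dualEps S) = 0 := rfl
  rw [this, map_zero]

/-- Naturality of F for the projection ε ↦ 0. -/
theorem fst_evalHom (F : OpFun B 𝔻) {S : CommAlgCat.{0} A} (c e : Fin l → 𝔻.obj S) :
    (dualFst S).hom (P.evalHom 𝔻 (fun i => 𝔻.map (Disc.toDual S) (c i) +
      𝔻.eps S * 𝔻.map (Disc.toDual S) (e i)) F) = P.evalHom 𝔻 c F := by
  rw [← P.evalHom_map]
  congr 2
  funext i
  rw [map_add, map_mul, map_dualFst_toDual, map_dualFst_eps, zero_mul, add_zero]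

theorem evalHom_derAct (h : 𝔻.obj (Disc.base A)) (F : OpFun B 𝔻) {S : CommAlgCat.{0} A}
    (c : Fin l → 𝔻.obj S) :
    P.evalHom 𝔻 c (derAct B 𝔻 h F) = Disc.dualSnd (P.evalHom 𝔻 (fun i =>
      𝔻.map (Disc.toDual S) (c i) + 𝔻.eps S * 𝔻.map (Disc.toDual S)
        (P.act (𝔻.cder S) (𝔻.map (fromBase S) (-h)) c i)) F) := by
  change Disc.dualSnd (F.eval (infMove B 𝔻 (-h) S (P.canOp _ c))) = _
  rw [P.infMove_canOp]
  rfl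

/-- The action of a vector field, as a derivation. -/
noncomputable def derActDer (h : 𝔻.obj (Disc.base A)) : Derivation A (OpFun B 𝔻) (OpFun B 𝔻) :=
  Derivation.mk'
    { toFun := derAct B 𝔻 h
      map_add' := fun F G => rfl
      map_smul' := fun a F => P.opFun_ext fun S c => by
        rw [RingHom.id_apply, map_smul, evalHom_derAct, evalHom_derAct, map_smul]
        rfl }
    (fun F G => P.opFun_ext fun S c => by
      have h1 := P.fst_evalHom F c (P.act (𝔻.cder S) (𝔻.map (fromBase S) (-h)) c)
      have h2 := P.fst_evalHom G c (P.act (𝔻.cder S) (𝔻.map (fromBase S) (-h)) c)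
      change P.evalHom 𝔻 c (derAct B 𝔻 h (F * G)) = P.evalHom 𝔻 c (F * derAct B 𝔻 h G +
        G * derAct B 𝔻 h F)
      rw [map_add, map_mul, map_mul, evalHom_derAct, evalHom_derAct, evalHom_derAct, map_mul,
        ← h1, ← h2]
      -- The Leibniz rule is the ε-coefficient of a product in S[ε]; the constant coefficients are
      -- the values at c.
      refine (TrivSqZeroExt.snd_mul (R := S) (M := S) _ _).trans ?_
      simp only [smul_eq_mul, op_smul_eq_smul]
      rfl)

end OperFrame

end OperFF

namespace OperFF

open Polynomial

/-! ### Functions on the punctured disc and residues -/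

section Laurent

variable {A : Type} [CommRing A] (φ : A[X]) (S : Type) [CommRing S] [Algebra A S]

/-- The powers of `φ` in `S(K)`. -/
noncomputable def phiZ (k : ℤ) : KRing φ S := ((unitK φ S ^ k : (KRing φ S)ˣ) : KRing φ S)

/-- The inclusion `S[z] → S(K)`. -/
noncomputable def polyHom : S[X] →+* KRing φ S :=
  (algebraMap (RRing φ S) (KRing φ S)).comp (Completion.of (phiIdeal φ S))

variable {φ S}

theorem phiZ_add (j k : ℤ) : phiZ φ S (j + k) = phiZ φ S j * phiZ φ S k := by
  rw [phiZ, zpow_add, Units.val_mul]; rfl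

theorem phiZ_zero : phiZ φ S 0 = 1 := by rw [phiZ, zpow_zero, Units.val_one]

theorem phiZ_natCast (k : ℕ) : phiZ φ S k = algebraMap _ _ (phiR φ S ^ k) := by
  rw [phiZ, zpow_natCast, Units.val_pow_eq_pow_val, map_pow]; rfl

theorem phiZ_one : phiZ φ S 1 = algebraMap _ _ (phiR φ S) := by
  simpa using phiZ_natCast (φ := φ) (S := S) 1

theorem phiZ_natCast_poly (k : ℕ) : phiZ φ S k = polyHom φ S (phiOver φ S ^ k) := by
  rw [phiZ_natCast, map_pow, map_pow]; rfl

theorem phiZ_mul_neg (k : ℤ) : phiZ φ S k * phiZ φ S (-k) = 1 := by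
  rw [← phiZ_add, add_neg_cancel, phiZ_zero]

theorem inPow_iff {k : ℤ} {f : KRing φ S} :
    InPow φ S k f ↔ ∃ r, f = phiZ φ S k * algebraMap (RRing φ S) _ r := Iff.rfl

theorem inPow_zero_iff {f : KRing φ S} : InPow φ S 0 f ↔ ∃ r, f = algebraMap (RRing φ S) _ r := by
  simp [inPow_iff, phiZ_zero]

theorem inPow_phiZ (k : ℤ) : InPow φ S k (phiZ φ S k) := ⟨1, by rw [map_one, mul_one]; rfl⟩

theorem inPow_algebraMap (r : RRing φ S) : InPow φ S 0 (algebraMap _ _ r) :=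
  inPow_zero_iff.2 ⟨r, rfl⟩

theorem inPow_polyHom (p : S[X]) : InPow φ S 0 (polyHom φ S p) := inPow_algebraMap _

theorem InPow.add {k : ℤ} {f g : KRing φ S} (hf : InPow φ S k f) (hg : InPow φ S k g) :
    InPow φ S k (f + g) := by
  obtain ⟨r, rfl⟩ := hf
  obtain ⟨s, rfl⟩ := hg
  exact ⟨r + s, by rw [map_add]; ring⟩

theorem inPow_of_eq_zero (k : ℤ) : InPow φ S k (0 : KRing φ S) := ⟨0, by rw [map_zero, mul_zero]⟩

theorem InPow.mul {j k : ℤ} {f g : KRing φ S} (hf : InPow φ S j f) (hg : InPow φ S k g) :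
    InPow φ S (j + k) (f * g) := by
  rw [inPow_iff] at *
  obtain ⟨r, rfl⟩ := hf
  obtain ⟨s, rfl⟩ := hg
  exact ⟨r * s, by rw [map_mul, phiZ_add]; ring⟩

theorem InPow.mono {j k : ℤ} {f : KRing φ S} (hf : InPow φ S k f) (h : j ≤ k) : InPow φ S j f := by
  obtain ⟨m, rfl⟩ := Int.le.dest h
  rw [inPow_iff] at *
  obtain ⟨r, rfl⟩ := hf
  exact ⟨phiR φ S ^ m * r, by rw [map_mul, phiZ_add, phiZ_natCast]; ring⟩

theorem inPow_algebraMap_base (s : S) : InPow φ S 0 (algebraMap S (KRing φ S) s) := by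
  rw [IsScalarTower.algebraMap_apply S (RRing φ S) (KRing φ S)]
  exact inPow_algebraMap _

theorem InPow.smul {k : ℤ} {f : KRing φ S} (hf : InPow φ S k f) (s : S) :
    InPow φ S k (s • f) := by
  rw [Algebra.smul_def, ← zero_add k]
  exact (inPow_algebraMap_base s).mul hf

theorem InPow.neg {k : ℤ} {f : KRing φ S} (hf : InPow φ S k f) : InPow φ S k (-f) := by
  rw [← neg_one_smul S f]; exact hf.smul _

theorem InPow.sub {k : ℤ} {f g : KRing φ S} (hf : InPow φ S k f) (hg : InPow φ S k g) :
    InPow φ S k (f - g) := by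
  rw [sub_eq_add_neg]; exact hf.add hg.neg

theorem inPow_sum {κ : Type*} {k : ℤ} (s : Finset κ) {f : κ → KRing φ S}
    (hf : ∀ i ∈ s, InPow φ S k (f i)) : InPow φ S k (∑ i ∈ s, f i) := by
  classical
  induction s using Finset.induction_on with
  | empty => simpa using inPow_of_eq_zero k
  | insert a s ha ih =>
    rw [Finset.sum_insert ha]
    exact (hf a (by simp)).add (ih fun i hi => hf i (by simp [hi]))

theorem exists_inPow (f : KRing φ S) : ∃ k : ℕ, InPow φ S (-k) f := by
  obtain ⟨k, r, hr⟩ := IsLocalization.Away.surj (phiR φ S) f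
  refine ⟨k, inPow_iff.2 ⟨r, ?_⟩⟩
  rw [← hr, ← map_pow, ← phiZ_natCast]
  linear_combination (-f) * phiZ_mul_neg (φ := φ) (S := S) k

theorem algebraMap_poly (s : S) : algebraMap S (KRing φ S) s = polyHom φ S (C s) := rfl

theorem derK_algebraMap (r : RRing φ S) : derK φ S (algebraMap _ _ r) =
    algebraMap _ _ (Completion.der derivative' (derivative_mem φ S) r) :=
  locDer_algebraMap _ _ _

theorem derK_polyHom (p : S[X]) : derK φ S (polyHom φ S p) = polyHom φ S (derivative p) := by
  have h1 : Completion.der derivative' (derivative_mem φ S) (Completion.of (phiIdeal φ S) p) =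
      Completion.of (phiIdeal φ S) (derivative p) :=
    Completion.ext fun N => Completion.der_val derivative' (derivative_mem φ S) _ N p rfl
  rw [polyHom, RingHom.comp_apply, RingHom.comp_apply, derK_algebraMap, h1]

/-- Induction for k ≥ 0; negative exponents follow by differentiating φᵏ φ⁻ᵏ = 1. -/
theorem derK_phiZ (k : ℤ) : derK φ S (phiZ φ S k) =
    k * phiZ φ S (k - 1) * polyHom φ S (derivative (phiOver φ S)) := by
  have h1 : derK φ S (phiZ φ S 1) = polyHom φ S (derivative (phiOver φ S)) := by
    rw [phiZ_one]; exact derK_polyHom _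
  have h2 : ∀ k : ℕ, derK φ S (phiZ φ S k) =
      k * phiZ φ S (k - 1) * polyHom φ S (derivative (phiOver φ S)) := by
    intro k
    induction k with
    | zero => simp [phiZ_zero]
    | succ k ih =>
      have e : phiZ φ S ((k : ℤ) - 1) * phiZ φ S 1 = phiZ φ S k := by rw [← phiZ_add]; simp
      push_cast
      rw [phiZ_add, Derivation.leibniz, h1, ih, add_sub_cancel_right, smul_eq_mul, smul_eq_mul]
      linear_combination (k : KRing φ S) * polyHom φ S (derivative (phiOver φ S)) * e
  obtain ⟨k, rfl | rfl⟩ := k.eq_nat_or_neg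
  · exact_mod_cast h2 k
  · have h3 := congrArg (derK φ S) (phiZ_mul_neg (φ := φ) (S := S) k)
    rw [Derivation.leibniz, h2, smul_eq_mul, smul_eq_mul, Derivation.map_one_eq_zero] at h3
    have e1 : phiZ φ S (-(k : ℤ)) * phiZ φ S ((k : ℤ) - 1) * phiZ φ S (-(k : ℤ)) =
        phiZ φ S (-(k : ℤ) - 1) := by
      rw [← phiZ_add, ← phiZ_add]; congr 1; ring
    push_cast
    linear_combination phiZ φ S (-(k : ℤ)) * h3 -
      derK φ S (phiZ φ S (-(k : ℤ))) * phiZ_mul_neg (φ := φ) (S := S) k -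
      (k : KRing φ S) * polyHom φ S (derivative (phiOver φ S)) * e1

theorem InPow.derK {k : ℤ} {f : KRing φ S} (hf : InPow φ S k f) :
    InPow φ S (k - 1) (derK φ S f) := by
  obtain ⟨r, rfl⟩ := inPow_iff.1 hf
  rw [Derivation.leibniz, derK_phiZ, derK_algebraMap, smul_eq_mul, smul_eq_mul]
  refine InPow.add ?_ ?_
  · exact (add_zero k ▸ (inPow_phiZ k).mul (inPow_algebraMap _)).mono (by omega)
  · have h1 : InPow φ S 0 ((k : KRing φ S)) := by
      have := inPow_algebraMap_base (φ := φ) (S := S) (k : S)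
      rwa [map_intCast] at this
    have h2 := (inPow_algebraMap r).mul ((h1.mul (inPow_phiZ (k - 1))).mul
      (inPow_polyHom (derivative (phiOver φ S))))
    rwa [zero_add, zero_add, add_zero] at h2

section Functoriality

variable {T : Type} [CommRing T] [Algebra A T] (F : S →ₐ[A] T)

theorem mapK_phiZ (k : ℤ) : mapK φ F (phiZ φ S k) = phiZ φ T k := by
  have h1 : Units.map (mapK φ F : KRing φ S →* KRing φ T) (unitK φ S) = unitK φ T :=
    Units.ext ((mapK_algebraMap φ F _).trans (congrArg _ (mapR_phiR φ F)))
  rw [phiZ, phiZ, ← h1, ← map_zpow]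
  rfl

theorem InPow.mapK {k : ℤ} {f : KRing φ S} (hf : InPow φ S k f) :
    InPow φ T k (OperFF.mapK φ F f) := by
  obtain ⟨r, rfl⟩ := inPow_iff.1 hf
  rw [map_mul, mapK_phiZ, mapK_algebraMap]
  exact inPow_iff.2 ⟨_, rfl⟩

theorem mapK_polyHom (p : S[X]) : mapK φ F (polyHom φ S p) = polyHom φ T (p.map (F : S →+* T)) :=
  mapK_algebraMap φ F _

theorem mapK_algebraMap_base (s : S) : mapK φ F (algebraMap S _ s) = algebraMap T _ (F s) := by
  rw [algebraMap_poly, mapK_polyHom, Polynomial.map_C]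
  rfl

end Functoriality

theorem natDegree_phiOver_pow [Nontrivial S] (hφ : φ.Monic) (k : ℕ) :
    (phiOver φ S ^ k).natDegree = φ.natDegree * k := by
  rw [phiOver, (hφ.map _).natDegree_pow, hφ.natDegree_map, mul_comm]

theorem monic_phiOver_pow (hφ : φ.Monic) (k : ℕ) : (phiOver φ S ^ k).Monic := (hφ.map _).pow k

/-- A monic polynomial is not a zero divisor, so φᵏ can be cancelled in S[z] with a loss of k orders
of precision. In the limit φ is not a zero divisor of S(R). -/
theorem phiR_mul_cancel (hφ : φ.Monic) {r : RRing φ S} (k : ℕ) {N : ℕ}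
    (h : (phiR φ S ^ k * r).1 (N + k) = 0) : r.1 N = 0 := by
  have h1 : (phiR φ S ^ k * r).1 (N + k) =
      Ideal.Quotient.mk (phiIdeal φ S (N + k)) (phiOver φ S ^ k * r.rep (N + k)) := by
    rw [map_mul, map_pow, ← r.rep_spec _ le_rfl]; rfl
  rw [h1, Ideal.Quotient.eq_zero_iff_mem, phiIdeal, Ideal.mem_span_singleton] at h
  obtain ⟨q, hq⟩ := h
  rw [r.rep_spec (N + k) (by omega), Ideal.Quotient.eq_zero_iff_mem, phiIdeal,
    Ideal.mem_span_singleton]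
  refine ⟨q, ?_⟩
  have : phiOver φ S ^ k * (r.rep (N + k) - phiOver φ S ^ N * q) = 0 := by
    rw [mul_sub, hq]; ring
  rwa [(monic_phiOver_pow hφ k).mul_right_eq_zero_iff, sub_eq_zero] at this

theorem algebraMap_injective (hφ : φ.Monic) :
    Function.Injective (algebraMap (RRing φ S) (KRing φ S)) := by
  rw [injective_iff_map_eq_zero]
  intro r hr
  obtain ⟨k, hk⟩ := IsLocalization.Away.exists_of_eq (phiR φ S) (hr.trans (map_zero _).symm)
  rw [mul_zero] at hk
  exact Completion.ext fun N => phiR_mul_cancel hφ k (by rw [hk]; rfl)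

/-- An element of `S(R)` whose reduction modulo `φ ^ N` vanishes is divisible by `φ ^ N`. -/
theorem exists_eq_phiR_pow_mul (hφ : φ.Monic) {r : RRing φ S} {N : ℕ} (h : r.1 N = 0) :
    ∃ s, r = phiR φ S ^ N * s := by
  have h1 : ∀ M, ∃ q, r.rep (M + N) = phiOver φ S ^ N * q := fun M => by
    rw [r.rep_spec (M + N) (by omega), Ideal.Quotient.eq_zero_iff_mem, phiIdeal,
      Ideal.mem_span_singleton] at h
    exact h
  choose q hq using h1
  refine ⟨⟨fun M => Ideal.Quotient.mk _ (q M), fun M => ⟨q M, fun M' hM => ?_⟩⟩,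
    Completion.ext fun M => ?_⟩
  · rw [Ideal.Quotient.eq, phiIdeal, Ideal.mem_span_singleton]
    have h2 : phiOver φ S ^ (M' + N) ∣ r.rep (M' + N) - r.rep (M + N) := by
      rw [← Ideal.mem_span_singleton, ← phiIdeal, ← Ideal.Quotient.eq,
        ← r.rep_spec _ le_rfl, ← r.rep_spec _ (by omega)]
    obtain ⟨t, ht⟩ := h2
    refine ⟨t, ?_⟩
    have : phiOver φ S ^ N * (q M' - q M - phiOver φ S ^ M' * t) = 0 := by
      rw [hq, hq] at ht
      linear_combination ht
    rwa [(monic_phiOver_pow hφ N).mul_right_eq_zero_iff, sub_eq_zero] at this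
  · change _ = Ideal.Quotient.mk _ (phiOver φ S ^ N) * Ideal.Quotient.mk _ (q M)
    rw [← map_mul, ← hq]
    exact r.rep_spec _ (by omega)

/-- Divisibility by a power of φ can thus be tested on polynomial representatives. -/
theorem inPow_natCast_iff (hφ : φ.Monic) {r : RRing φ S} {N : ℕ} :
    InPow φ S N (algebraMap _ _ r) ↔ r.1 N = 0 := by
  constructor
  · intro h
    obtain ⟨s, hs⟩ := inPow_iff.1 h
    rw [phiZ_natCast, ← map_mul] at hs
    rw [algebraMap_injective hφ hs]
    have : (phiR φ S ^ N * s).1 N = Ideal.Quotient.mk (phiIdeal φ S N) (phiOver φ S ^ N) * s.1 N :=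
      rfl
    have h0 : Ideal.Quotient.mk (phiIdeal φ S N) (phiOver φ S ^ N) = 0 :=
      Ideal.Quotient.eq_zero_iff_mem.2 (Ideal.mem_span_singleton_self _)
    exact this.trans ((congrArg (· * s.1 N) h0).trans (zero_mul _))
  · intro h
    obtain ⟨s, rfl⟩ := exists_eq_phiR_pow_mul hφ h
    exact inPow_iff.2 ⟨s, by rw [phiZ_natCast, map_mul]⟩

theorem eq_zero_of_inPow (hφ : φ.Monic) {f : KRing φ S} (h : ∀ k : ℕ, InPow φ S k f) : f = 0 := by
  obtain ⟨r, rfl⟩ := inPow_zero_iff.1 (h 0)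
  have : r = 0 := Completion.ext fun N => (inPow_natCast_iff hφ).1 (h N)
  rw [this, map_zero]

end Laurent

end OperFF

namespace OperFF

open Polynomial

/-! ### The residue pairing and expansions in the zʲ φᵏ -/

section Residue

variable {A : Type} [CommRing A] {φ : A[X]} {S : Type} [CommRing S] [Algebra A S]

theorem resAux_add (k : ℕ) (u v : S[X]) :
    resAux φ S k (u + v) = resAux φ S k u + resAux φ S k v := by
  rw [resAux, add_modByMonic, coeff_add]; rfl

theorem resAux_smul (k : ℕ) (s : S) (u : S[X]) :
    resAux φ S k (C s * u) = s * resAux φ S k u := by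
  rw [resAux, ← smul_eq_C_mul, smul_modByMonic, coeff_smul]; rfl

theorem resAux_eq_coeff (hφ : φ.Monic) {k : ℕ} {u : S[X]} (h : u.natDegree < φ.natDegree * k) :
    resAux φ S k u = u.coeff (φ.natDegree * k - 1) := by
  nontriviality S
  rw [resAux, (modByMonic_eq_self_iff (monic_phiOver_pow hφ k)).2]
  apply degree_lt_degree
  rwa [natDegree_phiOver_pow hφ]

theorem residue_phiZ_mul (hφ : φ.Monic) (k : ℕ) {r : RRing φ S} {u : S[X]}
    (h : r.1 k = Ideal.Quotient.mk _ u) :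
    residue φ S (phiZ φ S (-k) * algebraMap _ _ r) = resAux φ S k u := by
  refine residue_spec hφ _ k r u ?_ h
  rw [← map_pow, ← phiZ_natCast]
  linear_combination (algebraMap _ _ r) * phiZ_mul_neg (φ := φ) (S := S) k

theorem residue_polyHom (hφ : φ.Monic) (k : ℕ) (u : S[X]) :
    residue φ S (phiZ φ S (-k) * polyHom φ S u) = resAux φ S k u :=
  residue_phiZ_mul hφ k (r := Completion.of _ u) rfl

/-- The residue as a linear map. -/
noncomputable def resLin (hφ : φ.Monic) : KRing φ S →ₗ[S] S where
  toFun := residue φ S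
  map_add' f g := by
    obtain ⟨k, hf⟩ := exists_inPow f
    obtain ⟨k', hg⟩ := exists_inPow g
    obtain ⟨r, hr⟩ := inPow_iff.1 (hf.mono (j := -((k + k' : ℕ) : ℤ)) (by omega))
    obtain ⟨s, hs⟩ := inPow_iff.1 (hg.mono (j := -((k + k' : ℕ) : ℤ)) (by omega))
    have h : (r + s).1 (k + k') = Ideal.Quotient.mk _ (r.rep (k + k') + s.rep (k + k')) := by
      rw [map_add, ← r.rep_spec _ le_rfl, ← s.rep_spec _ le_rfl]; rfl
    rw [hr, hs, ← mul_add, ← map_add, residue_phiZ_mul hφ _ h,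
      residue_phiZ_mul hφ _ (r.rep_spec _ le_rfl), residue_phiZ_mul hφ _ (s.rep_spec _ le_rfl),
      resAux_add]
  map_smul' c f := by
    obtain ⟨k, hf⟩ := exists_inPow f
    obtain ⟨r, rfl⟩ := inPow_iff.1 hf
    have h : (Completion.of (phiIdeal φ S) (C c) * r).1 k =
        Ideal.Quotient.mk _ (C c * r.rep k) := by
      rw [map_mul, ← r.rep_spec _ le_rfl]; rfl
    have e : c • (phiZ φ S (-k) * algebraMap (RRing φ S) _ r) =
        phiZ φ S (-k) * algebraMap (RRing φ S) _ (Completion.of (phiIdeal φ S) (C c) * r) := by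
      rw [Algebra.smul_def, algebraMap_poly, map_mul, polyHom, RingHom.comp_apply]; ring
    rw [e, residue_phiZ_mul hφ _ h, residue_phiZ_mul hφ _ (r.rep_spec _ le_rfl), resAux_smul]
    rfl

theorem resLin_apply (hφ : φ.Monic) (f : KRing φ S) : resLin hφ f = residue φ S f := rfl

theorem residue_eq_zero (hφ : φ.Monic) {f : KRing φ S} (h : InPow φ S 0 f) :
    residue φ S f = 0 := by
  obtain ⟨r, rfl⟩ := inPow_iff.1 h
  have := residue_phiZ_mul hφ 0 (r.rep_spec 0 le_rfl)
  rw [Nat.cast_zero, neg_zero] at this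
  rw [this, resAux, pow_zero, modByMonic_one, coeff_zero]

theorem residue_mapK {T : Type} [CommRing T] [Algebra A T] (hφ : φ.Monic) (F : S →ₐ[A] T)
    (f : KRing φ S) : residue φ T (mapK φ F f) = F (residue φ S f) := by
  obtain ⟨k, hf⟩ := exists_inPow f
  obtain ⟨r, rfl⟩ := inPow_iff.1 hf
  have h : (mapR φ F r).1 k = Ideal.Quotient.mk _ ((r.rep k).map (F : S →+* T)) := by
    rw [mapR, Completion.map_val, r.rep_spec k le_rfl, Ideal.quotientMap_mk]; rfl
  rw [residue_phiZ_mul hφ _ (r.rep_spec _ le_rfl), map_mul, mapK_phiZ, mapK_algebraMap,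
    residue_phiZ_mul hφ _ h, resAux, resAux, ← map_phiOver φ F, coe_mapRingHom,
    ← Polynomial.map_pow, ← map_modByMonic _ (monic_phiOver_pow hφ k), coeff_map]
  rfl

/-- Up to a regular element, f = u / φᵏ with deg u < deg φᵏ. Then ∂f = (φ u' - k φ' u) / φᵏ⁺¹, and
the numerator has degree less than deg φᵏ⁺¹ - 1, which is the degree of the coefficient that
computes the residue. -/
theorem residue_derK (hφ : φ.Monic) (f : KRing φ S) : residue φ S (derK φ S f) = 0 := by
  nontriviality S
  obtain ⟨k, hf⟩ := exists_inPow f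
  obtain ⟨r, hr⟩ := inPow_iff.1 hf
  have hm := monic_phiOver_pow (S := S) hφ k
  have h0 : InPow φ S 0 (f - phiZ φ S (-k) * polyHom φ S (r.rep k %ₘ phiOver φ S ^ k)) := by
    have h1 : InPow φ S k (algebraMap _ _ (r - Completion.of _ (r.rep k %ₘ phiOver φ S ^ k))) := by
      rw [inPow_natCast_iff hφ]
      change r.1 k - Ideal.Quotient.mk _ (r.rep k %ₘ phiOver φ S ^ k) = 0
      rw [r.rep_spec k le_rfl, sub_eq_zero, Ideal.Quotient.eq, phiIdeal, Ideal.mem_span_singleton]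
      refine ⟨r.rep k /ₘ phiOver φ S ^ k, ?_⟩
      linear_combination -(modByMonic_add_div (r.rep k) (phiOver φ S ^ k))
    have h2 := (inPow_phiZ (φ := φ) (S := S) (-k)).mul h1
    rwa [neg_add_cancel, map_sub, mul_sub, ← hr] at h2
  set u := r.rep k %ₘ phiOver φ S ^ k with hu
  have h3 : residue φ S (derK φ S (f - phiZ φ S (-k) * polyHom φ S u)) = 0 := by
    obtain ⟨s, hs⟩ := inPow_zero_iff.1 h0
    rw [hs, derK_algebraMap]
    exact residue_eq_zero hφ (inPow_algebraMap _)
  rw [map_sub, ← resLin_apply hφ, map_sub, sub_eq_zero, resLin_apply, resLin_apply] at h3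
  rw [h3]
  rcases Nat.eq_zero_or_pos (φ.natDegree * k) with h | h
  · have : u = 0 := by
      have h1 : phiOver φ S ^ k = 1 := by
        rw [← hm.natDegree_eq_zero, natDegree_phiOver_pow hφ, h]
      rw [hu, h1, modByMonic_one]
    rw [this, map_zero, mul_zero, map_zero]
    exact map_zero (resLin hφ)
  have hd : u.natDegree < φ.natDegree * k := by
    have := natDegree_modByMonic_lt (r.rep k) hm (by
      intro h1; rw [← natDegree_phiOver_pow (S := S) hφ, h1, natDegree_one] at h; exact lt_irrefl _ h)
    rwa [natDegree_phiOver_pow hφ] at this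
  have e1 : derK φ S (phiZ φ S (-k) * polyHom φ S u) = phiZ φ S (-((k + 1 : ℕ) : ℤ)) *
      polyHom φ S (phiOver φ S * derivative u - C (k : S) * (derivative (phiOver φ S) * u)) := by
    have e2 : phiZ φ S (-(k : ℤ)) = phiZ φ S (-((k + 1 : ℕ) : ℤ)) * phiZ φ S 1 := by
      rw [← phiZ_add]; congr 1; push_cast; ring
    have e3 : phiZ φ S (-(k : ℤ) - 1) = phiZ φ S (-((k + 1 : ℕ) : ℤ)) := by
      congr 1; push_cast; ring
    have e4 : phiZ φ S 1 = polyHom φ S (phiOver φ S) := by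
      simpa using phiZ_natCast_poly (φ := φ) (S := S) 1
    rw [Derivation.leibniz, derK_phiZ, derK_polyHom, smul_eq_mul, smul_eq_mul, e3, e2, e4,
      map_sub, map_mul, map_mul, map_mul, C_eq_natCast, map_natCast]
    push_cast
    ring
  have hp : (phiOver φ S).natDegree = φ.natDegree := by
    simpa using natDegree_phiOver_pow (S := S) hφ 1
  have hdeg : (phiOver φ S * derivative u - C (k : S) * (derivative (phiOver φ S) * u)).natDegree <
      φ.natDegree * (k + 1) - 1 := by
    refine lt_of_le_of_lt (natDegree_sub_le _ _) (max_lt ?_ ?_)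
    · rcases Nat.eq_zero_or_pos u.natDegree with h4 | h4
      · rw [natDegree_eq_zero.1 h4 |>.choose_spec.symm, derivative_C, mul_zero, natDegree_zero]
        have : 0 < φ.natDegree := Nat.pos_of_mul_pos_right h
        rw [mul_add]; omega
      · have h5 := natDegree_mul_le (p := phiOver φ S) (q := derivative u)
        have h6 := natDegree_derivative_lt h4.ne'
        rw [hp] at h5
        rw [mul_add]; omega
    · have h5 := natDegree_C_mul_le (k : S) (derivative (phiOver φ S) * u)
      have h6 := natDegree_mul_le (p := derivative (phiOver φ S)) (q := u)
      have h7 := natDegree_derivative_lt (p := phiOver φ S) (by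
        rw [hp]; rintro h8; rw [h8, zero_mul] at h; exact lt_irrefl _ h)
      rw [hp] at h7
      rw [mul_add]; omega
  rw [e1, residue_polyHom hφ, resAux_eq_coeff hφ (by omega), coeff_eq_zero_of_natDegree_lt hdeg]

/-! #### Dual bases -/

variable (φ S)

/-- The polynomials `∑_{k > j} cₖ z^{k - 1 - j}`, where `φ = ∑ cₖ zᵏ`, which are dual to the `zʲ`. -/
noncomputable def dualPoly (j : ℕ) : S[X] :=
  ∑ k ∈ Finset.Ioc j φ.natDegree, C (algebraMap A S (φ.coeff k)) * X ^ (k - 1 - j)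

variable {φ S}

theorem coeff_dualPoly (j m : ℕ) :
    (dualPoly φ S j).coeff m = algebraMap A S (φ.coeff (m + j + 1)) := by
  rw [dualPoly, finsetSum_coeff]
  simp only [coeff_C_mul, coeff_X_pow]
  by_cases h : m + j + 1 ≤ φ.natDegree
  · rw [Finset.sum_eq_single (m + j + 1)]
    · rw [if_pos (by omega), mul_one]
    · intro b hb hne
      rw [Finset.mem_Ioc] at hb
      rw [if_neg (by omega), mul_zero]
    · intro h1
      exact absurd (Finset.mem_Ioc.2 ⟨by omega, h⟩) h1
  · rw [coeff_eq_zero_of_natDegree_lt (by omega), map_zero]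
    refine Finset.sum_eq_zero fun b hb => ?_
    rw [Finset.mem_Ioc] at hb
    rw [if_neg (by omega), mul_zero]

theorem natDegree_dualPoly (j : ℕ) : (dualPoly φ S j).natDegree ≤ φ.natDegree - 1 - j := by
  rw [natDegree_le_iff_coeff_eq_zero]
  intro m hm
  rw [coeff_dualPoly, coeff_eq_zero_of_natDegree_lt (by omega), map_zero]

theorem map_dualPoly {T : Type} [CommRing T] [Algebra A T] (F : S →ₐ[A] T) (j : ℕ) :
    (dualPoly φ S j).map (F : S →+* T) = dualPoly φ T j := by
  ext m
  rw [coeff_map, coeff_dualPoly, coeff_dualPoly]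
  exact F.commutes _

/-- For k = 1 and i ≤ j the product already has degree less than deg φ, and its top coefficient is
read off; for i > j it is first reduced modulo φ. For k ≥ 2 the degree is too small to give a
residue. -/
theorem resAux_dualPoly (hφ : φ.Monic) {i j k : ℕ} (hi : i < φ.natDegree) (hj : j < φ.natDegree) :
    resAux φ S k (dualPoly φ S j * X ^ i) = if i = j ∧ k = 1 then 1 else 0 := by
  have hdeg : (dualPoly φ S j * X ^ i).natDegree ≤ φ.natDegree - 1 - j + i := by
    refine natDegree_mul_le.trans (Nat.add_le_add (natDegree_dualPoly j) (natDegree_X_pow_le i))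
  rcases Nat.lt_trichotomy k 1 with hk | rfl | hk
  · obtain rfl : k = 0 := by omega
    rw [resAux, pow_zero, modByMonic_one, coeff_zero, if_neg (by omega)]
  · rcases le_or_gt i j with h | h
    · rw [resAux_eq_coeff hφ (by omega), mul_one, coeff_mul_X_pow', if_pos (by omega),
        coeff_dualPoly]
      rcases h.eq_or_lt with rfl | h
      · rw [if_pos ⟨rfl, rfl⟩]
        have : φ.natDegree - 1 - i + i + 1 = φ.natDegree := by omega
        rw [this, hφ.coeff_natDegree, map_one]
      · rw [if_neg (by omega), coeff_eq_zero_of_natDegree_lt (by omega), map_zero]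
    -- This is the part of φ of degree at most j, so modulo φ the product of zʲ⁺¹ and the dual
    -- polynomial can be replaced by -q.
    · set q := phiOver φ S - X ^ (j + 1) * dualPoly φ S j with hq
      have hq' : q.natDegree ≤ j := by
        rw [natDegree_le_iff_coeff_eq_zero]
        intro m hm
        rw [hq, coeff_sub, coeff_X_pow_mul', if_pos (by omega), coeff_dualPoly, phiOver, coeff_map]
        have : m - (j + 1) + j + 1 = m := by omega
        rw [this, sub_self]
      have h1 : resAux φ S 1 (dualPoly φ S j * X ^ i) = resAux φ S 1 (C (-1) * (X ^ (i - j - 1) * q)) := by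
        refine resAux_congr hφ ?_
        rw [Ideal.Quotient.eq, phiIdeal, Ideal.mem_span_singleton, pow_one]
        refine ⟨X ^ (i - j - 1), ?_⟩
        have : (X : S[X]) ^ i = X ^ (i - j - 1) * X ^ (j + 1) := by rw [← pow_add]; congr 1; omega
        rw [this, hq, C_neg, C_1]
        ring
      have h2 : (X ^ (i - j - 1) * q).natDegree ≤ i - 1 := by
        have := natDegree_mul_le (p := (X : S[X]) ^ (i - j - 1)) (q := q)
        have h3 := natDegree_X_pow_le (R := S) (i - j - 1)
        omega
      rw [h1, resAux_smul, resAux_eq_coeff hφ (by omega),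
        coeff_eq_zero_of_natDegree_lt (by omega), mul_zero, if_neg (by omega)]
  · have h2 : φ.natDegree * 2 ≤ φ.natDegree * k := Nat.mul_le_mul_left _ hk
    rw [resAux_eq_coeff hφ (by omega), coeff_eq_zero_of_natDegree_lt (by omega), if_neg (by omega)]

theorem residue_dualPoly (hφ : φ.Monic) {i j : ℕ} (hi : i < φ.natDegree) (hj : j < φ.natDegree)
    (m : ℤ) : residue φ S (phiZ φ S m * polyHom φ S (dualPoly φ S j * X ^ i)) =
      if i = j ∧ m = -1 then 1 else 0 := by
  rcases le_or_gt 0 m with h | h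
  · rw [if_neg (by omega), residue_eq_zero hφ]
    exact (add_zero m ▸ (inPow_phiZ m).mul (inPow_polyHom _)).mono h
  · obtain ⟨k, hk⟩ := Int.eq_ofNat_of_zero_le (a := -m) (by omega)
    obtain rfl : m = -k := by omega
    rw [residue_polyHom hφ, resAux_dualPoly hφ hi hj]
    congr 2
    apply propext
    omega

/-- The coefficient of `zʲ φᵏ`. -/
noncomputable def coeffK (hφ : φ.Monic) (k : ℤ) (j : ℕ) : KRing φ S →ₗ[S] S :=
  resLin hφ ∘ₗ LinearMap.mulLeft S (polyHom φ S (dualPoly φ S j) * phiZ φ S (-k - 1))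

theorem coeffK_apply (hφ : φ.Monic) (k : ℤ) (j : ℕ) (f : KRing φ S) :
    coeffK hφ k j f = residue φ S (polyHom φ S (dualPoly φ S j) * phiZ φ S (-k - 1) * f) := rfl

theorem coeffK_monomial (hφ : φ.Monic) {i j : ℕ} (hi : i < φ.natDegree) (hj : j < φ.natDegree)
    (k m : ℤ) : coeffK hφ k j (polyHom φ S (X ^ i) * phiZ φ S m) = if i = j ∧ m = k then 1 else 0 := by
  have e : polyHom φ S (dualPoly φ S j) * phiZ φ S (-k - 1) * (polyHom φ S (X ^ i) * phiZ φ S m) =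
      phiZ φ S (-k - 1 + m) * polyHom φ S (dualPoly φ S j * X ^ i) := by
    rw [phiZ_add, map_mul]; ring
  rw [coeffK_apply, e, residue_dualPoly hφ hi hj]
  congr 2
  apply propext
  omega

theorem coeffK_eq_zero (hφ : φ.Monic) {k : ℤ} (j : ℕ) {f : KRing φ S} (h : InPow φ S (k + 1) f) :
    coeffK hφ k j f = 0 := by
  rw [coeffK_apply]
  apply residue_eq_zero hφ
  have := ((inPow_polyHom (dualPoly φ S j)).mul (inPow_phiZ (φ := φ) (S := S) (-k - 1))).mul h
  exact this.mono (by omega)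

theorem coeffK_mapK (hφ : φ.Monic) {T : Type} [CommRing T] [Algebra A T] (F : S →ₐ[A] T) (k : ℤ)
    (j : ℕ) (f : KRing φ S) : coeffK hφ k j (mapK φ F f) = F (coeffK hφ k j f) := by
  rw [coeffK_apply, coeffK_apply, ← residue_mapK hφ, map_mul, map_mul, mapK_phiZ, mapK_polyHom,
    map_dualPoly]

/-- Modulo φᵏ⁺¹ S(R) the element is φᵏ u with deg u < deg φ, and the coefficients of u are the ones
assumed to vanish. -/
theorem InPow.succ_of_coeffK (hφ : φ.Monic) {k : ℤ} {f : KRing φ S} (hf : InPow φ S k f)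
    (h : ∀ j < φ.natDegree, coeffK hφ k j f = 0) : InPow φ S (k + 1) f := by
  rcases subsingleton_or_nontrivial S with hS | hS
  · rw [← one_smul S f, Subsingleton.elim (1 : S) 0, zero_smul]
    exact inPow_of_eq_zero _
  obtain ⟨r, rfl⟩ := inPow_iff.1 hf
  set u := r.rep 1 %ₘ phiOver φ S with hu
  have hm : (phiOver φ S).Monic := hφ.map _
  have hdeg : (phiOver φ S).natDegree = φ.natDegree := hφ.natDegree_map _
  have h1 : InPow φ S (k + 1)
      (phiZ φ S k * algebraMap _ _ r - phiZ φ S k * polyHom φ S u) := by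
    have h1 : InPow φ S (1 : ℕ) (algebraMap _ _ (r - Completion.of _ u)) := by
      rw [inPow_natCast_iff hφ]
      change r.1 1 - Ideal.Quotient.mk _ u = 0
      rw [r.rep_spec 1 le_rfl, sub_eq_zero, Ideal.Quotient.eq, phiIdeal, Ideal.mem_span_singleton,
        pow_one]
      refine ⟨r.rep 1 /ₘ phiOver φ S, ?_⟩
      linear_combination -(modByMonic_add_div (r.rep 1) (phiOver φ S))
    have h2 := (inPow_phiZ (φ := φ) (S := S) k).mul h1
    rwa [map_sub, mul_sub] at h2
  suffices hu0 : u = 0 by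
    rwa [hu0, map_zero, mul_zero, sub_zero] at h1
  have hlt : φ.natDegree ≠ 0 → u.natDegree < φ.natDegree := fun h0 => by
    rw [← hdeg]
    exact natDegree_modByMonic_lt _ hm (by
      intro h1; rw [h1, natDegree_one] at hdeg; exact h0 hdeg.symm)
  have hzero : φ.natDegree = 0 → u = 0 := fun h0 => by
    have h1 : phiOver φ S = 1 := by rw [← hm.natDegree_eq_zero, hdeg, h0]
    rw [hu, h1, modByMonic_one]
  rcases Nat.eq_zero_or_pos φ.natDegree with h0 | h0
  · exact hzero h0
  ext j
  rw [coeff_zero]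
  rcases lt_or_ge j φ.natDegree with hj | hj
  swap
  · exact coeff_eq_zero_of_natDegree_lt ((hlt h0.ne').trans_le hj)
  have h2 := coeffK_eq_zero hφ j h1
  rw [map_sub, h j hj, zero_sub, neg_eq_zero] at h2
  have h3 : phiZ φ S k * polyHom φ S u =
      ∑ i ∈ Finset.range φ.natDegree, u.coeff i • (polyHom φ S (X ^ i) * phiZ φ S k) := by
    conv_lhs => rw [u.as_sum_range_C_mul_X_pow' (hlt h0.ne'), map_sum, Finset.mul_sum]
    refine Finset.sum_congr rfl fun i _ => ?_
    rw [Algebra.smul_def, algebraMap_poly, map_mul]; ring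
  rw [h3, map_sum, Finset.sum_eq_single j] at h2
  · rwa [map_smul, coeffK_monomial hφ hj hj, if_pos ⟨rfl, rfl⟩, smul_eq_mul, mul_one] at h2
  · intro i hi hne
    rw [map_smul, coeffK_monomial hφ (Finset.mem_range.1 hi) hj, if_neg (fun h => hne h.1),
      smul_zero]
  · intro h4; exact absurd (Finset.mem_range.2 hj) h4

theorem InPow.of_coeffK (hφ : φ.Monic) {k k' : ℤ} {f : KRing φ S} (hf : InPow φ S k f)
    (h : ∀ m < k', ∀ j < φ.natDegree, coeffK hφ m j f = 0) : InPow φ S k' f := by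
  rcases le_total k' k with h1 | h1
  · exact hf.mono h1
  · induction k', h1 using Int.leInduction with
    | base => exact hf
    | succ m hm ih =>
      exact (ih fun i hi => h i (by omega)).succ_of_coeffK hφ (h m (by omega))

theorem ext_coeffK (hφ : φ.Monic) {f g : KRing φ S}
    (h : ∀ k, ∀ j < φ.natDegree, coeffK hφ k j f = coeffK hφ k j g) : f = g := by
  rw [← sub_eq_zero]
  obtain ⟨M, hM⟩ := exists_inPow (f - g)
  refine eq_zero_of_inPow hφ fun k => hM.of_coeffK hφ fun m _ j hj => ?_
  rw [map_sub, h m j hj, sub_self]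

/-- The part of the expansion of `f` in the `zʲ φᵐ` with `k ≤ m < k'`. -/
noncomputable def truncK (hφ : φ.Monic) (k k' : ℤ) (f : KRing φ S) : KRing φ S :=
  ∑ m ∈ Finset.Ico k k', ∑ j ∈ Finset.range φ.natDegree,
    coeffK hφ m j f • (polyHom φ S (X ^ j) * phiZ φ S m)

theorem inPow_sub_truncK (hφ : φ.Monic) {k : ℤ} (k' : ℤ) {f : KRing φ S} (hf : InPow φ S k f) :
    InPow φ S k' (f - truncK hφ k k' f) := by
  rcases le_total k' k with h1 | h1
  · have : Finset.Ico k k' = ∅ := Finset.Ico_eq_empty (by omega)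
    rw [truncK, this, Finset.sum_empty, sub_zero]
    exact hf.mono h1
  refine InPow.of_coeffK hφ (k := k) (hf.sub ?_) fun m hm j hj => ?_
  · refine inPow_sum _ fun m hm => inPow_sum _ fun j _ => InPow.smul ?_ _
    rw [Finset.mem_Ico] at hm
    exact (zero_add m ▸ (inPow_polyHom _).mul (inPow_phiZ m)).mono hm.1
  · rw [map_sub, sub_eq_zero]
    rcases lt_or_ge m k with h2 | h2
    · rw [coeffK_eq_zero hφ j (hf.mono (by omega)), truncK, map_sum]
      refine (Finset.sum_eq_zero fun m' hm' => ?_).symm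
      rw [Finset.mem_Ico] at hm'
      rw [map_sum]
      refine Finset.sum_eq_zero fun i hi => ?_
      rw [map_smul, coeffK_monomial hφ (Finset.mem_range.1 hi) hj, if_neg (by omega), smul_zero]
    · rw [truncK, map_sum, Finset.sum_eq_single m, map_sum, Finset.sum_eq_single j, map_smul,
        coeffK_monomial hφ hj hj, if_pos ⟨rfl, rfl⟩, smul_eq_mul, mul_one]
      · intro i hi hne
        rw [map_smul, coeffK_monomial hφ (Finset.mem_range.1 hi) hj, if_neg (fun h => hne h.1),
          smul_zero]
      · intro h; exact absurd (Finset.mem_range.2 hj) h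
      · intro m' _ hne
        rw [map_sum]
        refine Finset.sum_eq_zero fun i hi => ?_
        rw [map_smul, coeffK_monomial hφ (Finset.mem_range.1 hi) hj, if_neg (fun h => hne h.2),
          smul_zero]
      · intro h; exact absurd (Finset.mem_Ico.2 ⟨h2, hm⟩) h

/-- The remainder of the truncated expansion of f lies in φᴹ S(R), so its product with g is regular
and has no residue. -/
theorem residue_mul_eq_sum (hφ : φ.Monic) (M : ℕ) {f g : KRing φ S} (hf : InPow φ S (-M) f)
    (hg : InPow φ S (-M) g) :
    residue φ S (f * g) = ∑ m ∈ Finset.Ico (-M : ℤ) M, ∑ j ∈ Finset.range φ.natDegree,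
      coeffK hφ m j f * residue φ S (polyHom φ S (X ^ j) * phiZ φ S m * g) := by
  have h1 : residue φ S ((f - truncK hφ (-M) M f) * g) = 0 :=
    residue_eq_zero hφ (by simpa using (inPow_sub_truncK hφ (M : ℤ) hf).mul hg)
  rw [sub_mul, ← resLin_apply hφ, map_sub, sub_eq_zero, resLin_apply] at h1
  rw [h1, truncK, Finset.sum_mul, map_sum]
  refine Finset.sum_congr rfl fun m _ => ?_
  rw [Finset.sum_mul, map_sum]
  refine Finset.sum_congr rfl fun j _ => ?_
  rw [smul_mul_assoc, map_smul, smul_eq_mul, resLin_apply]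

/-- The coefficients of `(φ(z) - φ(w)) / (z - w)` are dual bases. -/
theorem sum_dualPoly {E : Type*} [AddCommGroup E] [Module A E] (g : S[X] →+ ℕ → E)
    (hg : ∀ (a : A) (p : S[X]) j, g (C (algebraMap A S a) * p) j = a • g p j) :
    ∑ k ∈ Finset.range (φ.natDegree + 1), ∑ i ∈ Finset.range k,
      φ.coeff k • g (X ^ i) (k - 1 - i) =
    ∑ j ∈ Finset.range φ.natDegree, g (dualPoly φ S j) j := by
  have h1 : ∀ k, ∑ i ∈ Finset.range k, φ.coeff k • g (X ^ i) (k - 1 - i) =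
      ∑ j ∈ Finset.range k, φ.coeff k • g (X ^ (k - 1 - j)) j := fun k => by
    rw [← Finset.sum_range_reflect]
    refine Finset.sum_congr rfl fun j hj => ?_
    rw [Finset.mem_range] at hj
    have : k - 1 - (k - 1 - j) = j := by omega
    rw [this]
  simp only [h1]
  -- The sum runs over the pairs j < k ≤ deg φ; for fixed j the sum over k assembles the dual
  -- polynomial.
  rw [Finset.sum_comm' (t' := Finset.range φ.natDegree) (s' := fun j => Finset.Ioc j φ.natDegree)]
  · refine Finset.sum_congr rfl fun j _ => ?_
    rw [dualPoly, map_sum, Finset.sum_apply]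
    refine Finset.sum_congr rfl fun k _ => ?_
    rw [hg]
  · intro k j
    simp only [Finset.mem_range, Finset.mem_Ioc]
    omega

/-! #### Elements with given coefficients -/

/-- The element `∑_{k ≥ 0} ∑ⱼ yₖⱼ zʲ φᵏ` of `S(R)`. -/
noncomputable def ofCoeffs (y : ℕ → ℕ → S) : RRing φ S :=
  ⟨fun N => Ideal.Quotient.mk _ (∑ k ∈ Finset.range N, ∑ j ∈ Finset.range φ.natDegree,
      C (y k j) * X ^ j * phiOver φ S ^ k), fun N => ⟨∑ k ∈ Finset.range N,
      ∑ j ∈ Finset.range φ.natDegree, C (y k j) * X ^ j * phiOver φ S ^ k, fun M hM => by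
    rw [Ideal.Quotient.eq, phiIdeal, Ideal.mem_span_singleton, ← dvd_neg, neg_sub,
      ← Finset.sum_range_add_sum_Ico _ hM, add_sub_cancel_left]
    refine Finset.dvd_sum fun k hk => Finset.dvd_sum fun j _ => Dvd.dvd.mul_left ?_ _
    exact pow_dvd_pow _ (Finset.mem_Ico.1 hk).1⟩⟩

theorem coeffK_ofCoeffs (hφ : φ.Monic) (y : ℕ → ℕ → S) (k : ℕ) {j : ℕ} (hj : j < φ.natDegree) :
    coeffK hφ k j (algebraMap _ _ (ofCoeffs (φ := φ) y)) = y k j := by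
  have h1 : InPow φ S ((k + 1 : ℕ) : ℤ) (algebraMap (RRing φ S) (KRing φ S)
    (ofCoeffs y - Completion.of (phiIdeal φ S)
      (∑ k ∈ Finset.range (k + 1), ∑ j ∈ Finset.range φ.natDegree,
        C (y k j) * X ^ j * phiOver φ S ^ k))) := by
    rw [inPow_natCast_iff hφ]
    exact sub_self ((ofCoeffs (φ := φ) y).1 (k + 1))
  have h2 := coeffK_eq_zero hφ j (k := k) (by exact_mod_cast h1)
  rw [map_sub, map_sub, sub_eq_zero] at h2
  have h3 : algebraMap (RRing φ S) (KRing φ S) (Completion.of (phiIdeal φ S)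
      (∑ k ∈ Finset.range (k + 1), ∑ j ∈ Finset.range φ.natDegree,
        C (y k j) * X ^ j * phiOver φ S ^ k)) =
      ∑ k ∈ Finset.range (k + 1), ∑ j ∈ Finset.range φ.natDegree,
        y k j • (polyHom φ S (X ^ j) * phiZ φ S k) := by
    change polyHom φ S _ = _
    simp only [map_sum, map_mul, Algebra.smul_def, algebraMap_poly, phiZ_natCast_poly]
    simp only [mul_assoc]
  rw [h2, h3, map_sum, Finset.sum_eq_single k, map_sum, Finset.sum_eq_single j, map_smul,
    coeffK_monomial hφ hj hj, if_pos ⟨rfl, rfl⟩, smul_eq_mul, mul_one]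
  · intro i hi hne
    rw [map_smul, coeffK_monomial hφ (Finset.mem_range.1 hi) hj, if_neg (fun h => hne h.1), smul_zero]
  · intro h; exact absurd (Finset.mem_range.2 hj) h
  · intro k' _ hne
    rw [map_sum]
    refine Finset.sum_eq_zero fun i hi => ?_
    rw [map_smul, coeffK_monomial hφ (Finset.mem_range.1 hi) hj, if_neg (by omega), smul_zero]
  · intro h; exact absurd (Finset.mem_range.2 (by omega)) h

variable (φ) in
/-- The element `∑_{k ≥ -M} ∑ⱼ yₖⱼ zʲ φᵏ` of `S(K)`. -/
noncomputable def seriesK (M : ℕ) (y : ℤ → ℕ → S) : KRing φ S :=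
  phiZ φ S (-M) * algebraMap _ _ (ofCoeffs (φ := φ) fun k j => y (k - M) j)

theorem inPow_seriesK (M : ℕ) (y : ℤ → ℕ → S) : InPow φ S (-M) (seriesK φ M y) :=
  inPow_iff.2 ⟨_, rfl⟩

theorem coeffK_seriesK (hφ : φ.Monic) (M : ℕ) (y : ℤ → ℕ → S) {k : ℤ} (hk : -M ≤ k) {j : ℕ}
    (hj : j < φ.natDegree) : coeffK hφ k j (seriesK φ M y) = y k j := by
  obtain ⟨i, hi⟩ := Int.eq_ofNat_of_zero_le (a := k + M) (by omega)
  obtain rfl : k = i - M := by omega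
  rw [← coeffK_ofCoeffs hφ (fun k j => y (k - M) j) i hj, coeffK_apply, coeffK_apply, seriesK]
  congr 1
  have : phiZ φ S (-(i : ℤ) - 1) = phiZ φ S (-((i : ℤ) - M) - 1) * phiZ φ S (-M) := by
    rw [← phiZ_add]; congr 1; ring
  rw [this]; ring

theorem seriesK_eq (hφ : φ.Monic) {M : ℕ} {y : ℤ → ℕ → S} {f : KRing φ S} (hf : InPow φ S (-M) f)
    (h : ∀ k : ℤ, -M ≤ k → ∀ j < φ.natDegree, coeffK hφ k j f = y k j) : seriesK φ M y = f := by
  refine ext_coeffK hφ fun k j hj => ?_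
  rcases le_or_gt (-M : ℤ) k with hk | hk
  · rw [coeffK_seriesK hφ M y hk hj, h k hk j hj]
  · rw [coeffK_eq_zero hφ j (hf.mono (by omega)),
      coeffK_eq_zero hφ j ((inPow_seriesK M y).mono (by omega))]

theorem mapK_seriesK (hφ : φ.Monic) {T : Type} [CommRing T] [Algebra A T] (F : S →ₐ[A] T) (M : ℕ)
    (y : ℤ → ℕ → S) : mapK φ F (seriesK φ M y) = seriesK φ M fun k j => F (y k j) :=
  (seriesK_eq hφ ((inPow_seriesK M y).mapK F) fun k hk j hj => by
    rw [coeffK_mapK, coeffK_seriesK hφ M y hk hj]).symm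

end Residue

end OperFF

namespace OperFF

open CategoryTheory

/-! ### Taylor series -/

section Taylor

variable {K : Type*} [CommRing K] [Algebra ℂ K] (D : Derivation ℂ K K)

/-- The `k`-th Taylor coefficient `∂ᵏ f / k!`. -/
noncomputable def taylorCoeff (k : ℕ) : K →ₗ[ℂ] K := (k.factorial : ℂ)⁻¹ • (D : K →ₗ[ℂ] K) ^ k

theorem taylorCoeff_apply (k : ℕ) (f : K) :
    taylorCoeff D k f = (k.factorial : ℂ)⁻¹ • D^[k] f := by
  rw [taylorCoeff, LinearMap.smul_apply, Module.End.pow_apply]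
  rfl

theorem taylorCoeff_zero (f : K) : taylorCoeff D 0 f = f := by simp [taylorCoeff_apply]

theorem der_taylorCoeff (k : ℕ) (f : K) :
    D (taylorCoeff D k f) = ((k : ℂ) + 1) • taylorCoeff D (k + 1) f := by
  have : (k : ℂ) + 1 ≠ 0 := by exact_mod_cast k.succ_ne_zero
  rw [taylorCoeff_apply, taylorCoeff_apply, D.map_smul, Function.iterate_succ_apply', smul_smul,
    Nat.factorial_succ]
  congr 1
  push_cast
  field_simp

theorem taylorCoeff_succ (k : ℕ) (f : K) :
    taylorCoeff D (k + 1) f = ((k : ℂ) + 1)⁻¹ • D (taylorCoeff D k f) := by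
  have : (k : ℂ) + 1 ≠ 0 := by exact_mod_cast k.succ_ne_zero
  rw [der_taylorCoeff, smul_smul, inv_mul_cancel₀ this, one_smul]

theorem taylorCoeff_der (k : ℕ) (f : K) : taylorCoeff D k (D f) = D (taylorCoeff D k f) := by
  rw [taylorCoeff_apply, taylorCoeff_apply, D.map_smul, ← Function.iterate_succ_apply,
    ← Function.iterate_succ_apply' D]

/-- Let F and G be the generating series of the Taylor coefficients. For each of them d/dt acts as D
on the coefficients, so (FG)' = F'G + FG' expresses (k + 1) times the next coefficient of FG as D of
the previous one. -/
theorem taylorCoeff_mul (k : ℕ) (f g : K) :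
    taylorCoeff D k (f * g) =
      ∑ p ∈ Finset.HasAntidiagonal.antidiagonal k, taylorCoeff D p.1 f * taylorCoeff D p.2 g := by
  induction k with
  | zero => simp [taylorCoeff_zero]
  | succ k ih =>
    set F : PowerSeries K := PowerSeries.mk fun k => taylorCoeff D k f
    set G : PowerSeries K := PowerSeries.mk fun k => taylorCoeff D k g
    have h1 : PowerSeries.coeff (k + 1) (F * G) =
        ∑ p ∈ Finset.HasAntidiagonal.antidiagonal (k + 1), taylorCoeff D p.1 f * taylorCoeff D p.2 g := by
      simp [PowerSeries.coeff_mul, F, G]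
    have hF : ∀ j, PowerSeries.coeff j (PowerSeries.derivative K F) = D (taylorCoeff D j f) := by
      intro j
      rw [PowerSeries.coeff_derivative, PowerSeries.coeff_mk, der_taylorCoeff, Algebra.smul_def]
      simp [mul_comm]
    have hG : ∀ j, PowerSeries.coeff j (PowerSeries.derivative K G) = D (taylorCoeff D j g) := by
      intro j
      rw [PowerSeries.coeff_derivative, PowerSeries.coeff_mk, der_taylorCoeff, Algebra.smul_def]
      simp [mul_comm]
    have h2 := PowerSeries.coeff_derivative (F * G) k
    rw [Derivation.leibniz, smul_eq_mul, smul_eq_mul, map_add, PowerSeries.coeff_mul,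
      PowerSeries.coeff_mul, ← Finset.Nat.sum_antidiagonal_swap (f := fun p : ℕ × ℕ =>
        PowerSeries.coeff p.1 G * PowerSeries.coeff p.2 (PowerSeries.derivative K F)),
      ← Finset.sum_add_distrib] at h2
    simp only [hF, hG, Prod.fst_swap, Prod.snd_swap] at h2
    rw [taylorCoeff_succ, ih, map_sum, ← h1]
    have h3 : ∑ p ∈ Finset.HasAntidiagonal.antidiagonal k, D (taylorCoeff D p.1 f * taylorCoeff D p.2 g) =
        PowerSeries.coeff (k + 1) (F * G) * (k + 1) := by
      rw [← h2]
      refine Finset.sum_congr rfl fun p _ => ?_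
      rw [Derivation.leibniz, smul_eq_mul, smul_eq_mul, PowerSeries.coeff_mk, PowerSeries.coeff_mk]
    have : (k : ℂ) + 1 ≠ 0 := by exact_mod_cast k.succ_ne_zero
    have h4 : PowerSeries.coeff (k + 1) (F * G) * (k + 1) =
        ((k : ℂ) + 1) • PowerSeries.coeff (k + 1) (F * G) := by
      rw [Algebra.smul_def]; simp [mul_comm]
    rw [h3, h4, smul_smul, inv_mul_cancel₀ this, one_smul]

/-- The Taylor series `∑ tᵏ ∂ᵏf / k!`. -/
noncomputable def taylor : K →+* PowerSeries K where
  toFun f := PowerSeries.mk fun k => taylorCoeff D k f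
  map_zero' := by ext k; simp
  map_one' := by
    ext k
    rw [PowerSeries.coeff_mk, PowerSeries.coeff_one]
    rcases k with _ | k
    · simp [taylorCoeff_zero]
    · rw [taylorCoeff_apply, Function.iterate_succ_apply, D.map_one_eq_zero,
        iterate_map_zero, smul_zero, if_neg k.succ_ne_zero]
  map_add' f g := by ext k; simp
  map_mul' f g := by ext k; simp [PowerSeries.coeff_mul, taylorCoeff_mul]

theorem coeff_taylor (k : ℕ) (f : K) :
    PowerSeries.coeff k (taylor D f) = taylorCoeff D k f :=
  PowerSeries.coeff_mk k fun k => taylorCoeff D k f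

theorem derivative_taylor (f : K) : PowerSeries.derivative K (taylor D f) = taylor D (D f) := by
  ext k
  rw [PowerSeries.coeff_derivative, coeff_taylor, coeff_taylor, taylorCoeff_der, der_taylorCoeff,
    Algebra.smul_def]
  simp [mul_comm]

theorem taylor_algebraMap (z : ℂ) :
    taylor D (algebraMap ℂ K z) = algebraMap K (PowerSeries K) (algebraMap ℂ K z) := by
  ext k
  rw [coeff_taylor]
  change _ = PowerSeries.coeff k (PowerSeries.C (algebraMap ℂ K z))
  rw [PowerSeries.coeff_C]
  rcases k with _ | k
  · simp [taylorCoeff_zero]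
  · rw [taylorCoeff_apply, Function.iterate_succ_apply, D.map_algebraMap, iterate_map_zero,
      smul_zero, if_neg k.succ_ne_zero]

theorem map_taylorCoeff {K' : Type*} [CommRing K'] [Algebra ℂ K'] {D' : Derivation ℂ K' K'}
    (f : K →ₐ[ℂ] K') (hf : ∀ x, f (D x) = D' (f x)) (k : ℕ) (x : K) :
    f (taylorCoeff D k x) = taylorCoeff D' k (f x) := by
  induction k with
  | zero => rw [taylorCoeff_zero, taylorCoeff_zero]
  | succ k ih => rw [taylorCoeff_succ, taylorCoeff_succ, map_smul, hf, ih]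

end Taylor

/-! ### Functions on opers on the formal disc -/

namespace OperFrame

variable {𝔤 : Type*} [LieRing 𝔤] [LieAlgebra ℂ 𝔤] {ι : Type*} [Fintype ι]
  {H : LieSubalgebra ℂ 𝔤} {B : LieAlgebra.Basis ι H} {l : ℕ} (P : OperFrame B l)

section Act

variable {A : Type} [CommRing A] [Algebra ℂ A] {𝔻 : Disc A}

/-- The action of vector fields on canonical coordinates is linear in the vector field. -/
noncomputable def actLin {S : CommAlgCat.{0} A} (c : Fin l → 𝔻.obj S) (i : Fin l) :
    𝔻.obj S →ₗ[S] 𝔻.obj S where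
  toFun h := P.act (𝔻.cder S) h c i
  map_add' h h' := by simp only [act, map_add]; ring
  map_smul' s h := by
    simp only [act, Disc.cder_apply, (𝔻.der S).map_smul, RingHom.id_apply, smul_sub, smul_add,
      smul_mul_assoc, mul_smul_comm]

theorem actLin_apply {S : CommAlgCat.{0} A} (c : Fin l → 𝔻.obj S) (i : Fin l) (h : 𝔻.obj S) :
    P.actLin c i h = P.act (𝔻.cder S) h c i := rfl

end Act

theorem X_pow_dvd_derivative {R : Type*} [CommRing R] {k : ℕ} {f : PowerSeries R}
    (h : PowerSeries.X ^ (k + 1) ∣ f) : PowerSeries.X ^ k ∣ PowerSeries.derivative R f := by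
  rw [PowerSeries.X_pow_dvd_iff] at *
  intro m hm
  rw [PowerSeries.coeff_derivative, h (m + 1) (by omega), zero_mul]

/-- The coefficients of a function on the formal disc. -/
noncomputable def discCoeff (S : CommAlgCat.{0} ℂ) (k : ℕ) : disc.obj S →ₗ[S] S :=
  PowerSeries.coeff (R := S) k

/-- The function `t ^ m` on the formal disc. -/
noncomputable def discMon (S : CommAlgCat.{0} ℂ) (m : ℕ) : disc.obj S :=
  (PowerSeries.X : PowerSeries S) ^ m

theorem disc_ext {S : CommAlgCat.{0} ℂ} {f g : disc.obj S}
    (h : ∀ k, discCoeff S k f = discCoeff S k g) : f = g := PowerSeries.ext h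

theorem discCoeff_mk {S : CommAlgCat.{0} ℂ} (a : ℕ → S) (k : ℕ) :
    discCoeff S k (PowerSeries.mk a : PowerSeries S) = a k := PowerSeries.coeff_mk _ _

theorem discCoeff_map {S T : CommAlgCat.{0} ℂ} (f : S ⟶ T) (x : disc.obj S) (k : ℕ) :
    discCoeff T k (disc.map f x) = f.hom (discCoeff S k x) := PowerSeries.coeff_map _ _ _

theorem discCoeff_cder {S : CommAlgCat.{0} ℂ} (x : disc.obj S) (k : ℕ) :
    discCoeff S k (disc.cder S x) = discCoeff S (k + 1) x * (k + 1) :=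
  PowerSeries.coeff_derivative x k

theorem discMon_zero (S : CommAlgCat.{0} ℂ) : discMon S 0 = 1 := pow_zero _

theorem map_discMon {S T : CommAlgCat.{0} ℂ} (f : S ⟶ T) (m : ℕ) :
    disc.map f (discMon S m) = discMon T m :=
  (map_pow (PowerSeries.map (f.hom : S →+* T)) (PowerSeries.X : PowerSeries S) m).trans
    (congrArg (· ^ m) (PowerSeries.map_X (f.hom : S →+* T)))

theorem discCoeff_mon (S : CommAlgCat.{0} ℂ) (k m : ℕ) :
    discCoeff S k (discMon S m) = if k = m then 1 else 0 := PowerSeries.coeff_X_pow (R := S) k m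

theorem discMon_dvd_iff {S : CommAlgCat.{0} ℂ} {m : ℕ} {x : disc.obj S} :
    discMon S m ∣ x ↔ ∀ k < m, discCoeff S k x = 0 := PowerSeries.X_pow_dvd_iff (R := S)

theorem discMon_dvd_cder {S : CommAlgCat.{0} ℂ} {m : ℕ} {x : disc.obj S}
    (h : discMon S (m + 1) ∣ x) : discMon S m ∣ disc.cder S x := X_pow_dvd_derivative h

/-- At most three derivatives of h occur, so the result is still divisible by tᵏ⁺¹. -/
theorem coeff_act_of_dvd {S : CommAlgCat.{0} ℂ} (c : Fin l → disc.obj S) (i : Fin l) (k : ℕ)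
    {h : disc.obj S} (hh : discMon S (k + 4) ∣ h) :
    discCoeff S k (P.act (disc.cder S) h c i) = 0 := by
  have h1 := discMon_dvd_cder hh
  have h2 := discMon_dvd_cder h1
  have h3 := discMon_dvd_cder h2
  have h4 : discMon S (k + 1) ∣ P.act (disc.cder S) h c i := by
    refine dvd_sub (dvd_add (Dvd.dvd.mul_right ?_ _)
      (Dvd.dvd.mul_right (Dvd.dvd.mul_left ?_ _) _)) (Dvd.dvd.mul_left h3 _)
    · exact (pow_dvd_pow (PowerSeries.X : PowerSeries S) (show k + 1 ≤ k + 4 by omega)).trans hh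
    · exact (pow_dvd_pow (PowerSeries.X : PowerSeries S) (show k + 1 ≤ k + 3 by omega)).trans h1
  exact discMon_dvd_iff.1 h4 k (by omega)

/-- Linearity in the vector field, together with the vanishing for vector fields divisible by tᵏ⁺⁴.
-/
theorem coeff_act {S : CommAlgCat.{0} ℂ} (c : Fin l → disc.obj S) (i : Fin l) (k : ℕ)
    (h : disc.obj S) :
    discCoeff S k (P.act (disc.cder S) h c i) =
      ∑ j ∈ Finset.range (k + 4), discCoeff S j h *
        discCoeff S k (P.act (disc.cder S) (discMon S j) c i) := by
  set h' : disc.obj S := ∑ j ∈ Finset.range (k + 4), discCoeff S j h • discMon S j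
  have h1 : discMon S (k + 4) ∣ h - h' := by
    rw [discMon_dvd_iff]
    intro m hm
    rw [map_sub, map_sum, Finset.sum_eq_single m]
    · rw [map_smul, discCoeff_mon, if_pos rfl, smul_eq_mul, mul_one, sub_self]
    · intro j _ hj
      rw [map_smul, discCoeff_mon, if_neg hj.symm, smul_zero]
    · intro h2; exact absurd (Finset.mem_range.2 hm) h2
  have h2 := P.coeff_act_of_dvd c i k h1
  rw [← P.actLin_apply, map_sub, map_sub, sub_eq_zero, map_sum, map_sum] at h2
  refine h2.trans (Finset.sum_congr rfl fun j _ => ?_)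
  rw [map_smul, map_smul]
  rfl

variable [FiniteDimensional ℂ 𝔤] [LieAlgebra.IsKilling ℂ 𝔤]

/-- The function that maps `d + (p₋₁ + ∑ cⱼ vⱼ) dt` to the `k`-th coefficient of `cᵢ`. -/
noncomputable def discCoord (i : Fin l) (k : ℕ) : DiscFun B :=
  P.opFunOf (𝔻 := disc) (fun S c => discCoeff S k (c i)) (fun _ _ => discCoeff_map _ _ _)

theorem evalHom_discCoord {S : CommAlgCat.{0} ℂ} (c : Fin l → disc.obj S) (i : Fin l) (k : ℕ) :
    P.evalHom disc c (P.discCoord i k) = discCoeff S k (c i) :=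
  P.evalHom_opFunOf (𝔻 := disc) (φ := fun S c => discCoeff S k (c i))
    (fun _ _ => discCoeff_map _ _ _) c

theorem constantCoeff_eq {S : CommAlgCat.{0} ℂ} (f : disc.obj S) :
    PowerSeries.constantCoeff (R := S) f = discCoeff S 0 f :=
  (PowerSeries.coeff_zero_eq_constantCoeff_apply (R := S) f).symm

theorem isDiskCoord_iff (i : Fin l) (F : DiscFun B) :
    IsDiskCoord (fun j => (P.v j : 𝔤)) i F ↔ F = P.discCoord i 0 := by
  constructor
  · intro h
    refine P.opFun_ext fun S c => ?_
    rw [P.evalHom_discCoord, ← constantCoeff_eq]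
    exact h S _ c ((P.isCanForm_iff _).2 rfl)
  · rintro rfl S x c hx
    rw [(P.isCanForm_iff _).1 hx]
    exact (P.evalHom_discCoord c i 0).trans (constantCoeff_eq (c i)).symm

/-- Yoneda: the value of F at the universal canonical form, with independent variables as Taylor
coefficients, is a polynomial, and every other canonical form is a specialization of the universal
one. -/
theorem adjoin_discCoord :
    Algebra.adjoin ℂ (range fun p : Fin l × ℕ => P.discCoord p.1 p.2) = ⊤ := by
  rw [eq_top_iff]
  rintro F -
  let U : CommAlgCat.{0} ℂ := CommAlgCat.of ℂ (MvPolynomial (Fin l × ℕ) ℂ)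
  let u : Fin l → disc.obj U := fun i =>
    (PowerSeries.mk fun k => (MvPolynomial.X (i, k) : MvPolynomial (Fin l × ℕ) ℂ))
  let p : MvPolynomial (Fin l × ℕ) ℂ := P.evalHom disc u F
  have hF : F = MvPolynomial.aeval (fun p : Fin l × ℕ => P.discCoord p.1 p.2) p := by
    refine P.opFun_ext fun S c => ?_
    let G : U ⟶ S := CommAlgCat.ofHom (X := MvPolynomial (Fin l × ℕ) ℂ) (Y := S)
      (MvPolynomial.aeval fun p : Fin l × ℕ => discCoeff S p.2 (c p.1))
    have h1 : (fun i => disc.map G (u i)) = c := by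
      funext i
      refine disc_ext fun k => ?_
      rw [discCoeff_map]
      exact (congrArg G.hom (discCoeff_mk _ _)).trans (MvPolynomial.aeval_X _ _)
    have h2 := P.evalHom_map F G u
    rw [h1] at h2
    rw [h2]
    have h3 : (P.evalHom disc c).comp
        (MvPolynomial.aeval (fun p : Fin l × ℕ => P.discCoord p.1 p.2)) =
        (MvPolynomial.aeval fun p : Fin l × ℕ => discCoeff S p.2 (c p.1)) := by
      refine MvPolynomial.algHom_ext fun q => ?_
      rw [AlgHom.comp_apply, MvPolynomial.aeval_X, P.evalHom_discCoord, MvPolynomial.aeval_X]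
    exact (DFunLike.congr_fun h3 p).symm
  rw [hF, MvPolynomial.aeval_def, Algebra.adjoin_range_eq_range_aeval]
  exact ⟨p, rfl⟩

theorem discFun_induction {p : DiscFun B → Prop} (coord : ∀ i k, p (P.discCoord i k))
    (const : ∀ z : ℂ, p (algebraMap ℂ _ z)) (add : ∀ F G, p F → p G → p (F + G))
    (mul : ∀ F G, p F → p G → p (F * G)) (F : DiscFun B) : p F := by
  have hF : F ∈ Algebra.adjoin ℂ (range fun p : Fin l × ℕ => P.discCoord p.1 p.2) := by
    rw [P.adjoin_discCoord]; trivial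
  induction hF using Algebra.adjoin_induction with
  | mem F hF =>
    obtain ⟨q, rfl⟩ := hF
    exact coord q.1 q.2
  | algebraMap z => exact const z
  | add F G _ _ hF hG => exact add F G hF hG
  | mul F G _ _ hF hG => exact mul F G hF hG

/-- The operator `L_{m-1}`, as a derivation. -/
noncomputable def discDer (m : ℕ) : Derivation ℂ (DiscFun B) (DiscFun B) :=
  P.derActDer (𝔻 := disc) (-(PowerSeries.X ^ m : PowerSeries ℂ))

theorem discDer_apply (m : ℕ) (F : DiscFun B) : P.discDer m F = discL B m F := rfl

theorem dualSnd_add {S : CommAlgCat.{0} ℂ} (a b : S) :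
    Disc.dualSnd ((Disc.toDual S).hom a + Disc.dualEps S * (Disc.toDual S).hom b) = b := by
  change TrivSqZeroExt.snd ((TrivSqZeroExt.inl a : DualNumber S) +
    (DualNumber.eps : DualNumber S) * (TrivSqZeroExt.inl b : DualNumber S)) = b
  simp

theorem evalHom_discL_coord (m : ℕ) (i : Fin l) (k : ℕ) {S : CommAlgCat.{0} ℂ}
    (c : Fin l → disc.obj S) : P.evalHom disc c (discL B m (P.discCoord i k)) =
      discCoeff S k (P.act (disc.cder S) (discMon S m) c i) := by
  -- Two signs cancel: Lₘ₋₁ is -tᵐ ∂ₜ, and a vector field h ∂ acts on functions through exp(-ε h ∂).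
  have h1 : disc.map (fromBase S) (-(-discMon (Disc.base ℂ) m)) = discMon S m := by
    rw [neg_neg, map_discMon]
  have h3 : discL B m (P.discCoord i k) =
      derAct B disc (-discMon (Disc.base ℂ) m) (P.discCoord i k) := rfl
  rw [h3, P.evalHom_derAct, P.evalHom_discCoord, h1]
  set e := P.act (disc.cder S) (discMon S m) c i
  have h2 : discCoeff (Disc.dual S) k (disc.eps S * disc.map (Disc.toDual S) e) =
      Disc.dualEps S * (Disc.toDual S).hom (discCoeff S k e) :=
    (PowerSeries.coeff_C_mul (R := Disc.dual S) _ _ _).trans (congrArg _ (discCoeff_map _ _ _))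
  rw [map_add, h2, discCoeff_map]
  exact dualSnd_add _ _

theorem discL_coord_eq_zero {m k : ℕ} (h : k + 4 ≤ m) (i : Fin l) :
    discL B m (P.discCoord i k) = 0 := P.opFun_ext fun S c => by
  rw [P.evalHom_discL_coord, map_zero]
  exact P.coeff_act_of_dvd c i k (pow_dvd_pow (PowerSeries.X : PowerSeries S) h)

theorem discL_zero_coord (i : Fin l) (k : ℕ) :
    discL B 0 (P.discCoord i k) = ((k : ℂ) + 1) • P.discCoord i (k + 1) :=
  P.opFun_ext fun S c => by
    rw [P.evalHom_discL_coord, map_smul, P.evalHom_discCoord, act, discMon_zero,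
      Derivation.map_one_eq_zero, map_zero, map_zero, mul_zero, mul_zero, zero_mul, add_zero,
      sub_zero, one_mul, discCoeff_cder, Algebra.smul_def, mul_comm, map_add, map_natCast, map_one]

/-- The summand k comes from t ∂ₜ on tᵏ and dᵢ + 1 from the weight of the coordinate; the third
derivative of t is zero. -/
theorem discL_one_coord (i : Fin l) (k : ℕ) :
    discL B 1 (P.discCoord i k) = ((P.d i + 1 + k : ℕ) : ℂ) • P.discCoord i k :=
  P.opFun_ext fun S c => by
    have h0 : discMon S 1 = (PowerSeries.X : PowerSeries S) := pow_one _
    have h1 : disc.cder S (discMon S 1) = 1 := by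
      rw [h0]; exact PowerSeries.derivative_X
    rw [P.evalHom_discL_coord, map_smul, P.evalHom_discCoord, act, h1, Derivation.map_one_eq_zero,
      map_zero, mul_zero, sub_zero, mul_one, map_add]
    have h2 : discCoeff S k (discMon S 1 * disc.cder S (c i)) = k * discCoeff S k (c i) := by
      rcases k with _ | k
      · rw [h0, Nat.cast_zero, zero_mul]
        exact PowerSeries.coeff_zero_X_mul _
      · rw [h0]
        refine (PowerSeries.coeff_succ_X_mul k _).trans ((discCoeff_cder (c i) k).trans ?_)
        rw [mul_comm]
        push_cast
        rfl
    have h3 : discCoeff S k (((P.d i : disc.obj S) + 1) * c i) =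
        ((P.d i : S) + 1) * discCoeff S k (c i) := by
      have : ((P.d i : disc.obj S) + 1) * c i = ((P.d i : S) + 1) • c i := by
        rw [Algebra.smul_def, map_add, map_natCast, map_one]
      rw [this, map_smul, smul_eq_mul]
    rw [h2, h3, Algebra.smul_def, map_natCast]
    push_cast
    ring

end OperFrame

end OperFF

namespace OperFF

open CategoryTheory

namespace OperFrame

variable {𝔤 : Type*} [LieRing 𝔤] [LieAlgebra ℂ 𝔤] {ι : Type*} [Fintype ι]
  {H : LieSubalgebra ℂ 𝔤} {B : LieAlgebra.Basis ι H} {l : ℕ} (P : OperFrame B l)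
  [FiniteDimensional ℂ 𝔤] [LieAlgebra.IsKilling ℂ 𝔤]

/-! ### Functions on opers on the formal disc, evaluated at Taylor series -/

section Jet

variable {K : Type} [CommRing K] [Algebra ℂ K] (D : Derivation ℂ K K)

/-- The Taylor series, as a function on the formal disc over `K`. -/
noncomputable def taylorDisc : K →+* disc.obj (CommAlgCat.of ℂ K) := taylor D

theorem discCoeff_taylorDisc (k : ℕ) (f : K) :
    discCoeff (CommAlgCat.of ℂ K) k (taylorDisc D f) = taylorCoeff D k f := coeff_taylor D k f

theorem cder_taylorDisc (f : K) :
    disc.cder (CommAlgCat.of ℂ K) (taylorDisc D f) = taylorDisc D (D f) := derivative_taylor D f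

theorem taylorDisc_algebraMap (z : ℂ) : taylorDisc D (algebraMap ℂ K z) =
    algebraMap ℂ (disc.obj (CommAlgCat.of ℂ K)) z := taylor_algebraMap D z

theorem act_taylorDisc (h : K) (c : Fin l → K) (i : Fin l) :
    P.act (disc.cder (CommAlgCat.of ℂ K)) (taylorDisc D h) (fun i => taylorDisc D (c i)) i =
      taylorDisc D (P.act D h c i) := by
  simp only [act, cder_taylorDisc, taylorDisc_algebraMap, map_sub, map_add, map_mul, map_natCast,
    map_one]

/-- The value of a function on opers on the formal disc at the Taylor series of the `cᵢ`. -/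
noncomputable def jet (c : Fin l → K) : DiscFun B →ₐ[ℂ] K :=
  P.evalHom disc (S := CommAlgCat.of ℂ K) fun i => taylorDisc D (c i)

theorem jet_coord (c : Fin l → K) (i : Fin l) (k : ℕ) :
    P.jet D c (P.discCoord i k) = taylorCoeff D k (c i) :=
  (P.evalHom_discCoord _ i k).trans (discCoeff_taylorDisc D k _)

theorem map_jet {K' : Type} [CommRing K'] [Algebra ℂ K'] {D' : Derivation ℂ K' K'}
    (f : K →ₐ[ℂ] K') (hf : ∀ x, f (D x) = D' (f x)) (c : Fin l → K) (F : DiscFun B) :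
    f (P.jet D c F) = P.jet D' (fun i => f (c i)) F := by
  induction F using P.discFun_induction with
  | coord i k => rw [jet_coord, jet_coord, map_taylorCoeff D f hf]
  | const z => rw [AlgHom.commutes, AlgHom.commutes, AlgHom.commutes]
  | add F G hF hG => rw [map_add, map_add, map_add, hF, hG]
  | mul F G hF hG => rw [map_mul, map_mul, map_mul, hF, hG]

/-- The translation operator becomes D on jets. Both sides are derivations along the jet
homomorphism, so it suffices to compare them on coordinates. -/
theorem jet_discL_zero (c : Fin l → K) (F : DiscFun B) :
    P.jet D c (discL B 0 F) = D (P.jet D c F) := by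
  rw [← discDer_apply P]
  induction F using P.discFun_induction with
  | coord i k =>
    rw [discDer_apply, discL_zero_coord, map_smul, jet_coord, jet_coord, der_taylorCoeff]
  | const z => rw [Derivation.map_algebraMap, map_zero, AlgHom.commutes, Derivation.map_algebraMap]
  | add F G hF hG => rw [map_add, map_add, map_add, map_add, hF, hG]
  | mul F G hF hG =>
    rw [Derivation.leibniz, map_mul, Derivation.leibniz]
    simp only [smul_eq_mul, map_add, map_mul, hF, hG]

/-- This makes the sum over k ≥ -1 in the action of a vector field finite. -/
theorem exists_discL_eq_zero (P : OperFrame B l) (F : DiscFun B) :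
    ∃ M, ∀ m ≥ M, discL B m F = 0 := by
  simp only [← discDer_apply P]
  induction F using P.discFun_induction with
  | coord i k => exact ⟨k + 4, fun m hm => P.discL_coord_eq_zero hm i⟩
  | const z => exact ⟨0, fun m _ => Derivation.map_algebraMap _ _⟩
  | add F G hF hG =>
    obtain ⟨M, hM⟩ := hF
    obtain ⟨N, hN⟩ := hG
    exact ⟨max M N, fun m hm => by
      rw [map_add, hM m (le_trans (le_max_left _ _) hm), hN m (le_trans (le_max_right _ _) hm),
        add_zero]⟩
  | mul F G hF hG =>
    obtain ⟨M, hM⟩ := hF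
    obtain ⟨N, hN⟩ := hG
    exact ⟨max M N, fun m hm => by
      rw [Derivation.leibniz, hM m (le_trans (le_max_left _ _) hm),
        hN m (le_trans (le_max_right _ _) hm), smul_zero, smul_zero, add_zero]⟩

theorem finite_discL (P : OperFrame B l) (F : DiscFun B) : {m | discL B m F ≠ 0}.Finite := by
  obtain ⟨M, hM⟩ := P.exists_discL_eq_zero F
  exact (Set.finite_lt_nat M).subset fun m hm => not_le.1 fun h => hm (hM m h)

/-- The derivative of the value at the Taylor series in the direction of a vector field. -/
noncomputable def jetDer (h : K) (c : Fin l → K) (F : DiscFun B) : K :=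
  ∑ᶠ m : ℕ, P.jet D c (discL B m F) * taylorCoeff D m h

theorem finite_support_jetDer (h : K) (c : Fin l → K) (F : DiscFun B) :
    (Function.support fun m => P.jet D c (discL B m F) * taylorCoeff D m h).Finite :=
  (P.finite_discL F).subset fun m hm h0 => hm (by
    change P.jet D c (discL B m F) * _ = 0
    rw [h0, map_zero, zero_mul])

theorem jetDer_add (h : K) (c : Fin l → K) (F G : DiscFun B) :
    P.jetDer D h c (F + G) = P.jetDer D h c F + P.jetDer D h c G := by
  rw [jetDer, jetDer, jetDer, ← finsum_add_distrib (P.finite_support_jetDer D h c F)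
    (P.finite_support_jetDer D h c G)]
  refine finsum_congr fun m => ?_
  rw [← discDer_apply P, map_add, map_add, add_mul]
  rfl

theorem jetDer_mul (h : K) (c : Fin l → K) (F G : DiscFun B) :
    P.jetDer D h c (F * G) = P.jet D c F * P.jetDer D h c G + P.jet D c G * P.jetDer D h c F := by
  rw [jetDer, jetDer, jetDer, mul_finsum' _ _ (P.finite_support_jetDer D h c F),
    mul_finsum' _ _ (P.finite_support_jetDer D h c G), ← finsum_add_distrib
      ((P.finite_support_jetDer D h c G).subset fun m hm h0 => hm
        ((congrArg (_ * ·) h0).trans (mul_zero _)))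
      ((P.finite_support_jetDer D h c F).subset fun m hm h0 => hm
        ((congrArg (_ * ·) h0).trans (mul_zero _)))]
  refine finsum_congr fun m => ?_
  rw [← discDer_apply P, Derivation.leibniz, map_add, smul_eq_mul, smul_eq_mul, map_mul, map_mul]
  simp only [discDer_apply]
  ring

theorem jetDer_const (h : K) (c : Fin l → K) (z : ℂ) :
    P.jetDer D h c (algebraMap ℂ _ z) = 0 := by
  rw [jetDer, ← finsum_zero (α := ℕ)]
  refine finsum_congr fun m => ?_
  rw [← discDer_apply P, Derivation.map_algebraMap, map_zero, zero_mul]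

/-- The vector fields tᵐ ∂ₜ, weighted with the Taylor coefficients of h, add up to the Taylor series
of h; and `act` commutes with passing to Taylor series. -/
theorem jetDer_coord (h : K) (c : Fin l → K) (i : Fin l) (k : ℕ) :
    P.jetDer D h c (P.discCoord i k) = taylorCoeff D k (P.act D h c i) := by
  rw [jetDer, finsum_eq_sum_of_support_subset (s := Finset.range (k + 4)),
    ← discCoeff_taylorDisc, ← act_taylorDisc, coeff_act]
  · refine Finset.sum_congr rfl fun m _ => ?_
    rw [discCoeff_taylorDisc, mul_comm]
    exact congrArg (taylorCoeff D m h * ·) (P.evalHom_discL_coord m i k _)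
  · intro m hm
    rw [Finset.coe_range, Set.mem_Iio]
    by_contra h1
    refine hm ?_
    change P.jet D c (discL B m _) * _ = 0
    rw [P.discL_coord_eq_zero (by omega), map_zero, zero_mul]

/-- This links the two actions: the first-order variation of F along h is ∑ₘ (Lₘ₋₁ F) ∂ᵐh / m! on
jets. Both sides are multiplicative in F because ε² = 0, so the claim reduces to coordinates. -/
theorem jet_add_eps {K' : Type} [CommRing K'] [Algebra ℂ K'] {D' : Derivation ℂ K' K'}
    (f : K →ₐ[ℂ] K') (hf : ∀ x, f (D x) = D' (f x)) {ε : K'} (hε : ε * ε = 0) (hD : D' ε = 0)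
    (h : K) (c : Fin l → K) (F : DiscFun B) :
    P.jet D' (fun i => f (c i) + ε * f (P.act D h c i)) F =
      f (P.jet D c F) + ε * f (P.jetDer D h c F) := by
  induction F using P.discFun_induction with
  | coord i k =>
    have h1 : ∀ (k : ℕ) x, taylorCoeff D' k (ε * x) = ε * taylorCoeff D' k x := by
      intro k x
      induction k with
      | zero => rw [taylorCoeff_zero, taylorCoeff_zero]
      | succ k ih =>
        rw [taylorCoeff_succ, taylorCoeff_succ, ih, Derivation.leibniz, hD, smul_zero, add_zero,
          smul_eq_mul, mul_smul_comm]
    rw [jet_coord, jet_coord, jetDer_coord, map_add, h1, map_taylorCoeff D f hf,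
      map_taylorCoeff D f hf]
  | const z =>
    rw [AlgHom.commutes, AlgHom.commutes, AlgHom.commutes, jetDer_const, map_zero, mul_zero,
      add_zero]
  | add F G hF hG => rw [map_add, map_add, map_add, jetDer_add, map_add, hF, hG]; ring
  | mul F G hF hG =>
    rw [map_mul, map_mul, map_mul, jetDer_mul, map_add, map_mul, map_mul, hF, hG]
    linear_combination (f (P.jetDer D h c F) * f (P.jetDer D h c G)) * hε

end Jet

end OperFrame

end OperFF

namespace OperFF

open CategoryTheory Polynomial

namespace OperFrame

variable {𝔤 : Type*} [LieRing 𝔤] [LieAlgebra ℂ 𝔤] {ι : Type*} [Fintype ι]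
  {H : LieSubalgebra ℂ 𝔤} {B : LieAlgebra.Basis ι H} {l : ℕ} (P : OperFrame B l)
  [FiniteDimensional ℂ 𝔤] [LieAlgebra.IsKilling ℂ 𝔤]
  {A : Type} [CommRing A] [Algebra ℂ A] (φ : A[X])

/-! ### Jets on the punctured disc -/

/-- The value of a function on opers on the formal disc at the Taylor series of elements of
`S(K)`. -/
noncomputable def jetK {S : CommAlgCat.{0} A} (c : Fin l → KRing φ S) : DiscFun B →+* KRing φ S :=
  (P.jet ((punct φ).cder S) c : DiscFun B →+* (punct φ).obj S)

/-- The derivative of `jetK` in the direction of a vector field. -/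
noncomputable def jetDerK {S : CommAlgCat.{0} A} (h : KRing φ S) (c : Fin l → KRing φ S)
    (F : DiscFun B) : KRing φ S :=
  P.jetDer (K := (punct φ).obj S) ((punct φ).cder S) h c F

/-- The change of canonical coordinates under an infinitesimal change of variables. -/
noncomputable def actK {S : CommAlgCat.{0} A} (h : KRing φ S) (c : Fin l → KRing φ S) (i : Fin l) :
    KRing φ S := P.act (L := (punct φ).obj S) ((punct φ).cder S) h c i

variable {φ} {S : CommAlgCat.{0} A}

theorem jetK_coord_zero (c : Fin l → KRing φ S) (i : Fin l) :
    P.jetK φ c (P.discCoord i 0) = c i :=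
  (P.jet_coord ((punct φ).cder S) c i 0).trans (taylorCoeff_zero _ _)

theorem jetK_discL_zero (c : Fin l → KRing φ S) (F : DiscFun B) :
    P.jetK φ c (discL B 0 F) = derK φ S (P.jetK φ c F) := P.jet_discL_zero ((punct φ).cder S) c F

theorem jetK_algebraMap (c : Fin l → KRing φ S) (z : ℂ) :
    P.jetK φ c (algebraMap ℂ _ z) = algebraMap S (KRing φ S) (algebraMap A S (algebraMap ℂ A z)) :=
  (P.jet ((punct φ).cder S) c).commutes z

theorem jetK_smul (c : Fin l → KRing φ S) (z : ℂ) (F : DiscFun B) :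
    P.jetK φ c (z • F) = algebraMap A S (algebraMap ℂ A z) • P.jetK φ c F := by
  rw [Algebra.smul_def, map_mul, jetK_algebraMap, Algebra.smul_def]

theorem mapK_jetK {T : CommAlgCat.{0} A} (f : S ⟶ T) (c : Fin l → KRing φ S) (F : DiscFun B) :
    mapK φ f.hom (P.jetK φ c F) = P.jetK φ (fun i => mapK φ f.hom (c i)) F :=
  P.map_jet (D' := (punct φ).cder T) ((punct φ).cder S) ((punct φ).baseChange f).toHom
    (fun x => (punct φ).map_der f x) c F

variable (φ S) in
/-- `ε`, as a function on the punctured disc over `S[ε]`. -/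
noncomputable def epsK : KRing φ (Disc.dual S) :=
  algebraMap (Disc.dual S) (KRing φ (Disc.dual S)) (Disc.dualEps S)

theorem jetK_add_eps (h : KRing φ S) (c : Fin l → KRing φ S) (F : DiscFun B) :
    P.jetK φ (fun i => mapK φ (Disc.toDual S).hom (c i) +
      epsK φ S * mapK φ (Disc.toDual S).hom (P.actK φ h c i)) F =
      mapK φ (Disc.toDual S).hom (P.jetK φ c F) +
        epsK φ S * mapK φ (Disc.toDual S).hom (P.jetDerK φ h c F) :=
  P.jet_add_eps (K := (punct φ).obj S) (D' := (punct φ).cder (Disc.dual S))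
    ((punct φ).cder S) ((punct φ).baseChange (Disc.toDual S)).toHom
    (fun x => (punct φ).map_der _ x) ((punct φ).eps_mul_eps S) ((punct φ).der_eps S) h c F

theorem taylorCoeff_derK (k : ℕ) (f : KRing φ S) :
    taylorCoeff (K := (punct φ).obj S) ((punct φ).cder S) k f =
    algebraMap A S (algebraMap ℂ A (k.factorial : ℂ)⁻¹) • (derK φ S)^[k] f := by
  refine (taylorCoeff_apply (K := (punct φ).obj S) _ k f).trans ((Algebra.smul_def _ _).trans ?_)
  rw [Algebra.smul_def]
  rfl

theorem inPow_iterate_derK {k : ℤ} {f : KRing φ S} (hf : InPow φ S k f) (m : ℕ) :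
    InPow φ S (k - m) ((derK φ S)^[m] f) := by
  induction m with
  | zero => simpa using hf
  | succ m ih =>
    rw [Function.iterate_succ_apply']
    exact ih.derK.mono (by push_cast; omega)

/-- The terms linear in c lose one order and the Schwarzian term loses three. -/
theorem InPow.actK {h : KRing φ S} {c : Fin l → KRing φ S} {a b : ℤ} (hh : InPow φ S a h)
    (hc : ∀ i, InPow φ S b (c i)) (i : Fin l) :
    InPow φ S (min (a + b - 1) (a - 3)) (P.actK φ h c i) := by
  have h1 : InPow φ S (a + b - 1) (h * derK φ S (c i)) := (hh.mul (hc i).derK).mono (by omega)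
  have h2 : InPow φ S (a + b - 1) (((P.d i : KRing φ S) + 1) * derK φ S h * c i) := by
    have h3 : InPow φ S 0 ((P.d i : KRing φ S) + 1) := by
      have := inPow_algebraMap_base (φ := φ) (S := S) ((P.d i : S) + 1)
      rwa [map_add, map_natCast, map_one] at this
    exact ((h3.mul hh.derK).mul (hc i)).mono (by omega)
  have h4 : InPow φ S (a - 3) (algebraMap S (KRing φ S) (algebraMap A S (algebraMap ℂ A
      (2⁻¹ * P.p₁Coeff i))) * derK φ S (derK φ S (derK φ S h))) :=
    ((inPow_algebraMap_base _).mul hh.derK.derK.derK).mono (by omega)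
  exact ((h1.add h2).mono (min_le_left _ _)).sub (h4.mono (min_le_right _ _))

/-! ### The grading -/

variable (φ)

/-- The elements of degree `m` whose jets have poles of order at most `m N` if the coordinates have
poles of order at most `N`. -/
noncomputable def weightPart (m : ℤ) : Submodule ℂ (DiscFun B) where
  carrier := {a | discL B 1 a = (m : ℂ) • a ∧ ∀ (S : CommAlgCat.{0} A) (c : Fin l → KRing φ S)
    (N : ℕ), 0 < N → (∀ i, InPow φ S (-N) (c i)) → InPow φ S (-(N * m)) (P.jetK φ c a)}
  add_mem' {a b} ha hb := by
    refine ⟨?_, fun S c N hN hc => ?_⟩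
    · rw [← P.discDer_apply, map_add, P.discDer_apply, P.discDer_apply, ha.1, hb.1, smul_add]
    · rw [map_add]; exact (ha.2 S c N hN hc).add (hb.2 S c N hN hc)
  zero_mem' := by
    refine ⟨?_, fun S c N hN hc => ?_⟩
    · rw [← P.discDer_apply, map_zero, smul_zero]
    · rw [map_zero]; exact inPow_of_eq_zero _
  smul_mem' z a ha := by
    refine ⟨?_, fun S c N hN hc => ?_⟩
    · rw [← P.discDer_apply, Derivation.map_smul, P.discDer_apply, ha.1, smul_comm]
    · rw [jetK_smul]; exact (ha.2 S c N hN hc).smul _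

/-- The k-th Taylor coefficient of cᵢ has degree dᵢ + 1 + k, and its pole has order at most N + k ≤
N (dᵢ + 1 + k) because N ≥ 1. In products both degrees and bounds add up. -/
theorem iSup_weightPart : ⨆ m : ℕ, P.weightPart φ m = ⊤ := by
  rw [eq_top_iff]
  rintro F -
  have hle : ∀ m : ℕ, P.weightPart φ m ≤ ⨆ m : ℕ, P.weightPart φ m :=
    fun m => le_iSup (fun m : ℕ => P.weightPart φ m) m
  induction F using P.discFun_induction with
  | coord i k =>
    refine hle (P.d i + 1 + k) ⟨(P.discL_one_coord i k).trans (by push_cast; rfl), ?_⟩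
    intro S c N hN hc
    have h1 : P.jetK φ c (P.discCoord i k) = _ := (P.jet_coord ((punct φ).cder S) c i k).trans
      (taylorCoeff_derK k (c i))
    rw [h1]
    refine ((inPow_iterate_derK (hc i) k).smul _).mono ?_
    push_cast
    nlinarith [mul_nonneg (Nat.cast_nonneg (α := ℤ) N) (Nat.cast_nonneg (α := ℤ) (P.d i)),
      mul_nonneg (show (0 : ℤ) ≤ N - 1 by omega) (Nat.cast_nonneg (α := ℤ) k)]
  | const z =>
    refine hle 0 ⟨?_, fun S c N hN hc => ?_⟩
    · rw [← P.discDer_apply, Derivation.map_algebraMap]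
      simp
    · rw [jetK_algebraMap]
      simpa using inPow_algebraMap_base _
  | add F G hF hG => exact add_mem hF hG
  | mul F G hF hG =>
    induction hF using Submodule.iSup_induction' with
    | zero => rw [zero_mul]; exact zero_mem _
    | add x y _ _ hx hy => rw [add_mul]; exact add_mem hx hy
    | mem i x hx =>
      induction hG using Submodule.iSup_induction' with
      | zero => rw [mul_zero]; exact zero_mem _
      | add y z _ _ hy hz => rw [mul_add]; exact add_mem hy hz
      | mem j y hy =>
        refine hle (i + j) ⟨?_, fun S c N hN hc => ?_⟩
        · rw [← P.discDer_apply, Derivation.leibniz, P.discDer_apply, P.discDer_apply, hx.1, hy.1,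
            smul_eq_mul, smul_eq_mul, mul_smul_comm, mul_smul_comm, mul_comm y x, ← add_smul]
          push_cast
          rw [add_comm]
        · rw [map_mul]
          refine ((hx.2 S c N hN hc).mul (hy.2 S c N hN hc)).mono ?_
          push_cast
          linarith

/-- Every element is a sum of parts that satisfy the pole estimate. Eigenspaces are independent, so
an eigenvector of degree m equals its part of degree m and inherits the estimate. -/
theorem mem_weightPart {a : DiscFun B} {m : ℤ} (ha : discL B 1 a = (m : ℂ) • a) :
    a ∈ P.weightPart φ m := by
  let E := Module.End.eigenspace (P.discDer 1 : DiscFun B →ₗ[ℂ] DiscFun B)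
  have hE : ∀ (j : ℤ) (b : DiscFun B), discL B 1 b = (j : ℂ) • b → b ∈ E j := fun j b hb =>
    Module.End.mem_eigenspace_iff.2 hb
  have h1 : (⨆ j : ℕ, P.weightPart φ j) ≤ P.weightPart φ m ⊔ ⨆ μ ≠ (m : ℂ), E μ := by
    refine iSup_le fun j => ?_
    by_cases h : (j : ℤ) = m
    · rw [h]; exact le_sup_left
    · refine le_trans (fun b hb => hE j b hb.1) (le_trans ?_ le_sup_right)
      exact le_iSup₂_of_le (j : ℂ) (by exact_mod_cast h) le_rfl
  have h2 : a ∈ P.weightPart φ m ⊔ ⨆ μ ≠ (m : ℂ), E μ := h1 (by rw [iSup_weightPart]; trivial)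
  obtain ⟨b, hb, b', hb', rfl⟩ := Submodule.mem_sup.1 h2
  have h3 : b' ∈ E m := by
    have := sub_mem (hE m _ ha) (hE m b hb.1)
    rwa [add_sub_cancel_left] at this
  have h4 := (Module.End.eigenspaces_iSupIndep
    (P.discDer 1 : DiscFun B →ₗ[ℂ] DiscFun B)) (m : ℂ)
  rw [Submodule.disjoint_def.1 h4 b' h3 hb', add_zero]
  exact hb

end OperFrame

end OperFF

namespace OperFF

open CategoryTheory Polynomial

/-! ### Expansions in the dual basis -/

section DualExpansion

variable {A : Type} [CommRing A] {φ : A[X]} {S : Type} [CommRing S] [Algebra A S]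

/-- The dual polynomials are combinations of the zʲ with j < deg φ, so residues against the zʲ
detect the order as well as the coefficients do. -/
theorem InPow.of_residue (hφ : φ.Monic) {k k' : ℤ} {f : KRing φ S} (hf : InPow φ S k f)
    (h : ∀ m < k', ∀ j < φ.natDegree,
      residue φ S (polyHom φ S (X ^ j) * phiZ φ S (-m - 1) * f) = 0) : InPow φ S k' f := by
  refine hf.of_coeffK hφ fun m hm j hj => ?_
  have h1 : (dualPoly φ S j).natDegree < φ.natDegree := by
    have := natDegree_dualPoly (φ := φ) (S := S) j; omega
  rw [coeffK_apply, (dualPoly φ S j).as_sum_range_C_mul_X_pow' h1, map_sum, Finset.sum_mul,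
    Finset.sum_mul, ← resLin_apply hφ, map_sum]
  refine Finset.sum_eq_zero fun i hi => ?_
  have e : polyHom φ S (C ((dualPoly φ S j).coeff i) * X ^ i) * phiZ φ S (-m - 1) * f =
      (dualPoly φ S j).coeff i • (polyHom φ S (X ^ i) * phiZ φ S (-m - 1) * f) := by
    rw [map_mul, Algebra.smul_def, algebraMap_poly]; ring
  rw [e, map_smul, resLin_apply, h m hm i (Finset.mem_range.1 hi), smul_zero]

/-- The expansion of f in the dual basis, truncated: its residues against the zʲ φᵐ agree with those
of f in the range that matters. -/
theorem inPow_sub_sum_dualPoly (hφ : φ.Monic) (M : ℕ) {f : KRing φ S} (hf : InPow φ S (-M) f) :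
    InPow φ S M (f - ∑ m ∈ Finset.Ico (-M : ℤ) M, ∑ j ∈ Finset.range φ.natDegree,
      residue φ S (polyHom φ S (X ^ j) * phiZ φ S m * f) •
        (polyHom φ S (dualPoly φ S j) * phiZ φ S (-m - 1))) := by
  refine InPow.of_residue hφ (k := -M) (hf.sub ?_) fun m hm j hj => ?_
  · refine inPow_sum _ fun m hm => inPow_sum _ fun j _ => InPow.smul ?_ _
    rw [Finset.mem_Ico] at hm
    exact ((inPow_polyHom _).mul (inPow_phiZ _)).mono (by omega)
  have key : ∀ m' : ℤ, ∀ i < φ.natDegree, residue φ S (polyHom φ S (X ^ j) * phiZ φ S (-m - 1) *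
      (polyHom φ S (dualPoly φ S i) * phiZ φ S (-m' - 1))) =
      if j = i ∧ -m - 1 = m' then 1 else 0 := fun m' i hi => by
    rw [← coeffK_monomial (S := S) hφ hj hi, coeffK_apply, mul_comm]
  rw [mul_sub, ← resLin_apply hφ, map_sub, sub_eq_zero, Finset.mul_sum, map_sum]
  have h2 : ∀ m', resLin hφ (polyHom φ S (X ^ j) * phiZ φ S (-m - 1) *
      ∑ i ∈ Finset.range φ.natDegree, residue φ S (polyHom φ S (X ^ i) * phiZ φ S m' * f) •
        (polyHom φ S (dualPoly φ S i) * phiZ φ S (-m' - 1))) =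
      if -m - 1 = m' then residue φ S (polyHom φ S (X ^ j) * phiZ φ S m' * f) else 0 := fun m' => by
    rw [Finset.mul_sum, map_sum, Finset.sum_eq_single j]
    · rw [mul_smul_comm, map_smul, resLin_apply, key m' j hj]
      by_cases h : -m - 1 = m' <;> simp [h]
    · intro i hi hne
      rw [mul_smul_comm, map_smul, resLin_apply, key m' i (Finset.mem_range.1 hi),
        if_neg (fun h => hne h.1.symm), smul_zero]
    · intro h; exact absurd (Finset.mem_range.2 hj) h
  simp only [h2, Finset.sum_ite_eq]
  split_ifs with h3
  · rfl
  · rw [Finset.mem_Ico] at h3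
    rw [resLin_apply]
    exact residue_eq_zero hφ
      ((((inPow_polyHom _).mul (inPow_phiZ (-m - 1))).mul hf).mono (by omega))

variable [Algebra ℂ A]

theorem complex_smul_eq (z : ℂ) (g : KRing φ A) : z • g = algebraMap ℂ A z • g := by
  rw [Algebra.smul_def, Algebra.smul_def]
  rfl

theorem mapK_ofId {S T : CommAlgCat.{0} A} (f : S ⟶ T) (g : KRing φ A) :
    mapK φ f.hom (mapK φ (Algebra.ofId A S) g) = mapK φ (Algebra.ofId A T) g := by
  have h1 : fromBase S ≫ f = fromBase T :=
    CommAlgCat.hom_ext (AlgHom.ext fun a => f.hom.commutes a)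
  have h2 := (punct φ).map_comp (fromBase S) f g
  rw [h1] at h2
  exact h2.symm

theorem mapK_ofId_smul {S : CommAlgCat.{0} A} (a : A) (g : KRing φ A) :
    mapK φ (Algebra.ofId A S) (a • g) = algebraMap A S a • mapK φ (Algebra.ofId A S) g := by
  rw [Algebra.smul_def, map_mul, mapK_algebraMap_base, Algebra.smul_def]
  rfl

end DualExpansion

namespace OperFrame

variable {𝔤 : Type*} [LieRing 𝔤] [LieAlgebra ℂ 𝔤] {ι : Type*} [Fintype ι]
  {H : LieSubalgebra ℂ 𝔤} {B : LieAlgebra.Basis ι H} {l : ℕ} (P : OperFrame B l)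
  [FiniteDimensional ℂ 𝔤] [LieAlgebra.IsKilling ℂ 𝔤]
  {A : Type} [CommRing A] [Algebra ℂ A] {φ : A[X]}

/-! ### Functions on opers on the punctured disc -/

/-- The value of a function at the oper with given canonical coordinates. -/
noncomputable def evalK {S : CommAlgCat.{0} A} (c : Fin l → KRing φ S) : PunctFun B φ →ₐ[A] S :=
  P.evalHom (punct φ) c

theorem punctFun_ext {F G : PunctFun B φ}
    (h : ∀ (S : CommAlgCat.{0} A) (c : Fin l → KRing φ S), P.evalK c F = P.evalK c G) : F = G :=
  P.opFun_ext h

theorem evalK_mapK {S T : CommAlgCat.{0} A} (f : S ⟶ T) (c : Fin l → KRing φ S)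
    (F : PunctFun B φ) : P.evalK (fun i => mapK φ f.hom (c i)) F = f.hom (P.evalK c F) :=
  P.evalHom_map F f c

theorem mem_polarIdeal_iff {N : ℕ} {F : PunctFun B φ} :
    F ∈ polarIdeal B φ (fun j => (P.v j : 𝔤)) N ↔ ∀ (S : CommAlgCat.{0} A)
      (c : Fin l → KRing φ S), (∀ i, InPow φ S (-N) (c i)) → P.evalK c F = 0 := by
  constructor
  · intro h S c hc
    exact h S _ c ((P.isCanForm_iff _).2 rfl) hc
  · intro h S x c hx hc
    rw [(P.isCanForm_iff (L := (punct φ).obj S) _).1 hx]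
    exact h S c hc

/-- A common bound for all coordinates, taken positive because the weight estimate needs N ≥ 1. -/
theorem exists_pole {S : Type} [CommRing S] [Algebra A S] (c : Fin l → KRing φ S) :
    ∃ N : ℕ, 0 < N ∧ ∀ i, InPow φ S (-N) (c i) := by
  choose N hN using fun i => exists_inPow (c i)
  refine ⟨∑ i, N i + 1, by omega, fun i => (hN i).mono ?_⟩
  have := Finset.single_le_sum (f := N) (fun _ _ => Nat.zero_le _) (Finset.mem_univ i)
  generalize ∑ i, N i = K at *
  push_cast
  omega

variable (hφ : φ.Monic)

theorem residue_jetK_mapK (hφ : φ.Monic) (a : DiscFun B) (g : KRing φ A)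
    {S T : CommAlgCat.{0} A} (f : S ⟶ T) (c : Fin l → KRing φ S) :
    residue φ T (P.jetK φ (fun i => mapK φ f.hom (c i)) a * mapK φ (Algebra.ofId A T) g) =
      f.hom (residue φ S (P.jetK φ c a * mapK φ (Algebra.ofId A S) g)) := by
  rw [← residue_mapK hφ, map_mul, mapK_ofId, mapK_jetK]

/-- The function `∫ a(c) g dt`, for a function `a` on opers on the formal disc. -/
noncomputable def fieldFun (a : DiscFun B) (g : KRing φ A) : PunctFun B φ :=
  P.opFunOf (𝔻 := punct φ)
    (fun S c => residue φ S (P.jetK φ c a * mapK φ (Algebra.ofId A S) g))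
    (fun f c => P.residue_jetK_mapK hφ a g f c)

theorem evalK_fieldFun (a : DiscFun B) (g : KRing φ A) {S : CommAlgCat.{0} A}
    (c : Fin l → KRing φ S) : P.evalK c (P.fieldFun hφ a g) =
      residue φ S (P.jetK φ c a * mapK φ (Algebra.ofId A S) g) :=
  P.evalHom_opFunOf (𝔻 := punct φ)
    (φ := fun S c => residue φ S (P.jetK φ c a * mapK φ (Algebra.ofId A S) g))
    (fun f c => P.residue_jetK_mapK hφ a g f c) c

theorem isCoord_iff (i : Fin l) (g : KRing φ A) (F : PunctFun B φ) :
    IsCoord (fun j => (P.v j : 𝔤)) i g F ↔ F = P.fieldFun hφ (P.discCoord i 0) g := by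
  constructor
  · intro h
    refine P.punctFun_ext fun S c => ?_
    rw [evalK_fieldFun, jetK_coord_zero]
    exact h S _ c ((P.isCanForm_iff _).2 rfl)
  · rintro rfl S x c hx
    rw [(P.isCanForm_iff (L := (punct φ).obj S) _).1 hx]
    refine (P.evalK_fieldFun hφ _ g c).trans ?_
    rw [jetK_coord_zero]

theorem fieldFun_add_left (a b : DiscFun B) (g : KRing φ A) :
    P.fieldFun hφ (a + b) g = P.fieldFun hφ a g + P.fieldFun hφ b g :=
  P.punctFun_ext fun S c => by
    rw [map_add, evalK_fieldFun, evalK_fieldFun, evalK_fieldFun, map_add, add_mul,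
      ← resLin_apply hφ, map_add]
    rfl

theorem fieldFun_add_right (a : DiscFun B) (g g' : KRing φ A) :
    P.fieldFun hφ a (g + g') = P.fieldFun hφ a g + P.fieldFun hφ a g' :=
  P.punctFun_ext fun S c => by
    rw [map_add, evalK_fieldFun, evalK_fieldFun, evalK_fieldFun, map_add, mul_add,
      ← resLin_apply hφ, map_add]
    rfl

theorem fieldFun_smul_right (a : DiscFun B) (s : A) (g : KRing φ A) :
    P.fieldFun hφ a (s • g) = s • P.fieldFun hφ a g :=
  P.punctFun_ext fun S c => by
    rw [map_smul, evalK_fieldFun, evalK_fieldFun, mapK_ofId_smul, mul_smul_comm,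
      ← resLin_apply hφ, map_smul, smul_eq_mul, Algebra.smul_def]
    rfl

theorem fieldFun_smul_left (a : DiscFun B) (z : ℂ) (g : KRing φ A) :
    P.fieldFun hφ (z • a) g = P.fieldFun hφ a (z • g) :=
  P.punctFun_ext fun S c => by
    rw [complex_smul_eq, evalK_fieldFun, evalK_fieldFun, mapK_ofId_smul, jetK_smul,
      mul_smul_comm, smul_mul_assoc]

/-- Integration by parts: T becomes ∂ on jets, and the residue of ∂(a(c) f) vanishes. -/
theorem fieldFun_discL_zero (a : DiscFun B) (f : KRing φ A) :
    P.fieldFun hφ a (derK φ A f) + P.fieldFun hφ (discL B 0 a) f = 0 :=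
  P.punctFun_ext fun S c => by
    rw [map_add, evalK_fieldFun, evalK_fieldFun, mapK_der, jetK_discL_zero, map_zero,
      ← resLin_apply hφ, ← resLin_apply hφ, ← map_add]
    have h1 := residue_derK hφ (P.jetK φ c a * mapK φ (Algebra.ofId A S) f)
    rw [Derivation.leibniz, smul_eq_mul, smul_eq_mul, mul_comm (mapK φ _ f)] at h1
    exact h1

theorem fieldFun_one (g : KRing φ A) :
    P.fieldFun hφ 1 g = algebraMap A _ (residue φ A g) :=
  P.punctFun_ext fun S c => by
    rw [evalK_fieldFun, map_one, one_mul, residue_mapK hφ, AlgHom.commutes]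
    rfl

/-- The pole of a(c), of order at most N m, is compensated by g, so the integrand is regular. -/
theorem fieldFun_mem_polarIdeal {a : DiscFun B} {g : KRing φ A} {m k : ℤ} {N : ℕ} (hN : 0 < N)
    (ha : discL B 1 a = (m : ℂ) • a) (hk : N * m ≤ k) (hg : InPow φ A k g) :
    P.fieldFun hφ a g ∈ polarIdeal B φ (fun j => (P.v j : 𝔤)) N := by
  rw [P.mem_polarIdeal_iff]
  intro S c hc
  rw [evalK_fieldFun]
  exact residue_eq_zero hφ
    ((((P.mem_weightPart φ ha).2 S c N hN hc).mul (hg.mapK _)).mono (by omega))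

/-! ### The homomorphism from `U⁰` -/

theorem zeroGen_add_left (a b : DiscFun B) (g : KRing φ A) :
    zeroGen φ (discL B) (a + b) g = zeroGen φ (discL B) a g + zeroGen φ (discL B) b g := by
  rw [zeroGen, lieGen, TensorProduct.tmul_add, Submodule.Quotient.mk_add, map_add, map_add]
  rfl

theorem zeroGen_smul_left (z : ℂ) (a : DiscFun B) (g : KRing φ A) :
    zeroGen φ (discL B) (z • a) g = zeroGen φ (discL B) a (z • g) := by
  rw [zeroGen, lieGen, TensorProduct.tmul_smul, TensorProduct.smul_tmul']
  rfl

variable (φ) in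
/-- The map `g ↦ a g`. -/
noncomputable def zeroGenLin (a : DiscFun B) : KRing φ A →ₗ[A] UZero φ (discL B) where
  toFun := zeroGen φ (discL B) a
  map_add' g g' := by
    rw [zeroGen, lieGen, TensorProduct.add_tmul, Submodule.Quotient.mk_add, map_add, map_add]
    rfl
  map_smul' s g := by
    rw [zeroGen, lieGen, ← TensorProduct.smul_tmul', Submodule.Quotient.mk_smul, map_smul]
    rfl

theorem zeroGenLin_apply (a : DiscFun B) (g : KRing φ A) :
    zeroGenLin φ a g = zeroGen φ (discL B) a g := rfl

theorem zeroGen_discL_zero (a : DiscFun B) (f : KRing φ A) :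
    zeroGen φ (discL B) (discL B 0 a) f = -zeroGen φ (discL B) a (derK φ A f) := by
  have h1 : lieGen φ (discL B) a (derK φ A f) + lieGen φ (discL B) (discL B 0 a) f = 0 := by
    rw [lieGen, lieGen, ← Submodule.Quotient.mk_add, Submodule.Quotient.mk_eq_zero]
    exact Submodule.subset_span ⟨f, a, rfl⟩
  rw [eq_neg_iff_add_eq_zero, add_comm, zeroGen, zeroGen, ← map_add, ← map_add, h1, map_zero,
    map_zero]

theorem zeroGen_one (g : KRing φ A) :
    zeroGen φ (discL B) 1 g = algebraMap A _ (residue φ A g) := by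
  rw [zeroGen]
  exact Ideal.Quotient.eq.2 (Ideal.subset_span ⟨g, rfl⟩)

theorem adjoin_zeroGen : Algebra.adjoin A (range fun p : DiscFun B × KRing φ A =>
    zeroGen φ (discL B) p.1 p.2) = ⊤ := by
  rw [eq_top_iff]
  rintro x -
  obtain ⟨x, rfl⟩ := Ideal.Quotient.mk_surjective x
  induction x using SymmetricAlgebra.induction with
  | algebraMap r => exact Subalgebra.algebraMap_mem _ r
  | ι y =>
    obtain ⟨y, rfl⟩ := Submodule.Quotient.mk_surjective _ y
    induction y using TensorProduct.induction_on with
    | zero => rw [Submodule.Quotient.mk_zero, map_zero, map_zero]; exact zero_mem _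
    | tmul g a => exact Algebra.subset_adjoin ⟨(a, g), rfl⟩
    | add y z hy hz =>
      rw [Submodule.Quotient.mk_add, map_add, map_add]; exact add_mem hy hz
  | mul x y hx hy => rw [map_mul]; exact mul_mem hx hy
  | add x y hx hy => rw [map_add]; exact add_mem hx hy

/-- The map `g ⊗ a ↦ ∫ a(c) g dt`. -/
noncomputable def tensorFun : KRing φ A ⊗[ℂ] DiscFun B →ₗ[A] PunctFun B φ :=
  let f : KRing φ A ⊗[ℂ] DiscFun B →+ PunctFun B φ := TensorProduct.liftAddHom
    { toFun := fun g =>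
        { toFun := fun a => P.fieldFun hφ a g
          map_zero' := by
            have := P.fieldFun_add_left hφ 0 0 g
            rwa [add_zero, left_eq_add] at this
          map_add' := fun a b => P.fieldFun_add_left hφ a b g }
      map_zero' := by
        ext a
        simpa using P.fieldFun_smul_right hφ a 0 0
      map_add' := fun g g' => by
        ext a
        exact P.fieldFun_add_right hφ a g g' }
    (fun z g a => (P.fieldFun_smul_left hφ a z g).symm)
  { f with
    map_smul' := fun s x => by
      change f (s • x) = s • f x
      induction x using TensorProduct.induction_on with
      | zero => rw [smul_zero, map_zero, smul_zero]
      | tmul g a => exact P.fieldFun_smul_right hφ a s g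
      | add x y hx hy => rw [smul_add, map_add, map_add, smul_add, hx, hy] }

theorem tensorFun_tmul (a : DiscFun B) (g : KRing φ A) :
    P.tensorFun hφ (g ⊗ₜ a) = P.fieldFun hφ a g := rfl

/-- The homomorphism `U⁰ → A[Op]`. -/
noncomputable def zeroHom : UZero φ (discL B) →ₐ[A] PunctFun B φ :=
  Ideal.Quotient.liftₐ _ (SymmetricAlgebra.lift ((lieRel φ (discL B)).liftQ (P.tensorFun hφ) (by
    rw [lieRel, Submodule.span_le]
    rintro _ ⟨f, a, rfl⟩
    rw [SetLike.mem_coe, LinearMap.mem_ker, map_add, tensorFun_tmul, tensorFun_tmul,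
      fieldFun_discL_zero]))) (by
    intro x hx
    rw [← RingHom.mem_ker]
    revert x
    rw [← SetLike.le_def, vacIdeal, Ideal.span_le]
    rintro _ ⟨g, rfl⟩
    rw [SetLike.mem_coe, RingHom.mem_ker, map_sub, sub_eq_zero, AlgHom.commutes,
      SymmetricAlgebra.lift_ι_apply]
    exact P.fieldFun_one hφ g)

theorem zeroHom_zeroGen (a : DiscFun B) (g : KRing φ A) :
    P.zeroHom hφ (zeroGen φ (discL B) a g) = P.fieldFun hφ a g := by
  refine (Ideal.Quotient.liftₐ_apply _ _ _ _).trans ?_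
  refine (Ideal.Quotient.lift_mk _ _ _).trans ?_
  exact SymmetricAlgebra.lift_ι_apply _ _

theorem zeroHom_mem_polarIdeal {N : ℕ} (hN : 0 < N) {u : UZero φ (discL B)}
    (hu : u ∈ degIdeal φ (discL B) N) :
    P.zeroHom hφ u ∈ polarIdeal B φ (fun j => (P.v j : 𝔤)) N := by
  have h1 : degIdeal φ (discL B) N ≤
      (polarIdeal B φ (fun j => (P.v j : 𝔤)) N).comap (P.zeroHom hφ) := by
    rw [degIdeal, Ideal.span_le]
    rintro _ ⟨a, g, m, k, ha, hk, hg, rfl⟩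
    rw [SetLike.mem_coe, Ideal.mem_comap, zeroHom_zeroGen]
    exact P.fieldFun_mem_polarIdeal hφ hN ha hk hg
  exact h1 hu

end OperFrame

end OperFF

namespace OperFF

open CategoryTheory Polynomial Filter

/-! ### The topology of completions -/

namespace Completion

variable {U : Type*} [CommRing U] {I : ℕ → Ideal U}

theorem tendsto_iff {α : Type*} {f : α → Completion I} {L : Filter α} {x : Completion I} :
    Tendsto f L (𝓝 x) ↔ ∀ N, ∀ᶠ a in L, (f a).1 N = x.1 N := by
  let : ∀ N, TopologicalSpace (U ⧸ I N) := fun _ => ⊥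
  have : ∀ N, DiscreteTopology (U ⧸ I N) := fun _ => ⟨rfl⟩
  have h1 : Tendsto f L (𝓝 x) ↔ Tendsto (fun a => (f a).1) L (𝓝 x.1) :=
    tendsto_subtype_rng (p := fun y => y ∈ limSubring I) (f := f) (x := x)
  rw [h1, tendsto_pi_nhds]
  simp only [nhds_discrete, tendsto_pure]

theorem eventually_eq (x : Completion I) (N : ℕ) : ∀ᶠ y in 𝓝 x, y.1 N = x.1 N :=
  tendsto_iff.1 tendsto_id N

/-- The image of U is dense: the chosen representatives of x converge to x. -/
theorem mem_of_isClosed {C : Set (Completion I)} (hC : IsClosed C) (h : ∀ u, of I u ∈ C)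
    (x : Completion I) : x ∈ C := by
  refine hC.mem_of_tendsto (f := fun N => of I (x.rep N)) (b := atTop) (tendsto_iff.2 fun N => ?_)
    (Eventually.of_forall fun N => h _)
  filter_upwards [eventually_ge_atTop N] with M hM
  exact (x.rep_spec M hM).symm

variable (I) in
/-- The projection to `U ⧸ I N`. -/
noncomputable def ev (N : ℕ) : Completion I →+* U ⧸ I N :=
  (Pi.evalRingHom _ N).comp (limSubring I).subtype

theorem ev_apply (N : ℕ) (x : Completion I) : ev I N x = x.1 N := rfl

theorem exists_hasSum {f : ℕ → Completion I} (h : ∀ N, ∃ M, ∀ m ≥ M, ev I N (f m) = 0) :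
    ∃ s, HasSum f s := by
  choose M hM using h
  have key : ∀ N K, M N ≤ K → ev I N (∑ m ∈ Finset.range K, f m) =
      ev I N (∑ m ∈ Finset.range (M N), f m) := fun N K hK => by
    rw [map_sum, map_sum]
    refine (Finset.sum_subset (Finset.range_subset_range.2 hK) fun m _ hm => hM N m ?_).symm
    simpa using hm
  -- One partial sum beyond all the bounds up to `N` represents the entries up to `N`
  -- simultaneously.
  refine ⟨⟨fun N => ev I N (∑ m ∈ Finset.range (M N), f m), fun N =>
    ⟨(∑ m ∈ Finset.range ((Finset.range (N + 1)).sup M), f m).rep N, fun N' hN' => ?_⟩⟩,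
    tendsto_iff.2 fun N => ?_⟩
  · rw [← rep_spec _ N hN', ← ev_apply, key]
    exact Finset.le_sup (f := M) (Finset.mem_range.2 (by omega))
  · change ∀ᶠ s in atTop, _
    filter_upwards [eventually_ge_atTop (Finset.range (M N))] with s hs
    change ev I N _ = ev I N _
    rw [map_sum, map_sum]
    refine (Finset.sum_subset hs fun m _ hm => hM N m ?_).symm
    simpa using hm

theorem exists_ev_eq_of_hasSum {f : ℕ → Completion I} {s : Completion I} (h : HasSum f s) (N : ℕ) :
    ∃ M, ∀ K ≥ M, ev I N (∑ m ∈ Finset.range K, f m) = ev I N s := by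
  have h1 : ∀ᶠ K in atTop, (∑ m ∈ Finset.range K, f m).1 N = s.1 N :=
    tendsto_iff.1 h.tendsto_sum_nat N
  obtain ⟨M, hM⟩ := eventually_atTop.1 h1
  exact ⟨M, hM⟩

end Completion

namespace OperFrame

variable {𝔤 : Type*} [LieRing 𝔤] [LieAlgebra ℂ 𝔤] {ι : Type*} [Fintype ι]
  {H : LieSubalgebra ℂ 𝔤} {B : LieAlgebra.Basis ι H} {l : ℕ} (P : OperFrame B l)
  [FiniteDimensional ℂ 𝔤] [LieAlgebra.IsKilling ℂ 𝔤]
  {A : Type} [CommRing A] [Algebra ℂ A] {φ : A[X]}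

theorem tendsto_opFun_iff {α : Type*} {f : α → PunctFun B φ} {L : Filter α} {F : PunctFun B φ} :
    Tendsto f L (@nhds _ (opFunTopology B φ fun j => (P.v j : 𝔤)) F) ↔
      ∀ N, ∀ᶠ a in L, f a - F ∈ polarIdeal B φ (fun j => (P.v j : 𝔤)) N := by
  rw [opFunTopology, nhds_iInf, tendsto_iInf]
  refine forall_congr' fun N => ?_
  let : TopologicalSpace (PunctFun B φ ⧸ polarIdeal B φ (fun j => (P.v j : 𝔤)) N) := ⊥
  have : DiscreteTopology (PunctFun B φ ⧸ polarIdeal B φ (fun j => (P.v j : 𝔤)) N) := ⟨rfl⟩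
  rw [nhds_induced, tendsto_comap_iff, nhds_discrete, tendsto_pure]
  simp only [Function.comp_apply, Ideal.Quotient.eq]

/-- A single oper has poles of bounded order, so functions that agree modulo every polar ideal agree
at every oper. -/
theorem t2Space_opFun : @T2Space (PunctFun B φ) (opFunTopology B φ fun j => (P.v j : 𝔤)) := by
  let := opFunTopology B φ fun j => (P.v j : 𝔤)
  let : ∀ N, TopologicalSpace (PunctFun B φ ⧸ polarIdeal B φ (fun j => (P.v j : 𝔤)) N) := fun _ => ⊥
  have : ∀ N, DiscreteTopology (PunctFun B φ ⧸ polarIdeal B φ (fun j => (P.v j : 𝔤)) N) :=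
    fun _ => ⟨rfl⟩
  refine T2Space.of_injective_continuous (f := fun (F : PunctFun B φ) (N : ℕ) =>
    Ideal.Quotient.mk (polarIdeal B φ (fun j => (P.v j : 𝔤)) N) F) ?_ ?_
  · intro F G h
    refine P.punctFun_ext fun S c => ?_
    obtain ⟨N, -, hN⟩ := exists_pole c
    have h1 := P.mem_polarIdeal_iff.1 (Ideal.Quotient.eq.1 (congrFun h N)) S c hN
    rwa [map_sub, sub_eq_zero] at h1
  · rw [continuous_pi_iff]
    exact fun N => continuous_iff_le_induced.2 (iInf_le _ N)

variable (hφ : φ.Monic)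

/-! ### The homomorphism from `U'` -/

/-- The value of x at c can be read off at any level that bounds the poles of c. Two levels are
compared through a representative at their maximum, which serves for both. -/
theorem evalK_zeroHom_congr {x : UPrime φ (discL B)} {S : CommAlgCat.{0} A}
    {c : Fin l → KRing φ S} {N N' : ℕ} (hN : 0 < N ∧ ∀ i, InPow φ S (-N) (c i))
    (hN' : 0 < N' ∧ ∀ i, InPow φ S (-N') (c i)) {u u' : UZero φ (discL B)}
    (hu : x.1 N = Ideal.Quotient.mk _ u) (hu' : x.1 N' = Ideal.Quotient.mk _ u') :
    P.evalK c (P.zeroHom hφ u) = P.evalK c (P.zeroHom hφ u') := by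
  have key : ∀ (N : ℕ) (u u' : UZero φ (discL B)), (0 < N ∧ ∀ i, InPow φ S (-N) (c i)) →
      x.1 N = Ideal.Quotient.mk _ u → x.1 N = Ideal.Quotient.mk _ u' →
      P.evalK c (P.zeroHom hφ u) = P.evalK c (P.zeroHom hφ u') := by
    intro N u u' hN h h'
    have h1 : u - u' ∈ degIdeal φ (discL B) N := Ideal.Quotient.eq.1 (h.symm.trans h')
    have h2 := P.mem_polarIdeal_iff.1 (P.zeroHom_mem_polarIdeal hφ hN.1 h1) S c hN.2
    rwa [map_sub, map_sub, sub_eq_zero] at h2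
  exact (key N u _ hN hu (x.rep_spec _ (le_max_left N N'))).trans
    (key N' u' _ hN' hu' (x.rep_spec _ (le_max_right N N'))).symm

/-- The value at `c` of the function that corresponds to an element of `U'`. -/
noncomputable def primeVal (x : UPrime φ (discL B)) (S : CommAlgCat.{0} A)
    (c : Fin l → KRing φ S) : S :=
  P.evalK c (P.zeroHom hφ (x.rep (exists_pole c).choose))

theorem primeVal_eq {x : UPrime φ (discL B)} {S : CommAlgCat.{0} A} {c : Fin l → KRing φ S} {N : ℕ}
    (hN : 0 < N ∧ ∀ i, InPow φ S (-N) (c i)) {u : UZero φ (discL B)}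
    (hu : x.1 N = Ideal.Quotient.mk _ u) : P.primeVal hφ x S c = P.evalK c (P.zeroHom hφ u) :=
  P.evalK_zeroHom_congr hφ (exists_pole c).choose_spec hN (x.rep_spec _ le_rfl) hu

theorem primeVal_mapK (x : UPrime φ (discL B)) {S T : CommAlgCat.{0} A} (f : S ⟶ T)
    (c : Fin l → KRing φ S) :
    P.primeVal hφ x T (fun i => mapK φ f.hom (c i)) = f.hom (P.primeVal hφ x S c) := by
  obtain ⟨N, hN, hc⟩ := exists_pole c
  rw [P.primeVal_eq hφ ⟨hN, hc⟩ (x.rep_spec N le_rfl), ← P.evalK_mapK]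
  exact P.primeVal_eq hφ ⟨hN, fun i => (hc i).mapK _⟩ (x.rep_spec N le_rfl)

/-- The function that corresponds to an element of `U'`. -/
noncomputable def primeFun (x : UPrime φ (discL B)) : PunctFun B φ :=
  P.opFunOf (𝔻 := punct φ) (fun S c => P.primeVal hφ x S c) (fun f c => P.primeVal_mapK hφ x f c)

theorem evalK_primeFun {x : UPrime φ (discL B)} {S : CommAlgCat.{0} A} {c : Fin l → KRing φ S}
    {N : ℕ} (hN : 0 < N ∧ ∀ i, InPow φ S (-N) (c i)) {u : UZero φ (discL B)}
    (hu : x.1 N = Ideal.Quotient.mk _ u) :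
    P.evalK c (P.primeFun hφ x) = P.evalK c (P.zeroHom hφ u) :=
  (P.evalHom_opFunOf (𝔻 := punct φ) (φ := fun S c => P.primeVal hφ x S c)
    (fun f c => P.primeVal_mapK hφ x f c) c).trans (P.primeVal_eq hφ hN hu)

/-- The homomorphism `U' → A[Op]`. -/
noncomputable def primeHom : UPrime φ (discL B) →ₐ[A] PunctFun B φ where
  toFun := P.primeFun hφ
  map_one' := P.punctFun_ext fun S c => by
    rw [P.evalK_primeFun hφ (exists_pole c).choose_spec (u := 1) (map_one _).symm, map_one, map_one]
  map_zero' := P.punctFun_ext fun S c => by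
    rw [P.evalK_primeFun hφ (exists_pole c).choose_spec (u := 0) (map_zero _).symm, map_zero]
  map_add' x y := P.punctFun_ext fun S c => by
    obtain ⟨N, hN⟩ := exists_pole c
    have h : (x + y).1 N = Ideal.Quotient.mk _ (x.rep N + y.rep N) := by
      rw [map_add, ← x.rep_spec _ le_rfl, ← y.rep_spec _ le_rfl]; rfl
    rw [P.evalK_primeFun hφ hN h, map_add, map_add, map_add,
      P.evalK_primeFun hφ hN (x.rep_spec _ le_rfl), P.evalK_primeFun hφ hN (y.rep_spec _ le_rfl)]
  map_mul' x y := P.punctFun_ext fun S c => by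
    obtain ⟨N, hN⟩ := exists_pole c
    have h : (x * y).1 N = Ideal.Quotient.mk _ (x.rep N * y.rep N) := by
      rw [map_mul, ← x.rep_spec _ le_rfl, ← y.rep_spec _ le_rfl]; rfl
    rw [P.evalK_primeFun hφ hN h, map_mul, map_mul, map_mul,
      P.evalK_primeFun hφ hN (x.rep_spec _ le_rfl), P.evalK_primeFun hφ hN (y.rep_spec _ le_rfl)]
  commutes' a := P.punctFun_ext fun S c => by
    rw [P.evalK_primeFun hφ (exists_pole c).choose_spec
      (u := algebraMap A (UZero φ (discL B)) a) rfl, AlgHom.commutes]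

theorem evalK_primeHom {x : UPrime φ (discL B)} {S : CommAlgCat.{0} A} {c : Fin l → KRing φ S}
    {N : ℕ} (hN : 0 < N ∧ ∀ i, InPow φ S (-N) (c i)) {u : UZero φ (discL B)}
    (hu : x.1 N = Ideal.Quotient.mk _ u) :
    P.evalK c (P.primeHom hφ x) = P.evalK c (P.zeroHom hφ u) := P.evalK_primeFun hφ hN hu

theorem primeHom_of (u : UZero φ (discL B)) :
    P.primeHom hφ (Completion.of _ u) = P.zeroHom hφ u := P.punctFun_ext fun _ c =>
  P.evalK_primeHom hφ (exists_pole c).choose_spec rfl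

theorem primeHom_fieldOf (a : DiscFun B) (g : KRing φ A) :
    P.primeHom hφ (fieldOf φ (discL B) a g) = P.fieldFun hφ a g := by
  rw [fieldOf, primeHom_of, zeroHom_zeroGen]

theorem primeHom_mem_polarIdeal {x y : UPrime φ (discL B)} {N : ℕ} (hN : 0 < N)
    (h : x.1 N = y.1 N) :
    P.primeHom hφ x - P.primeHom hφ y ∈ polarIdeal B φ (fun j => (P.v j : 𝔤)) N := by
  rw [P.mem_polarIdeal_iff]
  intro S c hc
  rw [map_sub, P.evalK_primeHom hφ ⟨hN, hc⟩ (x.rep_spec _ le_rfl),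
    P.evalK_primeHom hφ ⟨hN, hc⟩ (h.symm.trans (x.rep_spec _ le_rfl)), sub_self]

theorem polarIdeal_anti {N N' : ℕ} (h : N ≤ N') :
    polarIdeal B φ (fun j => (P.v j : 𝔤)) N' ≤ polarIdeal B φ (fun j => (P.v j : 𝔤)) N :=
  fun _ hF => P.mem_polarIdeal_iff.2 fun S c hc =>
    P.mem_polarIdeal_iff.1 hF S c fun i => (hc i).mono (by omega)

theorem continuous_primeHom : Continuous[inferInstance, opFunTopology B φ fun j => (P.v j : 𝔤)]
    (P.primeHom hφ) := by
  let := opFunTopology B φ fun j => (P.v j : 𝔤)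
  rw [continuous_iff_continuousAt]
  intro x
  refine P.tendsto_opFun_iff.2 fun N => ?_
  -- Level N + 1 rather than N, since the polar estimate needs a positive level.
  filter_upwards [x.eventually_eq (N + 1)] with y hy
  exact P.polarIdeal_anti N.le_succ (P.primeHom_mem_polarIdeal hφ N.succ_pos hy)

/-! ### Products -/

theorem fieldOf_eq_zero {a : DiscFun B} {g : KRing φ A} {m k : ℤ} {N : ℕ}
    (ha : discL B 1 a = (m : ℂ) • a) (hk : N * m ≤ k) (hg : InPow φ A k g) :
    Completion.ev _ N (fieldOf φ (discL B) a g) = 0 :=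
  Ideal.Quotient.eq_zero_iff_mem.2 (Ideal.subset_span ⟨a, g, m, k, ha, hk, hg, rfl⟩)

theorem minusOneTerm_eq (a b : DiscFun B) (g : KRing φ A) (m : ℕ) :
    minusOneTerm φ (discL B) a b g m =
      ∑ k ∈ Finset.range (φ.natDegree + 1), ∑ i ∈ Finset.range k, φ.coeff k •
        (fieldOf φ (discL B) a (polyHom φ A (X ^ i) * phiZ φ A (-(m : ℤ) - 1)) *
          fieldOf φ (discL B) b (polyHom φ A (X ^ (k - 1 - i)) * phiZ φ A m * g) +
        fieldOf φ (discL B) a (polyHom φ A (X ^ i) * phiZ φ A m) *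
          fieldOf φ (discL B) b (polyHom φ A (X ^ (k - 1 - i)) * phiZ φ A (-(m : ℤ) - 1) * g)) := by
  simp only [phiZ, zpow_natCast]
  rfl

theorem fieldOf_add_left (a b : DiscFun B) (g : KRing φ A) :
    fieldOf φ (discL B) (a + b) g = fieldOf φ (discL B) a g + fieldOf φ (discL B) b g := by
  rw [fieldOf, zeroGen_add_left, map_add]; rfl

theorem minusOneTerm_add_left (a a' b : DiscFun B) (g : KRing φ A) (m : ℕ) :
    minusOneTerm φ (discL B) (a + a') b g m =
      minusOneTerm φ (discL B) a b g m + minusOneTerm φ (discL B) a' b g m := by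
  simp only [minusOneTerm_eq, fieldOf_add_left, ← Finset.sum_add_distrib, ← smul_add]
  refine Finset.sum_congr rfl fun k _ => Finset.sum_congr rfl fun i _ => ?_
  congr 1
  ring

theorem minusOneTerm_add_right (a b b' : DiscFun B) (g : KRing φ A) (m : ℕ) :
    minusOneTerm φ (discL B) a (b + b') g m =
      minusOneTerm φ (discL B) a b g m + minusOneTerm φ (discL B) a b' g m := by
  simp only [minusOneTerm_eq, fieldOf_add_left, ← Finset.sum_add_distrib, ← smul_add]
  refine Finset.sum_congr rfl fun k _ => Finset.sum_congr rfl fun i _ => ?_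
  congr 1
  ring

theorem minusOneTerm_zero_left (b : DiscFun B) (g : KRing φ A) (m : ℕ) :
    minusOneTerm φ (discL B) 0 b g m = 0 := by
  have := minusOneTerm_add_left 0 0 b g m
  rwa [add_zero, left_eq_add] at this

theorem minusOneTerm_zero_right (a : DiscFun B) (g : KRing φ A) (m : ℕ) :
    minusOneTerm φ (discL B) a 0 g m = 0 := by
  have := minusOneTerm_add_right a 0 0 g m
  rwa [add_zero, left_eq_add] at this

theorem ev_smul (N : ℕ) (a : A) (x : UPrime φ (discL B)) (hx : Completion.ev _ N x = 0) :
    Completion.ev _ N (a • x) = 0 := by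
  rw [Algebra.smul_def]
  exact (RingHom.ker (Completion.ev _ N)).mul_mem_left _ hx

/-- In each summand of the m-th term one factor carries φᵐ. For homogeneous a and b it lies in the
N-th ideal once m exceeds N times its degree and the pole of g; the general case follows by
additivity. -/
theorem exists_ev_minusOneTerm_eq_zero (P : OperFrame B l) (a b : DiscFun B) (g : KRing φ A)
    (N : ℕ) : ∃ M, ∀ m ≥ M, Completion.ev _ N (minusOneTerm φ (discL B) a b g m) = 0 := by
  have ha : a ∈ ⨆ m : ℕ, P.weightPart φ m := by rw [P.iSup_weightPart]; trivial
  have hb : b ∈ ⨆ m : ℕ, P.weightPart φ m := by rw [P.iSup_weightPart]; trivial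
  induction ha using Submodule.iSup_induction' with
  | zero => exact ⟨0, fun m _ => by rw [minusOneTerm_zero_left, map_zero]⟩
  | add x y _ _ hx hy =>
    obtain ⟨M, hM⟩ := hx
    obtain ⟨M', hM'⟩ := hy
    exact ⟨max M M', fun m hm => by
      rw [minusOneTerm_add_left, map_add, hM m (le_trans (le_max_left _ _) hm),
        hM' m (le_trans (le_max_right _ _) hm), add_zero]⟩
  | mem p a ha =>
    induction hb using Submodule.iSup_induction' with
    | zero => exact ⟨0, fun m _ => by rw [minusOneTerm_zero_right, map_zero]⟩
    | add x y _ _ hx hy =>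
      obtain ⟨M, hM⟩ := hx
      obtain ⟨M', hM'⟩ := hy
      exact ⟨max M M', fun m hm => by
        rw [minusOneTerm_add_right, map_add, hM m (le_trans (le_max_left _ _) hm),
          hM' m (le_trans (le_max_right _ _) hm), add_zero]⟩
    | mem q b hb =>
      obtain ⟨k, hg⟩ := exists_inPow g
      refine ⟨N * p + N * q + k, fun m hm => ?_⟩
      have hm' : (N : ℤ) * p + N * q + k ≤ m := by exact_mod_cast hm
      have hNp : (0 : ℤ) ≤ N * p := by positivity
      have hNq : (0 : ℤ) ≤ N * q := by positivity
      rw [minusOneTerm_eq, map_sum]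
      refine Finset.sum_eq_zero fun j _ => ?_
      rw [map_sum]
      refine Finset.sum_eq_zero fun i _ => ev_smul N _ _ ?_
      have h₁ := fieldOf_eq_zero (g := polyHom φ A (X ^ (j - 1 - i)) * phiZ φ A m * g)
        hb.1 (N := N) (k := m - k) (by omega)
          ((((inPow_polyHom _).mul (inPow_phiZ _)).mul hg).mono (by omega))
      have h₂ := fieldOf_eq_zero (g := polyHom φ A (X ^ i) * phiZ φ A m) ha.1 (N := N) (k := m)
        (by omega) (((inPow_polyHom _).mul (inPow_phiZ _)).mono (by omega))
      exact (RingHom.ker (Completion.ev _ N)).add_mem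
        ((RingHom.ker (Completion.ev _ N)).mul_mem_left _ h₁)
        ((RingHom.ker (Completion.ev _ N)).mul_mem_right _ h₂)

theorem exists_hasSum_minusOneTerm (P : OperFrame B l) (a b : DiscFun B) (g : KRing φ A) :
    ∃ s, HasSum (minusOneTerm φ (discL B) a b g) s :=
  Completion.exists_hasSum (P.exists_ev_minusOneTerm_eq_zero a b g)

/-- The index m ≥ 0 is paired with -m - 1, as in the two expansions of (z - w)⁻¹. -/
theorem sum_Ico_neg {E : Type*} [AddCommMonoid E] (F : ℤ → E) (K : ℕ) :
    ∑ m ∈ Finset.Ico (-K : ℤ) K, F m = ∑ m ∈ Finset.range K, (F m + F (-(m : ℤ) - 1)) := by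
  induction K with
  | zero => simp
  | succ K ih =>
    have h : Finset.Ico (-((K + 1 : ℕ) : ℤ)) ((K + 1 : ℕ) : ℤ) =
        insert (-(K : ℤ) - 1) (insert (K : ℤ) (Finset.Ico (-K : ℤ) K)) := by
      ext m
      simp only [Finset.mem_Ico, Finset.mem_insert]
      omega
    rw [h, Finset.sum_insert, Finset.sum_insert, ih, Finset.sum_range_succ]
    · rw [add_comm, add_comm (F K), add_assoc]
    · simp
    · simp only [Finset.mem_Ico, Finset.mem_insert]
      omega

/-- At a fixed c, put α = a(c) and β = b(c) g. The two halves of the m-th term are the contributions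
of the indices m and -m - 1 to the expansion of ∫ α β in the zʲ φᵐ and their duals. That expansion
is finite, so the partial sums are eventually equal to ∫ a(c) b(c) g. -/
theorem evalK_sum_minusOneTerm (a b : DiscFun B) (g : KRing φ A) {S : CommAlgCat.{0} A}
    (c : Fin l → KRing φ S) : ∃ M : ℕ, ∀ K ≥ M,
      P.evalK c (P.primeHom hφ (∑ m ∈ Finset.range K, minusOneTerm φ (discL B) a b g m)) =
        P.evalK c (P.fieldFun hφ (a * b) g) := by
  set α := P.jetK φ c a
  set β := P.jetK φ c b * mapK φ (Algebra.ofId A S) g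
  obtain ⟨M₁, h₁⟩ := exists_inPow α
  obtain ⟨M₂, h₂⟩ := exists_inPow β
  refine ⟨max M₁ M₂, fun K hK => ?_⟩
  have hα : InPow φ S (-K) α := h₁.mono (by have := le_trans (le_max_left _ _) hK; omega)
  have hβ : InPow φ S (-K) β := h₂.mono (by have := le_trans (le_max_right _ _) hK; omega)
  have hterm : ∀ m, P.evalK c (P.primeHom hφ (minusOneTerm φ (discL B) a b g m)) =
      ∑ j ∈ Finset.range φ.natDegree,
        (coeffK hφ m j α * residue φ S (polyHom φ S (X ^ j) * phiZ φ S m * β) +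
        coeffK hφ (-(m : ℤ) - 1) j α *
          residue φ S (polyHom φ S (X ^ j) * phiZ φ S (-(m : ℤ) - 1) * β)) := by
    intro m
    let G : S[X] →+ ℕ → S :=
      { toFun := fun p j =>
          residue φ S (polyHom φ S p * phiZ φ S (-(m : ℤ) - 1) * α) *
            residue φ S (polyHom φ S (X ^ j) * phiZ φ S m * β) +
          residue φ S (polyHom φ S p * phiZ φ S m * α) *
            residue φ S (polyHom φ S (X ^ j) * phiZ φ S (-(m : ℤ) - 1) * β)
        map_zero' := by
          funext j
          simp only [map_zero, zero_mul, ← resLin_apply hφ, Pi.zero_apply, add_zero]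
        map_add' := fun p q => by
          funext j
          simp only [map_add, add_mul, ← resLin_apply hφ, Pi.add_apply]
          ring }
    have h3 := sum_dualPoly (φ := φ) G (fun s p j => by
      have e : ∀ x y, residue φ S (polyHom φ S (C (algebraMap A S s) * p) * x * y) =
          algebraMap A S s * residue φ S (polyHom φ S p * x * y) := fun x y => by
        have e' : polyHom φ S (C (algebraMap A S s) * p) * x * y =
            algebraMap A S s • (polyHom φ S p * x * y) := by
          rw [map_mul, Algebra.smul_def, algebraMap_poly]
          ring
        rw [e', ← resLin_apply hφ, map_smul]
        rfl
      change residue φ S _ * _ + residue φ S _ * _ = s • (residue φ S _ * _ + residue φ S _ * _)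
      rw [e, e, Algebra.smul_def]
      ring)
    have hf : ∀ (a : DiscFun B) (x : KRing φ A), P.evalK c (P.primeHom hφ (fieldOf φ (discL B) a x)) =
        residue φ S (P.jetK φ c a * mapK φ (Algebra.ofId A S) x) := fun a x => by
      rw [primeHom_fieldOf, evalK_fieldFun]
    have hX : ∀ i, mapK φ (Algebra.ofId A S) (polyHom φ A (X ^ i)) = polyHom φ S (X ^ i) := fun i => by
      rw [mapK_polyHom, Polynomial.map_pow, Polynomial.map_X]
    have h4 : P.evalK c (P.primeHom hφ (minusOneTerm φ (discL B) a b g m)) =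
        ∑ k ∈ Finset.range (φ.natDegree + 1), ∑ i ∈ Finset.range k,
          φ.coeff k • G (X ^ i) (k - 1 - i) := by
      rw [minusOneTerm_eq]
      simp only [map_sum, map_smul, map_add, map_mul, hf, hX, mapK_phiZ]
      refine Finset.sum_congr rfl fun k _ => Finset.sum_congr rfl fun i _ => ?_
      congr 1
      change _ = residue φ S _ * residue φ S _ + residue φ S _ * residue φ S _
      congr 3
      · ring
      · simp only [β]; ring
      · ring
      · simp only [β]; ring
    rw [h4, h3]
    refine Finset.sum_congr rfl fun j _ => ?_
    have e : (-(-(m : ℤ) - 1) - 1) = m := by ring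
    rw [coeffK_apply, coeffK_apply, e]
    rfl
  rw [map_sum, map_sum, evalK_fieldFun, map_mul, mul_assoc]
  change _ = residue φ S (α * β)
  rw [residue_mul_eq_sum hφ K hα hβ]
  simp only [hterm, Finset.sum_add_distrib]
  rw [sum_Ico_neg, Finset.sum_add_distrib]

end OperFrame

end OperFF

namespace OperFF

open CategoryTheory Polynomial Filter

namespace OperFrame

variable {𝔤 : Type*} [LieRing 𝔤] [LieAlgebra ℂ 𝔤] {ι : Type*} [Fintype ι]
  {H : LieSubalgebra ℂ 𝔤} {B : LieAlgebra.Basis ι H} {l : ℕ} (P : OperFrame B l)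
  [FiniteDimensional ℂ 𝔤] [LieAlgebra.IsKilling ℂ 𝔤]
  {A : Type} [CommRing A] [Algebra ℂ A] {φ : A[X]}

/-! ### The homomorphism to `U'` -/

variable (A l) in
/-- The polynomial algebra in the Laurent coefficients of canonical coordinates. -/
noncomputable abbrev coordAlg : CommAlgCat.{0} A := CommAlgCat.of A (MvPolynomial (Fin l × ℤ × ℕ) A)

variable (φ l) in
/-- The universal canonical form with poles of order at most `M`. -/
noncomputable def univPoint (M : ℕ) (i : Fin l) : KRing φ (coordAlg l A) :=
  seriesK φ M fun k j => (MvPolynomial.X (i, k, j) : MvPolynomial (Fin l × ℤ × ℕ) A)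

theorem mapK_univPoint {S : CommAlgCat.{0} A} (f : coordAlg l A ⟶ S) (hφ : φ.Monic) (M : ℕ)
    (i : Fin l) : mapK φ f.hom (univPoint l φ M i) =
      seriesK φ M fun k j => f.hom (MvPolynomial.X (i, k, j) : MvPolynomial (Fin l × ℤ × ℕ) A) :=
  mapK_seriesK hφ f.hom M _

theorem inPow_univPoint (M : ℕ) (i : Fin l) : InPow φ (coordAlg l A) (-M) (univPoint l φ M i) :=
  inPow_seriesK _ _

theorem coeffK_univPoint (hφ : φ.Monic) (M : ℕ) (i : Fin l) {k : ℤ} (hk : -M ≤ k) {j : ℕ}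
    (hj : j < φ.natDegree) : coeffK hφ k j (univPoint l φ M i) =
      (MvPolynomial.X (i, k, j) : MvPolynomial (Fin l × ℤ × ℕ) A) := coeffK_seriesK hφ _ _ hk hj

variable (φ) in
/-- The homomorphism that maps a Laurent coefficient to the corresponding element of `U⁰`. -/
noncomputable def coordHom : MvPolynomial (Fin l × ℤ × ℕ) A →ₐ[A] UZero φ (discL B) :=
  MvPolynomial.aeval fun x => zeroGen φ (discL B) (P.discCoord x.1 0)
    (polyHom φ A (dualPoly φ A x.2.2) * phiZ φ A (-x.2.1 - 1))

theorem coordHom_X (i : Fin l) (k : ℤ) (j : ℕ) :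
    P.coordHom φ (MvPolynomial.X (i, k, j)) = zeroGen φ (discL B) (P.discCoord i 0)
      (polyHom φ A (dualPoly φ A j) * phiZ φ A (-k - 1)) := MvPolynomial.aeval_X _ _

theorem evalK_zeroHom_coordHom (hφ : φ.Monic) {S : CommAlgCat.{0} A} (c : Fin l → KRing φ S)
    (p : MvPolynomial (Fin l × ℤ × ℕ) A) : P.evalK c (P.zeroHom hφ (P.coordHom φ p)) =
      MvPolynomial.aeval (fun x : Fin l × ℤ × ℕ => coeffK hφ x.2.1 x.2.2 (c x.1)) p := by
  have : ((P.evalK c).comp (P.zeroHom hφ)).comp (P.coordHom φ) =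
      MvPolynomial.aeval (fun x : Fin l × ℤ × ℕ => coeffK hφ x.2.1 x.2.2 (c x.1)) := by
    refine MvPolynomial.algHom_ext fun ⟨i, k, j⟩ => ?_
    rw [AlgHom.comp_apply, AlgHom.comp_apply, coordHom_X, zeroHom_zeroGen, evalK_fieldFun,
      jetK_coord_zero, MvPolynomial.aeval_X, coeffK_apply, map_mul, mapK_polyHom, mapK_phiZ,
      map_dualPoly, mul_comm]
  exact DFunLike.congr_fun this p

/-- A bound for the poles that are seen by `U⁰` modulo the `N`-th ideal. -/
def poleBound (N : ℕ) : ℕ := N * (∑ i, P.d i + 1)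

theorem le_poleBound (N : ℕ) : N ≤ P.poleBound N := Nat.le_mul_of_pos_right _ (Nat.succ_pos _)

theorem poleBound_mono {N N' : ℕ} (h : N ≤ N') : P.poleBound N ≤ P.poleBound N' :=
  Nat.mul_le_mul_right _ h

theorem mul_le_poleBound (N : ℕ) (i : Fin l) :
    (N : ℤ) * ((P.d i + 1 : ℕ) : ℤ) ≤ P.poleBound N := by
  have h : N * (P.d i + 1) ≤ P.poleBound N := Nat.mul_le_mul_left _
    (Nat.succ_le_succ (Finset.single_le_sum (fun _ _ => Nat.zero_le _) (Finset.mem_univ i)))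
  exact_mod_cast h

/-- The function v*_{i,-1} has degree dᵢ + 1, and the bound dominates N (dᵢ + 1) for all i at once.
-/
theorem zeroGen_coord_mem_degIdeal {N : ℕ} {k : ℤ} (hk : P.poleBound N ≤ k) (i : Fin l)
    {g : KRing φ A} (hg : InPow φ A k g) :
    zeroGen φ (discL B) (P.discCoord i 0) g ∈ degIdeal φ (discL B) N :=
  Ideal.subset_span ⟨_, g, ((P.d i + 1 : ℕ) : ℤ), k, by
    rw [discL_one_coord, add_zero, Int.cast_natCast], (P.mul_le_poleBound N i).trans hk, hg, rfl⟩

/-- Killing the variables of index k below -`poleBound N` specializes one universal point to the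
other. Those variables go to elements of the N-th ideal, so the specialization is invisible modulo
that ideal. -/
theorem coordHom_evalK_sub_mem (hφ : φ.Monic) {N M : ℕ} (hM : P.poleBound N ≤ M)
    (F : PunctFun B φ) :
    P.coordHom φ (P.evalK (univPoint l φ M) F) -
      P.coordHom φ (P.evalK (univPoint l φ (P.poleBound N)) F) ∈ degIdeal φ (discL B) N := by
  let τ : MvPolynomial (Fin l × ℤ × ℕ) A →ₐ[A] MvPolynomial (Fin l × ℤ × ℕ) A :=
    MvPolynomial.aeval fun x =>
      if -(P.poleBound N : ℤ) ≤ x.2.1 then MvPolynomial.X x else 0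
  have hτ : ∀ i k j, τ (MvPolynomial.X (i, k, j)) =
      if -(P.poleBound N : ℤ) ≤ k then MvPolynomial.X (i, k, j) else 0 := fun i k j =>
    MvPolynomial.aeval_X _ _
  have h1 : ∀ i, mapK φ τ (univPoint l φ M i) = univPoint l φ (P.poleBound N) i := fun i => by
    refine (mapK_univPoint (S := coordAlg l A) (CommAlgCat.ofHom τ) hφ M i).trans
      (seriesK_eq hφ ((inPow_seriesK _ _).mono (by omega)) fun k _ j hj => ?_)
    refine Eq.trans ?_ (hτ i k j).symm
    split_ifs with h
    · exact coeffK_seriesK hφ _ _ h hj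
    · exact coeffK_eq_zero hφ j ((inPow_seriesK _ _).mono (by omega))
  have h2 : ∀ p, Ideal.Quotient.mkₐ A (degIdeal φ (discL B) N) (P.coordHom φ p) =
      Ideal.Quotient.mkₐ A (degIdeal φ (discL B) N) (P.coordHom φ (τ p)) := by
    intro p
    refine DFunLike.congr_fun (f := (Ideal.Quotient.mkₐ A (degIdeal φ (discL B) N)).comp
      (P.coordHom φ)) (g := ((Ideal.Quotient.mkₐ A (degIdeal φ (discL B) N)).comp
      (P.coordHom φ)).comp τ) (MvPolynomial.algHom_ext fun ⟨i, k, j⟩ => ?_) p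
    rw [AlgHom.comp_apply, AlgHom.comp_apply, hτ]
    split_ifs with h
    · rfl
    · rw [map_zero, coordHom_X]
      exact Ideal.Quotient.eq_zero_iff_mem.2 (P.zeroGen_coord_mem_degIdeal (k := -k - 1) (by omega) i
        (((inPow_polyHom _).mul (inPow_phiZ _)).mono (by omega)))
  have h3 := P.evalK_mapK (S := coordAlg l A) (T := coordAlg l A) (CommAlgCat.ofHom τ)
    (univPoint l φ M) F
  have h4 : P.evalK (univPoint l φ (P.poleBound N)) F = τ (P.evalK (univPoint l φ M) F) := by
    refine Eq.trans ?_ h3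
    exact congrArg (fun c => P.evalK c F) (funext fun i => (h1 i).symm)
  rw [h4]
  exact Ideal.Quotient.eq.1 (h2 _)

/-- The homomorphism `A[Op] → U'`, as a homomorphism of rings. -/
noncomputable def primeInvRing (hφ : φ.Monic) : PunctFun B φ →+* UPrime φ (discL B) :=
  RingHom.codRestrict (RingHom.pi fun N => (Ideal.Quotient.mk (degIdeal φ (discL B) N)).comp
    ((P.coordHom φ).comp (P.evalK (univPoint l φ (P.poleBound N)))).toRingHom)
    (limSubring (degIdeal φ (discL B)))
    fun F N => ⟨P.coordHom φ (P.evalK (univPoint l φ (P.poleBound N)) F), fun _ hM =>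
      (Ideal.Quotient.eq.2 (P.coordHom_evalK_sub_mem hφ (P.poleBound_mono hM) F)).symm⟩

theorem primeInvRing_val (hφ : φ.Monic) (F : PunctFun B φ) (N : ℕ) :
    (P.primeInvRing hφ F).1 N =
      Ideal.Quotient.mk _ (P.coordHom φ (P.evalK (univPoint l φ (P.poleBound N)) F)) := rfl

/-- The homomorphism `A[Op] → U'`. -/
noncomputable def primeInv (hφ : φ.Monic) : PunctFun B φ →ₐ[A] UPrime φ (discL B) where
  __ := P.primeInvRing hφ
  commutes' a := Completion.ext fun N => by
    refine (P.primeInvRing_val hφ _ N).trans ?_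
    rw [AlgHom.commutes]
    exact congrArg _ ((P.coordHom φ).commutes a)

theorem primeInv_val (hφ : φ.Monic) (F : PunctFun B φ) (N : ℕ) :
    (P.primeInv hφ F).1 N =
      Ideal.Quotient.mk _ (P.coordHom φ (P.evalK (univPoint l φ (P.poleBound N)) F)) := rfl

theorem continuous_primeInv (hφ : φ.Monic) :
    Continuous[opFunTopology B φ fun j => (P.v j : 𝔤), inferInstance] (P.primeInv hφ) := by
  let := opFunTopology B φ fun j => (P.v j : 𝔤)
  rw [continuous_iff_continuousAt]
  intro F
  refine Completion.tendsto_iff.2 fun N => ?_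
  filter_upwards [P.tendsto_opFun_iff.1 (tendsto_id (α := PunctFun B φ) (x := 𝓝 F)) (P.poleBound N)]
    with G hG
  have h := P.mem_polarIdeal_iff.1 hG (coordAlg l A) (univPoint l φ (P.poleBound N))
    fun i => inPow_univPoint _ i
  rw [map_sub, sub_eq_zero] at h
  rw [primeInv_val, primeInv_val, ← h, id]

/-- A tuple c with poles of order at most N is the specialization of the universal point at the
coefficients of c, and F is natural. -/
theorem primeHom_primeInv (hφ : φ.Monic) (F : PunctFun B φ) :
    P.primeHom hφ (P.primeInv hφ F) = F := by
  refine P.punctFun_ext fun S c => ?_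
  obtain ⟨N, hN, hc⟩ := exists_pole c
  rw [P.evalK_primeHom hφ ⟨hN, hc⟩ (P.primeInv_val hφ F N), evalK_zeroHom_coordHom]
  let G := MvPolynomial.aeval (R := A) (fun x : Fin l × ℤ × ℕ => coeffK hφ x.2.1 x.2.2 (c x.1))
  let f : coordAlg l A ⟶ S := CommAlgCat.ofHom (X := MvPolynomial (Fin l × ℤ × ℕ) A) (Y := S) G
  have hG : ∀ i k j, coeffK hφ k j (c i) = G (MvPolynomial.X (i, k, j)) := fun i k j =>
    (MvPolynomial.aeval_X (fun x : Fin l × ℤ × ℕ => coeffK hφ x.2.1 x.2.2 (c x.1)) (i, k, j)).symm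
  have h1 : (fun i => mapK φ f.hom (univPoint l φ (P.poleBound N) i)) = c := by
    funext i
    rw [mapK_univPoint f hφ]
    refine seriesK_eq hφ ((hc i).mono ?_) fun k _ j _ => hG i k j
    have := P.le_poleBound N
    omega
  have h2 := P.evalK_mapK f (univPoint l φ (P.poleBound N)) F
  rw [h1] at h2
  exact h2.symm

/-- At the universal point ∫ cᵢ g is a finite linear combination of variables, with residues of g
against the zʲ φᵐ as coefficients. Replacing the variables turns it into the field at the truncated
expansion of g in the dual basis, and the error lies in the N-th ideal. -/
theorem primeInv_fieldFun_coord (hφ : φ.Monic) (i : Fin l) (g : KRing φ A) :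
    P.primeInv hφ (P.fieldFun hφ (P.discCoord i 0) g) =
      fieldOf φ (discL B) (P.discCoord i 0) g := by
  refine Completion.ext fun N => ?_
  obtain ⟨k, hg⟩ := exists_inPow g
  set M := max k (P.poleBound N)
  have hgM : InPow φ A (-M) g := hg.mono (by omega)
  have h1 := P.coordHom_evalK_sub_mem hφ (le_max_right k (P.poleBound N))
    (P.fieldFun hφ (P.discCoord i 0) g)
  have h2 : P.coordHom φ (P.evalK (univPoint l φ M) (P.fieldFun hφ (P.discCoord i 0) g)) =
      ∑ m ∈ Finset.Ico (-M : ℤ) M, ∑ j ∈ Finset.range φ.natDegree,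
        residue φ A (polyHom φ A (X ^ j) * phiZ φ A m * g) • zeroGen φ (discL B) (P.discCoord i 0)
          (polyHom φ A (dualPoly φ A j) * phiZ φ A (-m - 1)) := by
    rw [evalK_fieldFun, jetK_coord_zero,
      residue_mul_eq_sum hφ M (inPow_univPoint M i) (hgM.mapK _), map_sum]
    refine Finset.sum_congr rfl fun m hm => ?_
    rw [map_sum]
    refine Finset.sum_congr rfl fun j hj => ?_
    have e : polyHom φ (coordAlg l A) (X ^ j) * phiZ φ (coordAlg l A) m *
        mapK φ (Algebra.ofId A (coordAlg l A)) g =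
        mapK φ (Algebra.ofId A (coordAlg l A)) (polyHom φ A (X ^ j) * phiZ φ A m * g) := by
      rw [map_mul, map_mul, mapK_polyHom, mapK_phiZ, Polynomial.map_pow, Polynomial.map_X]
    rw [e, residue_mapK hφ, coeffK_univPoint hφ M i (Finset.mem_Ico.1 hm).1
      (Finset.mem_range.1 hj), ← coordHom_X, mul_comm]
    exact (congrArg (P.coordHom φ) (Algebra.smul_def (A := MvPolynomial (Fin l × ℤ × ℕ) A) _
      (MvPolynomial.X (i, m, j))).symm).trans (map_smul (P.coordHom φ) _ _)
  have h3 := P.zeroGen_coord_mem_degIdeal (N := N) (k := M) (by omega) i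
    (inPow_sub_sum_dualPoly hφ M hgM)
  rw [← zeroGenLin_apply, map_sub, map_sum] at h3
  simp only [map_sum, map_smul, zeroGenLin_apply] at h3
  rw [← h2] at h3
  have h4 := add_mem h3 h1
  rw [sub_add_sub_cancel] at h4
  exact (Ideal.Quotient.eq.2 h4).symm

end OperFrame

end OperFF

namespace OperFF

open CategoryTheory Polynomial Filter

/-! ### The quotient map `U' → Ũ` -/

section Tilde

variable {A : Type} [CommRing A] [Algebra ℂ A] {φ : A[X]}
  {V : Type*} [CommRing V] [Algebra ℂ V] {Lop : ℕ → V → V}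

variable (φ Lop) in
/-- The quotient map `U' → Ũ`. -/
noncomputable def tildeMk : UPrime φ Lop →ₐ[A] UTilde φ Lop :=
  Ideal.Quotient.mkₐ A (prodIdeal φ Lop)

theorem tildeMk_surjective : Function.Surjective (tildeMk φ Lop) := Ideal.Quotient.mk_surjective

theorem continuous_tildeMk : Continuous (tildeMk φ Lop) := continuous_quotient_mk'

theorem tildeMk_eq_iff {x y : UPrime φ Lop} :
    tildeMk φ Lop x = tildeMk φ Lop y ↔ x - y ∈ prodIdeal φ Lop := Ideal.Quotient.eq

theorem tildeMk_eq_zero {x : UPrime φ Lop} (h : x ∈ prodIdeal φ Lop) : tildeMk φ Lop x = 0 :=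
  Ideal.Quotient.eq_zero_iff_mem.2 h

theorem sub_mem_prodIdeal (a b : V) (g : KRing φ A) {s : UPrime φ Lop}
    (hs : HasSum (minusOneTerm φ Lop a b g) s) : fieldOf φ Lop (a * b) g - s ∈ prodIdeal φ Lop :=
  subset_closure (Ideal.subset_span ⟨a, b, g, s, hs, rfl⟩)

theorem isClosed_prodIdeal : IsClosed (prodIdeal φ Lop : Set (UPrime φ Lop)) := isClosed_closure

end Tilde

namespace OperFrame

variable {𝔤 : Type*} [LieRing 𝔤] [LieAlgebra ℂ 𝔤] {ι : Type*} [Fintype ι]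
  {H : LieSubalgebra ℂ 𝔤} {B : LieAlgebra.Basis ι H} {l : ℕ} (P : OperFrame B l)
  [FiniteDimensional ℂ 𝔤] [LieAlgebra.IsKilling ℂ 𝔤]
  {A : Type} [CommRing A] [Algebra ℂ A] {φ : A[X]}

/-! ### Topological generators -/

/-- Higher Taylor coefficients are obtained from v*_{i,-1} by T, and T can be moved to g as -∂;
constants give residues. A product is, modulo the product ideal, a limit of sums of products of
fields. Induction over the generators of ℂ[Op(D)] then reaches every a. -/
theorem fieldOf_mem {C : Subalgebra A (UPrime φ (discL B))}
    (hC : IsClosed (C : Set (UPrime φ (discL B)))) (hJ : ∀ x ∈ prodIdeal φ (discL B), x ∈ C)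
    (h : ∀ i g, fieldOf φ (discL B) (P.discCoord i 0) g ∈ C) (a : DiscFun B) :
    ∀ g, fieldOf φ (discL B) a g ∈ C := by
  have hsmul : ∀ (z : ℂ) (a : DiscFun B), (∀ g, fieldOf φ (discL B) a g ∈ C) →
      ∀ g, fieldOf φ (discL B) (z • a) g ∈ C := fun z a ha g => by
    rw [fieldOf, zeroGen_smul_left]
    exact ha _
  induction a using P.discFun_induction with
  | coord i k =>
    induction k with
    | zero => exact h i
    | succ k ih =>
      have hk : (k : ℂ) + 1 ≠ 0 := Nat.cast_add_one_ne_zero k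
      have e : P.discCoord i (k + 1) = ((k : ℂ) + 1)⁻¹ • discL B 0 (P.discCoord i k) := by
        rw [discL_zero_coord, smul_smul, inv_mul_cancel₀ hk, one_smul]
      rw [e]
      refine hsmul _ _ fun g => ?_
      rw [fieldOf, zeroGen_discL_zero, map_neg]
      exact C.neg_mem (ih _)
  | const z =>
    rw [Algebra.algebraMap_eq_smul_one]
    refine hsmul _ _ fun g => ?_
    rw [fieldOf, zeroGen_one]
    exact C.algebraMap_mem (residue φ A g)
  | add a b ha hb =>
    intro g
    rw [fieldOf_add_left]
    exact add_mem (ha g) (hb g)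
  | mul a b ha hb =>
    intro g
    obtain ⟨s, hs⟩ := P.exists_hasSum_minusOneTerm a b g
    rw [← sub_add_cancel (fieldOf φ (discL B) (a * b) g) s]
    refine add_mem (hJ _ (sub_mem_prodIdeal a b g hs)) ?_
    refine hC.mem_of_tendsto hs (Eventually.of_forall fun t => sum_mem fun m _ => ?_)
    exact sum_mem fun k _ => sum_mem fun i _ => C.smul_mem
      (add_mem (mul_mem (ha _) (hb _)) (mul_mem (ha _) (hb _))) _

theorem prime_mem_of_isClosed {C : Subalgebra A (UPrime φ (discL B))}
    (hC : IsClosed (C : Set (UPrime φ (discL B)))) (hJ : ∀ x ∈ prodIdeal φ (discL B), x ∈ C)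
    (h : ∀ i g, fieldOf φ (discL B) (P.discCoord i 0) g ∈ C) (x : UPrime φ (discL B)) : x ∈ C := by
  refine Completion.mem_of_isClosed hC (fun u => ?_) x
  have hu : u ∈ Algebra.adjoin A (range fun p : DiscFun B × KRing φ A =>
      zeroGen φ (discL B) p.1 p.2) := by rw [adjoin_zeroGen]; trivial
  induction hu using Algebra.adjoin_induction with
  | mem u hu =>
    obtain ⟨p, rfl⟩ := hu
    exact P.fieldOf_mem hC hJ h p.1 p.2
  | algebraMap r => exact C.algebraMap_mem r
  | add u v _ _ hu hv => rw [map_add]; exact C.add_mem hu hv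
  | mul u v _ _ hu hv => rw [map_mul]; exact C.mul_mem hu hv

theorem tilde_mem_of_isClosed {C : Subalgebra A (UTilde φ (discL B))}
    (hC : IsClosed (C : Set (UTilde φ (discL B))))
    (h : ∀ i g, gen φ (discL B) (P.discCoord i 0) g ∈ C) (x : UTilde φ (discL B)) : x ∈ C := by
  obtain ⟨x, rfl⟩ := tildeMk_surjective x
  exact P.prime_mem_of_isClosed (C := C.comap (tildeMk φ (discL B)))
    (hC.preimage continuous_tildeMk)
    (fun x hx => by rw [Subalgebra.mem_comap, tildeMk_eq_zero hx]; exact C.zero_mem) h x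

/-- The equalizer is a closed subalgebra and contains the topological generators. -/
theorem tildeAlgHom_ext {R : Type*} [Semiring R] [Algebra A R] [TopologicalSpace R] [T2Space R]
    {f g : UTilde φ (discL B) →ₐ[A] R} (hf : Continuous f) (hg : Continuous g)
    (h : ∀ i x, f (gen φ (discL B) (P.discCoord i 0) x) = g (gen φ (discL B) (P.discCoord i 0) x)) :
    f = g :=
  AlgHom.ext fun x => P.tilde_mem_of_isClosed (C := AlgHom.equalizer f g) (isClosed_eq hf hg) h x

/-! ### The isomorphism -/

/-- The kernel is closed because the target is Hausdorff, so only the generating relations matter.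
At a given c, a long partial sum has the value of the limit by continuity and that of ∫ a(c) b(c) g
by the expansion in dual bases. -/
theorem primeHom_eq_zero (hφ : φ.Monic) {x : UPrime φ (discL B)}
    (hx : x ∈ prodIdeal φ (discL B)) : P.primeHom hφ x = 0 := by
  let := opFunTopology B φ fun j => (P.v j : 𝔤)
  have := P.t2Space_opFun (φ := φ)
  have hcl : IsClosed {x | P.primeHom hφ x = 0} :=
    isClosed_singleton.preimage (P.continuous_primeHom hφ)
  refine closure_minimal (fun y hy => ?_) hcl hx
  refine (Ideal.span_le (I := RingHom.ker (P.primeHom hφ))).2 ?_ hy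
  rintro _ ⟨a, b, g, s, hs, rfl⟩
  refine (RingHom.mem_ker (f := P.primeHom hφ)).2 (P.punctFun_ext fun S c => ?_)
  obtain ⟨N, hN, hc⟩ := exists_pole c
  obtain ⟨M, hM⟩ := Completion.exists_ev_eq_of_hasSum hs N
  obtain ⟨M', hM'⟩ := P.evalK_sum_minusOneTerm hφ a b g c
  have h := P.mem_polarIdeal_iff.1 (P.primeHom_mem_polarIdeal hφ hN (hM _ (le_max_left M M'))) S c hc
  rw [map_sub, hM' _ (le_max_right M M'), sub_eq_zero] at h
  rw [map_sub, map_sub, map_zero, primeHom_fieldOf, h, sub_self]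

/-- The homomorphism `Ũ → A[Op]`. -/
noncomputable def tildeHom (hφ : φ.Monic) : UTilde φ (discL B) →ₐ[A] PunctFun B φ :=
  Ideal.Quotient.liftₐ (prodIdeal φ (discL B)) (P.primeHom hφ) fun _ h => P.primeHom_eq_zero hφ h

theorem tildeHom_gen (hφ : φ.Monic) (a : DiscFun B) (g : KRing φ A) :
    P.tildeHom hφ (gen φ (discL B) a g) = P.fieldFun hφ a g := P.primeHom_fieldOf hφ a g

/-- Both sides are continuous homomorphisms from U' to Ũ; they vanish on the product ideal and agree
on the fields of the v*_{i,-1}, which suffices by topological generation. -/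
theorem tildeMk_primeInv_primeHom (hφ : φ.Monic) (x : UPrime φ (discL B)) :
    tildeMk φ (discL B) (P.primeInv hφ (P.primeHom hφ x)) = tildeMk φ (discL B) x := by
  refine P.prime_mem_of_isClosed (C := AlgHom.equalizer
    ((tildeMk φ (discL B)).comp ((P.primeInv hφ).comp (P.primeHom hφ))) (tildeMk φ (discL B)))
    ?_ (fun x hx => ?_) (fun i g => ?_) x
  -- The equalizer is closed as the preimage of the closed product ideal under a difference of
  -- continuous maps, so no separation property of Ũ is needed yet.
  · have h1 : Continuous fun x => P.primeInv hφ (P.primeHom hφ x) := by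
      let := opFunTopology B φ fun j => (P.v j : 𝔤)
      exact (P.continuous_primeInv hφ).comp (P.continuous_primeHom hφ)
    have h2 := isClosed_prodIdeal.preimage (h1.sub continuous_id)
    convert h2 using 1
    ext x
    exact tildeMk_eq_iff
  · change tildeMk φ (discL B) (P.primeInv hφ (P.primeHom hφ x)) = tildeMk φ (discL B) x
    rw [P.primeHom_eq_zero hφ hx, tildeMk_eq_zero hx, map_zero, map_zero]
  · change tildeMk φ (discL B) (P.primeInv hφ (P.primeHom hφ _)) = tildeMk φ (discL B) _
    rw [primeHom_fieldOf, primeInv_fieldFun_coord]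

/-- The isomorphism `Ũ ≃ A[Op]`. -/
noncomputable def tildeEquiv (hφ : φ.Monic) : UTilde φ (discL B) ≃ₐ[A] PunctFun B φ :=
  AlgEquiv.ofAlgHom (P.tildeHom hφ) ((tildeMk φ (discL B)).comp (P.primeInv hφ))
    (AlgHom.ext fun F => P.primeHom_primeInv hφ F)
    (AlgHom.ext fun x => by
      obtain ⟨x, rfl⟩ := tildeMk_surjective x
      exact P.tildeMk_primeInv_primeHom hφ x)

theorem tildeEquiv_gen (hφ : φ.Monic) (a : DiscFun B) (g : KRing φ A) :
    P.tildeEquiv hφ (gen φ (discL B) a g) = P.fieldFun hφ a g := P.tildeHom_gen hφ a g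

theorem continuous_tildeEquiv (hφ : φ.Monic) :
    Continuous[inferInstance, opFunTopology B φ fun j => (P.v j : 𝔤)] (P.tildeEquiv hφ) := by
  let := opFunTopology B φ fun j => (P.v j : 𝔤)
  exact continuous_coinduced_dom.2 (P.continuous_primeHom hφ)

theorem continuous_tildeEquiv_symm (hφ : φ.Monic) :
    Continuous[opFunTopology B φ fun j => (P.v j : 𝔤), inferInstance] (P.tildeEquiv hφ).symm := by
  let := opFunTopology B φ fun j => (P.v j : 𝔤)
  exact continuous_tildeMk.comp (P.continuous_primeInv hφ)

theorem t2Space_tilde (P : OperFrame B l) (hφ : φ.Monic) : T2Space (UTilde φ (discL B)) := by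
  let := opFunTopology B φ fun j => (P.v j : 𝔤)
  have := P.t2Space_opFun (φ := φ)
  exact T2Space.of_injective_continuous (P.tildeEquiv hφ).injective (P.continuous_tildeEquiv hφ)

theorem isOperIso_tildeEquiv (hφ : φ.Monic) : IsOperIso B φ (fun j => (P.v j : 𝔤))
    (fun i => P.discCoord i 0) (fun i g => P.fieldFun hφ (P.discCoord i 0) g) (P.tildeEquiv hφ) :=
  ⟨P.continuous_tildeEquiv hφ, P.continuous_tildeEquiv_symm hφ, fun _ _ => P.tildeEquiv_gen hφ _ _⟩

theorem isOperIso_unique (hφ : φ.Monic) {Φ : UTilde φ (discL B) ≃ₐ[A] PunctFun B φ}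
    (h : IsOperIso B φ (fun j => (P.v j : 𝔤)) (fun i => P.discCoord i 0)
      (fun i g => P.fieldFun hφ (P.discCoord i 0) g) Φ) : Φ = P.tildeEquiv hφ := by
  let := opFunTopology B φ fun j => (P.v j : 𝔤)
  have := P.t2Space_opFun (φ := φ)
  have h1 := P.tildeAlgHom_ext (f := Φ.toAlgHom) (g := (P.tildeEquiv hφ).toAlgHom) h.1
    (P.continuous_tildeEquiv hφ) fun i g => (h.2.2 i g).trans (P.tildeEquiv_gen hφ _ _).symm
  exact AlgEquiv.ext fun x => DFunLike.congr_fun h1 x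

end OperFrame

end OperFF

namespace OperFF

open CategoryTheory Polynomial Filter

namespace OperFrame

variable {𝔤 : Type*} [LieRing 𝔤] [LieAlgebra ℂ 𝔤] {ι : Type*} [Fintype ι]
  {H : LieSubalgebra ℂ 𝔤} {B : LieAlgebra.Basis ι H} {l : ℕ} (P : OperFrame B l)
  [FiniteDimensional ℂ 𝔤] [LieAlgebra.IsKilling ℂ 𝔤]
  {A : Type} [CommRing A] [Algebra ℂ A] {φ : A[X]}

/-! ### The action of vector fields -/

theorem evalK_derAct (h : KRing φ A) (F : PunctFun B φ) {S : CommAlgCat.{0} A}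
    (c : Fin l → KRing φ S) :
    P.evalK c (derAct B (punct φ) h F) = Disc.dualSnd (P.evalK (fun i =>
      mapK φ (Disc.toDual S).hom (c i) + epsK φ S * mapK φ (Disc.toDual S).hom
        (P.actK φ (mapK φ (Algebra.ofId A S) (-h)) c i)) F) :=
  P.evalHom_derAct (𝔻 := punct φ) h F c

theorem dualSnd_add_eps_mul {S : CommAlgCat.{0} A} (x y : S) :
    Disc.dualSnd ((Disc.toDual S).hom x + Disc.dualEps S * (Disc.toDual S).hom y) = y := by
  change TrivSqZeroExt.snd ((TrivSqZeroExt.inl x : DualNumber S) + (DualNumber.eps : DualNumber S) *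
    (TrivSqZeroExt.inl y : DualNumber S)) = y
  simp

theorem evalK_derAct_fieldFun (hφ : φ.Monic) (h : KRing φ A) (a : DiscFun B) (g : KRing φ A)
    {S : CommAlgCat.{0} A} (c : Fin l → KRing φ S) :
    P.evalK c (derAct B (punct φ) h (P.fieldFun hφ a g)) =
      residue φ S (P.jetDerK φ (mapK φ (Algebra.ofId A S) (-h)) c a *
        mapK φ (Algebra.ofId A S) g) := by
  rw [evalK_derAct, evalK_fieldFun, jetK_add_eps, ← mapK_ofId (Disc.toDual S) g, add_mul,
    mul_assoc, ← map_mul, ← map_mul, ← resLin_apply hφ, map_add, epsK, ← Algebra.smul_def,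
    map_smul, resLin_apply, resLin_apply, residue_mapK hφ, residue_mapK hφ]
  exact dualSnd_add_eps_mul _ _

theorem finsum_discL {E : Type*} [AddCommMonoid E] {a : DiscFun B} {M : ℕ}
    (hM : ∀ m ≥ M, discL B m a = 0) (G : ℕ → DiscFun B → E) (hG : ∀ m, G m 0 = 0) :
    ∑ᶠ m, G m (discL B m a) = ∑ m ∈ Finset.range M, G m (discL B m a) := by
  refine finsum_eq_sum_of_support_subset _ fun m hm => ?_
  rw [Finset.coe_range, Set.mem_Iio]
  by_contra h
  exact hm ((congrArg (G m) (hM m (not_lt.1 h))).trans (hG m))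

theorem fieldFun_zero_left (hφ : φ.Monic) (g : KRing φ A) : P.fieldFun hφ 0 g = 0 := by
  have := P.fieldFun_add_left hφ 0 0 g
  rwa [add_zero, left_eq_add] at this

theorem iterate_derK_mapK {S T : CommAlgCat.{0} A} (f : S ⟶ T) (m : ℕ) (x : KRing φ S) :
    (derK φ T)^[m] (mapK φ f.hom x) = mapK φ f.hom ((derK φ S)^[m] x) :=
  (Function.Semiconj.iterate_right (f := mapK φ f.hom) (fun x => (punct φ).map_der f x) m x).symm

/-- The first-order variation of a(c) is known on jets. Pairing it with g and taking residues gives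
the sum; the minus sign comes from the action through exp(-ε h ∂). -/
theorem derAct_fieldFun (hφ : φ.Monic) (h : KRing φ A) (a : DiscFun B) (g : KRing φ A) :
    derAct B (punct φ) h (P.fieldFun hφ a g) = -∑ᶠ m : ℕ, P.fieldFun hφ (discL B m a)
      ((m.factorial : ℂ)⁻¹ • (g * (derK φ A)^[m] h)) := by
  obtain ⟨M, hM⟩ := P.exists_discL_eq_zero a
  rw [finsum_discL hM (fun m b => P.fieldFun hφ b ((m.factorial : ℂ)⁻¹ • (g * (derK φ A)^[m] h)))
    fun m => P.fieldFun_zero_left hφ _]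
  refine P.punctFun_ext fun S c => ?_
  have h1 : P.jetDerK φ (mapK φ (Algebra.ofId A S) (-h)) c a = -∑ m ∈ Finset.range M,
      P.jetK φ c (discL B m a) * mapK φ (Algebra.ofId A S)
        ((m.factorial : ℂ)⁻¹ • (derK φ A)^[m] h) := by
    rw [← Finset.sum_neg_distrib]
    let T : ℕ → KRing φ S := fun m => taylorCoeff (K := (punct φ).obj S)
      ((punct φ).cder S) m (mapK φ (Algebra.ofId A S) (-h))
    refine (finsum_discL hM (fun m b => P.jetK φ c b * T m)
      fun m => by rw [map_zero, zero_mul]).trans (Finset.sum_congr rfl fun m _ => ?_)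
    rw [← mul_neg]
    congr 1
    refine (taylorCoeff_derK m _).trans ?_
    have h2 := iterate_derK_mapK (φ := φ) (fromBase S) m (-h)
    have h3 : (derK φ A)^[m] (-h) = -(derK φ A)^[m] h := iterate_map_neg (derK φ A) m h
    rw [complex_smul_eq, mapK_ofId_smul, ← smul_neg, ← map_neg, ← h3]
    exact congrArg _ h2
  rw [evalK_derAct_fieldFun, h1, map_neg, map_sum, neg_mul, Finset.sum_mul, ← resLin_apply hφ,
    map_neg, map_sum]
  congr 1
  refine Finset.sum_congr rfl fun m _ => ?_
  rw [evalK_fieldFun, resLin_apply, mul_assoc, ← map_mul, smul_mul_assoc, mul_comm g]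

theorem continuous_derAct (h : KRing φ A) :
    Continuous[opFunTopology B φ fun j => (P.v j : 𝔤), opFunTopology B φ fun j => (P.v j : 𝔤)]
      (derAct B (punct φ) h) := by
  let := opFunTopology B φ fun j => (P.v j : 𝔤)
  rw [continuous_iff_continuousAt]
  intro F
  refine P.tendsto_opFun_iff.2 fun N => ?_
  -- If -h has a pole of order at most b and c has poles of order at most N, the displaced
  -- coordinates have poles of order at most b + N + 3; the 3 is due to ∂³h.
  obtain ⟨b, hb⟩ := exists_inPow (-h)
  filter_upwards [P.tendsto_opFun_iff.1 (tendsto_id (α := PunctFun B φ) (x := 𝓝 F)) (b + N + 3)]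
    with G hG
  refine P.mem_polarIdeal_iff.2 fun S c hc => ?_
  have h1 := P.mem_polarIdeal_iff.1 hG (Disc.dual S) (fun i =>
      mapK φ (Disc.toDual S).hom (c i) + epsK φ S * mapK φ (Disc.toDual S).hom
        (P.actK φ (mapK φ (Algebra.ofId A S) (-h)) c i)) fun i => by
    refine (((hc i).mapK _).mono ?_).add (((inPow_algebraMap_base _).mul
      ((OperFrame.InPow.actK P (hb.mapK _) hc i).mapK _)).mono ?_)
    · push_cast; omega
    · push_cast; omega
  have h2 := map_sub (P.derActDer (𝔻 := punct φ) h) G F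
  exact (congrArg (P.evalK c) h2.symm).trans
    ((P.evalK_derAct h (G - F) c).trans (congrArg Disc.dualSnd h1))

/-- The action of a vector field on `Ũ`. -/
noncomputable def tildeDer (hφ : φ.Monic) (h : KRing φ A) :
    Derivation A (UTilde φ (discL B)) (UTilde φ (discL B)) :=
  Derivation.mk' ((P.tildeEquiv hφ).symm.toLinearMap ∘ₗ
    (P.derActDer (𝔻 := punct φ) h : PunctFun B φ →ₗ[A] PunctFun B φ) ∘ₗ
      (P.tildeEquiv hφ).toLinearMap) fun x y => by
    refine (congrArg (P.tildeEquiv hφ).symm ((congrArg (P.derActDer (𝔻 := punct φ) h)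
      (map_mul (P.tildeEquiv hφ) x y)).trans (Derivation.leibniz _ _ _))).trans ?_
    rw [smul_eq_mul, smul_eq_mul, map_add, map_mul, map_mul, AlgEquiv.symm_apply_apply,
      AlgEquiv.symm_apply_apply]
    rfl

theorem tildeDer_apply (hφ : φ.Monic) (h : KRing φ A) (x : UTilde φ (discL B)) :
    P.tildeDer hφ h x = (P.tildeEquiv hφ).symm (derAct B (punct φ) h (P.tildeEquiv hφ x)) := rfl

theorem isDerAction_tildeDer (hφ : φ.Monic) (h : KRing φ A) :
    IsDerAction φ (discL B) h (P.tildeDer hφ h) := by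
  constructor
  · let := opFunTopology B φ fun j => (P.v j : 𝔤)
    exact (P.continuous_tildeEquiv_symm hφ).comp
      ((P.continuous_derAct h).comp (P.continuous_tildeEquiv hφ))
  · intro a g
    rw [tildeDer_apply, AlgEquiv.symm_apply_eq, tildeEquiv_gen, derAct_fieldFun, map_neg]
    congr 1
    refine Eq.trans (finsum_congr fun m => (P.tildeEquiv_gen hφ _ _).symm)
      (AddEquiv.map_finsum (P.tildeEquiv hφ).toRingEquiv.toAddEquiv fun m : ℕ =>
        gen φ (discL B) (discL B m a) ((m.factorial : ℂ)⁻¹ • (g * (derK φ A)^[m] h))).symm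

/-- Two continuous derivations agree on a closed subalgebra, because Ũ is Hausdorff, and the
prescribed formula covers the topological generators. -/
theorem isDerAction_unique (hφ : φ.Monic) {h : KRing φ A}
    {δ : Derivation A (UTilde φ (discL B)) (UTilde φ (discL B))}
    (hδ : IsDerAction φ (discL B) h δ) : δ = P.tildeDer hφ h := by
  have := P.t2Space_tilde hφ
  have hδ' := P.isDerAction_tildeDer hφ h
  let C : Subalgebra A (UTilde φ (discL B)) :=
    { carrier := {x | δ x = P.tildeDer hφ h x}
      mul_mem' := fun {x y} hx hy => by
        change δ (x * y) = P.tildeDer hφ h (x * y)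
        rw [Derivation.leibniz, Derivation.leibniz, show δ x = _ from hx, show δ y = _ from hy]
      add_mem' := fun {x y} hx hy => by
        change δ (x + y) = P.tildeDer hφ h (x + y)
        rw [map_add, map_add, show δ x = _ from hx, show δ y = _ from hy]
      algebraMap_mem' := fun a => by
        change δ _ = P.tildeDer hφ h _
        rw [Derivation.map_algebraMap, Derivation.map_algebraMap] }
  exact Derivation.ext fun x => P.tilde_mem_of_isClosed (C := C) (isClosed_eq hδ.1 hδ'.1)
    (fun i g => (hδ.2 _ g).trans (hδ'.2 _ g).symm) x

end OperFrame

end OperFF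

/-! ### The theorem -/

theorem mainTheorem8 {𝔤 : Type*} [LieRing 𝔤] [LieAlgebra ℂ 𝔤] [FiniteDimensional ℂ 𝔤]
    [LieAlgebra.IsSimple ℂ 𝔤] {ι : Type*} [Fintype ι] {H : LieSubalgebra ℂ 𝔤}
    (B : LieAlgebra.Basis ι H) (ρ p₁ : 𝔤) (hρ : ρ ∈ H) (hρe : ∀ i, ⁅ρ, B.e i⁆ = B.e i)
    (hp : IsSl2Triple ((2 : ℂ) • ρ) p₁ (pMinus B))
    {l : ℕ} (v : Module.Basis (Fin l) ℂ (canSpace p₁)) (d : Fin l → ℕ)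
    (hd : ∀ i, ⁅ρ, (v i : 𝔤)⁆ = (d i : ℂ) • (v i : 𝔤)) (n : ℕ) (hn : 0 < n) :
    ∃ (w : Fin l → DiscFun B) (c : Fin l → KRing (phi n) (BaseRing n) → PunctFun B (phi n)),
      (∀ i F, IsDiskCoord (fun j => (v j : 𝔤)) i F ↔ F = w i) ∧
      (∀ i g F, IsCoord (fun j => (v j : 𝔤)) i g F ↔ F = c i g) ∧
      (∃! Φ : UTilde (phi n) (discL B) ≃ₐ[BaseRing n] PunctFun B (phi n),
        IsOperIso B (phi n) (fun j => (v j : 𝔤)) w c Φ) ∧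
      (∀ h : KRing (phi n) (BaseRing n),
        ∃! δ : Derivation (BaseRing n) (UTilde (phi n) (discL B)) (UTilde (phi n) (discL B)),
          IsDerAction (phi n) (discL B) h δ) ∧
      ∀ Φ : UTilde (phi n) (discL B) ≃ₐ[BaseRing n] PunctFun B (phi n),
        IsOperIso B (phi n) (fun j => (v j : 𝔤)) w c Φ →
        ∀ (h : KRing (phi n) (BaseRing n))
          (δ : Derivation (BaseRing n) (UTilde (phi n) (discL B)) (UTilde (phi n) (discL B))),
          IsDerAction (phi n) (discL B) h δ →
          ∀ x, Φ (δ x) = derAct B (punct (phi n)) h (Φ x) := by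
  -- The principal grading: every eᵢ has degree 1.
  obtain ⟨gr⟩ := exists_grading B hρ (fun _ => 1) fun i => by rw [hρe, Int.cast_one, one_smul]
  let P : OperFrame B l := ⟨ρ, p₁, hρ, hρe, hp, v, d, hd, gr⟩
  have hφ : (phi n).Monic := Polynomial.monic_prod_of_monic _ _ fun i _ => Polynomial.monic_X_sub_C _
  refine ⟨fun i => P.discCoord i 0, fun i g => P.fieldFun hφ (P.discCoord i 0) g,
    fun i F => P.isDiskCoord_iff i F, fun i g F => P.isCoord_iff hφ i g F,
    ⟨P.tildeEquiv hφ, P.isOperIso_tildeEquiv hφ, fun Φ h => P.isOperIso_unique hφ h⟩,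
    fun h => ⟨P.tildeDer hφ h, P.isDerAction_tildeDer hφ h, fun δ hδ => P.isDerAction_unique hφ hδ⟩,
    fun Φ hΦ h δ hδ x => ?_⟩
  rw [P.isOperIso_unique hφ hΦ, P.isDerAction_unique hφ hδ]
  -- By uniqueness δ is the transport by Φ of the action on A[Op], so equivariance is the identity Φ
  -- Φ⁻¹ = 1.
  exact (P.tildeEquiv hφ).apply_symm_apply _
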